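/- **Conventions.** $\lambda$ is the security parameter. Algorithms and adversaries are (non-uniform) families of circuits of polynomial size: Boolean circuits with uniform random coins for classical algorithms, and circuits over Hadamard, phase $K=\mathrm{diag}(1,i)$, CNOT and Toffoli gates with ancillas and measurements for quantum (BQP) algorithms and for adversaries. A function $\nu$ is negligible if $p(\lambda)\nu(\lambda)\to 0$ for every polynomial $p$. **Classical scheme.** Let $\mathrm{HE}=(\mathrm{Keygen},\mathrm{Enc},\mathrm{Dec},\mathrm{Eval})$ be a classical leveled fully homomorphic bit encryption scheme: $\mathrm{Keygen}(1^\lambda,1^L)$ outputs $(pk,evk,sk)$; all algorithms are efficient; ciphertexts (fresh or evaluated) have a length polynomial in $\lambda,L$; for polynomially bounded $L$ and Boolean circuits $f$ of depth at most $L$ and polynomial size, $\mathrm{Dec}_{sk}(\mathrm{Eval}_{evk}(f,\mathrm{Enc}_{pk}(\mu_1),\dots,\mathrm{Enc}_{pk}(\mu_l)))=f(\mu_1,\dots,\mu_l)$ except with negligible probability; and HE is IND-CPA secure against quantum polynomial-size adversaries given $(pk,evk,\mathrm{Enc}_{pk}(b))$. **Quantum capability.** Let $L_c=L_c(\lambda)$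 be polynomially bounded, and assume HE is quantum capable for depth $L_c$: there are an encryption scheme AltHE with the same public and secret keys, trapdoor information $t_{sk}$ computed along with the keys, and a density $D=D_{pk}$ on pairs $(\mu,r)$ of a bit and a random string such that, except with negligible probability over the keys, for every ciphertext $c$ that results from homomorphically evaluating a circuit of depth at most $L_c$ and polynomial size on fresh ciphertexts, 1. an efficient algorithm HE.Convert maps $c$ to an AltHE-ciphertext $\hat c$ with the same decrypted value; 2. there is an efficient operation $\oplus_H$ on AltHE-ciphertexts that, with overwhelming probability over $(\mu,r)\leftarrow D$, acts on $\mathrm{AltHE.Enc}_{pk}(\mu;r)$ and $\hat c$ as a homomorphic XOR, and can be inverted efficiently from $pk$ and $\hat c$; AltHE decrypts $\mathrm{AltHE.Enc}_{pk}(\mu;r)$ to $\mu$ with overwhelming probability over $D$; 3. (a) for $(\mu,r)\leftarrow D$ the distributions of $\mathrm{AltHE.Enc}_{pk}(\mu;r)$ and of $\mathrm{AltHE.Enc}_{pk}(\mu;r)\oplus_H\hat c$ have negligible Hellinger distance; (b) given $pk$, a state within negligible trace distance of $\sum_{\mu,r}\sqrt{D(\mu,r)}\,|\mu,r\rangle$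 can be prepared efficiently; (c) $(\mu,r)$ can be computed efficiently from $\mathrm{AltHE.Enc}_{pk}(\mu;r)$, $sk$ and $t_{sk}$ with overwhelming probability over $D$. All error bounds are uniform over these $c$ (for each polynomial bound on the circuit size). **Circuits and levels.** A level of a quantum circuit on $\lambda$ qubits consists of Clifford gates (Hadamard, $K$, CNOT), followed by a layer of non-intersecting Toffoli gates; a depth-$L$ quantum circuit has $L$ levels. The parameter $L_c$ is such that the classical computation belonging to each level (decrypting the Pauli keys, recovering the randomness of the encrypted CNOT operations of the previous level, and updating the Pauli keys for these operations and for the gates of the current level; for the first level only the update for its gates) is performed by given Boolean circuits of depth at most $L_c$ and of size polynomial in $\lambda$ and the sizes of the levels. **The scheme QHE.** - $\mathrm{KeyGen}(1^\lambda,1^L)$: for $1\le i\le L+1$ generate independent $(pk_i,evk_i,sk_i,t_{sk_i})$ with HE for depth $L_c$. The public key is $pk_1$, the secret key is $sk_{L+1}$, and the evaluation key consists of $evk_1,\dots,evk_{L+1}$ and $(pk_{i+1},\mathrm{HE.Enc}_{pk_{i+1}}(sk_i),\mathrm{HE.Enc}_{pk_{i+1}}(t_{sk_i}))$ for $1\le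 i\le L$. - $\mathrm{Enc}_{pk}(m)$, $m\in\{0,1\}^\lambda$: choose $z,x\in\{0,1\}^\lambda$ uniformly; output $Z^zX^x|m\rangle$, i.e. the string $x\oplus m$, and $\mathrm{HE.Enc}_{pk_1}(z,x)$. (A quantum state $|\psi\rangle$ on $\lambda$ qubits is encrypted in the same way.) - $\mathrm{Dec}_{sk}$: decrypt the encrypted Pauli keys with $sk_{L+1}$ to $z,x$; map the measured string $m$ to $x\oplus m$. (For quantum output, apply $(Z^zX^x)^\dagger$.) - $\mathrm{Eval}$: in each level apply the Clifford and Toffoli gates to the padded state and update the encrypted Pauli keys homomorphically. A Toffoli gate $T$ on qubits $1,2,3$ satisfies $TZ^zX^xT^\dagger=C_{zx}P_{zx}$ up to a phase, where $P_{zx}$ is a Pauli operator and $C_{zx}=\mathrm{CNOT}_{1,3}^{x_2}\mathrm{CNOT}_{2,3}^{x_1}\hat Z_{1,2}^{z_3}$ with $\hat Z_{1,2}=(I\otimes H)\mathrm{CNOT}_{1,2}(I\otimes H)$; $C_{zx}$ is removed by three encrypted CNOT operations. An encrypted $\mathrm{CNOT}^s_{a,b}$ with a ciphertext $c$ of $s$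 computes $\hat c=\mathrm{HE.Convert}(c)$, prepares the superposition of 3(b), computes $\mathrm{AltHE.Enc}_{pk}(\mu;r)$, shifted by $\oplus_H\hat c$ if qubit $a$ is $1$, into a new register and measures it to obtain $y$, adds $\mu$ to qubit $b$, applies Hadamard gates to the register of $(\mu,r)$ and measures it to obtain $d$. The server encrypts $pk_i$, the ciphertexts of the Pauli keys, and all $\hat c,y,d$ under $pk_{i+1}$, and with the encryptions of $sk_i,t_{sk_i}$ it homomorphically obtains, under $pk_{i+1}$, the Pauli keys, the updates $d\cdot((\mu_0,r_0)\oplus(\mu_1,r_1))$ (for the $Z$-key of the control) and $\mu_0$ (for the $X$-key of the target), where $y=\mathrm{AltHE.Enc}_{pk_i}(\mu_0;r_0)=\mathrm{AltHE.Enc}_{pk_i}(\mu_1;r_1)\oplus_H\hat c$, and the keys and control bits for the next level (where the third operation of each Toffoli is conjugated by the Hadamard gate, which turns its $X$-update into a $Z$-update). **Theorem.** QHE is a quantum leveled fully homomorphic encryption scheme: 1. (Efficiency) key generation, encryption and decryption are classical algorithms of size polynomial in $\lambda,L$; the evaluation of a circuit $C$ is a quantum algorithm of size polynomial in $\lambda$,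 $L$ and the size of $C$. 2. (IND-CPA security) For polynomially bounded $L$, every quantum polynomial-size adversary and all messages $m_0,m_1\in\{0,1\}^\lambda$ (depending on $\lambda$), the difference between the probabilities that the adversary outputs $1$ on $(pk,evk,\mathrm{QHE.Enc}_{pk}(m_0))$ and on $(pk,evk,\mathrm{QHE.Enc}_{pk}(m_1))$ is negligible. 3. (Compactness) The output length of QHE.Eval is bounded by a polynomial in $\lambda$, regardless of $C$ and $L$. 4. (Homomorphic evaluation) For polynomially bounded $L$ and every polynomial $p$ there is a negligible $\nu$ such that for all circuits $C$ of depth $L(\lambda)$ with at most $p(\lambda)$ gates: for every $m\in\{0,1\}^\lambda$, the result of encrypting $m$, evaluating $C$, measuring and decrypting has total variation distance at most $\nu(\lambda)$ from the result of measuring $C|m\rangle$; and for every $\lambda$-qubit state $|\psi\rangle$, encrypting $|\psi\rangle$, evaluating $C$, and removing the Pauli operator given by the decrypted final Pauli keys from the server's final state gives a state within trace distance $\nu(\lambda)$ of $C|\psi\rangle\langle\psi|C^\dagger$. -/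

import Mathlib

noncomputable section

namespace QFHE

/-! ## Asymptotics -/

/-- `f` is bounded by a polynomial. -/
def PolyBounded (f : ℕ → ℕ) : Prop :=
  ∃ p : Polynomial ℕ, ∀ n, f n ≤ p.eval n

/-- `μ` is negligible: `n ^ k * μ n → 0` for every `k`. -/
def Negligible (μ : ℕ → ℝ) : Prop :=
  Asymptotics.SuperpolynomialDecay Filter.atTop (fun n : ℕ => (n : ℝ)) μ

/-! ## Bit strings, averages over uniform coins -/

/-- Bit strings of length `k`. Bit strings indexed by other finite types `ι` are written
`ι → Bool`; concatenation is `Sum.elim`. -/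
abbrev Bits (k : ℕ) : Type := Fin k → Bool

/-- The expectation of `f` over uniformly random coins. -/
def avg {κ : Type} [Fintype κ] [DecidableEq κ] (f : (κ → Bool) → ℝ) : ℝ :=
  (∑ r, f r) / 2 ^ Fintype.card κ

open Classical in
/-- The probability of the event `P` over uniformly random coins. -/
def prob {κ : Type} [Fintype κ] [DecidableEq κ] (P : (κ → Bool) → Prop) : ℝ :=
  avg fun r => if P r then 1 else 0

/-- The number of common ones of two bit strings. -/
def overlap {ι : Type} [Fintype ι] (d u : ι → Bool) : ℕ :=
  (Finset.univ.filter fun i => d i = true ∧ u i = true).card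

/-- The inner product `d · u` modulo two. -/
def dotBit {ι : Type} [Fintype ι] (d u : ι → Bool) : Bool := decide (Odd (overlap d u))

/-- The sign `(-1) ^ (d · u)`. -/
def sgn {ι : Type} [Fintype ι] (d u : ι → Bool) : ℂ := (-1) ^ overlap d u

/-- Bitwise exclusive or. -/
def bxor {ι : Type} (u v : ι → Bool) : ι → Bool := fun i => xor (u i) (v i)

/-! ## Boolean circuits -/

/-- A gate reads wires: `Sum.inl i` is input `i`, `Sum.inr k` is the value of the `k`-th gate. -/
inductive BoolGate (ι : Type) : Type
  | const (b : Bool)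
  | not (a : ι ⊕ ℕ)
  | and (a b : ι ⊕ ℕ)
  | xor (a b : ι ⊕ ℕ)

/-- A Boolean circuit as a straight-line program: a list of gates, each of which may read the
inputs and the earlier gates, and the wires that are output. -/
structure BoolCircuit (ι o : Type) where
  gates : List (BoolGate ι)
  out : o → ι ⊕ ℕ

namespace BoolCircuit

variable {ι o : Type}

/-- The value of a wire, given the values of the gates so far. -/
def wireVal (x : ι → Bool) (vs : List Bool) (w : ι ⊕ ℕ) : Bool :=
  Sum.elim x (fun k => vs.getD k false) w

/-- The value of a gate, given the values of the earlier gates. -/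
def gateVal (x : ι → Bool) (vs : List Bool) : BoolGate ι → Bool
  | .const b => b
  | .not a => !(wireVal x vs a)
  | .and a b => wireVal x vs a && wireVal x vs b
  | .xor a b => Bool.xor (wireVal x vs a) (wireVal x vs b)

/-- The values of all gates on input `x`. -/
def vals (C : BoolCircuit ι o) (x : ι → Bool) : List Bool :=
  C.gates.foldl (fun vs g => vs ++ [gateVal x vs g]) []

/-- The function computed by a circuit. -/
def eval (C : BoolCircuit ι o) (x : ι → Bool) : o → Bool :=
  fun j => wireVal x (C.vals x) (C.out j)

/-- The depth of a wire (inputs have depth zero). -/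
def wireDepth (ds : List ℕ) (w : ι ⊕ ℕ) : ℕ := Sum.elim (fun _ => 0) (fun k => ds.getD k 0) w

/-- The depth of a gate. -/
def gateDepth (ds : List ℕ) : BoolGate ι → ℕ
  | .const _ => 0
  | .not a => wireDepth ds a + 1
  | .and a b => max (wireDepth ds a) (wireDepth ds b) + 1
  | .xor a b => max (wireDepth ds a) (wireDepth ds b) + 1

/-- The depth of a circuit: the length of a longest path. -/
def depth (C : BoolCircuit ι o) : ℕ :=
  (C.gates.foldl (fun ds g => ds ++ [gateDepth ds g]) []).foldr max 0

/-- The size of a circuit: the number of inputs, outputs and gates. -/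
def size [Fintype ι] [Fintype o] (C : BoolCircuit ι o) : ℕ :=
  Fintype.card ι + Fintype.card o + C.gates.length

/-- Renaming of the inputs of a gate. -/
def mapGate {ι' : Type} (e : ι → ι') : BoolGate ι → BoolGate ι'
  | .const b => .const b
  | .not a => .not (a.map e id)
  | .and a b => .and (a.map e id) (b.map e id)
  | .xor a b => .xor (a.map e id) (b.map e id)

/-- The one-bit circuit that computes output bit `j`, with its inputs numbered. -/
def single [Fintype ι] (C : BoolCircuit ι o) (j : o) :
    BoolCircuit (Fin (Fintype.card ι)) Unit where
  gates := C.gates.map (mapGate (Fintype.equivFin ι))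
  out := fun _ => (C.out j).map (Fintype.equivFin ι) id

end BoolCircuit

/-- `F` is computed by a Boolean circuit of size at most `s` (inputs, outputs and gates). -/
def ComputableInSize {ι o : Type} [Fintype ι] [Fintype o]
    (F : (ι → Bool) → (o → Bool)) (s : ℕ) : Prop :=
  ∃ C : BoolCircuit ι o, (∀ x, C.eval x = F x) ∧ C.size ≤ s

/-! ## Pure states, gates, trace distance -/

/-- (Unnormalized) state vectors on the qubits `W`. -/
abbrev Vec (W : Type) : Type := (W → Bool) → ℂ

/-- The standard basis vector `|x⟩`. -/
def ket {W : Type} [Fintype W] (x : W → Bool) : Vec W := fun v => if v = x then 1 else 0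

/-- `|φ⟩⟨φ|`. -/
def outer {X : Type} (φ : X → ℂ) : Matrix X X ℂ := fun u v => φ u * star (φ v)

open scoped MatrixOrder in
/-- The trace distance `Tr √((ρ - σ)²) / 2`. -/
def traceDist {X : Type} [Fintype X] [DecidableEq X] (ρ σ : Matrix X X ℂ) : ℝ :=
  (Matrix.trace (CFC.sqrt ((ρ - σ) ^ 2))).re / 2

/-- The generators of the Clifford group: the Hadamard gate, the phase gate `diag(1, i)` and the
controlled NOT (control first, target second). -/
inductive CliffordGate (W : Type) : Type
  | h (i : W)
  | k (i : W)
  | cnot (c t : W) (hne : c ≠ t)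

/-- The position of a Toffoli gate: two controls and a target. -/
structure ToffoliGate (W : Type) where
  a : W
  b : W
  c : W
  hab : a ≠ b
  hac : a ≠ c
  hbc : b ≠ c

/-- Clifford generators and the Toffoli gate. -/
inductive QGate (W : Type) : Type
  | cliff (g : CliffordGate W)
  | tof (t : ToffoliGate W)

section Gates

variable {W : Type} [DecidableEq W]

def CliffordGate.apply (g : CliffordGate W) (ψ : Vec W) : Vec W :=
  match g with
  | .h i => fun v => (1 / (Real.sqrt 2 : ℂ)) *
      (ψ (Function.update v i false) +
        (if v i then -1 else 1) * ψ (Function.update v i true))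
  | .k i => fun v => (if v i then Complex.I else 1) * ψ v
  | .cnot c t _ => fun v => ψ (Function.update v t (xor (v t) (v c)))

def ToffoliGate.apply (g : ToffoliGate W) (ψ : Vec W) : Vec W :=
  fun v => ψ (Function.update v g.c (xor (v g.c) (v g.a && v g.b)))

def QGate.apply (g : QGate W) (ψ : Vec W) : Vec W :=
  match g with
  | .cliff g => g.apply ψ
  | .tof t => t.apply ψ

/-- Apply the gates of a list, the head first. -/
def runGates (gs : List (QGate W)) (ψ : Vec W) : Vec W := gs.foldl (fun φ g => g.apply φ) ψ

end Gates

/-- One level of a quantum circuit: Clifford gates, followed by a layer of non-intersecting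
Toffoli gates. -/
structure Level (W : Type) where
  cliff : List (CliffordGate W)
  tof : List (ToffoliGate W)
  disjoint : tof.Pairwise fun s t =>
    Disjoint ({s.a, s.b, s.c} : Set W) ({t.a, t.b, t.c} : Set W)

namespace Level

variable {W : Type}

/-- The level without gates. -/
def empty : Level W := ⟨[], [], List.Pairwise.nil⟩

/-- The number of gates. -/
def size (l : Level W) : ℕ := l.cliff.length + l.tof.length

def apply [DecidableEq W] (l : Level W) (ψ : Vec W) : Vec W :=
  l.tof.foldl (fun φ t => t.apply φ) (l.cliff.foldl (fun φ g => g.apply φ) ψ)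

end Level

/-- Quantum circuits with `L` levels on the qubits `W`. -/
abbrev QCircuit (W : Type) (L : ℕ) : Type := Fin L → Level W

namespace QCircuit

variable {W : Type} {L : ℕ}

/-- The number of gates. -/
def size (C : QCircuit W L) : ℕ := ∑ i, (C i).size

def apply [DecidableEq W] (C : QCircuit W L) (ψ : Vec W) : Vec W :=
  (List.ofFn C).foldl (fun φ l => l.apply φ) ψ

/-- The `i`-th level; there are no gates from level `L` on. -/
def level (C : QCircuit W L) (i : ℕ) : Level W :=
  if h : i < L then C ⟨i, h⟩ else Level.empty

end QCircuit

/-! ## Efficient quantum algorithms with classical input -/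

/-- A quantum circuit that decides about a classical input with bits `ι`, using ancillas that are
initially zero. The answer is the measured value of the first ancilla. -/
structure Distinguisher (ι : Type) where
  anc : ℕ
  gates : List (QGate (ι ⊕ Fin (anc + 1)))

namespace Distinguisher

variable {ι : Type}

def size (A : Distinguisher ι) : ℕ := A.anc + A.gates.length

/-- The probability that the answer on input `x` is one. -/
def accept [Fintype ι] [DecidableEq ι] (A : Distinguisher ι) (x : ι → Bool) : ℝ :=
  ∑ v : ι ⊕ Fin (A.anc + 1) → Bool,
    if v (Sum.inr 0) then ‖runGates A.gates (ket (Sum.elim x fun _ => false)) v‖ ^ 2 else 0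

end Distinguisher

/-- A quantum circuit that prepares a quantum state on the qubits `o` from a classical input with
bits `ι`, using ancillas that are initially zero. The input and ancilla qubits are discarded. -/
structure StatePrep (ι o : Type) where
  anc : ℕ
  gates : List (QGate (ι ⊕ o ⊕ Fin anc))

namespace StatePrep

variable {ι o : Type} [Fintype ι] [DecidableEq ι] [Fintype o] [DecidableEq o]

def size (P : StatePrep ι o) : ℕ := P.anc + P.gates.length

/-- The amplitude of `w` on the output qubits when the discarded qubits are found in state `g`. -/
def amp (P : StatePrep ι o) (x : ι → Bool) (g : ι ⊕ Fin P.anc → Bool) (w : o → Bool) : ℂ :=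
  runGates P.gates (ket (Sum.elim x fun _ => false))
    (Sum.elim (fun i => g (Sum.inl i)) (Sum.elim w fun i => g (Sum.inr i)))

/-- The density matrix of the output qubits. -/
def density (P : StatePrep ι o) (x : ι → Bool) : Matrix (o → Bool) (o → Bool) ℂ :=
  ∑ g, outer (P.amp x g)

end StatePrep

/-- Quantum-classical processes on the qubits `W` with a classical result in `α`: a state is sent
to an ensemble of results and unnormalized states, where the squared norm of a state is the
probability of its branch. -/
def QProg (W α : Type) : Type := Vec W → Multiset (α × Vec W)

namespace QProg

variable {W α β : Type}

instance : Monad (QProg W) where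
  pure a := fun ψ => {(a, ψ)}
  bind m f := fun ψ => (m ψ).bind fun b => f b.1 b.2

/-- Apply an operator. -/
def op (U : Vec W → Vec W) : QProg W Unit := fun ψ => {((), U ψ)}

/-- Perform a measurement with the Kraus operators `K`. -/
def kraus [Fintype α] (K : α → Vec W → Vec W) : QProg W α :=
  fun ψ => Finset.univ.val.map fun a => (a, K a ψ)

/-- Toss uniform coins. -/
def coins (κ : Type) [Fintype κ] [DecidableEq κ] : QProg W (κ → Bool) :=
  kraus fun _ ψ => ((1 / (Real.sqrt 2 : ℂ)) ^ Fintype.card κ) • ψ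

/-- Measure all qubits in the standard basis. -/
def measure [Fintype W] [DecidableEq W] : QProg W (W → Bool) :=
  kraus fun x ψ v => if v = x then ψ v else 0

/-- Run `f 0, f 1, …` one after the other and collect the results. -/
def forFin : (k : ℕ) → (Fin k → QProg W α) → QProg W (Fin k → α)
  | 0, _ => pure Fin.elim0
  | k + 1, f => do
      let a ← f 0
      let r ← forFin k fun i => f i.succ
      pure (Fin.cons a r)

/-- The final density matrix, from the initial state `ψ`. -/
def density (m : QProg W α) (ψ : Vec W) : Matrix (W → Bool) (W → Bool) ℂ :=
  ((m ψ).map fun b => outer b.2).sum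

/-- The part of the final density matrix that belongs to the result `a`. -/
def densityAt [DecidableEq α] (m : QProg W α) (ψ : Vec W) (a : α) :
    Matrix (W → Bool) (W → Bool) ℂ :=
  ((m ψ).map fun b => if b.1 = a then outer b.2 else 0).sum

/-- The probability of the result `a`, from the initial state `ψ`. -/
def resultProb [Fintype W] [DecidableEq W] [DecidableEq α] (m : QProg W α) (ψ : Vec W) (a : α) : ℝ :=
  ((m ψ).map fun b => if b.1 = a then ∑ v, ‖b.2 v‖ ^ 2 else 0).sum

end QProg

/-- The process `m` on the qubits `W`, with classical input bits `ι` and classical output bits `o`,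
is realized exactly by a quantum circuit of size at most `s` (qubits and gates): ancillas and
outputs start as zero, outputs are measured, inputs and ancillas are discarded. -/
def QComputableInSize {ι o W : Type} [Fintype ι] [DecidableEq ι] [Fintype o] [DecidableEq o]
    [Fintype W] [DecidableEq W] (m : (ι → Bool) → QProg W (o → Bool)) (s : ℕ) : Prop :=
  ∃ (anc : ℕ) (gates : List (QGate (W ⊕ ι ⊕ o ⊕ Fin anc))),
    Fintype.card (W ⊕ ι ⊕ o ⊕ Fin anc) + gates.length ≤ s ∧
    ∀ (x : ι → Bool) (ψ : Vec W) (a : o → Bool),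
      (m x).densityAt ψ a =
        ∑ g : ι ⊕ Fin anc → Bool, outer fun v : W → Bool =>
          runGates gates
            (fun u => ψ (fun i => u (Sum.inl i)) *
              ket (Sum.elim x fun _ => false) (fun i => u (Sum.inr i)))
            (Sum.elim v (Sum.elim (fun i => g (Sum.inl i))
              (Sum.elim a fun i => g (Sum.inr i))))

/-! ## Classical leveled homomorphic encryption -/

/-- The data of a classical leveled homomorphic bit encryption scheme; `n` is the security
parameter and `L` the depth parameter. Every algorithm gets its random coins as an argument.
Ciphertexts, fresh or evaluated, have `ctLen n L` bits. -/
structure LeveledHE where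
  pkLen : ℕ → ℕ → ℕ
  evkLen : ℕ → ℕ → ℕ
  skLen : ℕ → ℕ → ℕ
  ctLen : ℕ → ℕ → ℕ
  keyCoins : ℕ → ℕ → ℕ
  encCoins : ℕ → ℕ → ℕ
  evalCoins : (n L : ℕ) → {l : ℕ} → BoolCircuit (Fin l) Unit → ℕ
  keygen : (n L : ℕ) → Bits (keyCoins n L) →
    Bits (pkLen n L) × Bits (evkLen n L) × Bits (skLen n L)
  enc : (n L : ℕ) → Bits (pkLen n L) → Bool → Bits (encCoins n L) → Bits (ctLen n L)
  dec : (n L : ℕ) → Bits (skLen n L) → Bits (ctLen n L) → Bool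
  eval : (n L : ℕ) → {l : ℕ} → (f : BoolCircuit (Fin l) Unit) → Bits (evkLen n L) →
    (Fin l → Bits (ctLen n L)) → Bits (evalCoins n L f) → Bits (ctLen n L)

namespace LeveledHE

variable (HE : LeveledHE)

def pk {n L : ℕ} (κ : Bits (HE.keyCoins n L)) : Bits (HE.pkLen n L) := (HE.keygen n L κ).1
def evk {n L : ℕ} (κ : Bits (HE.keyCoins n L)) : Bits (HE.evkLen n L) := (HE.keygen n L κ).2.1
def sk {n L : ℕ} (κ : Bits (HE.keyCoins n L)) : Bits (HE.skLen n L) := (HE.keygen n L κ).2.2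

/-- All algorithms are computed by circuits of size polynomial in `n`, `L` and, for the
evaluation, the size of the evaluated circuit. In particular this bounds the lengths of all keys
and ciphertexts (compactness). -/
def Efficient : Prop :=
  ∃ p : Polynomial ℕ, ∀ n L,
    ComputableInSize (fun κ : Bits (HE.keyCoins n L) =>
      Sum.elim (HE.pk κ) (Sum.elim (HE.evk κ) (HE.sk κ))) (p.eval (n + L)) ∧
    ComputableInSize
      (fun x : Fin (HE.pkLen n L) ⊕ Unit ⊕ Fin (HE.encCoins n L) → Bool =>
        HE.enc n L (fun i => x (.inl i)) (x (.inr (.inl ()))) fun i => x (.inr (.inr i)))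
      (p.eval (n + L)) ∧
    ComputableInSize
      (fun (x : Fin (HE.skLen n L) ⊕ Fin (HE.ctLen n L) → Bool) (_ : Unit) =>
        HE.dec n L (fun i => x (.inl i)) fun i => x (.inr i))
      (p.eval (n + L)) ∧
    ∀ (l : ℕ) (f : BoolCircuit (Fin l) Unit),
      ComputableInSize
        (fun x : Fin (HE.evkLen n L) ⊕ (Fin l × Fin (HE.ctLen n L)) ⊕ Fin (HE.evalCoins n L f) →
            Bool =>
          HE.eval n L f (fun i => x (.inl i)) (fun j i => x (.inr (.inl (j, i))))
            fun i => x (.inr (.inr i)))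
        (p.eval (n + L + f.size))

/-- For polynomially bounded depth, evaluating a circuit of polynomial size on fresh ciphertexts
and decrypting gives the value of the circuit, except with negligible probability. -/
def Correct : Prop :=
  ∀ L : ℕ → ℕ, PolyBounded L → ∀ p : Polynomial ℕ, ∃ ν : ℕ → ℝ, Negligible ν ∧
    ∀ (n l : ℕ) (f : BoolCircuit (Fin l) Unit) (μ : Bits l),
      f.depth ≤ L n → f.size ≤ p.eval n →
      prob (fun r : Fin (HE.keyCoins n (L n)) ⊕ (Fin l × Fin (HE.encCoins n (L n))) ⊕
          Fin (HE.evalCoins n (L n) f) → Bool =>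
        let κ : Bits (HE.keyCoins n (L n)) := fun i => r (.inl i)
        HE.dec n (L n) (HE.sk κ) (HE.eval n (L n) f (HE.evk κ)
          (fun j => HE.enc n (L n) (HE.pk κ) (μ j) fun i => r (.inr (.inl (j, i))))
          fun i => r (.inr (.inr i))) ≠ f.eval μ ()) ≤ ν n

/-- IND-CPA security against quantum adversaries of polynomial size. -/
def CPASecure : Prop :=
  ∀ L : ℕ → ℕ, PolyBounded L →
    ∀ A : (n : ℕ) → Distinguisher
        (Fin (HE.pkLen n (L n)) ⊕ Fin (HE.evkLen n (L n)) ⊕ Fin (HE.ctLen n (L n))),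
      PolyBounded (fun n => (A n).size) →
      Negligible fun n =>
        |avg (fun r : Fin (HE.keyCoins n (L n)) ⊕ Fin (HE.encCoins n (L n)) → Bool =>
            let κ : Bits (HE.keyCoins n (L n)) := fun i => r (.inl i)
            (A n).accept (Sum.elim (HE.pk κ) (Sum.elim (HE.evk κ)
              (HE.enc n (L n) (HE.pk κ) false fun i => r (.inr i))))) -
          avg (fun r : Fin (HE.keyCoins n (L n)) ⊕ Fin (HE.encCoins n (L n)) → Bool =>
            let κ : Bits (HE.keyCoins n (L n)) := fun i => r (.inl i)
            (A n).accept (Sum.elim (HE.pk κ) (Sum.elim (HE.evk κ)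
              (HE.enc n (L n) (HE.pk κ) true fun i => r (.inr i)))))|

/-- A classical leveled fully homomorphic encryption scheme. -/
def IsLeveledFHE : Prop := HE.Efficient ∧ HE.Correct ∧ HE.CPASecure

/-- `c` can occur during a computation under the keys with coins `κ`: it is the result of evaluating
a circuit of depth at most `L` and size at most `s` on fresh ciphertexts. -/
def Occurs {n L : ℕ} (s : ℕ) (κ : Bits (HE.keyCoins n L)) (c : Bits (HE.ctLen n L)) : Prop :=
  ∃ (l : ℕ) (f : BoolCircuit (Fin l) Unit) (μ : Bits l) (r : Fin l → Bits (HE.encCoins n L))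
    (ρ : Bits (HE.evalCoins n L f)), f.depth ≤ L ∧ f.size ≤ s ∧
      c = HE.eval n L f (HE.evk κ) (fun j => HE.enc n L (HE.pk κ) (μ j) (r j)) ρ

end LeveledHE

/-! ## Quantum capability -/

/-- The Hellinger distance `1 - ∑ √(f₁ f₂)` of two densities. -/
def hellinger {Y : Type} [Fintype Y] (f₁ f₂ : Y → ℝ) : ℝ := 1 - ∑ y, Real.sqrt (f₁ y * f₂ y)

open Classical in
/-- The density of `F w` for `w` with density `D`. -/
def pushDensity {X Y : Type} [Fintype X] (D : X → ℝ) (F : X → Y) : Y → ℝ :=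
  fun y => ∑ w, if F w = y then D w else 0

open Classical in
/-- The probability of `P` under the density `D`. -/
def probOf {X : Type} [Fintype X] (D : X → ℝ) (P : X → Prop) : ℝ :=
  ∑ w, if P w then D w else 0

/-- The data that make `HE` quantum capable for depth `Lc n`: the scheme AltHE, which has the same
public and secret keys as `HE`, the conversion, the homomorphic XOR and its inverse, the trapdoor
information (computed with the coins of the key generation), the recovery of message and
randomness, the density `D`, and the preparation of the superposition. A pair `(μ, r)` of a message
bit and randomness is a string `w` with `w none = μ` and `w (some i) = r i`. -/
structure AltScheme (HE : LeveledHE) (Lc : ℕ → ℕ) where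
  ctLen : ℕ → ℕ
  rndLen : ℕ → ℕ
  tdLen : ℕ → ℕ
  enc : (n : ℕ) → Bits (HE.pkLen n (Lc n)) → (Option (Fin (rndLen n)) → Bool) → Bits (ctLen n)
  dec : (n : ℕ) → Bits (HE.skLen n (Lc n)) → Bits (ctLen n) → Bool
  convert : (n : ℕ) → Bits (HE.pkLen n (Lc n)) → Bits (HE.ctLen n (Lc n)) → Bits (ctLen n)
  xor : (n : ℕ) → Bits (HE.pkLen n (Lc n)) → Bits (ctLen n) → Bits (ctLen n) → Bits (ctLen n)
  xorInv : (n : ℕ) → Bits (HE.pkLen n (Lc n)) → Bits (ctLen n) → Bits (ctLen n) → Bits (ctLen n)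
  trapdoor : (n : ℕ) → Bits (HE.keyCoins n (Lc n)) → Bits (tdLen n)
  recover : (n : ℕ) → Bits (HE.skLen n (Lc n)) → Bits (tdLen n) → Bits (ctLen n) →
    (Option (Fin (rndLen n)) → Bool)
  D : (n : ℕ) → Bits (HE.pkLen n (Lc n)) → (Option (Fin (rndLen n)) → Bool) → ℝ
  prep : (n : ℕ) → StatePrep (Fin (HE.pkLen n (Lc n))) (Option (Fin (rndLen n)))

namespace AltScheme

variable {HE : LeveledHE} {Lc : ℕ → ℕ} (A : AltScheme HE Lc)

/-- All algorithms have polynomial size. -/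
def Efficient : Prop :=
  ∃ p : Polynomial ℕ, ∀ n,
    ComputableInSize
      (fun x : Fin (HE.pkLen n (Lc n)) ⊕ Option (Fin (A.rndLen n)) → Bool =>
        A.enc n (fun i => x (.inl i)) fun i => x (.inr i)) (p.eval n) ∧
    ComputableInSize
      (fun (x : Fin (HE.skLen n (Lc n)) ⊕ Fin (A.ctLen n) → Bool) (_ : Unit) =>
        A.dec n (fun i => x (.inl i)) fun i => x (.inr i)) (p.eval n) ∧
    ComputableInSize
      (fun x : Fin (HE.pkLen n (Lc n)) ⊕ Fin (HE.ctLen n (Lc n)) → Bool =>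
        A.convert n (fun i => x (.inl i)) fun i => x (.inr i)) (p.eval n) ∧
    ComputableInSize
      (fun x : Fin (HE.pkLen n (Lc n)) ⊕ Fin (A.ctLen n) ⊕ Fin (A.ctLen n) → Bool =>
        A.xor n (fun i => x (.inl i)) (fun i => x (.inr (.inl i))) fun i => x (.inr (.inr i)))
      (p.eval n) ∧
    ComputableInSize
      (fun x : Fin (HE.pkLen n (Lc n)) ⊕ Fin (A.ctLen n) ⊕ Fin (A.ctLen n) → Bool =>
        A.xorInv n (fun i => x (.inl i)) (fun i => x (.inr (.inl i))) fun i => x (.inr (.inr i)))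
      (p.eval n) ∧
    ComputableInSize (A.trapdoor n) (p.eval n) ∧
    ComputableInSize
      (fun x : Fin (HE.skLen n (Lc n)) ⊕ Fin (A.tdLen n) ⊕ Fin (A.ctLen n) → Bool =>
        A.recover n (fun i => x (.inl i)) (fun i => x (.inr (.inl i)))
          fun i => x (.inr (.inr i))) (p.eval n) ∧
    (A.prep n).size ≤ p.eval n

/-- The requirements, with error `ε`, for the keys with coins `κ` and ciphertexts that occur in a
computation of size at most `s`. -/
def Capable (n s : ℕ) (ε : ℝ) (κ : Bits (HE.keyCoins n (Lc n))) : Prop :=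
  let pk := HE.pk κ
  let sk := HE.sk κ
  let D := A.D n pk
  -- the superposition with amplitudes `√D` is prepared from the public key
  traceDist ((A.prep n).density pk) (outer fun w => (Real.sqrt (D w) : ℂ)) ≤ ε ∧
  -- message and randomness are recovered from ciphertexts of samples of `D`
  probOf D (fun w => A.recover n sk (A.trapdoor n κ) (A.enc n pk w) ≠ w) ≤ ε ∧
  probOf D (fun w => A.dec n sk (A.enc n pk w) ≠ w none) ≤ ε ∧
  ∀ c, HE.Occurs s κ c →
    let cHat := A.convert n pk c
    -- the conversion preserves the encrypted bit
    A.dec n sk cHat = HE.dec n (Lc n) sk c ∧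
    -- the XOR operation is homomorphic and invertible
    probOf D (fun w => A.dec n sk (A.xor n pk (A.enc n pk w) cHat) ≠
      Bool.xor (w none) (A.dec n sk cHat)) ≤ ε ∧
    probOf D (fun w => A.xorInv n pk (A.xor n pk (A.enc n pk w) cHat) cHat ≠ A.enc n pk w) ≤ ε ∧
    -- ciphertexts of samples of `D` hardly change under a shift by `cHat`
    hellinger (pushDensity D fun w => A.enc n pk w)
      (pushDensity D fun w => A.xor n pk (A.enc n pk w) cHat) ≤ ε

/-- The data make `HE` quantum capable for depth `Lc`. -/
def IsQuantumCapable : Prop :=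
  A.Efficient ∧
  (∀ n pk, (∀ w, 0 ≤ A.D n pk w) ∧ ∑ w, A.D n pk w = 1) ∧
  ∀ p : Polynomial ℕ, ∃ ν : ℕ → ℝ, Negligible ν ∧
    ∀ n, prob (fun κ => ¬ A.Capable n (p.eval n) (ν n) κ) ≤ ν n

end AltScheme

/-! ## Pauli keys -/

/-- Indices of Pauli keys: `Sum.inl i` for the bit `z i`, `Sum.inr i` for the bit `x i`. -/
abbrev KeyIdx (W : Type) : Type := W ⊕ W

section Pauli

variable {W : Type}

/-- The Pauli operator `Z^z X^x`. -/
def pauli [Fintype W] (k : KeyIdx W → Bool) (ψ : Vec W) : Vec W :=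
  fun v => sgn (fun i => k (.inl i)) v * ψ (bxor v fun i => k (.inr i))

/-- The inverse `X^x Z^z` of the Pauli operator `Z^z X^x`. -/
def pauliInv [Fintype W] (k : KeyIdx W → Bool) (ψ : Vec W) : Vec W :=
  fun v => sgn (fun i => k (.inl i)) (bxor v fun i => k (.inr i)) * ψ (bxor v fun i => k (.inr i))

variable [DecidableEq W]

/-- Add the bit `b` to the key bit `i`. -/
def addKey (k : KeyIdx W → Bool) (i : KeyIdx W) (b : Bool) : KeyIdx W → Bool :=
  Function.update k i (xor (k i) b)

/-- The new Pauli key when a Clifford gate is moved past a Pauli operator. -/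
def CliffordGate.updateKey (k : KeyIdx W → Bool) : CliffordGate W → (KeyIdx W → Bool)
  | .h i => Function.update (Function.update k (.inl i) (k (.inr i))) (.inr i) (k (.inl i))
  | .k i => addKey k (.inl i) (k (.inr i))
  | .cnot c t _ => addKey (addKey k (.inr t) (k (.inr c))) (.inl c) (k (.inl t))

/-- The Pauli part of the Pauli operator conjugated by a Toffoli gate `T`:
`T Z^z X^x T⁻¹ = C P` up to a phase, where
`C = CNOT_{a,c}^{x_b} CNOT_{b,c}^{x_a} CZ_{a,b}^{z_c}` and `P` is the Pauli operator with the
new key. -/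
def ToffoliGate.updateKey (k : KeyIdx W → Bool) (t : ToffoliGate W) : KeyIdx W → Bool :=
  addKey (addKey (addKey k (.inl t.a) (k (.inr t.b) && k (.inl t.c)))
    (.inl t.b) (k (.inr t.a) && k (.inl t.c)))
    (.inr t.c) (k (.inr t.a) && k (.inr t.b))

/-- The exponents `x_b, x_a, z_c` of the controlled gates in `C`. -/
def ToffoliGate.controls (k : KeyIdx W → Bool) (t : ToffoliGate W) : Fin 3 → Bool :=
  ![k (.inr t.b), k (.inr t.a), k (.inl t.c)]

/-- The Pauli key after the three encrypted CNOT operations that remove `C`; the `j`-th operation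
leaves the Pauli operator `Z^α` on its control and `X^β` on its target, `(α, β) = e j`. The third
operation is conjugated by a Hadamard gate on its target. -/
def ToffoliGate.correctKey (k : KeyIdx W → Bool) (t : ToffoliGate W) (e : Fin 3 → Bool × Bool) :
    KeyIdx W → Bool :=
  addKey (addKey (addKey k (.inl t.a) (xor (e 0).1 (e 2).1))
    (.inl t.b) (xor (e 1).1 (e 2).2))
    (.inr t.c) (xor (e 0).2 (e 1).2)

/-- The Pauli key after the Clifford gates of a level. -/
def Level.cliffKey (l : Level W) (k : KeyIdx W → Bool) : KeyIdx W → Bool :=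
  l.cliff.foldl (fun k g => g.updateKey k) k

/-- The Pauli key after the Clifford and Toffoli gates of a level. -/
def Level.tofKey (l : Level W) (k : KeyIdx W → Bool) : KeyIdx W → Bool :=
  l.tof.foldl (fun k t => t.updateKey k) (l.cliffKey k)

/-- The Pauli key after the encrypted CNOT operations of a level. -/
def Level.correctKey (l : Level W) (k : KeyIdx W → Bool)
    (e : Fin l.tof.length × Fin 3 → Bool × Bool) : KeyIdx W → Bool :=
  (List.finRange l.tof.length).foldl
    (fun k t => (l.tof.get t).correctKey k fun j => e (t, j)) k

/-- Indices of the output bits of the classical computation of a level: Pauli keys, and the control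
bits of the encrypted CNOT operations. -/
abbrev LevelOut (l : Level W) : Type := KeyIdx W ⊕ (Fin l.tof.length × Fin 3)

/-- The classical computation on Pauli keys for the Clifford and Toffoli gates of a level. -/
def Level.output (l : Level W) (k : KeyIdx W → Bool) : LevelOut l → Bool :=
  Sum.elim (l.tofKey k) fun t => (l.tof.get t.1).controls (l.cliffKey k) t.2

end Pauli

/-! ## The classical circuits of the levels -/

section Levels

variable {HE : LeveledHE} {Lc : ℕ → ℕ} (A : AltScheme HE Lc) (n : ℕ)

/-- Indices of the classical data of an encrypted CNOT operation: the converted control ciphertext,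
the measured image `y`, and the measured string `d`. -/
abbrev RecIdx : Type := Fin (A.ctLen n) ⊕ Fin (A.ctLen n) ⊕ Option (Fin (A.rndLen n))

/-- Indices of the input bits of the classical computation that follows level `l`: the secret key,
trapdoor and public key used in level `l`, the ciphertexts of the Pauli keys, and the data of the
encrypted CNOT operations. -/
abbrev NextIn (l : Level (Fin n)) : Type :=
  (Fin (HE.skLen n (Lc n)) ⊕ Fin (A.tdLen n) ⊕ Fin (HE.pkLen n (Lc n))) ⊕
    (KeyIdx (Fin n) × Fin (HE.ctLen n (Lc n))) ⊕
    ((Fin l.tof.length × Fin 3) × RecIdx A n)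

variable {n}

/-- The exponents `d · ((μ₀, r₀) + (μ₁, r₁))` and `μ₀` of the Pauli operators left by an encrypted
CNOT operation with data `ĉ, y, d`, where `(μ₀, r₀)` is recovered from `y` and `(μ₁, r₁)` from the
solution `u` of `y = u ⊕ ĉ`. -/
def leftover (sk : Bits (HE.skLen n (Lc n))) (td : Bits (A.tdLen n))
    (pk : Bits (HE.pkLen n (Lc n))) (e : RecIdx A n → Bool) : Bool × Bool :=
  let cHat : Bits (A.ctLen n) := fun i => e (.inl i)
  let y : Bits (A.ctLen n) := fun i => e (.inr (.inl i))
  let d : Option (Fin (A.rndLen n)) → Bool := fun i => e (.inr (.inr i))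
  let w₀ := A.recover n sk td y
  let w₁ := A.recover n sk td (A.xorInv n pk y cHat)
  (dotBit d (bxor w₀ w₁), w₀ none)

/-- The classical computation between the encrypted CNOT operations of the level `l` and those of
the level `l'`: decrypt the Pauli keys, update them for the encrypted CNOT operations of `l`, and
then for the Clifford and Toffoli gates of `l'`. -/
def nextOutput (l l' : Level (Fin n)) (x : NextIn A n l → Bool) : LevelOut l' → Bool :=
  let sk : Bits (HE.skLen n (Lc n)) := fun i => x (.inl (.inl i))
  let td : Bits (A.tdLen n) := fun i => x (.inl (.inr (.inl i)))
  let pk : Bits (HE.pkLen n (Lc n)) := fun i => x (.inl (.inr (.inr i)))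
  let k : KeyIdx (Fin n) → Bool :=
    fun j => HE.dec n (Lc n) sk fun i => x (.inr (.inl (j, i)))
  l'.output (l.correctKey k fun t => leftover A sk td pk fun i => x (.inr (.inr (t, i))))

/-- Boolean circuits for the classical computations of the levels. -/
structure LevelCircuits where
  first : (n : ℕ) → (l : Level (Fin n)) → BoolCircuit (KeyIdx (Fin n)) (LevelOut l)
  next : (n : ℕ) → (l l' : Level (Fin n)) → BoolCircuit (NextIn A n l) (LevelOut l')

/-- The circuits compute the classical computations of the levels, in depth at most `Lc` and
polynomial size. -/
def LevelCircuits.Valid {A : AltScheme HE Lc} (V : LevelCircuits A) : Prop :=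
  (∀ n l x, (V.first n l).eval x = l.output x) ∧
  (∀ n l l' x, (V.next n l l').eval x = nextOutput A l l' x) ∧
  (∀ n l, (V.first n l).depth ≤ Lc n) ∧
  (∀ n l l', (V.next n l l').depth ≤ Lc n) ∧
  ∃ p : Polynomial ℕ,
    (∀ n l, (V.first n l).size ≤ p.eval (n + l.size)) ∧
    ∀ n l l', (V.next n l l').size ≤ p.eval (n + l.size + l'.size)

end Levels

/-! ## The homomorphic evaluation of quantum circuits -/

section Eval

variable {HE : LeveledHE} {W : Type}

/-- Encrypt bits with fresh coins. -/
def encBits (n L : ℕ) {I : Type} [Fintype I] [DecidableEq I] (pk : Bits (HE.pkLen n L))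
    (x : I → Bool) : QProg W (I → Bits (HE.ctLen n L)) := do
  let r ← QProg.coins (I × Fin (HE.encCoins n L))
  pure fun j => HE.enc n L pk (x j) fun i => r (j, i)

/-- Evaluate a circuit homomorphically, output bit by output bit. -/
def evalBits (n L : ℕ) {I O : Type} [Fintype I] [Fintype O] [DecidableEq O]
    (C : BoolCircuit I O) (evk : Bits (HE.evkLen n L)) (c : I → Bits (HE.ctLen n L)) :
    QProg W (O → Bits (HE.ctLen n L)) := do
  let r ← QProg.coins (Σ o : O, Fin (HE.evalCoins n L (C.single o)))
  pure fun o => HE.eval n L (C.single o) evk (fun j => c ((Fintype.equivFin I).symm j))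
    fun i => r ⟨o, i⟩

variable {Lc : ℕ → ℕ} (A : AltScheme HE Lc)

/-- The encrypted CNOT operation with control qubit `i` and target qubit `j`, for the ciphertext
`cHat` of AltHE: prepare the superposition over `w = (μ, r)` (the discarded qubits of the
preparation are found in state `g`), compute and measure `y = Enc w ⊕ a · cHat`, where `a` is the
value of the qubit `i`, add `μ` to the qubit `j`, apply Hadamard gates to `w` and measure `d`. -/
def encryptedCNOT [DecidableEq W] (n : ℕ) (pk : Bits (HE.pkLen n (Lc n)))
    (cHat : Bits (A.ctLen n)) (i j : W) :
    QProg W (Bits (A.ctLen n) × (Option (Fin (A.rndLen n)) → Bool)) := do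
  let o ← QProg.kraus
    fun (o : (Fin (HE.pkLen n (Lc n)) ⊕ Fin (A.prep n).anc → Bool) ×
        Bits (A.ctLen n) × (Option (Fin (A.rndLen n)) → Bool)) (ψ : Vec W) =>
      let (g, y, d) := o
      let image (a : Bool) (w : Option (Fin (A.rndLen n)) → Bool) : Bits (A.ctLen n) :=
        if a then A.xor n pk (A.enc n pk w) cHat else A.enc n pk w
      let joint : (W → Bool) → (Option (Fin (A.rndLen n)) → Bool) → ℂ :=
        fun v w => ψ v * (A.prep n).amp pk g w
      let collapsed : (W → Bool) → (Option (Fin (A.rndLen n)) → Bool) → ℂ :=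
        fun v w => if image (v i) w = y then joint v w else 0
      let added : (W → Bool) → (Option (Fin (A.rndLen n)) → Bool) → ℂ :=
        fun v w => collapsed (Function.update v j (xor (v j) (w none))) w
      fun v => ∑ w, (1 / (Real.sqrt 2 : ℂ)) ^ (A.rndLen n + 1) * sgn d w * added v w
  pure o.2

/-- Remove the gate number `j` of the correction `C` of a Toffoli gate by an encrypted CNOT
operation, given a ciphertext `c` of its exponent; the controlled phase gate is a CNOT conjugated by
a Hadamard gate on the target. The result consists of the converted ciphertext, `y` and `d`. -/
def removeGate [DecidableEq W] (n : ℕ) (pk : Bits (HE.pkLen n (Lc n))) (t : ToffoliGate W)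
    (j : Fin 3) (c : Bits (HE.ctLen n (Lc n))) : QProg W (RecIdx A n → Bool) := do
  let cHat := A.convert n pk c
  if j = 0 then
    let (y, d) ← encryptedCNOT A n pk cHat t.a t.c
    pure (Sum.elim cHat (Sum.elim y d))
  else if j = 1 then
    let (y, d) ← encryptedCNOT A n pk cHat t.b t.c
    pure (Sum.elim cHat (Sum.elim y d))
  else
    QProg.op (CliffordGate.h t.b).apply
    let (y, d) ← encryptedCNOT A n pk cHat t.a t.b
    QProg.op (CliffordGate.h t.b).apply
    pure (Sum.elim cHat (Sum.elim y d))

/-- The classical data held by the server after level `l`: the ciphertexts of the Pauli keys, and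
the data of the encrypted CNOT operations. -/
abbrev ServerData (n : ℕ) (l : Level W) : Type :=
  (KeyIdx W → Bits (HE.ctLen n (Lc n))) × (Fin l.tof.length × Fin 3 → RecIdx A n → Bool)

/-- The quantum part of a level: apply the Clifford and Toffoli gates, and then the encrypted CNOT
operations. The input consists of ciphertexts of the updated Pauli keys and of the controls. -/
def runLevel [DecidableEq W] (n : ℕ) (pk : Bits (HE.pkLen n (Lc n))) (l : Level W)
    (c : LevelOut l → Bits (HE.ctLen n (Lc n))) : QProg W (ServerData A n l) := do
  QProg.op l.apply
  let e ← QProg.forFin l.tof.length fun t => QProg.forFin 3 fun j =>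
    removeGate A n pk (l.tof.get t) j (c (.inr (t, j)))
  pure (fun i => c (.inl i), fun t => e t.1 t.2)

/-- Indices of the bits of the evaluation key: the evaluation keys of all levels, the public keys of
all but the first level, and for each level but the last the ciphertexts, under the next public
key, of the secret key and of the trapdoor. -/
abbrev EvkIdx (n L : ℕ) : Type :=
  (Fin (L + 1) × Fin (HE.evkLen n (Lc n))) ⊕ (Fin L × Fin (HE.pkLen n (Lc n))) ⊕
    (Fin L × (Fin (HE.skLen n (Lc n)) ⊕ Fin (A.tdLen n)) × Fin (HE.ctLen n (Lc n)))

variable {A}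

/-- The evaluation key of level `i`. -/
def evkAt {n L : ℕ} (e : EvkIdx A n L → Bool) (i : Fin (L + 1)) : Bits (HE.evkLen n (Lc n)) :=
  fun b => e (.inl (i, b))

/-- The public key of level `i`. -/
def pkAt {n L : ℕ} (pk : Bits (HE.pkLen n (Lc n))) (e : EvkIdx A n L → Bool) (i : Fin (L + 1)) :
    Bits (HE.pkLen n (Lc n)) :=
  Fin.cases pk (fun i b => e (.inr (.inl (i, b)))) i

/-- The ciphertexts of the secret key and the trapdoor of level `i`, under the public key of level
`i + 1`. -/
def encKeyAt {n L : ℕ} (e : EvkIdx A n L → Bool) (i : Fin L)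
    (j : Fin (HE.skLen n (Lc n)) ⊕ Fin (A.tdLen n)) : Bits (HE.ctLen n (Lc n)) :=
  fun b => e (.inr (.inr (i, j, b)))

/-- The server's computation up to level `i` (levels are counted from zero; level `L` has no gates).
In level `i + 1` the server encrypts the data of level `i` under the public key of level `i + 1`,
evaluates the classical circuit under that key, and runs the quantum part of the level. -/
def runUpTo (V : LevelCircuits A) {n L : ℕ} (C : QCircuit (Fin n) L)
    (pk : Bits (HE.pkLen n (Lc n))) (e : EvkIdx A n L → Bool)
    (c : KeyIdx (Fin n) → Bits (HE.ctLen n (Lc n))) :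
    (i : ℕ) → i ≤ L → QProg (Fin n) (ServerData A n (C.level i))
  | 0, _ => do
      let c' ← evalBits n (Lc n) (V.first n (C.level 0)) (evkAt e 0) c
      runLevel A n pk (C.level 0) c'
  | i + 1, h => do
      let s ← runUpTo V C pk e c i (Nat.le_of_succ_le h)
      let pk₀ := pkAt pk e ⟨i, by omega⟩
      let pk₁ := pkAt pk e ⟨i + 1, by omega⟩
      let cpk ← encBits n (Lc n) pk₁ pk₀
      let cc ← encBits n (Lc n) pk₁
        fun x : KeyIdx (Fin n) × Fin (HE.ctLen n (Lc n)) => s.1 x.1 x.2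
      let ce ← encBits n (Lc n) pk₁
        fun x : (Fin (C.level i).tof.length × Fin 3) × RecIdx A n => s.2 x.1 x.2
      let ck := encKeyAt e ⟨i, by omega⟩
      let c' ← evalBits n (Lc n) (V.next n (C.level i) (C.level (i + 1)))
        (evkAt e ⟨i + 1, by omega⟩)
        (Sum.elim (Sum.elim (fun j => ck (.inl j)) (Sum.elim (fun j => ck (.inr j)) cpk))
          (Sum.elim cc ce))
      runLevel A n pk₁ (C.level (i + 1)) c'

end Eval

/-! ## Quantum leveled homomorphic encryption -/

/-- A finite set of bit positions. -/
structure Reg where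
  carrier : Type
  [fin : Fintype carrier]
  [dec : DecidableEq carrier]

attribute [instance] Reg.fin Reg.dec

/-- The bit strings of a register. -/
abbrev Reg.Str (R : Reg) : Type := R.carrier → Bool

/-- The data of a quantum leveled homomorphic encryption scheme with classical keys, for messages
of `n` bits, where `n` is the security parameter and `L` the number of levels. Key generation,
encryption and decryption are classical. A ciphertext consists of `n` (qu)bits and a classical
part. The evaluation is quantum; the `n` qubits of its output are measured before decryption. -/
structure QuantumHE where
  PK : ℕ → ℕ → Reg
  EVK : ℕ → ℕ → Reg
  SK : ℕ → ℕ → Reg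
  KeyCoins : ℕ → ℕ → Reg
  EncCoins : ℕ → ℕ → Reg
  CT : ℕ → ℕ → Reg
  EvalCT : ℕ → ℕ → Reg
  pk : (n L : ℕ) → (KeyCoins n L).Str → (PK n L).Str
  evk : (n L : ℕ) → (KeyCoins n L).Str → (EVK n L).Str
  sk : (n L : ℕ) → (KeyCoins n L).Str → (SK n L).Str
  enc : (n L : ℕ) → (PK n L).Str → Bits n → (EncCoins n L).Str → Bits n × (CT n L).Str
  eval : (n L : ℕ) → QCircuit (Fin n) L → (PK n L).Str → (EVK n L).Str → (CT n L).Str →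
    QProg (Fin n) (EvalCT n L).Str
  dec : (n L : ℕ) → (SK n L).Str → Bits n → (EvalCT n L).Str → Bits n

namespace QuantumHE

variable (S : QuantumHE)

/-- Key generation, encryption and decryption are computed by Boolean circuits of size polynomial in
`n` and `L`, and the evaluation of `C` is realized by a quantum circuit of size polynomial in `n`,
`L` and the size of `C`. -/
def Efficient : Prop :=
  ∃ p : Polynomial ℕ, ∀ n L,
    ComputableInSize (fun κ : (S.KeyCoins n L).Str =>
      Sum.elim (S.pk n L κ) (Sum.elim (S.evk n L κ) (S.sk n L κ))) (p.eval (n + L)) ∧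
    ComputableInSize
      (fun x : (S.PK n L).carrier ⊕ Fin n ⊕ (S.EncCoins n L).carrier → Bool =>
        let c := S.enc n L (fun i => x (.inl i)) (fun i => x (.inr (.inl i)))
          fun i => x (.inr (.inr i))
        Sum.elim c.1 c.2) (p.eval (n + L)) ∧
    ComputableInSize
      (fun x : (S.SK n L).carrier ⊕ Fin n ⊕ (S.EvalCT n L).carrier → Bool =>
        S.dec n L (fun i => x (.inl i)) (fun i => x (.inr (.inl i)))
          fun i => x (.inr (.inr i))) (p.eval (n + L)) ∧
    ∀ C : QCircuit (Fin n) L,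
      QComputableInSize
        (fun x : (S.PK n L).carrier ⊕ (S.EVK n L).carrier ⊕ (S.CT n L).carrier → Bool =>
          S.eval n L C (fun i => x (.inl i)) (fun i => x (.inr (.inl i)))
            fun i => x (.inr (.inr i)))
        (p.eval (n + L + C.size))

/-- The length of the output of the evaluation is bounded by a polynomial in the security parameter
alone. -/
def Compact : Prop :=
  ∃ s : Polynomial ℕ, ∀ n L, n + Fintype.card (S.EvalCT n L).carrier ≤ s.eval n

/-- IND-CPA security against quantum adversaries of polynomial size. -/
def CPASecure : Prop :=
  ∀ L : ℕ → ℕ, PolyBounded L →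
    ∀ A : (n : ℕ) → Distinguisher
        ((S.PK n (L n)).carrier ⊕ (S.EVK n (L n)).carrier ⊕ Fin n ⊕ (S.CT n (L n)).carrier),
      PolyBounded (fun n => (A n).size) →
      ∀ m₀ m₁ : (n : ℕ) → Bits n,
        let acc (m : (n : ℕ) → Bits n) (n : ℕ) : ℝ :=
          avg fun r : (S.KeyCoins n (L n)).carrier ⊕ (S.EncCoins n (L n)).carrier → Bool =>
            let κ : (S.KeyCoins n (L n)).Str := fun i => r (.inl i)
            let c := S.enc n (L n) (S.pk n (L n) κ) (m n) fun i => r (.inr i)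
            (A n).accept (Sum.elim (S.pk n (L n) κ)
              (Sum.elim (S.evk n (L n) κ) (Sum.elim c.1 c.2)))
        Negligible fun n => |acc m₀ n - acc m₁ n|

/-- Generate keys, encrypt `m`, evaluate `C`, measure the output qubits and decrypt. The encryption
of `m` sets the qubits to `c.1`, by adding `c.1` to the initial state `|0⟩`. -/
def experiment {n L : ℕ} (C : QCircuit (Fin n) L) (m : Bits n) : QProg (Fin n) (Bits n) := do
  let κ ← QProg.coins (S.KeyCoins n L).carrier
  let r ← QProg.coins (S.EncCoins n L).carrier
  let c := S.enc n L (S.pk n L κ) m r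
  QProg.op fun ψ v => ψ (bxor v c.1)
  let out ← S.eval n L C (S.pk n L κ) (S.evk n L κ) c.2
  let x ← QProg.measure
  pure (S.dec n L (S.sk n L κ) x out)

/-- For a polynomially bounded number of levels and circuits of polynomial size, the decrypted
result of the evaluation of `C` on an encryption of `m` is distributed like the result of measuring
`C|m⟩`, up to negligible total variation distance. -/
def Correct : Prop :=
  ∀ L : ℕ → ℕ, PolyBounded L → ∀ p : Polynomial ℕ, ∃ ν : ℕ → ℝ, Negligible ν ∧
    ∀ (n : ℕ) (C : QCircuit (Fin n) (L n)) (m : Bits n), C.size ≤ p.eval n →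
      (∑ m' : Bits n, |(S.experiment C m).resultProb (ket fun _ => false) m' -
        ‖C.apply (ket m) m'‖ ^ 2|) / 2 ≤ ν n

/-- A quantum leveled fully homomorphic encryption scheme. -/
def IsQuantumLeveledFHE : Prop := S.Efficient ∧ S.CPASecure ∧ S.Compact ∧ S.Correct

end QuantumHE

/-! ## The scheme -/

section Scheme

variable {HE : LeveledHE} {Lc : ℕ → ℕ} {A : AltScheme HE Lc}

/-- Indices of the coins of the key generation: the coins of `L + 1` key pairs, and for each level
but the last the coins for encrypting the secret key and the trapdoor. -/
abbrev KeyCoinIdx (A : AltScheme HE Lc) (n L : ℕ) : Type :=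
  (Fin (L + 1) × Fin (HE.keyCoins n (Lc n))) ⊕
    (Fin L × (Fin (HE.skLen n (Lc n)) ⊕ Fin (A.tdLen n)) × Fin (HE.encCoins n (Lc n)))

/-- The coins of the key pair of level `i`. -/
def coinsAt {n L : ℕ} (κ : KeyCoinIdx A n L → Bool) (i : Fin (L + 1)) :
    Bits (HE.keyCoins n (Lc n)) := fun b => κ (.inl (i, b))

/-- The evaluation key. -/
def makeEvk {n L : ℕ} (κ : KeyCoinIdx A n L → Bool) : EvkIdx A n L → Bool
  | .inl (i, b) => HE.evk (coinsAt κ i) b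
  | .inr (.inl (i, b)) => HE.pk (coinsAt κ i.succ) b
  | .inr (.inr (i, j, b)) =>
      HE.enc n (Lc n) (HE.pk (coinsAt κ i.succ))
        (Sum.elim (HE.sk (coinsAt κ i.castSucc)) (A.trapdoor n (coinsAt κ i.castSucc)) j)
        (fun a => κ (.inr (i, j, a))) b

/-- The scheme QHE. The coins of the encryption are the Pauli keys `z, x` and the coins for
encrypting them; the message is padded to `x + m`, which is `Z^z X^x |m⟩` up to a phase. -/
def QHE (V : LevelCircuits A) : QuantumHE where
  PK n _ := ⟨Fin (HE.pkLen n (Lc n))⟩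
  EVK n L := ⟨EvkIdx A n L⟩
  SK n _ := ⟨Fin (HE.skLen n (Lc n))⟩
  KeyCoins n L := ⟨KeyCoinIdx A n L⟩
  EncCoins n _ := ⟨KeyIdx (Fin n) ⊕ (KeyIdx (Fin n) × Fin (HE.encCoins n (Lc n)))⟩
  CT n _ := ⟨KeyIdx (Fin n) × Fin (HE.ctLen n (Lc n))⟩
  EvalCT n _ := ⟨KeyIdx (Fin n) × Fin (HE.ctLen n (Lc n))⟩
  pk _ _ κ := HE.pk (coinsAt κ 0)
  evk _ _ κ := makeEvk κ
  sk _ L κ := HE.sk (coinsAt κ (Fin.last L))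
  enc n _ pk m r :=
    (bxor (fun i => r (.inl (.inr i))) m,
      fun x => HE.enc n (Lc n) pk (r (.inl x.1)) (fun a => r (.inr (x.1, a))) x.2)
  eval _ L C pk evk c := do
    let s ← runUpTo V C pk evk (fun j b => c (j, b)) L le_rfl
    pure fun x => s.1 x.1 x.2
  dec n _ sk m c := bxor (fun i => HE.dec n (Lc n) sk fun b => c (.inr i, b)) m

/-- Generate keys, encrypt a quantum state with random Pauli keys, evaluate `C` and remove the Pauli
operator given by the decrypted Pauli keys. -/
def stateExperiment (V : LevelCircuits A) {n L : ℕ} (C : QCircuit (Fin n) L) :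
    QProg (Fin n) Unit := do
  let κ ← QProg.coins (KeyCoinIdx A n L)
  let k ← QProg.coins (KeyIdx (Fin n))
  QProg.op (pauli k)
  let c ← encBits n (Lc n) (HE.pk (coinsAt κ 0)) k
  let out ← (QHE V).eval n L C (HE.pk (coinsAt κ 0)) (makeEvk κ) fun x => c x.1 x.2
  QProg.op (pauliInv fun j =>
    HE.dec n (Lc n) (HE.sk (coinsAt κ (Fin.last L))) fun b => out (j, b))

/-- For a polynomially bounded number of levels and circuits of polynomial size, the decryption of
the server's final state is within negligible trace distance of the ideal state `C|ψ⟩`. -/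
def FinalStateCorrect (V : LevelCircuits A) : Prop :=
  ∀ L : ℕ → ℕ, PolyBounded L → ∀ p : Polynomial ℕ, ∃ ν : ℕ → ℝ, Negligible ν ∧
    ∀ (n : ℕ) (C : QCircuit (Fin n) (L n)) (ψ : Vec (Fin n)), ∑ v, ‖ψ v‖ ^ 2 = 1 →
      C.size ≤ p.eval n →
      traceDist ((stateExperiment V C).density ψ) (outer (C.apply ψ)) ≤ ν n

end Scheme

end QFHE

end

/-!
Fully homomorphic encryption of quantum computations with classical keys.

The server keeps the state `Z^z X^x |ψ⟩` and classical ciphertexts of `z, x`. Moving the Pauli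
operator past a Clifford gate only changes `z, x` (`CliffordGate.exists_apply_pauli`). Moving it
past a Toffoli gate leaves in addition three gates `CNOT^s` with secret exponents `s`, one of them
conjugated by Hadamard gates (`ToffoliGate.apply_pauli`). The server holds ciphertexts of the
exponents and removes these gates by encrypted CNOT operations.

*Correctness.* The branches of an encrypted CNOT operation are given by Kraus operators. Given the
measured ciphertext `y`, each value of the control is, ideally, left with exactly one sample
`(μ, r)`. The two messages differ by `s`, so adding the message to the target applies `CNOT^s` up to
an `X` operator, and the measurement of the register in the Hadamard basis leaves a `Z` operator on the
control. The true Kraus operators differ from these ideal ones by the error of the prepared state,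
the weight of the samples that cannot be recovered from `y`, and the Hellinger distance between the
distributions of `y` for both values of the control (`sum_nsq_cnotKraus_sub_le`).

Errors are measured by `infid χ φ`, the squared distance of a branch `φ` from the multiples of the
intended state `χ`. It is insensitive to phases, and as a quadratic quantity it can be summed over
the unnormalized branches. An operation whose Kraus operators have error `ε` in mean square
multiplies the accumulated error by at most `1 + 1 / T` and adds a term proportional to `(1 + T) *
ε`. With `T` larger than the number of operations the factors remain bounded. The decryption of
Pauli keys and the recovery of randomness take place inside the next level's ciphertexts. Since the
next key pair and its ciphertexts use fresh coins, these coins can be resampled when the data of the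
server are given, and the homomorphic evaluation fails with negligible probability
(`ErrorBound.avg_failProb_le`, `ErrorBound.avg_runUpTo_le`). Finally, small `infid` on average
bounds the total variation distance of measured results (`sum_abs_measure_sub_le`) and the trace
distance of the final states (`traceDist_outer_le`).

*Security.* The adversary sees bits encrypted under `pk₁, …, pk_{L+1}`, where the secret key and the
trapdoor of each level but the last are encrypted under the next key. Starting with the last key
pair, whose secret key is not encrypted at all, the encrypted bits are replaced by zeros one by one.
Each replacement is an IND-CPA experiment: the remaining view is computed from the challenge by a
small circuit, whose coins are fixed to the best values (`abs_avg_hybrid_sub_le`). The number of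
replacements is polynomial, and the advantages have a common negligible bound since adversaries are
non-uniform (`LeveledHE.CPASecure.uniform`). In the end, the message is perfectly hidden by the
one-time pad (`avg_hybrid_univ`).

*Efficiency.* A Boolean circuit becomes a quantum circuit on basis states that returns its ancillas
to zero (`Comp.exists_oracle`). A process that alternates gates, classical computation, coin tosses
and measurements is turned into one circuit by deferring the measurements (`Realizes`,
`Realizes.bind`), with size additive under composition. The output of the evaluation consists of `λ`
qubits and `2 * λ` ciphertexts, which gives compactness.
-/

noncomputable section

namespace QFHE

/-! ### Composition of Boolean circuits -/

namespace BoolCircuit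

variable {ι ι' o : Type}

/-- The values of the gates so far, extended by the values of the gates of a list. -/
def run (x : ι → Bool) (vs : List Bool) (gs : List (BoolGate ι)) : List Bool :=
  gs.foldl (fun vs g => vs ++ [gateVal x vs g]) vs

theorem run_cons (x : ι → Bool) (vs : List Bool) (g : BoolGate ι) (gs : List (BoolGate ι)) :
    run x vs (g :: gs) = run x (vs ++ [gateVal x vs g]) gs := rfl

theorem run_append (x : ι → Bool) (vs : List Bool) (gs hs : List (BoolGate ι)) :
    run x vs (gs ++ hs) = run x (run x vs gs) hs := List.foldl_append

theorem length_run (x : ι → Bool) (gs : List (BoolGate ι)) :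
    ∀ vs, (run x vs gs).length = vs.length + gs.length := by
  induction gs with
  | nil => intro vs; rfl
  | cons g gs ih =>
    intro vs
    rw [run_cons, ih]
    simp only [List.length_append, List.length_cons, List.length_nil]
    omega

/-- Feed wires `s i` to the inputs of a circuit whose gates start at number `m`. -/
def substWire (s : ι → ι' ⊕ ℕ) (m : ℕ) : ι ⊕ ℕ → ι' ⊕ ℕ :=
  Sum.elim s fun k => .inr (m + k)

/-- Shift a gate of a circuit in the same way as `substWire` shifts its wires. -/
def substGate (s : ι → ι' ⊕ ℕ) (m : ℕ) : BoolGate ι → BoolGate ι'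
  | .const b => .const b
  | .not a => .not (substWire s m a)
  | .and a b => .and (substWire s m a) (substWire s m b)
  | .xor a b => .xor (substWire s m a) (substWire s m b)

theorem wireVal_substWire {x : ι' → Bool} {y : ι → Bool} {A : List Bool} {s : ι → ι' ⊕ ℕ}
    (h : ∀ vs i, wireVal x (A ++ vs) (s i) = y i) (vs : List Bool) (w : ι ⊕ ℕ) :
    wireVal x (A ++ vs) (substWire s A.length w) = wireVal y vs w := by
  cases w with
  | inl i => exact h vs i
  | inr k => simp [wireVal, substWire, List.getD_eq_getElem?_getD, List.getElem?_append_right]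

theorem run_subst {x : ι' → Bool} {y : ι → Bool} {A : List Bool} {s : ι → ι' ⊕ ℕ}
    (h : ∀ vs i, wireVal x (A ++ vs) (s i) = y i) (gs : List (BoolGate ι)) :
    ∀ vs, run x (A ++ vs) (gs.map (substGate s A.length)) = A ++ run y vs gs := by
  induction gs with
  | nil => intro vs; rfl
  | cons g gs ih =>
    intro vs
    have hg : gateVal x (A ++ vs) (substGate s A.length g) = gateVal y vs g := by
      cases g <;> simp [gateVal, substGate, wireVal_substWire h]
    rw [List.map_cons, run_cons, run_cons, hg, List.append_assoc, ih]

end BoolCircuit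

open BoolCircuit

/-- `F` is computed by a Boolean circuit with at most `g` gates whose outputs are inputs or existing
gates. In contrast to `ComputableInSize`, inputs and outputs are not counted. -/
def Comp {ι o : Type} (F : (ι → Bool) → (o → Bool)) (g : ℕ) : Prop :=
  ∃ C : BoolCircuit ι o, C.gates.length ≤ g ∧
    (∀ j k, C.out j = .inr k → k < C.gates.length) ∧ ∀ x, C.eval x = F x

section Comp

variable {ι ι' o o' m : Type}

theorem Comp.mono {F : (ι → Bool) → (o → Bool)} {g g' : ℕ} (h : Comp F g) (hg : g ≤ g') :
    Comp F g' := by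
  obtain ⟨C, h1, h2, h3⟩ := h
  exact ⟨C, h1.trans hg, h2, h3⟩

theorem Comp.congr {F G : (ι → Bool) → (o → Bool)} {g : ℕ} (h : Comp F g) (hFG : ∀ x, F x = G x) :
    Comp G g := by
  obtain rfl : F = G := funext hFG
  exact h

theorem Comp.computableInSize [Fintype ι] [Fintype o] {F : (ι → Bool) → (o → Bool)} {g s : ℕ}
    (h : Comp F g) (hs : Fintype.card ι + Fintype.card o + g ≤ s) : ComputableInSize F s := by
  obtain ⟨C, h1, _, h3⟩ := h
  exact ⟨C, h3, by unfold BoolCircuit.size; omega⟩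

theorem length_vals (C : BoolCircuit ι o) (x : ι → Bool) : (C.vals x).length = C.gates.length :=
  (length_run x C.gates []).trans (Nat.zero_add _)

/-- An additional gate with value zero replaces output wires that refer to no gate. -/
theorem comp_eval (C : BoolCircuit ι o) : Comp C.eval (C.gates.length + 1) := by
  refine ⟨⟨C.gates ++ [.const false],
    fun j => (C.out j).map id fun k => min k C.gates.length⟩, by simp, ?_, ?_⟩
  · intro j k hk
    simp only [List.length_append, List.length_cons, List.length_nil]
    rcases hj : C.out j with i | k' <;> simp [hj] at hk
    omega
  · intro x
    funext j
    have hv : vals ⟨C.gates ++ [.const false],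
        fun j => (C.out j).map id fun k => min k C.gates.length⟩ x = C.vals x ++ [false] := by
      exact run_append x [] C.gates [.const false]
    have hlen : (C.vals x).length = C.gates.length := by
      exact length_vals C x
    unfold BoolCircuit.eval
    rw [hv]
    rcases hj : C.out j with i | k
    · simp [wireVal, hj]
    · simp only [wireVal, hj, Sum.map_inr, Sum.elim_inr]
      rcases lt_or_ge k C.gates.length with hk | hk
      · rw [min_eq_left hk.le, List.getD_append _ _ _ _ (by omega)]
      · rw [List.getD_eq_default _ _ (hlen.trans_le hk), min_eq_right hk,
          List.getD_append_right _ _ _ _ hlen.le, hlen, Nat.sub_self]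
        rfl

theorem ComputableInSize.comp [Fintype ι] [Fintype o] {F : (ι → Bool) → (o → Bool)} {s : ℕ}
    (h : ComputableInSize F s) : Comp F (s + 1) := by
  obtain ⟨C, h1, h2⟩ := h
  unfold BoolCircuit.size at h2
  exact ((comp_eval C).congr h1).mono (by omega)

theorem ComputableInSize.card_le [Fintype ι] [Fintype o] {F : (ι → Bool) → (o → Bool)} {s : ℕ}
    (h : ComputableInSize F s) : Fintype.card ι ≤ s ∧ Fintype.card o ≤ s := by
  obtain ⟨C, h1, h2⟩ := h
  unfold BoolCircuit.size at h2
  omega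

theorem comp_wire (e : o → ι) : Comp (fun (x : ι → Bool) j => x (e j)) 0 :=
  ⟨⟨[], fun j => .inl (e j)⟩, le_rfl, fun _ _ h => by simp at h, fun _ => rfl⟩

theorem comp_const (c : o → Bool) : Comp (fun (_ : ι → Bool) => c) 2 := by
  refine ⟨⟨[.const false, .const true], fun j => .inr (if c j then 1 else 0)⟩, le_rfl, ?_, ?_⟩
  · intro j k h
    simp only [Sum.inr.injEq] at h
    simp only [List.length_cons, List.length_nil]
    split_ifs at h <;> omega
  · intro x
    funext j
    cases h : c j <;> simp [BoolCircuit.eval, vals, wireVal, gateVal, h]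

theorem comp_xor (a b : o → ι) [Fintype o] :
    Comp (fun (x : ι → Bool) j => xor (x (a j)) (x (b j))) (Fintype.card o) := by
  classical
  let e := Fintype.equivFin o
  let gs : List (BoolGate ι) :=
    List.ofFn fun k : Fin (Fintype.card o) => .xor (.inl (a (e.symm k))) (.inl (b (e.symm k)))
  have hrun : ∀ (x : ι → Bool) (l : List o) (vs : List Bool),
      run x vs (l.map fun j => BoolGate.xor (.inl (a j)) (.inl (b j))) =
        vs ++ l.map fun j => xor (x (a j)) (x (b j)) := by
    intro x l
    induction l with
    | nil => intro vs; simp [run]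
    | cons j l ih => intro vs; rw [List.map_cons, run_cons, ih]; simp [gateVal, wireVal]
  refine ⟨⟨(List.ofFn e.symm).map fun j => BoolGate.xor (.inl (a j)) (.inl (b j)),
    fun j => .inr (e j)⟩, by simp, ?_, ?_⟩
  · intro j k h
    simp only [Sum.inr.injEq] at h
    simp [← h]
  · intro x
    funext j
    have := hrun x (List.ofFn e.symm) []
    simp only [List.nil_append] at this
    unfold BoolCircuit.eval
    change wireVal x (run x [] _) _ = _
    rw [this]
    simp [wireVal, List.getD_eq_getElem?_getD]

theorem Comp.reindex {F : (ι → Bool) → (o → Bool)} {g : ℕ} (h : Comp F g) (e : o' → o) :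
    Comp (fun x j => F x (e j)) g := by
  obtain ⟨C, h1, h2, h3⟩ := h
  exact ⟨⟨C.gates, fun j => C.out (e j)⟩, h1, fun j k => h2 (e j) k,
    fun x => funext fun j => congrFun (h3 x) (e j)⟩

theorem Comp.compose {F : (ι → Bool) → (m → Bool)} {G : (m → Bool) → (o → Bool)} {g g' : ℕ}
    (hF : Comp F g) (hG : Comp G g') : Comp (fun x => G (F x)) (g + g') := by
  obtain ⟨C, h1, h2, h3⟩ := hF
  obtain ⟨C', h1', h2', h3'⟩ := hG
  let n := C.gates.length
  refine ⟨⟨C.gates ++ C'.gates.map (substGate C.out n), fun j => substWire C.out n (C'.out j)⟩,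
    by simp; omega, ?_, ?_⟩
  · intro j k hk
    rcases hj : C'.out j with i | k' <;> simp only [hj, substWire, Sum.elim_inl, Sum.elim_inr] at hk
    · have := h2 i k hk
      simp; omega
    · have := h2' j k' hj
      simp only [Sum.inr.injEq] at hk
      simp; omega
  · intro x
    -- The outputs of the first circuit are inputs or existing gates, so gates that are appended do
    -- not change them.
    have hA : ∀ vs i, wireVal x (C.vals x ++ vs) (C.out i) = F x i := by
      intro vs i
      rw [← h3 x]
      unfold BoolCircuit.eval
      rcases hi : C.out i with i' | k
      · simp [wireVal]
      · have := h2 i k hi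
        simp only [wireVal, Sum.elim_inr]
        rw [List.getD_append _ _ _ _ (by rw [length_vals]; exact this)]
    have hlen : n = (C.vals x).length := (length_vals C x).symm
    have hv : run x [] (C.gates ++ C'.gates.map (substGate C.out n)) =
        C.vals x ++ C'.vals (F x) := by
      rw [run_append, hlen]
      have := run_subst hA C'.gates []
      rwa [List.append_nil] at this
    change _ = G (F x)
    rw [← h3' (F x)]
    funext j
    change wireVal x (run x [] _) _ = _
    rw [hv]
    simp only [hlen]
    exact wireVal_substWire hA _ _

theorem Comp.precomp {F : (ι → Bool) → (o → Bool)} {g : ℕ} (h : Comp F g) (e : ι → ι') :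
    Comp (fun x => F fun i => x (e i)) g :=
  ((comp_wire e).compose h).mono (by omega)

theorem Comp.sum {F : (ι → Bool) → (o → Bool)} {G : (ι → Bool) → (o' → Bool)} {g g' : ℕ}
    (hF : Comp F g) (hG : Comp G g') : Comp (fun x => Sum.elim (F x) (G x)) (g + g') := by
  obtain ⟨C, h1, h2, h3⟩ := hF
  obtain ⟨C', h1', h2', h3'⟩ := hG
  let n := C.gates.length
  refine ⟨⟨C.gates ++ C'.gates.map (substGate .inl n),
    -- The second circuit reads the same inputs; only its gate numbers are shifted.
    Sum.elim C.out fun j => substWire .inl n (C'.out j)⟩, by simp; omega, ?_, ?_⟩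
  · rintro (j | j) k hk
    · have := h2 j k hk
      simp; omega
    · rcases hj : C'.out j with i | k' <;>
        simp only [hj, substWire, Sum.elim_inl, Sum.elim_inr] at hk
      · simp at hk
      · have := h2' j k' hj
        simp only [Sum.inr.injEq] at hk
        simp; omega
  · intro x
    have hA : ∀ vs i, wireVal x (C.vals x ++ vs) (.inl i) = x i := fun _ _ => rfl
    have hlen : n = (C.vals x).length := (length_vals C x).symm
    have hv : run x [] (C.gates ++ C'.gates.map (substGate .inl n)) =
        C.vals x ++ C'.vals x := by
      rw [run_append, hlen]
      have := run_subst hA C'.gates []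
      rwa [List.append_nil] at this
    funext j
    change wireVal x (run x [] _) _ = _
    rw [hv]
    rcases j with j | j
    · simp only [Sum.elim_inl]
      rw [← h3 x]
      unfold BoolCircuit.eval
      rcases hi : C.out j with i' | k
      · simp [wireVal]
      · have := h2 j k hi
        simp only [wireVal, Sum.elim_inr]
        rw [List.getD_append _ _ _ _ (by rw [length_vals]; exact this)]
    · simp only [Sum.elim_inr, hlen]
      rw [← h3' x]
      exact wireVal_substWire hA _ _

theorem comp_isEmpty [IsEmpty o] (F : (ι → Bool) → (o → Bool)) : Comp F 0 :=
  ⟨⟨[], isEmptyElim⟩, le_rfl, fun j => isEmptyElim j, fun _ => funext fun j => isEmptyElim j⟩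

theorem comp_fin {g : ℕ} : ∀ (k : ℕ) (F : Fin k → (ι → Bool) → (o → Bool)),
    (∀ j, Comp (F j) g) → Comp (fun x (p : Fin k × o) => F p.1 x p.2) (k * g)
  | 0, _, _ => (comp_isEmpty _).mono (by omega)
  | k + 1, F, h => by
    have h1 := (h 0).sum (comp_fin k (fun j => F j.succ) fun j => h j.succ)
    have h2 := h1.reindex (fun p : Fin (k + 1) × o =>
      Fin.cases (motive := fun _ => o ⊕ (Fin k × o)) (.inl p.2) (fun j => .inr (j, p.2)) p.1)
    refine (h2.congr fun x => ?_).mono (by rw [Nat.succ_mul]; omega)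
    funext ⟨j, b⟩
    refine Fin.cases ?_ (fun j => ?_) j <;> simp

/-- A family of circuits on the same inputs. -/
theorem Comp.family {J : Type} [Fintype J] {g : ℕ} {F : J → (ι → Bool) → (o → Bool)}
    (h : ∀ j, Comp (F j) g) : Comp (fun x (p : J × o) => F p.1 x p.2) (Fintype.card J * g) := by
  let e := Fintype.equivFin J
  have h1 := comp_fin (Fintype.card J) (fun k => F (e.symm k)) fun k => h _
  have h2 := h1.reindex fun p : J × o => (e p.1, p.2)
  simpa using h2

end Comp

/-! ### Gates as linear isometries -/

/-- The squared norm of a state vector. -/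
def nsq {X : Type} [Fintype X] (φ : X → ℂ) : ℝ := ∑ x, ‖φ x‖ ^ 2

theorem nsq_nonneg {X : Type} [Fintype X] (φ : X → ℂ) : 0 ≤ nsq φ :=
  Finset.sum_nonneg fun _ _ => sq_nonneg _

theorem nsq_smul {X : Type} [Fintype X] (c : ℂ) (φ : X → ℂ) : nsq (c • φ) = ‖c‖ ^ 2 * nsq φ := by
  simp [nsq, Finset.mul_sum, mul_pow]

theorem nsq_ket {W : Type} [Fintype W] [DecidableEq W] (x : W → Bool) : nsq (ket x) = 1 := by
  unfold nsq ket
  rw [Finset.sum_eq_single x] <;> simp +contextual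

/-- The involution that negates bit `i`. -/
def flip {W : Type} [DecidableEq W] (i : W) (v : W → Bool) : W → Bool :=
  Function.update v i (!v i)

section Linear

variable {W : Type} [DecidableEq W]

theorem flip_flip (i : W) (v : W → Bool) : flip i (flip i v) = v := by
  simp [flip]

theorem sum_flip [Fintype W] {M : Type} [AddCommMonoid M] (i : W) (f : (W → Bool) → M) :
    ∑ v, f (flip i v) = ∑ v, f v :=
  Equiv.sum_comp (Function.Involutive.toPerm (flip i) (flip_flip i)) f

theorem CliffordGate.isLinearMap (g : CliffordGate W) : IsLinearMap ℂ g.apply := by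
  cases g <;> constructor <;> intros <;> funext v <;>
    simp only [CliffordGate.apply, Pi.add_apply, Pi.smul_apply, smul_eq_mul] <;> ring

theorem ToffoliGate.isLinearMap (g : ToffoliGate W) : IsLinearMap ℂ g.apply :=
  ⟨fun _ _ => rfl, fun _ _ => rfl⟩

theorem QGate.isLinearMap (g : QGate W) : IsLinearMap ℂ g.apply := by
  cases g with
  | cliff g => exact g.isLinearMap
  | tof t => exact t.isLinearMap

theorem runGates_cons (g : QGate W) (gs : List (QGate W)) (ψ : Vec W) :
    runGates (g :: gs) ψ = runGates gs (g.apply ψ) := rfl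

theorem runGates_append (gs hs : List (QGate W)) (ψ : Vec W) :
    runGates (gs ++ hs) ψ = runGates hs (runGates gs ψ) := List.foldl_append

theorem runGates_isLinearMap (gs : List (QGate W)) : IsLinearMap ℂ (runGates gs) := by
  induction gs with
  | nil => exact ⟨fun _ _ => rfl, fun _ _ => rfl⟩
  | cons g gs ih =>
    exact ⟨fun a b => by rw [runGates_cons, g.isLinearMap.map_add, ih.map_add]; rfl,
      fun c a => by rw [runGates_cons, g.isLinearMap.map_smul, ih.map_smul]; rfl⟩

theorem runGates_sum {I : Type} (gs : List (QGate W)) (s : Finset I) (f : I → Vec W) :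
    runGates gs (∑ i ∈ s, f i) = ∑ i ∈ s, runGates gs (f i) :=
  map_sum (IsLinearMap.mk' _ (runGates_isLinearMap gs)) f s

theorem nsq_reindex [Fintype W] {r : (W → Bool) → (W → Bool)} (hr : Function.Involutive r)
    (ψ : Vec W) : nsq (fun v => ψ (r v)) = nsq ψ :=
  Equiv.sum_comp hr.toPerm fun v => ‖ψ v‖ ^ 2

theorem cnot_involutive {c t : W} (hne : c ≠ t) :
    Function.Involutive fun v : W → Bool => Function.update v t (xor (v t) (v c)) := by
  intro v
  simp [Function.update_of_ne hne]

theorem tof_involutive (g : ToffoliGate W) :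
    Function.Involutive fun v : W → Bool =>
      Function.update v g.c (xor (v g.c) (v g.a && v g.b)) := by
  intro v
  simp [Function.update_of_ne g.hac, Function.update_of_ne g.hbc]

/-- The Hadamard gate is an isometry by the parallelogram law on each pair of basis states that
differ in bit `i`. -/
theorem CliffordGate.nsq_apply [Fintype W] (g : CliffordGate W) (ψ : Vec W) :
    nsq (g.apply ψ) = nsq ψ := by
  cases g with
  | h i =>
    have key : ∀ v, ‖(CliffordGate.h i).apply ψ v‖ ^ 2 + ‖(CliffordGate.h i).apply ψ (flip i v)‖ ^ 2
        = ‖ψ v‖ ^ 2 + ‖ψ (flip i v)‖ ^ 2 := by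
      intro v
      have h2 : ‖(1 / (Real.sqrt 2 : ℂ))‖ ^ 2 = 1 / 2 := by
        rw [norm_div, norm_one, Complex.norm_real, div_pow, Real.norm_eq_abs, sq_abs,
          Real.sq_sqrt (by norm_num)]
        norm_num
      have hpar := fun a b : ℂ => parallelogram_law_with_norm ℝ a b
      have hv : Function.update v i (v i) = v := Function.update_eq_self i v
      cases hi : v i
      · have e1 : Function.update v i false = v := by rw [← hi]; exact hv
        have e2 : flip i v = Function.update v i true := by simp [flip, hi]
        simp only [CliffordGate.apply, e1, e2, hi, Function.update_self, Function.update_idem,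
          norm_mul, mul_pow, h2]
        have := hpar (ψ v) (ψ (Function.update v i true))
        simp only [sub_eq_add_neg] at this
        simp
        nlinarith [this]
      · have e1 : Function.update v i true = v := by rw [← hi]; exact hv
        have e2 : flip i v = Function.update v i false := by simp [flip, hi]
        simp only [CliffordGate.apply, e1, e2, hi, Function.update_self, Function.update_idem,
          norm_mul, mul_pow, h2]
        have := hpar (ψ (Function.update v i false)) (ψ v)
        simp only [sub_eq_add_neg] at this
        simp
        nlinarith [this]
    -- Summing over all `v` counts each pair of basis states twice on both sides.
    have h1 := Finset.sum_congr rfl fun v (_ : v ∈ Finset.univ) => key v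
    simp only [Finset.sum_add_distrib] at h1
    rw [sum_flip i fun v => ‖(CliffordGate.h i).apply ψ v‖ ^ 2, sum_flip i fun v => ‖ψ v‖ ^ 2] at h1
    unfold nsq
    linarith
  | k i =>
    unfold nsq CliffordGate.apply
    refine Finset.sum_congr rfl fun v _ => ?_
    dsimp only
    split_ifs <;> simp
  | cnot c t hne => exact nsq_reindex (cnot_involutive hne) ψ

theorem ToffoliGate.nsq_apply [Fintype W] (g : ToffoliGate W) (ψ : Vec W) :
    nsq (g.apply ψ) = nsq ψ := nsq_reindex (tof_involutive g) ψ

theorem QGate.nsq_apply [Fintype W] (g : QGate W) (ψ : Vec W) : nsq (g.apply ψ) = nsq ψ := by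
  cases g with
  | cliff g => exact g.nsq_apply ψ
  | tof t => exact t.nsq_apply ψ

theorem nsq_runGates [Fintype W] (gs : List (QGate W)) : ∀ ψ : Vec W,
    nsq (runGates gs ψ) = nsq ψ := by
  induction gs with
  | nil => exact fun _ => rfl
  | cons g gs ih => exact fun ψ => (ih _).trans (g.nsq_apply ψ)

end Linear

/-! ### Gates on a larger set of qubits -/

section Map

variable {W W' : Type}

/-- A gate on the images of its qubits under an embedding of the qubits. -/
def CliffordGate.map (e : W ↪ W') : CliffordGate W → CliffordGate W'
  | .h i => .h (e i)
  | .k i => .k (e i)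
  | .cnot c t hne => .cnot (e c) (e t) (e.injective.ne hne)

/-- A Toffoli gate on the images of its qubits under an embedding. -/
def ToffoliGate.map (e : W ↪ W') (t : ToffoliGate W) : ToffoliGate W' :=
  ⟨e t.a, e t.b, e t.c, e.injective.ne t.hab, e.injective.ne t.hac, e.injective.ne t.hbc⟩

/-- A gate on the images of its qubits under an embedding. -/
def QGate.map (e : W ↪ W') : QGate W → QGate W'
  | .cliff g => .cliff (g.map e)
  | .tof t => .tof (t.map e)

/-- The bit string `v'` with the bits in the range of `e` replaced by `v`. -/
def glue (e : W ↪ W') (v : W → Bool) (v' : W' → Bool) : W' → Bool := Function.extend e v v'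

theorem glue_apply (e : W ↪ W') (v : W → Bool) (v' : W' → Bool) (i : W) : glue e v v' (e i) = v i :=
  e.injective.extend_apply _ _ _

theorem glue_of_notMem {e : W ↪ W'} {v : W → Bool} {v' : W' → Bool} {j : W'}
    (h : ∀ i, e i ≠ j) : glue e v v' j = v' j :=
  Function.extend_apply' _ _ _ fun ⟨i, hi⟩ => h i hi

theorem glue_comp (e : W ↪ W') (v : W → Bool) (v' : W' → Bool) : (fun i => glue e v v' (e i)) = v :=
  funext fun i => glue_apply e v v' i

theorem glue_glue (e : W ↪ W') (v w : W → Bool) (v' : W' → Bool) :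
    glue e w (glue e v v') = glue e w v' := by
  funext j
  by_cases h : ∃ i, e i = j
  · obtain ⟨i, rfl⟩ := h
    rw [glue_apply, glue_apply]
  · push Not at h
    rw [glue_of_notMem h, glue_of_notMem h, glue_of_notMem h]

theorem glue_self (e : W ↪ W') (v' : W' → Bool) : glue e (fun i => v' (e i)) v' = v' := by
  funext j
  by_cases h : ∃ i, e i = j
  · obtain ⟨i, rfl⟩ := h
    rw [glue_apply]
  · push Not at h
    rw [glue_of_notMem h]

variable [DecidableEq W] [DecidableEq W']

theorem update_eq_glue (e : W ↪ W') (v' : W' → Bool) (i : W) (b : Bool) :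
    Function.update v' (e i) b = glue e (Function.update (fun i => v' (e i)) i b) v' := by
  funext j
  by_cases h : ∃ i, e i = j
  · obtain ⟨k, rfl⟩ := h
    rw [glue_apply]
    by_cases hk : k = i
    · subst hk; simp
    · rw [Function.update_of_ne hk, Function.update_of_ne (e.injective.ne hk)]
  · push Not at h
    rw [glue_of_notMem h, Function.update_of_ne (h i).symm]

/-- A gate acts on the qubits in the range of an embedding, for each state of the other qubits. -/
theorem QGate.apply_map (e : W ↪ W') (g : QGate W) (Ψ : Vec W') (v' : W' → Bool) :
    (g.map e).apply Ψ v' = g.apply (fun v => Ψ (glue e v v')) fun i => v' (e i) := by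
  cases g with
  | cliff g =>
    cases g with
    | h i => simp [QGate.map, CliffordGate.map, QGate.apply, CliffordGate.apply, update_eq_glue]
    | k i => simp [QGate.map, CliffordGate.map, QGate.apply, CliffordGate.apply, glue_self]
    | cnot c t hne =>
      simp [QGate.map, CliffordGate.map, QGate.apply, CliffordGate.apply, update_eq_glue]
  | tof t =>
    simp [QGate.map, ToffoliGate.map, QGate.apply, ToffoliGate.apply, update_eq_glue]

theorem runGates_map (e : W ↪ W') (gs : List (QGate W)) : ∀ (Ψ : Vec W') (v' : W' → Bool),
    runGates (gs.map (QGate.map e)) Ψ v' =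
      runGates gs (fun v => Ψ (glue e v v')) fun i => v' (e i) := by
  induction gs with
  | nil => intro Ψ v'; simp [runGates, glue_self]
  | cons g gs ih =>
    intro Ψ v'
    rw [List.map_cons, runGates_cons, ih, runGates_cons]
    congr 1
    funext v
    rw [QGate.apply_map]
    simp only [glue_glue, glue_apply]

end Map

/-! ### Boolean circuits as quantum circuits -/

section Permutes

variable {Q : Type} [DecidableEq Q]

/-- The gates map the basis state `v` to the basis state `R v`. -/
def Permutes (gs : List (QGate Q)) (R : (Q → Bool) → (Q → Bool)) : Prop :=
  ∀ (Ψ : Vec Q) v, runGates gs Ψ (R v) = Ψ v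

theorem Permutes.append {gs hs : List (QGate Q)} {R S : (Q → Bool) → (Q → Bool)}
    (h : Permutes gs R) (h' : Permutes hs S) : Permutes (gs ++ hs) fun v => S (R v) := by
  intro Ψ v
  rw [runGates_append, h', h]

theorem permutes_nil : Permutes ([] : List (QGate Q)) id := fun _ _ => rfl

theorem permutes_cnot {c t : Q} (hne : c ≠ t) :
    Permutes [.cliff (.cnot c t hne)] fun v => Function.update v t (xor (v t) (v c)) := by
  intro Ψ v
  exact congrArg Ψ (cnot_involutive hne v)

theorem permutes_tof (t : ToffoliGate Q) :
    Permutes [.tof t] fun v => Function.update v t.c (xor (v t.c) (v t.a && v t.b)) := by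
  intro Ψ v
  exact congrArg Ψ (tof_involutive t v)

/-- The gate `X = H K K H`. -/
def notGates (i : Q) : List (QGate Q) :=
  [.cliff (.h i), .cliff (.k i), .cliff (.k i), .cliff (.h i)]

theorem one_div_sqrt_two_mul_self :
    (1 / (Real.sqrt 2 : ℂ)) * (1 / (Real.sqrt 2 : ℂ)) = 1 / 2 := by
  rw [div_mul_div_comm, one_mul, ← Complex.ofReal_mul, Real.mul_self_sqrt (by norm_num)]
  norm_num

theorem permutes_not (i : Q) : Permutes (notGates i) (flip i) := by
  intro Ψ v
  have h2 := one_div_sqrt_two_mul_self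
  simp only [notGates, runGates, List.foldl_cons, List.foldl_nil, QGate.apply, CliffordGate.apply,
    flip, Function.update_self, Function.update_idem]
  generalize (1 / (Real.sqrt 2 : ℂ)) = c at h2
  have hv : Function.update v i (v i) = v := Function.update_eq_self i v
  cases hi : v i <;> rw [hi] at hv <;> simp [hv]
  · linear_combination
      (2 * Ψ v) * h2 + c ^ 2 * (Ψ (Function.update v i true) - Ψ v) * Complex.I_sq
  · linear_combination
      (2 * Ψ v) * h2 + c ^ 2 * (Ψ (Function.update v i false) - Ψ v) * Complex.I_sq

theorem not_cnot_involutive {c t : Q} (hne : c ≠ t) :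
    Function.Involutive fun v : Q → Bool =>
      Function.update (flip t v) t (xor (flip t v t) (flip t v c)) := by
  intro v
  simp [flip, Function.update_of_ne hne]

theorem cnot_cnot_involutive {a b t : Q} (ha : a ≠ t) (hb : b ≠ t) :
    Function.Involutive fun v : Q → Bool =>
      Function.update (Function.update v t (xor (v t) (v a))) t
        (xor (Function.update v t (xor (v t) (v a)) t) (Function.update v t (xor (v t) (v a)) b)) :=
    by
  intro v
  simp only [Function.update_of_ne ha, Function.update_of_ne hb, Function.update_self,
    Function.update_idem]
  convert Function.update_eq_self t v using 2
  cases v t <;> cases v a <;> cases v b <;> rfl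

end Permutes

section Compile

variable {E o : Type}

/-- The wires of a reversible computation: inputs, outputs, and ancillas. -/
abbrev OracleWires (E o : Type) (n : ℕ) : Type := E ⊕ o ⊕ Fin (n + 1)

/-- The wire that holds the value of a wire of the Boolean circuit while gate `k` is computed. The
last ancilla is always zero and replaces the gates that do not exist yet. -/
def readWire (n k : ℕ) : E ⊕ ℕ → OracleWires E o n :=
  Sum.elim .inl fun j => .inr (.inr (if h : j < k ∧ j < n then ⟨j, by omega⟩ else Fin.last n))

/-- The assignment of wires with inputs `x`, outputs `y` and gate values `vs`. -/
def wires (n : ℕ) (x : E → Bool) (y : o → Bool) (vs : List Bool) : OracleWires E o n → Bool :=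
  Sum.elim x (Sum.elim y fun j => vs.getD j false)

theorem wires_readWire {n : ℕ} (x : E → Bool) (y : o → Bool) {vs : List Bool} (hn : vs.length ≤ n)
    (w : E ⊕ ℕ) :
    wires n x y vs (readWire n vs.length w) = BoolCircuit.wireVal x vs w := by
  rcases w with i | j
  · rfl
  · simp only [wires, readWire, BoolCircuit.wireVal, Sum.elim_inr]
    split_ifs with h
    · rfl
    · rw [List.getD_eq_default _ _ (by simpa using hn), List.getD_eq_default _ _ (by omega)]

theorem update_wires [DecidableEq E] [DecidableEq o] {n k : ℕ} (x : E → Bool) (y : o → Bool)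
    {vs : List Bool} (hk : vs.length = k)
    (hn : k < n) (b : Bool) :
    Function.update (wires n x y vs) (.inr (.inr ⟨k, by omega⟩)) b = wires n x y (vs ++ [b]) := by
  subst hk
  funext w
  rcases w with i | i | j
  · simp [wires]
  · simp [wires]
  · by_cases hj : j = ⟨vs.length, by omega⟩
    · subst hj
      simp [wires]
    · rw [Function.update_of_ne (by simpa using hj)]
      simp only [wires, Sum.elim_inr]
      have hj' : (j : ℕ) ≠ vs.length := fun h => hj (Fin.ext h)
      rcases lt_or_gt_of_ne hj' with h | h
      · rw [List.getD_append _ _ _ _ h]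
      · rw [List.getD_eq_default _ _ h.le, List.getD_eq_default _ _ (by simp; omega)]

/-- No gate reads the ancilla into which it is computed, as CNOT and Toffoli gates require. -/
theorem readWire_ne {n k : ℕ} (hn : k < n) (w : E ⊕ ℕ) :
    readWire (o := o) n k w ≠ .inr (.inr ⟨k, by omega⟩) := by
  rcases w with i | j
  · simp [readWire]
  · simp only [readWire, Sum.elim_inr, ne_eq, Sum.inr.injEq]
    split_ifs with h
    · intro h'
      have := congrArg Fin.val h'
      simp at this
      omega
    · intro h'
      have := congrArg Fin.val h'
      simp at this
      omega

theorem update_wires_out [DecidableEq E] [DecidableEq o] {n : ℕ} (x : E → Bool) (y : o → Bool)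
    (vs : List Bool) (j : o) (b : Bool) :
    Function.update (wires n x y vs) (.inr (.inl j)) b =
      wires n x (Function.update y j b) vs := by
  rw [wires, Sum.update_elim_inr, Sum.update_elim_inl, wires]

variable [DecidableEq E] [DecidableEq o]

/-- A gate of a Boolean circuit is computed into its ancilla by at most five gates, and this
operation is an involution. -/
theorem exists_permutes_gate {n k : ℕ} (hn : k < n) (g : BoolGate E) :
    ∃ (U : List (QGate (OracleWires E o n))) (R : (OracleWires E o n → Bool) → _),
      U.length ≤ 5 ∧ Permutes U R ∧ Function.Involutive R ∧
      ∀ x y (vs : List Bool), vs.length = k →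
        R (wires n x y vs) = wires n x y (vs ++ [BoolCircuit.gateVal x vs g]) := by
  let t : OracleWires E o n := .inr (.inr ⟨k, by omega⟩)
  have h0 : ∀ x y (vs : List Bool), vs.length = k → wires n x y vs t = false := by
    intro x y vs h
    simp [wires, t, ← h]
  cases g with
  | const b =>
    cases b with
    | false =>
      refine ⟨[], id, by simp, permutes_nil, fun _ => rfl, fun x y vs h => ?_⟩
      rw [← update_wires x y h hn]
      exact (Function.update_eq_self_iff.2 (h0 x y vs h).symm).symm
    | true =>
      refine ⟨notGates t, flip t, by simp [notGates], permutes_not t, flip_flip t,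
        fun x y vs h => ?_⟩
      rw [← update_wires x y h hn, flip, h0 x y vs h]
      rfl
  | not a =>
    have ha := readWire_ne (o := o) hn a
    refine ⟨notGates t ++ [.cliff (.cnot _ t ha)], _, by simp [notGates],
      (permutes_not t).append (permutes_cnot ha), not_cnot_involutive ha,
      fun x y vs h => ?_⟩
    · have ha' : readWire n k a ≠ t := ha
      rw [← update_wires x y h hn]
      have hr := wires_readWire x y (by omega : vs.length ≤ n) a
      rw [h] at hr
      simp [flip, Function.update_of_ne ha', h0 x y vs h, hr, BoolCircuit.gateVal, t]
  | and a b =>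
    have ha := readWire_ne (o := o) hn a
    have hb := readWire_ne (o := o) hn b
    -- A Toffoli gate needs two distinct controls.
    by_cases hab : readWire (o := o) n k a = readWire n k b
    · refine ⟨[.cliff (.cnot _ t ha)], _, by simp, permutes_cnot ha, cnot_involutive ha,
        fun x y vs h => ?_⟩
      rw [← update_wires x y h hn]
      have hr := wires_readWire x y (by omega : vs.length ≤ n) a
      have hr' := wires_readWire x y (by omega : vs.length ≤ n) b
      rw [h] at hr hr'
      rw [← hab, hr] at hr'
      simp [h0 x y vs h, hr, BoolCircuit.gateVal, t, ← hr']
    · refine ⟨[.tof ⟨_, _, t, hab, ha, hb⟩], _, by simp, permutes_tof _, tof_involutive _,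
        fun x y vs h => ?_⟩
      rw [← update_wires x y h hn]
      have hr := wires_readWire x y (by omega : vs.length ≤ n) a
      have hr' := wires_readWire x y (by omega : vs.length ≤ n) b
      rw [h] at hr hr'
      simp [h0 x y vs h, hr, hr', BoolCircuit.gateVal, t]
  | xor a b =>
    have ha := readWire_ne (o := o) hn a
    have hb := readWire_ne (o := o) hn b
    have ha' : readWire n k a ≠ t := ha
    have hb' : readWire n k b ≠ t := hb
    refine ⟨[.cliff (.cnot _ t ha)] ++ [.cliff (.cnot _ t hb)], _, by simp,
      (permutes_cnot ha).append (permutes_cnot hb), cnot_cnot_involutive ha hb,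
      fun x y vs h => ?_⟩
    · rw [← update_wires x y h hn]
      have hr := wires_readWire x y (by omega : vs.length ≤ n) a
      have hr' := wires_readWire x y (by omega : vs.length ≤ n) b
      rw [h] at hr hr'
      simp [h0 x y vs h, Function.update_of_ne hb', hr, hr', BoolCircuit.gateVal, t]

/-- The gates of a Boolean circuit are computed into ancillas, and uncomputed. -/
theorem exists_permutes_gates {n : ℕ} (gs : List (BoolGate E)) : ∀ k, k + gs.length ≤ n →
    ∃ (U U' : List (QGate (OracleWires E o n))) (R R' : (OracleWires E o n → Bool) → _),
      U.length ≤ 5 * gs.length ∧ U'.length ≤ 5 * gs.length ∧ Permutes U R ∧ Permutes U' R' ∧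
      (∀ v, R' (R v) = v) ∧
      ∀ x y (vs : List Bool), vs.length = k →
        R (wires n x y vs) = wires n x y (BoolCircuit.run x vs gs) := by
  induction gs with
  | nil =>
    intro k _
    exact ⟨[], [], id, id, by simp, by simp, permutes_nil, permutes_nil, fun _ => rfl,
      fun _ _ _ _ => rfl⟩
  | cons g gs ih =>
    intro k hk
    simp only [List.length_cons] at hk
    obtain ⟨G, S, hG, hS, hi, hw⟩ := exists_permutes_gate (o := o) (by omega : k < n) g
    obtain ⟨U, U', R, R', h1, h2, h3, h4, h5, h6⟩ := ih (k + 1) (by omega)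
    refine ⟨G ++ U, U' ++ G, _, _, ?_, ?_, hS.append h3, h4.append hS, fun v => ?_,
      fun x y vs h => ?_⟩
    · simp; omega
    · simp; omega
    · simp only [h5, hi (v)]
    · rw [hw x y vs h, h6 x y _ (by simp [h]), BoolCircuit.run_cons]

/-- A function that is computed by a Boolean circuit is added to output wires by a quantum circuit
that returns its ancillas to zero. -/
theorem Comp.exists_oracle [Fintype o] {F : (E → Bool) → (o → Bool)} {g : ℕ} (hF : Comp F g) :
    ∃ (n : ℕ) (U : List (QGate (OracleWires E o n))) (R : (OracleWires E o n → Bool) → _),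
      n ≤ g ∧ U.length ≤ 10 * g + Fintype.card o ∧ Permutes U R ∧
      ∀ x y, R (Sum.elim x (Sum.elim y fun _ => false)) =
        Sum.elim x (Sum.elim (bxor y (F x)) fun _ => false) := by
  obtain ⟨C, hg, hout, hC⟩ := hF
  let n := C.gates.length
  obtain ⟨U, U', R, R', h1, h2, h3, h4, h5, h6⟩ :=
    exists_permutes_gates (o := o) (n := n) C.gates 0 (by omega)
  have hwires : ∀ x y, (Sum.elim x (Sum.elim y fun _ => false) : OracleWires E o n → Bool) =
      wires n x y [] := by
    intro x y
    funext w
    rcases w with i | i | i <;> simp [wires]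
  let rd (j : o) : OracleWires E o n := readWire n n (C.out j)
  have hrd : ∀ (x : E → Bool) y j, wires n x y (C.vals x) (rd j) = F x j := by
    intro x y j
    have hl : (C.vals x).length = n := length_vals C x
    have := wires_readWire x y hl.le (C.out j)
    rw [hl] at this
    rw [← hC x]
    exact this
  have hne : ∀ j i, rd j ≠ .inr (.inl i) := by
    intro j i
    simp only [rd]
    rcases C.out j with a | a <;> simp [readWire]
  -- Between computation and uncomputation the results are added to the outputs by CNOT gates.
  have hcopy : ∀ l : List o, l.Nodup →
      ∃ (V : List (QGate (OracleWires E o n))) (S : (OracleWires E o n → Bool) → _),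
        V.length ≤ l.length ∧ Permutes V S ∧ ∀ x y, S (wires n x y (C.vals x)) =
          wires n x (fun j => if j ∈ l then xor (y j) (F x j) else y j) (C.vals x) := by
    intro l
    induction l with
    | nil => intro _; exact ⟨[], id, by simp, permutes_nil, fun x y => by simp⟩
    | cons j l ih =>
      intro hl
      obtain ⟨V, S, hV, hS, hx⟩ := ih (List.nodup_cons.1 hl).2
      refine ⟨[.cliff (.cnot _ _ (hne j j))] ++ V, _, by simp; omega,
        (permutes_cnot (hne j j)).append hS, fun x y => ?_⟩
      have : Function.update (wires n x y (C.vals x)) (.inr (.inl j))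
          (xor (wires n x y (C.vals x) (.inr (.inl j))) (wires n x y (C.vals x) (rd j))) =
          wires n x (Function.update y j (xor (y j) (F x j))) (C.vals x) := by
        rw [hrd]
        exact update_wires_out x y _ j _
      rw [this, hx]
      congr 1
      funext i
      by_cases hi : i = j
      · subst hi
        simp [(List.nodup_cons.1 hl).1]
      · simp [hi]
  obtain ⟨V, S, hV, hS, hx⟩ := hcopy Finset.univ.toList Finset.univ.nodup_toList
  refine ⟨n, U ++ V ++ U', _, hg, ?_, (h3.append hS).append h4, fun x y => ?_⟩
  · simp only [List.length_append]
    simp at hV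
    omega
  · rw [hwires, hwires, h6 x y [] rfl]
    change R' (S (wires n x y (C.vals x))) = _
    rw [hx]
    have := h6 x (bxor y (F x)) [] rfl
    change _ = wires n x (bxor y (F x)) (C.vals x) at this
    simp only [Finset.mem_toList, Finset.mem_univ, if_true]
    change R' (wires n x (bxor y (F x)) (C.vals x)) = _
    rw [← this, h5]

end Compile

/-! ### Distinguishers with preprocessed input -/

section Accept

theorem runGates_zero {Q : Type} [DecidableEq Q] (gs : List (QGate Q)) :
    runGates gs (0 : Vec Q) = 0 :=
  (runGates_isLinearMap gs).map_zero

open Classical in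
/-- A basis state, restricted to the qubits in the range of an embedding while the others are fixed
to `v'`, is a basis state or zero. -/
theorem ket_glue {Q Q' : Type} [Fintype Q] [Fintype Q'] (e : Q ↪ Q') (v' x : Q' → Bool) :
    (fun v => ket x (glue e v v')) =
      if ∃ j, (∀ i, e i ≠ j) ∧ v' j ≠ x j then 0 else ket fun i => x (e i) := by
  split_ifs with h
  · obtain ⟨j, hj, hne⟩ := h
    funext v
    have : glue e v v' ≠ x := fun h => hne (by rw [← h, glue_of_notMem hj])
    simp [ket, this]
  · push Not at h
    funext v
    have : glue e v v' = x ↔ v = fun i => x (e i) := by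
      constructor
      · rintro rfl
        exact (glue_comp e v v').symm
      · rintro rfl
        funext j
        by_cases hj : ∃ i, e i = j
        · obtain ⟨i, rfl⟩ := hj
          exact glue_apply _ _ _ _
        · push Not at hj
          exact (glue_of_notMem hj).trans (h j hj)
    simp [ket, this]

theorem Permutes.map {Q Q' : Type} [DecidableEq Q] [DecidableEq Q']
    {gs : List (QGate Q)} {R : (Q → Bool) → (Q → Bool)} (h : Permutes gs R)
    (e : Q ↪ Q') : Permutes (gs.map (QGate.map e)) fun v => glue e (R fun i => v (e i)) v := by
  intro Ψ v
  rw [runGates_map, glue_comp, h, glue_glue, glue_self]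

variable {Q Q' : Type} [Fintype Q] [DecidableEq Q] [Fintype Q'] [DecidableEq Q']

/-- A state of norm one with an amplitude one is a basis state. -/
theorem runGates_ket {gs : List (QGate Q)} {x y : Q → Bool} (h : runGates gs (ket x) y = 1) :
    runGates gs (ket x) = ket y := by
  have h1 : nsq (runGates gs (ket x)) = 1 := (nsq_runGates gs _).trans (nsq_ket x)
  funext v
  by_cases hv : v = y
  · subst hv
    simp [h, ket]
  · have h2 : ‖runGates gs (ket x) y‖ ^ 2 + ‖runGates gs (ket x) v‖ ^ 2 ≤
        nsq (runGates gs (ket x)) := by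
      rw [← Finset.sum_pair (Ne.symm hv) (f := fun v => ‖runGates gs (ket x) v‖ ^ 2)]
      exact Finset.sum_le_sum_of_subset_of_nonneg (Finset.subset_univ _) fun _ _ _ => sq_nonneg _
    rw [h1, h] at h2
    have h3 : ‖runGates gs (ket x) v‖ ^ 2 ≤ 0 := by simpa using h2
    have h4 : ‖runGates gs (ket x) v‖ = 0 := by
      nlinarith [norm_nonneg (runGates gs (ket x) v)]
    rw [norm_eq_zero.1 h4]
    simp [ket, hv]

/-- A sum over all bit strings of a function that vanishes unless the bits outside of the range of an
embedding are those of `x`. -/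
theorem sum_glue {M : Type} [AddCommMonoid M] (e : Q ↪ Q') (x : Q' → Bool) (f : (Q' → Bool) → M)
    (hf : ∀ v, (∃ j, (∀ i, e i ≠ j) ∧ v j ≠ x j) → f v = 0) :
    ∑ v, f v = ∑ w : Q → Bool, f (glue e w x) := by
  symm
  refine Finset.sum_of_injOn (fun w => glue e w x) ?_ (by simp) ?_ (by simp)
  · intro w _ w' _ h
    have := congrArg (fun v i => v (e i)) h
    simpa [glue_apply] using this
  · intro v _ hv
    apply hf
    by_contra! hcon
    refine hv ⟨fun i => v (e i), by simp, ?_⟩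
    funext j
    by_cases hj : ∃ i, e i = j
    · obtain ⟨i, rfl⟩ := hj
      exact glue_apply _ _ _ _
    · push Not at hj
      exact (glue_of_notMem hj).trans (hcon j hj).symm

/-- The probability that the measurement of the wire `a` gives one. -/
def wireProb (gs : List (QGate Q)) (x : Q → Bool) (a : Q) : ℝ :=
  ∑ v : Q → Bool, if v a then ‖runGates gs (ket x) v‖ ^ 2 else 0

theorem wireProb_map (e : Q ↪ Q') (gs : List (QGate Q)) (x : Q' → Bool) (a : Q) :
    wireProb (gs.map (QGate.map e)) x (e a) = wireProb gs (fun i => x (e i)) a := by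
  unfold wireProb
  rw [sum_glue e x]
  · refine Finset.sum_congr rfl fun w _ => ?_
    have h : ¬ ∃ j, (∀ i, e i ≠ j) ∧ glue e w x j ≠ x j := by
      rintro ⟨j, hj, hne⟩
      exact hne (glue_of_notMem hj)
    rw [glue_apply, runGates_map, ket_glue, if_neg h, glue_comp]
  · intro v hv
    rw [runGates_map, ket_glue, if_pos hv, runGates_zero]
    simp

end Accept

namespace Distinguisher

variable {ι ι' : Type} [Fintype ι] [DecidableEq ι] [Fintype ι'] [DecidableEq ι']

theorem accept_eq (A : Distinguisher ι) (x : ι → Bool) :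
    A.accept x = wireProb A.gates (Sum.elim x fun _ => false) (.inr 0) := rfl

theorem accept_nonneg (A : Distinguisher ι) (x : ι → Bool) : 0 ≤ A.accept x :=
  Finset.sum_nonneg fun v _ => by split_ifs <;> positivity

theorem accept_le_one (A : Distinguisher ι) (x : ι → Bool) : A.accept x ≤ 1 := by
  rw [← nsq_ket (Sum.elim x fun _ => false : ι ⊕ Fin (A.anc + 1) → Bool), ← nsq_runGates A.gates]
  refine Finset.sum_le_sum fun v _ => ?_
  split_ifs
  · exact le_rfl
  · positivity

/-- A distinguisher can first apply a function that is computed by a Boolean circuit. -/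
theorem exists_precomp (B : Distinguisher ι') {F : (ι → Bool) → (ι' → Bool)} {g : ℕ}
    (hF : Comp F g) :
    ∃ B' : Distinguisher ι, B'.size ≤ B.size + 11 * g + 2 * Fintype.card ι' + 1 ∧
      ∀ x, B'.accept x = B.accept (F x) := by
  obtain ⟨n, U, R, hn, hU, hR, hw⟩ := hF.exists_oracle
  let m := Fintype.card ι' + (n + 1)
  -- The ancillas are those of `B`, the output of `F`, and those of the circuit for `F`; the qubit
  -- that is measured has to keep the number zero.
  let f : Fin (B.anc + 1) ⊕ ι' ⊕ Fin (n + 1) ≃ Fin (B.anc + m + 1) :=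
    (Equiv.sumCongr (Equiv.refl _)
      ((Equiv.sumCongr (Fintype.equivFin ι') (Equiv.refl _)).trans finSumFinEquiv)).trans
      (finSumFinEquiv.trans (finCongr (by omega)))
  have hf0 : f (.inl 0) = 0 := by
    apply Fin.ext
    simp [f]
  -- `e₁` places the circuit for `F`, and `e₂` places `B` on the output of `F`.
  let e₁ : OracleWires ι ι' n ↪ ι ⊕ Fin (B.anc + m + 1) :=
    ⟨Sum.map id fun w => f (.inr w),
      Function.injective_id.sumMap (f.injective.comp Sum.inr_injective)⟩
  let e₂ : ι' ⊕ Fin (B.anc + 1) ↪ ι ⊕ Fin (B.anc + m + 1) :=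
    ⟨fun w => .inr (f (Sum.elim (fun i => .inr (.inl i)) .inl w)), by
      refine Sum.inr_injective.comp (f.injective.comp ?_)
      rintro (a | a) (b | b) h <;> simp at h <;> rw [h]⟩
  refine ⟨⟨B.anc + m, U.map (QGate.map e₁) ++ B.gates.map (QGate.map e₂)⟩, ?_, fun x => ?_⟩
  · simp only [size, List.length_append, List.length_map, m]
    omega
  · rw [accept_eq, accept_eq]
    have h0 : (.inr 0 : ι ⊕ Fin (B.anc + m + 1)) = e₂ (.inr 0) := by
      simp only [e₂, Function.Embedding.coeFn_mk, Sum.elim_inr, hf0]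
    let x₀ : ι ⊕ Fin (B.anc + m + 1) → Bool := Sum.elim x fun _ => false
    let x₁ := glue e₁ (R fun i => x₀ (e₁ i)) x₀
    have hx₀ : (fun i => x₀ (e₁ i)) = Sum.elim x (Sum.elim (fun _ => false) fun _ => false) := by
      funext i
      rcases i with i | i | i <;> rfl
    have hx₁ : (fun i => x₁ (e₂ i)) = Sum.elim (F x) fun _ => false := by
      funext i
      rcases i with i | i
      · have : e₂ (.inl i) = e₁ (.inr (.inl i)) := rfl
        simp only [x₁, this, glue_apply, hx₀, hw]
        simp [bxor]
      · simp only [x₁]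
        rw [glue_of_notMem]
        · rfl
        · rintro (j | j | j) h <;> simp [e₁, e₂] at h
    have hket : runGates (U.map (QGate.map e₁)) (ket x₀) = ket x₁ :=
      runGates_ket ((hR.map e₁ (ket x₀) x₀).trans (by simp [ket]))
    rw [← hx₁, ← wireProb_map e₂, ← h0]
    unfold wireProb
    simp only [runGates_append]
    rw [hket]

end Distinguisher

/-! ### Averages -/

section Avg

variable {κ κ' : Type} [Fintype κ] [DecidableEq κ] [Fintype κ'] [DecidableEq κ']

theorem avg_mono {f g : (κ → Bool) → ℝ} (h : ∀ r, f r ≤ g r) : avg f ≤ avg g := by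
  unfold avg
  gcongr with r
  exact h r

theorem avg_const (c : ℝ) : avg (fun _ : κ → Bool => c) = c := by
  unfold avg
  simp

theorem avg_add (f g : (κ → Bool) → ℝ) : avg (fun r => f r + g r) = avg f + avg g := by
  unfold avg
  rw [Finset.sum_add_distrib, add_div]

theorem avg_sub (f g : (κ → Bool) → ℝ) : avg (fun r => f r - g r) = avg f - avg g := by
  unfold avg
  rw [Finset.sum_sub_distrib, sub_div]

theorem avg_mul_left (c : ℝ) (f : (κ → Bool) → ℝ) : avg (fun r => c * f r) = c * avg f := by
  unfold avg
  rw [← Finset.mul_sum, mul_div_assoc]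

theorem avg_sum {I : Type} (s : Finset I) (f : I → (κ → Bool) → ℝ) :
    avg (fun r => ∑ i ∈ s, f i r) = ∑ i ∈ s, avg (f i) := by
  unfold avg
  rw [Finset.sum_comm, Finset.sum_div]

theorem abs_avg_le (f : (κ → Bool) → ℝ) : |avg f| ≤ avg fun r => |f r| := by
  unfold avg
  rw [abs_div, abs_of_pos (by positivity : (0 : ℝ) < 2 ^ Fintype.card κ)]
  gcongr
  exact Finset.abs_sum_le_sum_abs _ _

theorem avg_nonneg {f : (κ → Bool) → ℝ} (h : ∀ r, 0 ≤ f r) : 0 ≤ avg f := by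
  have := avg_mono h
  rwa [avg_const] at this

theorem avg_sumElim (f : (κ ⊕ κ' → Bool) → ℝ) :
    avg f = avg fun a : κ → Bool => avg fun b : κ' → Bool => f (Sum.elim a b) := by
  unfold avg
  rw [Fintype.card_sum, pow_add, ← Finset.sum_div, div_div, mul_comm]
  congr 1
  rw [← Fintype.sum_prod_type' fun a b => f (Sum.elim a b)]
  exact (Equiv.sum_comp (Equiv.sumArrowEquivProdArrow κ κ' Bool).symm f).symm

theorem avg_comm (f : (κ → Bool) → (κ' → Bool) → ℝ) :
    (avg fun a => avg fun b => f a b) = avg fun b => avg fun a => f a b := by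
  unfold avg
  rw [← Finset.sum_div, ← Finset.sum_div, Finset.sum_comm, div_div, div_div, mul_comm]

/-- Some of the coins can be tossed again. The map `(r, b) ↦ (glue e b r, r ∘ e)` that exchanges the
old and the new values of these coins is an involution. -/
theorem avg_glue (e : κ ↪ κ') (f : (κ' → Bool) → ℝ) :
    avg f = avg fun r => avg fun b => f (glue e b r) := by
  let Φ : (κ' → Bool) × (κ → Bool) → (κ' → Bool) × (κ → Bool) :=
    fun p => (glue e p.2 p.1, fun i => p.1 (e i))
  have hΦ : Function.Involutive Φ := by
    rintro ⟨r, b⟩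
    simp only [Φ, glue_glue, glue_self, glue_apply]
  have h := Equiv.sum_comp hΦ.toPerm fun p => f p.1
  change ∑ p : (κ' → Bool) × (κ → Bool), f (glue e p.2 p.1) =
    ∑ p : (κ' → Bool) × (κ → Bool), f p.1 at h
  rw [Fintype.sum_prod_type, Fintype.sum_prod_type] at h
  unfold avg
  simp only [Finset.sum_const, Finset.card_univ, Fintype.card_fun, Fintype.card_bool,
    nsmul_eq_mul] at h
  rw [← Finset.sum_div, h, ← Finset.mul_sum, Nat.cast_pow, Nat.cast_ofNat,
    mul_div_cancel_left₀ _ (by positivity)]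

open Classical in
theorem prob_nonneg (P : (κ → Bool) → Prop) : 0 ≤ prob P :=
  avg_nonneg fun r => by split_ifs <;> norm_num

end Avg

/-! ### Polynomial bounds and negligible functions -/

theorem eval_mono (p : Polynomial ℕ) : Monotone fun n => p.eval n := by
  intro a b h
  simp only [Polynomial.eval_eq_sum_range]
  exact Finset.sum_le_sum fun i _ => Nat.mul_le_mul_left _ (Nat.pow_le_pow_left h i)

namespace PolyBounded

variable {f g : ℕ → ℕ}

theorem mono (hg : PolyBounded g) (h : ∀ n, f n ≤ g n) : PolyBounded f :=
  let ⟨p, hp⟩ := hg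
  ⟨p, fun n => (h n).trans (hp n)⟩

theorem const (c : ℕ) : PolyBounded fun _ => c := ⟨.C c, fun n => by simp⟩

theorem self : PolyBounded fun n => n := ⟨.X, fun n => by simp⟩

theorem add (hf : PolyBounded f) (hg : PolyBounded g) : PolyBounded fun n => f n + g n :=
  let ⟨p, hp⟩ := hf
  let ⟨q, hq⟩ := hg
  ⟨p + q, fun n => by rw [Polynomial.eval_add]; exact Nat.add_le_add (hp n) (hq n)⟩

theorem mul (hf : PolyBounded f) (hg : PolyBounded g) : PolyBounded fun n => f n * g n :=
  let ⟨p, hp⟩ := hf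
  let ⟨q, hq⟩ := hg
  ⟨p * q, fun n => by rw [Polynomial.eval_mul]; exact Nat.mul_le_mul (hp n) (hq n)⟩

theorem eval (p : Polynomial ℕ) (hf : PolyBounded f) : PolyBounded fun n => p.eval (f n) :=
  let ⟨q, hq⟩ := hf
  ⟨p.comp q, fun n => by rw [Polynomial.eval_comp]; exact eval_mono p (hq n)⟩

end PolyBounded

namespace Negligible

variable {μ ν : ℕ → ℝ}

theorem mono (hν : Negligible ν) (h0 : ∀ n, 0 ≤ μ n) (h : ∀ n, μ n ≤ ν n) : Negligible μ :=
  Asymptotics.SuperpolynomialDecay.trans_abs_le hν fun n => by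
    rw [abs_of_nonneg (h0 n)]
    exact (h n).trans (le_abs_self _)

theorem polynomial_mul {f : ℕ → ℕ} (hf : PolyBounded f) (hν : Negligible ν) :
    Negligible fun n => (f n : ℝ) * ν n := by
  obtain ⟨p, hp⟩ := hf
  have h := Asymptotics.SuperpolynomialDecay.polynomial_mul hν (p.map (Nat.castRingHom ℝ))
  refine Asymptotics.SuperpolynomialDecay.trans_abs_le h fun n => ?_
  have he : (p.map (Nat.castRingHom ℝ)).eval (n : ℝ) = ((p.eval n : ℕ) : ℝ) :=
    Polynomial.eval_natCast_map (Nat.castRingHom ℝ) p n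
  rw [he, abs_mul, abs_mul, Nat.abs_cast, Nat.abs_cast]
  gcongr
  exact hp n

end Negligible

/-! ### Lengths and circuit sizes of the classical schemes -/

/-- `b` bounds the lengths of all strings of `HE` and AltHE for security parameter `n`, and the sizes
of circuits for all algorithms but the homomorphic evaluation. -/
structure SizeBound {HE : LeveledHE} {Lc : ℕ → ℕ} (A : AltScheme HE Lc) (n b : ℕ) : Prop where
  self : n ≤ b
  pkLen : HE.pkLen n (Lc n) ≤ b
  evkLen : HE.evkLen n (Lc n) ≤ b
  skLen : HE.skLen n (Lc n) ≤ b
  ctLen : HE.ctLen n (Lc n) ≤ b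
  keyCoins : HE.keyCoins n (Lc n) ≤ b
  encCoins : HE.encCoins n (Lc n) ≤ b
  altLen : A.ctLen n ≤ b
  rndLen : A.rndLen n + 1 ≤ b
  tdLen : A.tdLen n ≤ b
  keygen : Comp (fun κ : Bits (HE.keyCoins n (Lc n)) =>
      Sum.elim (HE.pk κ) (Sum.elim (HE.evk κ) (HE.sk κ))) b
  enc : Comp
      (fun x : Fin (HE.pkLen n (Lc n)) ⊕ Unit ⊕ Fin (HE.encCoins n (Lc n)) → Bool =>
        HE.enc n (Lc n) (fun i => x (.inl i)) (x (.inr (.inl ()))) fun i => x (.inr (.inr i))) b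
  dec : Comp
      (fun (x : Fin (HE.skLen n (Lc n)) ⊕ Fin (HE.ctLen n (Lc n)) → Bool) (_ : Unit) =>
        HE.dec n (Lc n) (fun i => x (.inl i)) fun i => x (.inr i)) b
  altEnc : Comp
      (fun x : Fin (HE.pkLen n (Lc n)) ⊕ Option (Fin (A.rndLen n)) → Bool =>
        A.enc n (fun i => x (.inl i)) fun i => x (.inr i)) b
  convert : Comp
      (fun x : Fin (HE.pkLen n (Lc n)) ⊕ Fin (HE.ctLen n (Lc n)) → Bool =>
        A.convert n (fun i => x (.inl i)) fun i => x (.inr i)) b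
  xor : Comp
      (fun x : Fin (HE.pkLen n (Lc n)) ⊕ Fin (A.ctLen n) ⊕ Fin (A.ctLen n) → Bool =>
        A.xor n (fun i => x (.inl i)) (fun i => x (.inr (.inl i))) fun i => x (.inr (.inr i))) b
  trapdoor : Comp (A.trapdoor n) b
  prep : (A.prep n).size ≤ b

theorem exists_sizeBound {HE : LeveledHE} {Lc : ℕ → ℕ} {A : AltScheme HE Lc} (hHE : HE.Efficient)
    (hLc : PolyBounded Lc) (hA : A.Efficient) :
    ∃ b : ℕ → ℕ, PolyBounded b ∧ ∀ n, SizeBound A n (b n) := by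
  obtain ⟨p, hp⟩ := hHE
  obtain ⟨q, hq⟩ := hA
  refine ⟨fun n => p.eval (n + Lc n) + q.eval n + n + 2, ?_, fun n => ?_⟩
  · exact (((PolyBounded.eval p (.add .self hLc)).add (.eval q .self)).add .self).add (.const 2)
  · dsimp only
    obtain ⟨h1, h2, h3, -⟩ := hp n (Lc n)
    obtain ⟨g1, g2, g3, g4, g5, g6, g7, g8⟩ := hq n
    have c1 := h1.card_le
    have c2 := h2.card_le
    have c3 := g1.card_le
    have c6 := g6.card_le
    simp only [Fintype.card_sum, Fintype.card_fin, Fintype.card_option, Fintype.card_unit]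
      at c1 c2 c3 c6
    exact
      { self := by omega
        pkLen := by omega
        evkLen := by omega
        skLen := by omega
        ctLen := by omega
        keyCoins := by omega
        encCoins := by omega
        altLen := by omega
        rndLen := by omega
        tdLen := by omega
        keygen := h1.comp.mono (by omega)
        enc := h2.comp.mono (by omega)
        dec := h3.comp.mono (by omega)
        altEnc := g1.comp.mono (by omega)
        convert := g3.comp.mono (by omega)
        xor := g4.comp.mono (by omega)
        trapdoor := g6.comp.mono (by omega)
        prep := by omega }

/-! ### IND-CPA security -/

section Security

/-- The advantage of a distinguisher between encryptions of the two bits. -/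
def advantage (HE : LeveledHE) (n L : ℕ)
    (B : Distinguisher (Fin (HE.pkLen n L) ⊕ Fin (HE.evkLen n L) ⊕ Fin (HE.ctLen n L))) : ℝ :=
  |avg (fun r : Fin (HE.keyCoins n L) ⊕ Fin (HE.encCoins n L) → Bool =>
      let κ : Bits (HE.keyCoins n L) := fun i => r (.inl i)
      B.accept (Sum.elim (HE.pk κ) (Sum.elim (HE.evk κ)
        (HE.enc n L (HE.pk κ) false fun i => r (.inr i))))) -
    avg (fun r : Fin (HE.keyCoins n L) ⊕ Fin (HE.encCoins n L) → Bool =>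
      let κ : Bits (HE.keyCoins n L) := fun i => r (.inl i)
      B.accept (Sum.elim (HE.pk κ) (Sum.elim (HE.evk κ)
        (HE.enc n L (HE.pk κ) true fun i => r (.inr i)))))|

theorem advantage_le_one (HE : LeveledHE) (n L : ℕ)
    (B : Distinguisher (Fin (HE.pkLen n L) ⊕ Fin (HE.evkLen n L) ⊕ Fin (HE.ctLen n L))) :
    advantage HE n L B ≤ 1 := by
  have h : ∀ f : (Fin (HE.keyCoins n L) ⊕ Fin (HE.encCoins n L) → Bool) → _,
      0 ≤ avg (fun r => B.accept (f r)) ∧ avg (fun r => B.accept (f r)) ≤ 1 := fun f =>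
    ⟨avg_nonneg fun _ => B.accept_nonneg _, by
      rw [← avg_const (κ := Fin (HE.keyCoins n L) ⊕ Fin (HE.encCoins n L)) 1]
      exact avg_mono fun r => B.accept_le_one _⟩
  exact abs_sub_le_of_nonneg_of_le (h _).1 (h _).2 (h _).1 (h _).2

/-- Against non-uniform adversaries, IND-CPA security holds uniformly: the supremum of the advantages
of the distinguishers of a given size is almost attained by some family of distinguishers. -/
theorem LeveledHE.CPASecure.uniform {HE : LeveledHE} (h : HE.CPASecure) {L : ℕ → ℕ}
    (hL : PolyBounded L) {q : ℕ → ℕ} (hq : PolyBounded q) :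
    ∃ ν : ℕ → ℝ, Negligible ν ∧ ∀ n B, B.size ≤ q n → advantage HE n (L n) B ≤ ν n := by
  let S (n : ℕ) : Set ℝ := {a | ∃ B, B.size ≤ q n ∧ advantage HE n (L n) B = a}
  have hb : ∀ n, BddAbove (S n) := fun n =>
    ⟨1, by rintro _ ⟨B, _, rfl⟩; exact advantage_le_one HE n (L n) B⟩
  have hex : ∀ n, ∃ B, B.size ≤ q n ∧ sSup (S n) ≤ 2 * advantage HE n (L n) B := by
    intro n
    have hne : (S n).Nonempty := ⟨_, ⟨0, []⟩, Nat.zero_le _, rfl⟩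
    have h0 : ∀ B, 0 ≤ advantage HE n (L n) B := fun B => abs_nonneg _
    rcases le_or_gt (sSup (S n)) 0 with hs | hs
    · exact ⟨⟨0, []⟩, Nat.zero_le _, hs.trans (by have := h0 ⟨0, []⟩; linarith)⟩
    · obtain ⟨_, ⟨B, hB, rfl⟩, hlt⟩ := exists_lt_of_lt_csSup hne (half_lt_self hs)
      exact ⟨B, hB, by linarith⟩
  choose B hB hsup using hex
  have hneg := h L hL B (hq.mono hB)
  refine ⟨fun n => sSup (S n), Negligible.mono (hneg.const_mul 2) (fun n => ?_) hsup,
    fun n B' hB' => le_csSup (hb n) ⟨B', hB', rfl⟩⟩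
  exact Real.sSup_nonneg (by rintro _ ⟨B, _, rfl⟩; exact abs_nonneg _)

variable {HE : LeveledHE} {Lc : ℕ → ℕ} (A : AltScheme HE Lc) (n L : ℕ)

/-- Positions of the ciphertexts that an adversary sees: the encrypted bits of the secret keys and
trapdoors, and the encrypted Pauli keys. -/
abbrev Pos : Type := (Fin L × (Fin (HE.skLen n (Lc n)) ⊕ Fin (A.tdLen n))) ⊕ KeyIdx (Fin n)

/-- The coins of the key generation and the encryption. -/
abbrev AllCoins : Type :=
  KeyCoinIdx A n L ⊕ (KeyIdx (Fin n) ⊕ (KeyIdx (Fin n) × Fin (HE.encCoins n (Lc n))))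

/-- What the adversary sees: public key, evaluation key, padded message, encrypted Pauli keys. -/
abbrev ViewIdx : Type :=
  Fin (HE.pkLen n (Lc n)) ⊕ EvkIdx A n L ⊕ Fin n ⊕ (KeyIdx (Fin n) × Fin (HE.ctLen n (Lc n)))

variable {A n L}

/-- The number of the public key under which the bit at a position is encrypted. -/
def posKey : Pos A n L → Fin (L + 1) := Sum.elim (fun p => p.1.succ) fun _ => 0

/-- The coins with which the bit at a position is encrypted. -/
def posCoin : Pos A n L → Fin (HE.encCoins n (Lc n)) → AllCoins A n L :=
  Sum.elim (fun p a => .inl (.inr (p.1, p.2, a))) fun x a => .inr (.inr (x, a))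

/-- The bit that is encrypted at a position. -/
def posMsg (r : AllCoins A n L → Bool) : Pos A n L → Bool :=
  Sum.elim
    (fun p => Sum.elim (HE.sk (coinsAt (fun i => r (.inl i)) p.1.castSucc))
      (A.trapdoor n (coinsAt (fun i => r (.inl i)) p.1.castSucc)) p.2)
    fun x => r (.inr (.inl x))

/-- The view of the adversary, assembled from the public keys, the evaluation keys, the padded
message and the ciphertexts. -/
def view (pks : Fin (L + 1) → Bits (HE.pkLen n (Lc n)))
    (evks : Fin (L + 1) → Bits (HE.evkLen n (Lc n))) (pad : Bits n)
    (ct : Pos A n L → Bits (HE.ctLen n (Lc n))) : ViewIdx A n L → Bool :=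
  Sum.elim (pks 0) (Sum.elim
    (Sum.elim (fun x => evks x.1 x.2)
      (Sum.elim (fun x => pks x.1.succ x.2) fun x => ct (.inl (x.1, x.2.1)) x.2.2))
    (Sum.elim pad fun x => ct (.inr x.1) x.2))

/-- The view of the adversary when the bits at the positions in `M` are replaced by zero. -/
def hybrid (M : Finset (Pos A n L)) (m : Bits n) (r : AllCoins A n L → Bool) :
    ViewIdx A n L → Bool :=
  view (fun i => HE.pk (coinsAt (fun i => r (.inl i)) i))
    (fun i => HE.evk (coinsAt (fun i => r (.inl i)) i))
    (bxor (fun i => r (.inr (.inl (.inr i)))) m)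
    fun p => HE.enc n (Lc n) (HE.pk (coinsAt (fun i => r (.inl i)) (posKey p)))
      (if p ∈ M then false else posMsg r p) fun a => r (posCoin p a)

theorem hybrid_empty (V : LevelCircuits A) (m : Bits n) (r : AllCoins A n L → Bool) :
    hybrid ∅ m r =
      Sum.elim ((QHE V).pk n L fun i => r (.inl i)) (Sum.elim ((QHE V).evk n L fun i => r (.inl i))
        (Sum.elim ((QHE V).enc n L ((QHE V).pk n L fun i => r (.inl i)) m fun i => r (.inr i)).1
          ((QHE V).enc n L ((QHE V).pk n L fun i => r (.inl i)) m fun i => r (.inr i)).2)) := by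
  funext x
  rcases x with x | (x | x | x) | x | x <;> rfl

theorem posCoin_injective (p : Pos A n L) : Function.Injective (posCoin p) := by
  intro a b h
  rcases p with p | p <;> simpa [posCoin] using h

/-- The coins of the keys under which the bit at position `p` is encrypted, and of this
encryption. -/
def blockEmb (p : Pos A n L) :
    Fin (HE.keyCoins n (Lc n)) ⊕ Fin (HE.encCoins n (Lc n)) ↪ AllCoins A n L where
  toFun := Sum.elim (fun b => .inl (.inl (posKey p, b))) (posCoin p)
  inj' := by
    rintro (a | a) (b | b) h
    · simpa using h
    · rcases p with p | p <;> simp [posCoin] at h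
    · rcases p with p | p <;> simp [posCoin] at h
    · exact congrArg _ (posCoin_injective p h)

section Resample

variable (p : Pos A n L) (b : Fin (HE.keyCoins n (Lc n)) ⊕ Fin (HE.encCoins n (Lc n)) → Bool)
  (r : AllCoins A n L → Bool)

theorem coinsAt_glue_blockEmb (i : Fin (L + 1)) :
    coinsAt (fun j => glue (blockEmb p) b r (.inl j)) i =
      if i = posKey p then fun j => b (.inl j) else coinsAt (fun j => r (.inl j)) i := by
  funext j
  split_ifs with h
  · subst h
    exact glue_apply (blockEmb p) b r (.inl j)
  · refine glue_of_notMem ?_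
    rintro (a | a) ha
    · change (.inl (.inl (posKey p, a)) : AllCoins A n L) = _ at ha
      simp only [Sum.inl.injEq, Prod.mk.injEq] at ha
      exact h ha.1.symm
    · rcases p with p | p <;> simp [blockEmb, posCoin] at ha

theorem glue_blockEmb_posCoin (p' : Pos A n L) (a : Fin (HE.encCoins n (Lc n))) :
    glue (blockEmb p) b r (posCoin p' a) = if p' = p then b (.inr a) else r (posCoin p' a) := by
  split_ifs with h
  · subst h
    exact glue_apply (blockEmb p') b r (.inr a)
  · refine glue_of_notMem ?_
    rintro (c | c) hc
    · rcases p' with p' | p' <;> simp [blockEmb, posCoin] at hc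
    · rcases p' with p' | p' <;> rcases p with p | p <;> simp [blockEmb, posCoin] at hc
      · exact h (congrArg _ (Prod.ext hc.1.symm hc.2.1.symm))
      · exact h (congrArg _ hc.1.symm)

theorem glue_blockEmb_pauli (x : KeyIdx (Fin n)) :
    glue (blockEmb p) b r (.inr (.inl x)) = r (.inr (.inl x)) := by
  refine glue_of_notMem ?_
  rintro (c | c) hc
  · exact absurd hc Sum.inl_ne_inr
  · rcases p with p | p <;> simp [blockEmb, posCoin] at hc

/-- The secret key and the trapdoor of level `i` are encrypted under the public key of level
`i + 1`, so the encrypted bits do not depend on the keys from this level on. -/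
theorem posMsg_glue_blockEmb {p' : Pos A n L} (h : posKey p' ≤ posKey p) :
    posMsg (glue (blockEmb p) b r) p' = posMsg r p' := by
  rcases p' with p' | p'
  · have hne : p'.1.castSucc ≠ posKey p := by
      intro he
      rw [← he] at h
      exact absurd h (not_le.2 (Fin.castSucc_lt_succ))
    simp only [posMsg, Sum.elim_inl]
    rw [coinsAt_glue_blockEmb, if_neg hne]
  · exact glue_blockEmb_pauli p b r p'

end Resample

/-- The view of the adversary as a function of one public key, one evaluation key and one ciphertext;
all other coins are fixed. -/
def reduction (M : Finset (Pos A n L)) (m : Bits n) (p : Pos A n L) (r : AllCoins A n L → Bool)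
    (x : Fin (HE.pkLen n (Lc n)) ⊕ Fin (HE.evkLen n (Lc n)) ⊕ Fin (HE.ctLen n (Lc n)) → Bool) :
    ViewIdx A n L → Bool :=
  view
    (fun i => if i = posKey p then fun j => x (.inl j)
      else HE.pk (coinsAt (fun i => r (.inl i)) i))
    (fun i => if i = posKey p then fun j => x (.inr (.inl j))
      else HE.evk (coinsAt (fun i => r (.inl i)) i))
    (bxor (fun i => r (.inr (.inl (.inr i)))) m)
    fun p' => if p' = p then fun j => x (.inr (.inr j)) else
      HE.enc n (Lc n) (if posKey p' = posKey p then fun j => x (.inl j)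
        else HE.pk (coinsAt (fun i => r (.inl i)) (posKey p')))
      (if p' ∈ M then false else posMsg r p') fun a => r (posCoin p' a)

/-- When the coins of the keys and the encryption at position `p` are replaced by `b`, the view
depends on `b` only through the public key, the evaluation key and the ciphertext: all secret keys
and trapdoors that were encrypted under later keys have already been replaced by zeros. -/
theorem hybrid_glue {M M' : Finset (Pos A n L)} {p : Pos A n L}
    (hM : ∀ p' ∉ M, posKey p' ≤ posKey p) (hp : p ∉ M) (hM' : ∀ p' ≠ p, p' ∈ M' ↔ p' ∈ M)
    (m : Bits n) (r : AllCoins A n L → Bool)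
    (b : Fin (HE.keyCoins n (Lc n)) ⊕ Fin (HE.encCoins n (Lc n)) → Bool) :
    hybrid M' m (glue (blockEmb p) b r) =
      reduction M m p r (Sum.elim (HE.pk fun i => b (.inl i)) (Sum.elim (HE.evk fun i => b (.inl i))
        (HE.enc n (Lc n) (HE.pk fun i => b (.inl i)) (if p ∈ M' then false else posMsg r p)
          fun i => b (.inr i)))) := by
  unfold hybrid reduction
  simp only [Sum.elim_inl, Sum.elim_inr, coinsAt_glue_blockEmb, glue_blockEmb_pauli,
    glue_blockEmb_posCoin]
  congr 1
  · funext i; split_ifs <;> rfl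
  · funext i; split_ifs <;> rfl
  · funext p'
    by_cases h : p' = p
    · subst h
      simp [posMsg_glue_blockEmb p' b r le_rfl]
    · simp only [h, if_false, hM' p' h]
      by_cases hm : p' ∈ M
      · simp only [hm, if_true]
        congr 1
        split_ifs <;> rfl
      · simp only [hm, if_false, posMsg_glue_blockEmb p b r (hM p' hm)]
        congr 1
        split_ifs <;> rfl

theorem comp_view {ι : Type} {c : ℕ} {P : Fin (L + 1) → (ι → Bool) → Bits (HE.pkLen n (Lc n))}
    {E : Fin (L + 1) → (ι → Bool) → Bits (HE.evkLen n (Lc n))} {pad : Bits n}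
    {T : Pos A n L → (ι → Bool) → Bits (HE.ctLen n (Lc n))} (hP : ∀ i, Comp (P i) c)
    (hE : ∀ i, Comp (E i) c) (hT : ∀ i, Comp (T i) c) :
    Comp (fun x => view (fun i => P i x) (fun i => E i x) pad fun i => T i x)
      (c + (((L + 1) * c + (L * c + L * (HE.skLen n (Lc n) + A.tdLen n) * c)) +
        (2 + (n + n) * c))) := by
  have h1 := Comp.family hE
  have h2 := Comp.family fun i : Fin L => hP i.succ
  have h3 := (Comp.family fun p : Fin L × (Fin (HE.skLen n (Lc n)) ⊕ Fin (A.tdLen n)) =>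
    hT (.inl p)).reindex fun x : Fin L × (Fin (HE.skLen n (Lc n)) ⊕ Fin (A.tdLen n)) ×
      Fin (HE.ctLen n (Lc n)) => ((x.1, x.2.1), x.2.2)
  have h4 := Comp.family fun x : KeyIdx (Fin n) => hT (.inr x)
  have h := (hP 0).sum ((h1.sum (h2.sum h3)).sum ((comp_const pad).sum h4))
  simp only [Fintype.card_sum, Fintype.card_prod, Fintype.card_fin] at h
  exact h

/-- The reduction is a small circuit, as all coins but those of the challenge are hardwired. -/
theorem comp_reduction {b : ℕ} (hb : SizeBound A n b) (M : Finset (Pos A n L)) (m : Bits n)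
    (p : Pos A n L) (r : AllCoins A n L → Bool) :
    Comp (reduction M m p r) ((b + 6) * (2 * L + 3 + 2 * L * b + 2 * n)) := by
  have hw : ∀ {ι o : Type} (P : Prop) [Decidable P] (e : o → ι) (c : o → Bool),
      Comp (fun (x : ι → Bool) => if P then fun j => x (e j) else c) 2 := by
    intro ι o P _ e c
    split_ifs
    · exact (comp_wire e).mono (by omega)
    · exact comp_const c
  refine (comp_view (c := b + 6) (fun i => (hw _ _ _).mono (by omega))
    (fun i => (hw _ _ _).mono (by omega)) (fun p' => ?_)).mono ?_
  · by_cases h : p' = p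
    · simp only [h, if_true]
      exact (comp_wire _).mono (by omega)
    · simp only [h, if_false]
      have h1 := hw (posKey p' = posKey p)
        (fun j => (.inl j : Fin (HE.pkLen n (Lc n)) ⊕ Fin (HE.evkLen n (Lc n)) ⊕
          Fin (HE.ctLen n (Lc n)))) (HE.pk (coinsAt (fun i => r (.inl i)) (posKey p')))
      have h2 := ((h1.sum ((comp_const fun _ => if p' ∈ M then false else posMsg r p').sum
        (comp_const fun a => r (posCoin p' a)))).compose hb.enc)
      exact (h2.congr fun x => rfl).mono (by omega)
  · have h1 := hb.skLen
    have h2 := hb.tdLen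
    calc _ ≤ (b + 6) + (((L + 1) * (b + 6) + (L * (b + 6) + L * (b + b) * (b + 6))) +
          ((b + 6) + (n + n) * (b + 6))) := by
          gcongr
          omega
      _ = _ := by ring

/-- Replacing one more encrypted bit by zero changes the acceptance probability at most by the
advantage of some distinguisher against the classical scheme. -/
theorem abs_avg_hybrid_sub_le {b q : ℕ} {ν : ℝ} (hb : SizeBound A n b)
    (D : Distinguisher (ViewIdx A n L))
    (hq : D.size + 11 * ((b + 6) * (2 * L + 3 + 2 * L * b + 2 * n)) +
      2 * Fintype.card (ViewIdx A n L) + 1 ≤ q)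
    (hν : ∀ B, B.size ≤ q → advantage HE n (Lc n) B ≤ ν) {M : Finset (Pos A n L)} {p : Pos A n L}
    (hM : ∀ p' ∉ M, posKey p' ≤ posKey p) (hp : p ∉ M) (m : Bits n) :
    |avg (fun r => D.accept (hybrid M m r)) -
      avg (fun r => D.accept (hybrid (insert p M) m r))| ≤ ν := by
  -- The coins of the key pair and of the encryption at `p` are resampled, with all others fixed.
  rw [avg_glue (blockEmb p) fun r => D.accept (hybrid M m r),
    avg_glue (blockEmb p) fun r => D.accept (hybrid (insert p M) m r), ← avg_sub]
  refine (abs_avg_le _).trans ?_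
  rw [← avg_const (κ := AllCoins A n L) ν]
  refine avg_mono fun r => ?_
  obtain ⟨B, hB, hacc⟩ := D.exists_precomp (comp_reduction hb M m p r)
  have h := hν B (hB.trans hq)
  have e1 := fun x => hybrid_glue hM hp (fun p' _ => Iff.rfl) m r x
  have e2 := fun x => hybrid_glue (M' := insert p M) hM hp (fun p' h => by simp [h]) m r x
  simp only [e1, e2, ← hacc, hp, Finset.mem_insert_self, if_true, if_false]
  -- If the bit is zero already, nothing changes.
  cases hmsg : posMsg r p
  · rw [sub_self, abs_zero]
    exact (abs_nonneg _).trans h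
  · rw [abs_sub_comm]
    exact h

/-- All encrypted bits are replaced by zeros, beginning with those under the last key. -/
theorem abs_avg_hybrid_sub_univ_le {b q : ℕ} {ν : ℝ} (hb : SizeBound A n b)
    (D : Distinguisher (ViewIdx A n L))
    (hq : D.size + 11 * ((b + 6) * (2 * L + 3 + 2 * L * b + 2 * n)) +
      2 * Fintype.card (ViewIdx A n L) + 1 ≤ q)
    (hν : ∀ B, B.size ≤ q → advantage HE n (Lc n) B ≤ ν) (m : Bits n) (k : ℕ) :
    ∀ M : Finset (Pos A n L), Mᶜ.card = k →
    |avg (fun r => D.accept (hybrid M m r)) -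
      avg (fun r => D.accept (hybrid Finset.univ m r))| ≤ k * ν := by
  induction k with
  | zero =>
    intro M hM
    rw [Finset.card_eq_zero, Finset.compl_eq_empty_iff] at hM
    simp [hM]
  | succ k ih =>
    intro M hM
    have hne : Mᶜ.Nonempty := Finset.card_pos.1 (by omega)
    -- Among the bits that are left, one under the last possible key is replaced next.
    obtain ⟨p, hp, hmax⟩ := Finset.exists_max_image Mᶜ posKey hne
    rw [Finset.mem_compl] at hp
    have h1 := abs_avg_hybrid_sub_le hb D hq hν (fun p' h => hmax p' (Finset.mem_compl.2 h)) hp m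
    have h2 := ih (insert p M) (by
      rw [Finset.compl_insert, Finset.card_erase_of_mem (Finset.mem_compl.2 hp), hM]; rfl)
    have h3 := abs_sub_le (avg fun r => D.accept (hybrid M m r))
      (avg fun r => D.accept (hybrid (insert p M) m r))
      (avg fun r => D.accept (hybrid Finset.univ m r))
    push_cast
    linarith

theorem avg_bxor {κ : Type} [Fintype κ] [DecidableEq κ] (t : κ → Bool) (f : (κ → Bool) → ℝ) :
    avg f = avg fun r => f (bxor r t) := by
  unfold avg
  congr 1
  have hinv : Function.Involutive fun r : κ → Bool => bxor r t := by
    intro r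
    funext i
    simp [bxor]
  exact (Equiv.sum_comp hinv.toPerm f).symm

/-- When nothing about the Pauli keys is revealed, the padded message is uniformly random. -/
theorem avg_hybrid_univ (D : Distinguisher (ViewIdx A n L)) (m : Bits n) :
    avg (fun r => D.accept (hybrid Finset.univ m r)) =
      avg fun r => D.accept (hybrid Finset.univ (fun _ => false) r) := by
  -- Adding `m` to the coins of the `X`-keys turns the pad of `m` into the pad of zero.
  rw [avg_bxor (fun i : AllCoins A n L => Sum.elim (fun _ => false)
    (Sum.elim (Sum.elim (fun _ => false) m) fun _ => false) i)
    fun r => D.accept (hybrid Finset.univ (fun _ => false) r)]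
  congr 1
  funext r
  congr 1
  unfold hybrid
  simp only [Finset.mem_univ, if_true]
  have h1 : ∀ i : KeyCoinIdx A n L, bxor r (fun i : AllCoins A n L => Sum.elim (fun _ => false)
    (Sum.elim (Sum.elim (fun _ => false) m) fun _ => false) i) (.inl i) = r (.inl i) := by
    intro i; simp [bxor]
  simp only [h1]
  congr 1
  · funext i; simp [bxor]
  · funext p
    congr 1
    funext a
    rcases p with p | p <;> simp [bxor, posCoin]

/-- With only polynomially many hybrids, the total advantage is negligible. -/
theorem negligible_abs_avg_hybrid_sub (hHE : HE.IsLeveledFHE) (hLc : PolyBounded Lc)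
    (hA : A.Efficient) {L : ℕ → ℕ} (hL : PolyBounded L)
    (D : (n : ℕ) → Distinguisher (ViewIdx A n (L n))) (hD : PolyBounded fun n => (D n).size)
    (m₀ m₁ : (n : ℕ) → Bits n) :
    Negligible fun n => |avg (fun r => (D n).accept (hybrid ∅ (m₀ n) r)) -
      avg (fun r => (D n).accept (hybrid ∅ (m₁ n) r))| := by
  obtain ⟨b, hbp, hb⟩ := exists_sizeBound hHE.1 hLc hA
  -- The number of bits of the view; `d` accounts for the circuit of the reduction, and `q` is a
  -- bound on the size of the distinguishers against the classical scheme.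
  let c (n : ℕ) : ℕ := b n + (((L n + 1) * b n + (L n * b n + L n * ((b n + b n) * b n))) +
        (n + (n + n) * b n))
  have hcard : ∀ n, Fintype.card (ViewIdx A n (L n)) ≤ c n := by
    intro n
    have h1 := (hb n).pkLen
    have h2 := (hb n).evkLen
    have h3 := (hb n).skLen
    have h4 := (hb n).tdLen
    have h5 := (hb n).ctLen
    simp only [Fintype.card_sum, Fintype.card_prod, Fintype.card_fin, c]
    gcongr
  let d (n : ℕ) : ℕ := 11 * ((b n + 6) * (2 * L n + 3 + 2 * L n * b n + 2 * n))
  let q (n : ℕ) : ℕ := (D n).size + d n + 2 * c n + 1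
  have hLb := hL.mul hbp
  have hc : PolyBounded c := hbp.add ((((hL.add (.const 1)).mul hbp).add (hLb.add
    (hL.mul ((hbp.add hbp).mul hbp)))).add (PolyBounded.self.add ((PolyBounded.self.add .self).mul
      hbp)))
  have hd : PolyBounded d := (PolyBounded.const 11).mul ((hbp.add (.const 6)).mul
    (((((PolyBounded.const 2).mul hL).add (.const 3)).add
      (((PolyBounded.const 2).mul hL).mul hbp)).add ((PolyBounded.const 2).mul .self)))
  have hq : PolyBounded q := ((hD.add hd).add ((PolyBounded.const 2).mul hc)).add (.const 1)
  obtain ⟨ν, hν, hadv⟩ := hHE.2.2.uniform hLc hq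
  have hPos : PolyBounded fun n => 2 * Fintype.card (Pos A n (L n)) := by
    refine ((PolyBounded.const 2).mul
      ((hL.mul (hbp.add hbp)).add (PolyBounded.self.add .self))).mono fun n => ?_
    have h3 := (hb n).skLen
    have h4 := (hb n).tdLen
    simp only [Fintype.card_sum, Fintype.card_prod, Fintype.card_fin]
    gcongr
  refine (Negligible.polynomial_mul hPos hν).mono (fun n => abs_nonneg _) fun n => ?_
  have hstep : ∀ m : Bits n, |avg (fun r => (D n).accept (hybrid ∅ m r)) -
      avg (fun r => (D n).accept (hybrid Finset.univ (fun _ => false) r))| ≤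
      Fintype.card (Pos A n (L n)) * ν n := by
    intro m
    rw [← avg_hybrid_univ (D n) m]
    refine abs_avg_hybrid_sub_univ_le (hb n) (D n) ?_ (hadv n) m _ ∅ (by simp)
    have := hcard n
    simp only [q, d]
    omega
  have h0 := hstep (m₀ n)
  have h1 := hstep (m₁ n)
  rw [abs_sub_comm] at h1
  refine (abs_sub_le _ _ _).trans ((add_le_add h0 h1).trans (le_of_eq ?_))
  push_cast
  ring

/-- IND-CPA security of the quantum scheme: the view of the adversary is classical, and a hybrid
argument over the encrypted bits reduces it to the security of the classical scheme. -/
theorem QHE_cpaSecure (hHE : HE.IsLeveledFHE) (hLc : PolyBounded Lc) (hA : A.Efficient)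
    (V : LevelCircuits A) : (QHE V).CPASecure := by
  intro L hL D hD m₀ m₁ acc
  have hacc : ∀ m n, acc m n = avg fun r : AllCoins A n (L n) → Bool =>
      Distinguisher.accept (ι := ViewIdx A n (L n)) (D n) (hybrid ∅ (m n) r) := fun m n =>
    congrArg avg (funext fun r => congrArg (Distinguisher.accept (ι := ViewIdx A n (L n)) (D n))
      (hybrid_empty V (m n) r).symm)
  simp only [hacc]
  exact negligible_abs_avg_hybrid_sub hHE hLc hA hL D hD m₀ m₁

end Security

/-! ### Distance of a state from the multiples of a unit vector -/

section Infid

variable {X : Type} [Fintype X]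

/-- The inner product of two state vectors. -/
def ip (χ φ : X → ℂ) : ℂ := ∑ x, star (χ x) * φ x

theorem ip_add (χ φ φ' : X → ℂ) : ip χ (φ + φ') = ip χ φ + ip χ φ' := by
  simp [ip, mul_add, Finset.sum_add_distrib]

theorem ip_smul (χ φ : X → ℂ) (c : ℂ) : ip χ (c • φ) = c * ip χ φ := by
  simp only [ip, Pi.smul_apply, smul_eq_mul, Finset.mul_sum]
  exact Finset.sum_congr rfl fun _ _ => by ring

theorem ip_smul_left (χ φ : X → ℂ) (c : ℂ) : ip (c • χ) φ = star c * ip χ φ := by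
  simp only [ip, Pi.smul_apply, smul_eq_mul, Finset.mul_sum, star_mul']
  exact Finset.sum_congr rfl fun _ _ => by ring

theorem ip_self (φ : X → ℂ) : ip φ φ = nsq φ := by
  simp only [ip, nsq, Complex.ofReal_sum]
  exact Finset.sum_congr rfl fun x _ => by
    rw [Complex.star_def, Complex.conj_mul', Complex.ofReal_pow]

/-- For a unit vector `χ`, the squared distance of `φ` from the multiples of `χ`. -/
def infid (χ φ : X → ℂ) : ℝ := nsq φ - ‖ip χ φ‖ ^ 2

theorem nsq_sub_smul {χ : X → ℂ} (hχ : nsq χ = 1) (φ : X → ℂ) (c : ℂ) :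
    nsq (φ - c • χ) = infid χ φ + ‖ip χ φ - c‖ ^ 2 := by
  have hpt : ∀ a b : ℂ, ‖a - b‖ ^ 2 = ‖a‖ ^ 2 + ‖b‖ ^ 2 - 2 * (star b * a).re := by
    intro a b
    rw [← Complex.normSq_eq_norm_sq, ← Complex.normSq_eq_norm_sq, ← Complex.normSq_eq_norm_sq,
      Complex.normSq_sub, mul_comm (star b) a, Complex.star_def]
  have h1 : nsq (φ - c • χ) = nsq φ + nsq (c • χ) - 2 * (ip (c • χ) φ).re := by
    simp only [nsq, ip, Pi.sub_apply, hpt, Finset.sum_sub_distrib, Finset.sum_add_distrib,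
      ← Finset.mul_sum, Complex.re_sum]
  rw [h1, nsq_smul, hχ, ip_smul_left, infid, hpt]
  ring

theorem infid_le {χ : X → ℂ} (hχ : nsq χ = 1) (φ : X → ℂ) (c : ℂ) :
    infid χ φ ≤ nsq (φ - c • χ) := by
  rw [nsq_sub_smul hχ]
  nlinarith [sq_nonneg ‖ip χ φ - c‖]

theorem infid_eq {χ : X → ℂ} (hχ : nsq χ = 1) (φ : X → ℂ) :
    infid χ φ = nsq (φ - ip χ φ • χ) := by
  rw [nsq_sub_smul hχ]
  simp

theorem infid_nonneg {χ : X → ℂ} (hχ : nsq χ = 1) (φ : X → ℂ) : 0 ≤ infid χ φ := by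
  rw [infid_eq hχ]
  exact nsq_nonneg _

theorem infid_le_nsq (χ φ : X → ℂ) : infid χ φ ≤ nsq φ := by
  unfold infid
  nlinarith [sq_nonneg ‖ip χ φ‖]

theorem infid_smul (χ φ : X → ℂ) (c : ℂ) : infid χ (c • φ) = ‖c‖ ^ 2 * infid χ φ := by
  unfold infid
  rw [nsq_smul, ip_smul, norm_mul]
  ring

theorem infid_smul_left (χ φ : X → ℂ) {c : ℂ} (hc : ‖c‖ = 1) : infid (c • χ) φ = infid χ φ := by
  unfold infid
  rw [ip_smul_left, norm_mul, norm_star, hc, one_mul]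

theorem infid_smul_self {χ : X → ℂ} (hχ : nsq χ = 1) (c : ℂ) : infid χ (c • χ) = 0 := by
  unfold infid
  rw [nsq_smul, ip_smul, ip_self, hχ]
  simp

theorem norm_add_sq_le {T : ℝ} (hT : 0 < T) (a b : ℂ) :
    ‖a + b‖ ^ 2 ≤ (1 + T) * ‖a‖ ^ 2 + (1 + 1 / T) * ‖b‖ ^ 2 := by
  have h1 := norm_add_le a b
  have h2 : ‖a + b‖ ^ 2 ≤ (‖a‖ + ‖b‖) ^ 2 := by gcongr
  have h3 : 2 * (‖a‖ * ‖b‖) ≤ T * ‖a‖ ^ 2 + 1 / T * ‖b‖ ^ 2 := by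
    have h4 : 0 ≤ 1 / T * (T * ‖a‖ - ‖b‖) ^ 2 := by positivity
    have h5 : 1 / T * (T * ‖a‖ - ‖b‖) ^ 2 =
        T * ‖a‖ ^ 2 + 1 / T * ‖b‖ ^ 2 - 2 * (‖a‖ * ‖b‖) := by field_simp; ring
    linarith
  nlinarith

theorem nsq_add_le {T : ℝ} (hT : 0 < T) (φ φ' : X → ℂ) :
    nsq (φ + φ') ≤ (1 + T) * nsq φ + (1 + 1 / T) * nsq φ' := by
  unfold nsq
  rw [Finset.mul_sum, Finset.mul_sum, ← Finset.sum_add_distrib]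
  exact Finset.sum_le_sum fun x _ => norm_add_sq_le hT _ _

variable {Y : Type} [Fintype Y]

theorem infid_map_le {U : (X → ℂ) → (Y → ℂ)} (hU : IsLinearMap ℂ U)
    (hn : ∀ φ, nsq (U φ) = nsq φ) {χ : X → ℂ} (hχ : nsq χ = 1) (φ : X → ℂ) :
    infid (U χ) (U φ) ≤ infid χ φ := by
  refine (infid_le ((hn χ).trans hχ) _ (ip χ φ)).trans (le_of_eq ?_)
  rw [infid_eq hχ, ← hU.map_smul, ← hU.map_sub, hn]

/-- If `φ'` approximates `c U φ` for an isometry `U`, then `φ'` is close to the multiples of `U χ`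
provided that `φ` is close to the multiples of `χ`. -/
theorem infid_approx_le {U : (X → ℂ) → (Y → ℂ)} (hU : IsLinearMap ℂ U)
    (hn : ∀ φ, nsq (U φ) = nsq φ) {χ : X → ℂ} (hχ : nsq χ = 1) {T : ℝ} (hT : 0 < T) (φ : X → ℂ)
    (φ' : Y → ℂ) (c : ℂ) :
    infid (U χ) φ' ≤ (1 + T) * nsq (φ' - c • U φ) + (1 + 1 / T) * (‖c‖ ^ 2 * infid χ φ) := by
  refine (infid_le ((hn χ).trans hχ) _ (c * ip χ φ)).trans ?_
  have h : φ' - (c * ip χ φ) • U χ = (φ' - c • U φ) + c • U (φ - ip χ φ • χ) := by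
    rw [hU.map_sub, hU.map_smul, smul_sub, smul_smul]
    abel
  rw [h]
  refine (nsq_add_le hT _ _).trans ?_
  rw [nsq_smul, hn, ← infid_eq hχ]

end Infid

/-! ### Trace distance -/

section TraceDist

variable {X : Type} [Fintype X]

/-- The family of unit vectors of an orthonormal basis, characterized by Parseval's identity. -/
def IsParseval {I : Type} [Fintype I] (e : I → X → ℂ) : Prop :=
  ∀ φ : X → ℂ, ∑ i, ‖ip (e i) φ‖ ^ 2 = nsq φ

theorem isParseval_single [DecidableEq X] :
    IsParseval fun (x : X) (y : X) => if y = x then (1 : ℂ) else 0 := by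
  intro φ
  simp [ip, nsq]

/-- An ensemble of states `φ` that are close to multiples of `χ` has almost the same measurement
statistics as `χ`. -/
theorem sum_abs_measure_sub_le {I : Type} [Fintype I] {e : I → X → ℂ} (he : IsParseval e)
    {χ : X → ℂ} (hχ : nsq χ = 1) (s : Multiset (X → ℂ)) {η : ℝ} (hη : (s.map (infid χ)).sum ≤ η)
    (hs : (s.map nsq).sum = 1) :
    ∑ i, |(s.map fun φ => ‖ip (e i) φ‖ ^ 2).sum - ‖ip (e i) χ‖ ^ 2| ≤ 2 * Real.sqrt η + 2 * η := by
  have hη0 : 0 ≤ (s.map (infid χ)).sum := by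
    refine Multiset.sum_nonneg fun a ha => ?_
    obtain ⟨φ, -, rfl⟩ := Multiset.mem_map.1 ha
    exact infid_nonneg hχ φ
  have habs : ∀ (f : (X → ℂ) → ℝ), |(s.map f).sum| ≤ (s.map fun φ => |f φ|).sum := by
    intro f
    have := Multiset.abs_sum_le_sum_abs (s := s.map f)
    rwa [Multiset.map_map] at this
  have hcsum : (s.map fun φ => ‖ip χ φ‖ ^ 2).sum = 1 - (s.map (infid χ)).sum := by
    rw [← hs, ← Multiset.sum_map_sub]
    congr 1
    exact Multiset.map_congr rfl fun φ _ => by unfold infid; ring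
  have hswap : ∀ f : I → (X → ℂ) → ℝ,
      ∑ i, (s.map (f i)).sum = (s.map fun φ => ∑ i, f i φ).sum := fun f => by
    clear hη hs hη0 habs hcsum
    induction s using Multiset.induction_on with
    | empty => simp
    | cons a s ih => simp only [Multiset.map_cons, Multiset.sum_cons, Finset.sum_add_distrib, ih]
  -- Each squared amplitude is expanded around the component along `χ`; the weight `t` of the cross
  -- term is optimized at the end, as the square root of the total infidelity.
  have key : ∀ t : ℝ, 0 < t →
      ∑ i, |(s.map fun φ => ‖ip (e i) φ‖ ^ 2).sum - ‖ip (e i) χ‖ ^ 2| ≤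
        t + (s.map (infid χ)).sum / t + 2 * (s.map (infid χ)).sum := by
    intro t ht
    have hpt : ∀ i φ, |‖ip (e i) φ‖ ^ 2 - ‖ip χ φ‖ ^ 2 * ‖ip (e i) χ‖ ^ 2| ≤
        t * (‖ip χ φ‖ ^ 2 * ‖ip (e i) χ‖ ^ 2) +
          (1 / t + 1) * ‖ip (e i) (φ - ip χ φ • χ)‖ ^ 2 := by
      intro i φ
      have hd : ip (e i) φ = ip χ φ * ip (e i) χ + ip (e i) (φ - ip χ φ • χ) := by
        rw [← ip_smul, ← ip_add]
        congr 1
        abel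
      set a := ip χ φ * ip (e i) χ with ha
      set b := ip (e i) (φ - ip χ φ • χ)
      have hna : ‖ip χ φ‖ ^ 2 * ‖ip (e i) χ‖ ^ 2 = ‖a‖ ^ 2 := by rw [ha, norm_mul, mul_pow]
      rw [hd, hna]
      have h1 : |‖a + b‖ - ‖a‖| ≤ ‖b‖ := by
        have := abs_norm_sub_norm_le (a + b) a
        simpa using this
      have h2 := norm_add_le a b
      have h3 : |‖a + b‖ ^ 2 - ‖a‖ ^ 2| ≤ ‖b‖ * (2 * ‖a‖ + ‖b‖) := by
        have : ‖a + b‖ ^ 2 - ‖a‖ ^ 2 = (‖a + b‖ - ‖a‖) * (‖a + b‖ + ‖a‖) := by ring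
        rw [this, abs_mul, abs_of_nonneg (by positivity : 0 ≤ ‖a + b‖ + ‖a‖)]
        exact mul_le_mul h1 (by linarith) (by positivity) (norm_nonneg _)
      -- The cross term is at most `t * ‖a‖ ^ 2 + ‖b‖ ^ 2 / t`.
      have h4 : 0 ≤ 1 / t * (t * ‖a‖ - ‖b‖) ^ 2 := by positivity
      have h5 : 1 / t * (t * ‖a‖ - ‖b‖) ^ 2 =
          t * ‖a‖ ^ 2 + 1 / t * ‖b‖ ^ 2 - 2 * (‖a‖ * ‖b‖) := by field_simp; ring
      nlinarith
    have h1 : ∀ i, |(s.map fun φ => ‖ip (e i) φ‖ ^ 2).sum - ‖ip (e i) χ‖ ^ 2| ≤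
        (s.map fun φ => |‖ip (e i) φ‖ ^ 2 - ‖ip χ φ‖ ^ 2 * ‖ip (e i) χ‖ ^ 2|).sum +
          (s.map (infid χ)).sum * ‖ip (e i) χ‖ ^ 2 := by
      intro i
      have h2 := habs fun φ => ‖ip (e i) φ‖ ^ 2 - ‖ip χ φ‖ ^ 2 * ‖ip (e i) χ‖ ^ 2
      rw [Multiset.sum_map_sub, Multiset.sum_map_mul_right, hcsum] at h2
      have h3 := abs_le.1 h2
      have h4 : 0 ≤ (s.map (infid χ)).sum * ‖ip (e i) χ‖ ^ 2 := by positivity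
      rw [abs_le]
      constructor <;> nlinarith [h3.1, h3.2]
    calc _ ≤ ∑ i, ((s.map fun φ => t * (‖ip χ φ‖ ^ 2 * ‖ip (e i) χ‖ ^ 2) +
          (1 / t + 1) * ‖ip (e i) (φ - ip χ φ • χ)‖ ^ 2).sum +
          (s.map (infid χ)).sum * ‖ip (e i) χ‖ ^ 2) :=
          Finset.sum_le_sum fun i _ => (h1 i).trans (by
            gcongr
            exact Multiset.sum_map_le_sum_map _ _ fun φ _ => hpt i φ)
      _ = (s.map fun φ => t * ‖ip χ φ‖ ^ 2 + (1 / t + 1) * infid χ φ).sum +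
          (s.map (infid χ)).sum := by
          rw [Finset.sum_add_distrib, hswap, ← Finset.mul_sum, he χ, hχ, mul_one]
          congr 3
          funext φ
          rw [Finset.sum_add_distrib, ← Finset.mul_sum, ← Finset.mul_sum, ← Finset.mul_sum, he, he,
            hχ, mul_one, ← infid_eq hχ]
      _ = t * (1 - (s.map (infid χ)).sum) + (1 / t + 1) * (s.map (infid χ)).sum +
          (s.map (infid χ)).sum := by
          rw [Multiset.sum_map_add, Multiset.sum_map_mul_left, Multiset.sum_map_mul_left, hcsum]
      _ ≤ _ := by
          have : 0 ≤ t * (s.map (infid χ)).sum := by positivity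
          have h6 : 1 / t * (s.map (infid χ)).sum = (s.map (infid χ)).sum / t := by ring
          nlinarith
  set S := (s.map (infid χ)).sum with hS
  rcases eq_or_lt_of_le hη0 with h0 | h0
  · rw [← h0] at key hη
    have : ∑ i, |(s.map fun φ => ‖ip (e i) φ‖ ^ 2).sum - ‖ip (e i) χ‖ ^ 2| ≤ 0 :=
      le_of_forall_pos_le_add fun t ht => by simpa using key t ht
    have := Real.sqrt_nonneg η
    linarith
  · have h1 := key (Real.sqrt S) (Real.sqrt_pos.2 h0)
    rw [Real.div_sqrt] at h1
    have h2 := Real.sqrt_le_sqrt hη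
    linarith

open scoped MatrixOrder in
theorem traceDist_eq [DecidableEq X] {ρ σ : Matrix X X ℂ} (h : (ρ - σ).IsHermitian) :
    traceDist ρ σ = (∑ i, |h.eigenvalues i|) / 2 := by
  have h1 : CFC.sqrt ((ρ - σ) ^ 2) = cfc (fun x : ℝ => ‖x‖) (ρ - σ) := by
    have := CFC.abs_eq_cfc_norm (ρ - σ) h
    rw [← this, CFC.abs, h.isSelfAdjoint.star_eq, sq]
  unfold traceDist
  rw [h1, h.cfc_eq, Matrix.IsHermitian.cfc, Unitary.conjStarAlgAut_apply, Matrix.trace_mul_comm,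
    ← mul_assoc]
  simp [Matrix.trace_diagonal, Real.norm_eq_abs]

theorem outer_isHermitian {X : Type} (φ : X → ℂ) : (outer φ).IsHermitian := by
  ext i j
  simp [outer, mul_comm]

theorem star_dotProduct_outer_mulVec (φ e : X → ℂ) :
    star e ⬝ᵥ (outer φ).mulVec e = ((‖ip e φ‖ ^ 2 : ℝ) : ℂ) := by
  have h1 : star e ⬝ᵥ (outer φ).mulVec e = ip e φ * star (ip e φ) := by
    simp only [dotProduct, Matrix.mulVec, outer, ip, Pi.star_apply, star_sum, star_mul', star_star,
      Finset.sum_mul_sum]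
    refine Finset.sum_congr rfl fun i _ => ?_
    rw [Finset.mul_sum]
    exact Finset.sum_congr rfl fun j _ => by ring
  rw [h1, Complex.star_def, Complex.mul_conj', Complex.ofReal_pow]

theorem sum_outer_isHermitian {X : Type} (s : Multiset (X → ℂ)) :
    (s.map outer).sum.IsHermitian := by
  induction s using Multiset.induction_on with
  | empty => simp
  | cons a s ih =>
    rw [Multiset.map_cons, Multiset.sum_cons]
    exact (outer_isHermitian a).add ih

theorem star_dotProduct_sum_outer_mulVec (s : Multiset (X → ℂ)) (e : X → ℂ) :
    star e ⬝ᵥ ((s.map outer).sum).mulVec e = (((s.map fun φ => ‖ip e φ‖ ^ 2).sum : ℝ) : ℂ) := by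
  induction s using Multiset.induction_on with
  | empty => simp
  | cons a s ih =>
    rw [Multiset.map_cons, Multiset.sum_cons, Multiset.map_cons, Multiset.sum_cons,
      Matrix.add_mulVec, dotProduct_add, ih, star_dotProduct_outer_mulVec]
    push_cast
    rfl

theorem ip_eq_inner (e : EuclideanSpace ℂ X) (φ : X → ℂ) :
    ip (fun x => e x) φ = inner ℂ e (WithLp.toLp 2 φ) := by
  simp [ip, PiLp.inner_apply, mul_comm]

theorem isParseval_orthonormalBasis [DecidableEq X]
    (b : OrthonormalBasis X ℂ (EuclideanSpace ℂ X)) :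
    IsParseval fun i x => b i x := by
  intro φ
  simp only [ip_eq_inner]
  rw [OrthonormalBasis.sum_sq_norm_inner_right, EuclideanSpace.norm_sq_eq]
  rfl

/-- The trace distance is half of the total variation distance between the outcomes of a measurement
in the eigenbasis of the difference. -/
theorem traceDist_outer_le [DecidableEq X] {χ : X → ℂ} (hχ : nsq χ = 1) (s : Multiset (X → ℂ))
    {η : ℝ} (hη : (s.map (infid χ)).sum ≤ η) (hs : (s.map nsq).sum = 1) :
    traceDist (s.map outer).sum (outer χ) ≤ Real.sqrt η + η := by
  have h := (sum_outer_isHermitian s).sub (outer_isHermitian χ)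
  rw [traceDist_eq h]
  have h1 := sum_abs_measure_sub_le (isParseval_orthonormalBasis h.eigenvectorBasis) hχ s hη hs
  have h2 : ∀ i, h.eigenvalues i = (s.map fun φ => ‖ip (fun x => h.eigenvectorBasis i x) φ‖ ^ 2).sum
      - ‖ip (fun x => h.eigenvectorBasis i x) χ‖ ^ 2 := by
    intro i
    have := h.eigenvalues_eq i
    rw [this, Matrix.sub_mulVec, dotProduct_sub]
    change RCLike.re (star (fun x => h.eigenvectorBasis i x) ⬝ᵥ
      ((s.map outer).sum).mulVec (fun x => h.eigenvectorBasis i x) -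
      star (fun x => h.eigenvectorBasis i x) ⬝ᵥ
      (outer χ).mulVec (fun x => h.eigenvectorBasis i x)) = _
    rw [star_dotProduct_sum_outer_mulVec, star_dotProduct_outer_mulVec, ← Complex.ofReal_sub]
    exact Complex.ofReal_re _
  simp only [← h2] at h1
  linarith

/-- A mixed state that is close to a pure state `χ` in trace distance has almost unit overlap
with it. -/
theorem one_sub_le_traceDist [DecidableEq X] {χ : X → ℂ} (hχ : nsq χ = 1) (s : Multiset (X → ℂ)) :
    1 - (s.map fun φ => ‖ip χ φ‖ ^ 2).sum ≤ 2 * traceDist (s.map outer).sum (outer χ) := by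
  have h := (sum_outer_isHermitian s).sub (outer_isHermitian χ)
  rw [traceDist_eq h]
  set M := (s.map outer).sum - outer χ
  -- The expectation of `M` in the state `χ` is computed from the overlaps, and from the eigenvalues
  -- of `M`.
  have h1 : star χ ⬝ᵥ M.mulVec χ = (((s.map fun φ => ‖ip χ φ‖ ^ 2).sum - 1 : ℝ) : ℂ) := by
    rw [Matrix.sub_mulVec, dotProduct_sub, star_dotProduct_sum_outer_mulVec,
      star_dotProduct_outer_mulVec, ip_self, hχ]
    simp
  have hb := isParseval_orthonormalBasis h.eigenvectorBasis
  have h2 : star χ ⬝ᵥ M.mulVec χ =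
      ((∑ i, h.eigenvalues i * ‖ip (fun x => h.eigenvectorBasis i x) χ‖ ^ 2 : ℝ) : ℂ) := by
    have e1 : star χ ⬝ᵥ M.mulVec χ =
        inner ℂ (WithLp.toLp 2 χ) (WithLp.toLp 2 (M.mulVec χ)) := by
      rw [← ip_eq_inner (WithLp.toLp 2 χ)]
      rfl
    rw [e1, ← h.eigenvectorBasis.sum_inner_mul_inner, Complex.ofReal_sum]
    refine Finset.sum_congr rfl fun i _ => ?_
    have e2 : inner ℂ (h.eigenvectorBasis i) (WithLp.toLp 2 (M.mulVec χ)) =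
        h.eigenvalues i * inner ℂ (h.eigenvectorBasis i) (WithLp.toLp 2 χ) := by
      rw [← ip_eq_inner, ← ip_eq_inner]
      have e3 := h.mulVec_eigenvectorBasis i
      change star (fun x => h.eigenvectorBasis i x) ⬝ᵥ M.mulVec χ = _
      have e4 : star (fun x => h.eigenvectorBasis i x) ⬝ᵥ M.mulVec χ =
          star (M.mulVec (fun x => h.eigenvectorBasis i x)) ⬝ᵥ χ := by
        rw [Matrix.star_mulVec, h.eq, Matrix.dotProduct_mulVec]
      rw [e4]
      have e5 : M.mulVec (fun x => h.eigenvectorBasis i x) =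
          (h.eigenvalues i : ℂ) • fun x => h.eigenvectorBasis i x := e3
      rw [e5, star_smul, smul_dotProduct]
      simp [ip, dotProduct]
    rw [e2, ip_eq_inner, ← inner_conj_symm (WithLp.toLp 2 χ)]
    push_cast
    rw [← Complex.conj_mul']
    ring
  rw [h1] at h2
  have h3 := Complex.ofReal_injective h2
  have h4 : ∀ i, ‖ip (fun x => h.eigenvectorBasis i x) χ‖ ^ 2 ≤ 1 := by
    intro i
    rw [← hχ, ← hb χ]
    exact Finset.single_le_sum (f := fun i => ‖ip (fun x => h.eigenvectorBasis i x) χ‖ ^ 2)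
      (fun _ _ => sq_nonneg _) (Finset.mem_univ i)
  have h5 : -∑ i, h.eigenvalues i * ‖ip (fun x => h.eigenvectorBasis i x) χ‖ ^ 2 ≤
      ∑ i, |h.eigenvalues i| := by
    rw [← Finset.sum_neg_distrib]
    refine Finset.sum_le_sum fun i _ => ?_
    have := neg_abs_le (h.eigenvalues i)
    have := h4 i
    nlinarith [abs_nonneg (h.eigenvalues i),
      sq_nonneg ‖ip (fun x => h.eigenvectorBasis i x) χ‖]
  linarith

end TraceDist

/-! ### The Hadamard transform -/

section Hadamard

variable {R : Type} [Fintype R]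

theorem sgn_eq_prod (d u : R → Bool) : sgn d u = ∏ i, if d i && u i then (-1 : ℂ) else 1 := by
  rw [Finset.prod_ite]
  simp [sgn, overlap]

theorem sgn_bxor (d u u' : R → Bool) : sgn d (bxor u u') = sgn d u * sgn d u' := by
  simp only [sgn_eq_prod, ← Finset.prod_mul_distrib, bxor]
  refine Finset.prod_congr rfl fun i _ => ?_
  have h : ∀ a b c : Bool, (if a && xor b c then (-1 : ℂ) else 1) =
      (if a && b then -1 else 1) * if a && c then -1 else 1 := by
    rintro (_ | _) (_ | _) (_ | _) <;> simp
  exact h _ _ _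

theorem dotBit_sgn (d u : R → Bool) : (if dotBit d u then (-1 : ℂ) else 1) = sgn d u := by
  unfold dotBit sgn
  rcases Nat.even_or_odd (overlap d u) with h | h
  · simp [h.neg_one_pow, Nat.not_odd_iff_even.2 h]
  · simp [h.neg_one_pow, h]

theorem norm_sgn (d u : R → Bool) : ‖sgn d u‖ = 1 := by simp [sgn]

variable [DecidableEq R]

/-- A Hadamard gate on a qubit on which a product kernel `M` acts as the identity replaces this
factor of the kernel by that of the Hadamard gate. -/
theorem hadamard_apply_eq_sum (i : R) (M : R → Bool → Bool → ℂ)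
    (hM : ∀ b b', M i b b' = if b = b' then 1 else 0) (ψ : Vec R) (v : R → Bool) :
    (CliffordGate.h i).apply (fun v => ∑ w : R → Bool, (∏ k, M k (v k) (w k)) * ψ w) v =
      ∑ w : R → Bool, (∏ k, if k = i then
        1 / (Real.sqrt 2 : ℂ) * (if v k && w k then -1 else 1) else M k (v k) (w k)) * ψ w := by
  simp only [CliffordGate.apply, Finset.mul_sum, ← Finset.sum_add_distrib]
  refine Finset.sum_congr rfl fun w _ => ?_
  have h1 : ∀ b, (∏ k, M k (Function.update v i b k) (w k)) =
      (if b = w i then 1 else 0) * ∏ k ∈ Finset.univ.erase i, M k (v k) (w k) := by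
    intro b
    rw [← Finset.mul_prod_erase _ _ (Finset.mem_univ i), Function.update_self, hM]
    congr 1
    refine Finset.prod_congr rfl fun k hk => ?_
    rw [Function.update_of_ne (Finset.ne_of_mem_erase hk)]
  rw [h1, h1, ← Finset.mul_prod_erase Finset.univ _ (Finset.mem_univ i)]
  have h2 : (∏ k ∈ Finset.univ.erase i, if k = i then
      1 / (Real.sqrt 2 : ℂ) * (if v k && w k then -1 else 1) else M k (v k) (w k)) =
      ∏ k ∈ Finset.univ.erase i, M k (v k) (w k) :=
    Finset.prod_congr rfl fun k hk => if_neg (Finset.ne_of_mem_erase hk)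
  rw [h2]
  cases w i <;> cases v i <;> simp <;> ring

theorem runGates_hadamard_list (ψ : Vec R) : ∀ l : List R, l.Nodup → ∀ v,
    runGates (l.map fun i => .cliff (.h i)) ψ v = ∑ w : R → Bool, (∏ k, if k ∈ l then
      1 / (Real.sqrt 2 : ℂ) * (if v k && w k then -1 else 1) else if v k = w k then 1 else 0) *
        ψ w := by
  intro l
  induction l using List.reverseRecOn with
  | nil =>
    intro _ v
    rw [Finset.sum_eq_single v]
    · simp [runGates]
    · intro w _ hw
      obtain ⟨k, hk⟩ := Function.ne_iff.1 hw
      rw [Finset.prod_eq_zero (Finset.mem_univ k), zero_mul]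
      simp [hk.symm]
    · simp
  | append_singleton l i ih =>
    intro hl v
    rw [List.nodup_append] at hl
    have hi : i ∉ l := fun h => hl.2.2 i h i (by simp) rfl
    rw [List.map_append, runGates_append]
    change (CliffordGate.h i).apply (runGates _ ψ) v = _
    have h1 := funext (ih hl.1)
    rw [h1, hadamard_apply_eq_sum i (fun k b b' => if k ∈ l then
      1 / (Real.sqrt 2 : ℂ) * (if b && b' then -1 else 1) else if b = b' then 1 else 0)
      (by simp [hi])]
    refine Finset.sum_congr rfl fun w _ => ?_
    congr 1
    refine Finset.prod_congr rfl fun k _ => ?_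
    by_cases hk : k = i
    · simp [hk]
    · simp [hk]

/-- Hadamard gates on all qubits. -/
theorem runGates_hadamard (ψ : Vec R) (v : R → Bool) :
    runGates (Finset.univ.toList.map fun i : R => .cliff (.h i)) ψ v =
      ∑ w : R → Bool, (1 / (Real.sqrt 2 : ℂ)) ^ Fintype.card R * sgn v w * ψ w := by
  rw [runGates_hadamard_list ψ _ Finset.univ.nodup_toList]
  refine Finset.sum_congr rfl fun w _ => ?_
  congr 1
  simp only [Finset.mem_toList, Finset.mem_univ, if_true, Finset.prod_mul_distrib,
    Finset.prod_const, Finset.card_univ, sgn_eq_prod]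

theorem sum_norm_hadamard (ψ : Vec R) :
    ∑ d, ‖∑ w : R → Bool, (1 / (Real.sqrt 2 : ℂ)) ^ Fintype.card R * sgn d w * ψ w‖ ^ 2 =
      ∑ w, ‖ψ w‖ ^ 2 := by
  simp only [← runGates_hadamard]
  exact nsq_runGates _ ψ

theorem norm_one_div_sqrt_two_pow (k : ℕ) : ‖(1 / (Real.sqrt 2 : ℂ)) ^ k‖ ^ 2 = 1 / 2 ^ k := by
  rw [norm_pow, ← pow_mul, mul_comm, pow_mul, ← norm_pow, sq (1 / (Real.sqrt 2 : ℂ)),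
    one_div_sqrt_two_mul_self]
  simp

end Hadamard

/-! ### Elementary operations on one and two qubits -/

section Ops

variable {W : Type} [DecidableEq W]

/-- The operator `Z^b` on qubit `i`. -/
def zOp (i : W) (b : Bool) (φ : Vec W) : Vec W := fun v => (if b && v i then -1 else 1) * φ v

/-- The operator `X^b` on qubit `j`. -/
def xOp (j : W) (b : Bool) (φ : Vec W) : Vec W := fun v => φ (Function.update v j (xor (v j) b))

/-- The operator `CNOT^s` with control `i` and target `j`. -/
def cxOp (i j : W) (s : Bool) (φ : Vec W) : Vec W :=
  fun v => φ (Function.update v j (xor (v j) (s && v i)))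

/-- The controlled phase operator to the power `s`. -/
def czOp (i j : W) (s : Bool) (φ : Vec W) : Vec W :=
  fun v => (if s && v i && v j then -1 else 1) * φ v

theorem shift_involutive (j : W) (b : Bool) :
    Function.Involutive fun v : W → Bool => Function.update v j (xor (v j) b) := by
  intro v
  simp

theorem sum_shift [Fintype W] {M : Type} [AddCommMonoid M] (j : W) (b : Bool)
    (f : (W → Bool) → M) : ∑ v, f (Function.update v j (xor (v j) b)) = ∑ v, f v :=
  Equiv.sum_comp (shift_involutive j b).toPerm f

theorem xOp_isLinearMap (j : W) (b : Bool) : IsLinearMap ℂ (xOp j b) :=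
  ⟨fun _ _ => rfl, fun _ _ => rfl⟩

theorem cxOp_isLinearMap (i j : W) (s : Bool) : IsLinearMap ℂ (cxOp i j s) :=
  ⟨fun _ _ => rfl, fun _ _ => rfl⟩

theorem nsq_zOp [Fintype W] (i : W) (b : Bool) (φ : Vec W) : nsq (zOp i b φ) = nsq φ := by
  unfold nsq zOp
  refine Finset.sum_congr rfl fun v _ => ?_
  split_ifs <;> simp

theorem nsq_czOp [Fintype W] (i j : W) (s : Bool) (φ : Vec W) : nsq (czOp i j s φ) = nsq φ := by
  unfold nsq czOp
  refine Finset.sum_congr rfl fun v _ => ?_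
  split_ifs <;> simp

theorem nsq_xOp [Fintype W] (j : W) (b : Bool) (φ : Vec W) : nsq (xOp j b φ) = nsq φ :=
  sum_shift j b fun v => ‖φ v‖ ^ 2

theorem nsq_cxOp [Fintype W] {i j : W} (hij : i ≠ j) (s : Bool) (φ : Vec W) :
    nsq (cxOp i j s φ) = nsq φ :=
  nsq_reindex (r := fun v => Function.update v j (xor (v j) (s && v i)))
    (fun v => by simp [Function.update_of_ne hij]) φ

end Ops

theorem zOp_isLinearMap {W : Type} (i : W) (b : Bool) : IsLinearMap ℂ (zOp i b) :=
  ⟨fun _ _ => funext fun _ => by simp only [zOp, Pi.add_apply]; ring,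
    fun _ _ => funext fun _ => by simp only [zOp, Pi.smul_apply, smul_eq_mul]; ring⟩

/-! ### Analysis of the encrypted CNOT operation -/

theorem pushDensity_eq {X Y : Type} [Fintype X] [DecidableEq Y] (D : X → ℝ) (F : X → Y) (y : Y) :
    pushDensity D F y = ∑ w, if F w = y then D w else 0 := by
  unfold pushDensity
  exact Finset.sum_congr rfl fun w _ => by congr

/-- The final Hadamard gates and the measurement of the register `R` preserve norms. -/
theorem sum_nsq_kraus {W R Y G : Type} [Fintype W] [DecidableEq W] [Fintype R] [DecidableEq R]
    [Fintype Y] [Fintype G] (X : G × Y → (W → Bool) → (R → Bool) → ℂ) :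
    ∑ o : G × Y × (R → Bool), nsq (fun v : W → Bool => ∑ w : R → Bool,
      (1 / (Real.sqrt 2 : ℂ)) ^ Fintype.card R * sgn o.2.2 w * X (o.1, o.2.1) v w) =
      ∑ g, ∑ y, ∑ v, ∑ w, ‖X (g, y) v w‖ ^ 2 := by
  rw [Fintype.sum_prod_type]
  refine Finset.sum_congr rfl fun g _ => ?_
  rw [Fintype.sum_prod_type]
  refine Finset.sum_congr rfl fun y _ => ?_
  unfold nsq
  rw [Finset.sum_comm]
  exact Finset.sum_congr rfl fun v _ => sum_norm_hadamard (X (g, y) v)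

section Approx

variable {W R Y G : Type} [Fintype W] [DecidableEq W] [Fintype R] [DecidableEq R] [Fintype Y]
  [DecidableEq Y] [Fintype G]

theorem probOf_eq {X : Type} [Fintype X] (D : X → ℝ) (P : X → Prop) [DecidablePred P] :
    probOf D P = ∑ w, if P w then D w else 0 := by
  unfold probOf
  exact Finset.sum_congr rfl fun w _ => by congr

/-- The Kraus operators of the encrypted CNOT operation: `f b` is the map from samples to images for
the value `b` of the control, `amp g` are the prepared amplitudes, and `msg` is the message bit. -/
def cnotKraus (amp : G → (R → Bool) → ℂ) (f : Bool → (R → Bool) → Y) (msg : (R → Bool) → Bool)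
    (i j : W) (o : G × Y × (R → Bool)) (φ : Vec W) : Vec W := fun v =>
  ∑ w : R → Bool, (1 / (Real.sqrt 2 : ℂ)) ^ Fintype.card R * sgn o.2.2 w *
    (if f (v i) w = o.2.1 then φ (Function.update v j (xor (v j) (msg w))) * amp o.1 w else 0)

/-- The Kraus operators of the encrypted CNOT operation are those of a quantum channel. -/
theorem sum_nsq_cnotKraus (amp : G → (R → Bool) → ℂ) (f : Bool → (R → Bool) → Y)
    (msg : (R → Bool) → Bool) (i j : W) (hamp : ∑ g, nsq (amp g) = 1) (φ : Vec W) :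
    ∑ o, nsq (cnotKraus amp f msg i j o φ) = nsq φ := by
  unfold cnotKraus
  rw [sum_nsq_kraus fun (p : G × Y) v w =>
    if f (v i) w = p.2 then φ (Function.update v j (xor (v j) (msg w))) * amp p.1 w else 0]
  have h1 : ∀ g, ∑ y, ∑ v : W → Bool, ∑ w : R → Bool, ‖if f (v i) w = y then
      φ (Function.update v j (xor (v j) (msg w))) * amp g w else 0‖ ^ 2 = nsq φ * nsq (amp g) := by
    intro g
    rw [Finset.sum_comm]
    have h2 : ∀ (v : W → Bool) (w : R → Bool), ∑ y, ‖if f (v i) w = y then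
        φ (Function.update v j (xor (v j) (msg w))) * amp g w else 0‖ ^ 2 =
        ‖φ (Function.update v j (xor (v j) (msg w)))‖ ^ 2 * ‖amp g w‖ ^ 2 := by
      intro v w
      rw [Finset.sum_eq_single (f (v i) w)] <;> simp +contextual [mul_pow, eq_comm]
    have h3 : ∀ v : W → Bool, ∑ y, ∑ w : R → Bool, ‖if f (v i) w = y then
        φ (Function.update v j (xor (v j) (msg w))) * amp g w else 0‖ ^ 2 =
        ∑ w : R → Bool,
          ‖φ (Function.update v j (xor (v j) (msg w)))‖ ^ 2 * ‖amp g w‖ ^ 2 := by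
      intro v
      rw [Finset.sum_comm]
      exact Finset.sum_congr rfl fun w _ => h2 v w
    simp only [h3]
    rw [Finset.sum_comm]
    simp only [← Finset.sum_mul]
    unfold nsq
    rw [Finset.mul_sum]
    refine Finset.sum_congr rfl fun w _ => ?_
    rw [sum_shift j (msg w) fun v => ‖φ v‖ ^ 2]
  simp only [h1]
  rw [← Finset.mul_sum, hamp, mul_one]

variable (amp : G → (R → Bool) → ℂ) (D : (R → Bool) → ℝ) (f : Bool → (R → Bool) → Y)
  (u : Bool → Y → (R → Bool)) (msg : (R → Bool) → Bool) (s : Bool)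

/-- A sample that is recovered correctly from its image, for the value `b` of the control. -/
def GoodSample (b : Bool) (w : R → Bool) : Prop :=
  u b (f b w) = w ∧ msg w = xor (msg (u false (f b w))) (s && b)

instance (b : Bool) : DecidablePred (GoodSample f u msg s b) := fun _ => by
  unfold GoodSample; infer_instance

/-- The coefficients of the ideal Kraus operators. -/
def idealCoeff (o : G × Y × (R → Bool)) : ℂ :=
  ip (fun w => (Real.sqrt (D w) : ℂ)) (amp o.1) * (1 / (Real.sqrt 2 : ℂ)) ^ Fintype.card R *
    (Real.sqrt (pushDensity D (f false) o.2.1) : ℂ) * sgn o.2.2 (u false o.2.1)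

/-- The ideal Kraus operators, up to coefficients: `CNOT^s` followed by a Pauli operator. -/
def idealKraus (i j : W) (o : G × Y × (R → Bool)) (φ : Vec W) : Vec W :=
  zOp i (dotBit o.2.2 (bxor (u false o.2.1) (u true o.2.1)))
    (xOp j (msg (u false o.2.1)) (cxOp i j s φ))

variable {amp D f u msg s}

theorem sum_norm_idealCoeff_le (hD0 : ∀ w, 0 ≤ D w) (hD1 : ∑ w, D w = 1)
    (ha : ∑ g, ‖ip (fun w => (Real.sqrt (D w) : ℂ)) (amp g)‖ ^ 2 ≤ 1) :
    ∑ o : G × Y × (R → Bool), ‖idealCoeff amp D f u o‖ ^ 2 ≤ 1 := by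
  have hF0 : ∀ y, 0 ≤ pushDensity D (f false) y := fun y => by
    rw [pushDensity_eq]
    exact Finset.sum_nonneg fun w _ => by split_ifs <;> simp [hD0]
  have hF1 : ∑ y, pushDensity D (f false) y = 1 := by
    simp only [pushDensity_eq]
    rw [Finset.sum_comm]
    simpa using hD1
  refine le_trans (le_of_eq ?_) ha
  rw [Fintype.sum_prod_type]
  refine Finset.sum_congr rfl fun g _ => ?_
  rw [Fintype.sum_prod_type]
  have h1 : ∀ y (d : R → Bool), ‖idealCoeff amp D f u (g, y, d)‖ ^ 2 =
      ‖ip (fun w => (Real.sqrt (D w) : ℂ)) (amp g)‖ ^ 2 * (1 / 2 ^ Fintype.card R) *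
        pushDensity D (f false) y := by
    intro y d
    simp only [idealCoeff, norm_mul, norm_sgn, mul_one, mul_pow, norm_one_div_sqrt_two_pow,
      Complex.norm_real, Real.norm_eq_abs, sq_abs, Real.sq_sqrt (hF0 y)]
  simp only [h1]
  rw [Finset.sum_comm]
  simp only [← Finset.mul_sum, hF1, Finset.sum_const, Finset.card_univ, Fintype.card_fun,
    Fintype.card_bool, nsmul_eq_mul]
  push_cast
  field_simp

/-- The amplitude that remains of a sample, for the image `y` and the value `b` of the control. -/
def sampleAmp (D : (R → Bool) → ℝ) (f : Bool → (R → Bool) → Y) (u : Bool → Y → (R → Bool))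
    (msg : (R → Bool) → Bool) (s b : Bool) (y : Y) : ℝ :=
  if f b (u b y) = y ∧ GoodSample f u msg s b (u b y) then Real.sqrt (D (u b y)) else 0

/-- The difference is the weight of the samples with image `y` that are not recovered. -/
theorem pushDensity_sub_sampleAmp {R Y : Type} [Fintype R] [DecidableEq R] [DecidableEq Y]
    {D : (R → Bool) → ℝ} {f : Bool → (R → Bool) → Y} {u : Bool → Y → (R → Bool)}
    {msg : (R → Bool) → Bool} {s : Bool} (hD0 : ∀ w, 0 ≤ D w) (b : Bool) (y : Y) :
    pushDensity D (f b) y - sampleAmp D f u msg s b y ^ 2 =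
      ∑ w, if f b w = y ∧ ¬ GoodSample f u msg s b w then D w else 0 := by
  have h1 : sampleAmp D f u msg s b y ^ 2 =
      ∑ w, if f b w = y ∧ GoodSample f u msg s b w then D w else 0 := by
    rw [Finset.sum_eq_single (u b y)]
    · unfold sampleAmp
      split_ifs with h
      · exact Real.sq_sqrt (hD0 _)
      · simp
    · rintro w - hw
      rw [if_neg]
      rintro ⟨h1, h2⟩
      exact hw (by rw [← h2.1, h1])
    · simp
  rw [h1, pushDensity_eq, ← Finset.sum_sub_distrib]
  refine Finset.sum_congr rfl fun w _ => ?_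
  by_cases h2 : f b w = y <;> by_cases h3 : GoodSample f u msg s b w <;> simp [h2, h3]

/-- The remaining amplitudes are close to those of the images for the control zero, if most samples
are recovered and the images have similar distributions for both values of the control. -/
theorem sum_sampleAmp_sub_le (hD0 : ∀ w, 0 ≤ D w) (b : Bool) :
    ∑ y, (sampleAmp D f u msg s b y - Real.sqrt (pushDensity D (f false) y)) ^ 2 ≤
      2 * probOf D (fun w => ¬ GoodSample f u msg s b w) +
        2 * ∑ y, (Real.sqrt (pushDensity D (f b) y) - Real.sqrt (pushDensity D (f false) y)) ^ 2 := by
  have h1 : probOf D (fun w => ¬ GoodSample f u msg s b w) =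
      ∑ y, (pushDensity D (f b) y - sampleAmp D f u msg s b y ^ 2) := by
    simp only [pushDensity_sub_sampleAmp hD0, probOf_eq]
    rw [Finset.sum_comm]
    refine Finset.sum_congr rfl fun w _ => ?_
    rw [Finset.sum_eq_single (f b w)] <;> simp +contextual [eq_comm]
  rw [h1, Finset.mul_sum, Finset.mul_sum, ← Finset.sum_add_distrib]
  refine Finset.sum_le_sum fun y _ => ?_
  have h2 : 0 ≤ pushDensity D (f b) y - sampleAmp D f u msg s b y ^ 2 := by
    rw [pushDensity_sub_sampleAmp hD0]
    exact Finset.sum_nonneg fun w _ => by split_ifs <;> simp [hD0]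
  have h3 : 0 ≤ sampleAmp D f u msg s b y := by
    unfold sampleAmp
    split_ifs
    · exact Real.sqrt_nonneg _
    · exact le_rfl
  have h4 : sampleAmp D f u msg s b y ≤ Real.sqrt (pushDensity D (f b) y) :=
    Real.le_sqrt_of_sq_le (by linarith)
  have h5 : Real.sqrt (pushDensity D (f b) y) ^ 2 = pushDensity D (f b) y :=
    Real.sq_sqrt (by nlinarith)
  set a := sampleAmp D f u msg s b y
  set c := Real.sqrt (pushDensity D (f b) y)
  set e := Real.sqrt (pushDensity D (f false) y)
  rw [← h5]
  nlinarith [sq_nonneg (a - c - (c - e)), mul_nonneg h3 (sub_nonneg.2 h4)]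

/-- The Kraus operators of the encrypted CNOT operation are close to the ideal ones. The error has
three sources: the prepared state, samples that are not recovered, and the difference of the
distributions of the images for the two values of the control. -/
theorem sum_nsq_cnotKraus_sub_le (hD0 : ∀ w, 0 ≤ D w)
    (ha : ∑ g, ‖ip (fun w => (Real.sqrt (D w) : ℂ)) (amp g)‖ ^ 2 ≤ 1) {ε₀ ε₁ ε₂ : ℝ}
    (hε₀ : ∑ g, nsq (amp g - ip (fun w => (Real.sqrt (D w) : ℂ)) (amp g) •
      fun w => (Real.sqrt (D w) : ℂ)) ≤ ε₀)
    (hε₁ : ∑ b, probOf D (fun w => ¬ GoodSample f u msg s b w) ≤ ε₁)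
    (hε₂ : ∑ y, (Real.sqrt (pushDensity D (f true) y) -
      Real.sqrt (pushDensity D (f false) y)) ^ 2 ≤ ε₂) {i j : W} (hij : i ≠ j) (φ : Vec W) :
    ∑ o, nsq (cnotKraus amp f msg i j o φ - idealCoeff amp D f u o • idealKraus u msg s i j o φ) ≤
      3 * (ε₀ + 3 * ε₁ + 2 * ε₂) * nsq φ := by
  set a : G → ℂ := fun g => ip (fun w => (Real.sqrt (D w) : ℂ)) (amp g) with ha_def
  let F (y : Y) : ℝ := Real.sqrt (pushDensity D (f false) y)
  let sh (v : W → Bool) (b : Bool) : ℂ := φ (Function.update v j (xor (v j) b))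
  let X (p : G × Y) (v : W → Bool) (w : R → Bool) : ℂ :=
    (if f (v i) w = p.2 then sh v (msg w) * amp p.1 w else 0) -
      (if w = u (v i) p.2 then a p.1 * F p.2 * sh v (xor (msg (u false p.2)) (s && v i)) else 0)
  -- Both Kraus operators are obtained from a state on `W` and the register `R` by Hadamard gates on
  -- `R`. In the ideal case, this state has the single sample `u (v i) y` in the register `R`, and
  -- the sign `sgn d (u (v i) y)` splits into a global sign and a `Z` operator on the control.
  have hX : ∀ o : G × Y × (R → Bool),
      cnotKraus amp f msg i j o φ - idealCoeff amp D f u o • idealKraus u msg s i j o φ =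
      fun v => ∑ w : R → Bool, (1 / (Real.sqrt 2 : ℂ)) ^ Fintype.card R * sgn o.2.2 w *
        X (o.1, o.2.1) v w := by
    rintro ⟨g, y, d⟩
    funext v
    simp only [X, mul_sub, Finset.sum_sub_distrib, Pi.sub_apply]
    congr 1
    simp only [mul_ite, mul_zero, Finset.sum_ite_eq', Finset.mem_univ, if_true]
    have h1 : Function.update (Function.update v j (xor (v j) (msg (u false y)))) j
        (xor (xor (v j) (msg (u false y))) (s && v i)) =
        Function.update v j (xor (v j) (xor (msg (u false y)) (s && v i))) := by
      rw [Function.update_idem, Bool.xor_assoc]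
    have h2 : sgn d (u false y) * (if dotBit d (bxor (u false y) (u true y)) && v i then -1 else 1) =
        sgn d (u (v i) y) := by
      have hss : sgn d (u false y) * sgn d (u false y) = 1 := by
        rw [← sgn_bxor, sgn_eq_prod]
        simp [bxor]
      cases hv : v i
      · simp
      · simp only [Bool.and_true]
        rw [dotBit_sgn, sgn_bxor, ← mul_assoc, hss, one_mul]
    simp only [Pi.smul_apply, smul_eq_mul, idealCoeff, idealKraus, zOp, xOp, cxOp,
      Function.update_self, Function.update_of_ne hij, h1, ← h2, sh, F, a]
    ring
  simp only [hX]
  rw [sum_nsq_kraus X]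
  -- The three sources of the error: `X₁` is due to the preparation, `X₂` to samples that are not
  -- recovered, and `X₃` to the dependence of the amplitude of an image on the control.
  let X₁ (g : G) (y : Y) (v : W → Bool) (w : R → Bool) : ℂ :=
    if f (v i) w = y then sh v (msg w) * (amp g w - a g * Real.sqrt (D w)) else 0
  let X₂ (g : G) (y : Y) (v : W → Bool) (w : R → Bool) : ℂ :=
    if f (v i) w = y ∧ ¬ GoodSample f u msg s (v i) w then sh v (msg w) * (a g * Real.sqrt (D w))
    else 0
  let X₃ (g : G) (y : Y) (v : W → Bool) (w : R → Bool) : ℂ :=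
    if w = u (v i) y then sh v (xor (msg (u false y)) (s && v i)) *
      (a g * ((sampleAmp D f u msg s (v i) y - F y : ℝ) : ℂ)) else 0
  have hsum : ∀ g y v w, X (g, y) v w = X₁ g y v w + X₂ g y v w + X₃ g y v w := by
    intro g y v w
    simp only [X, X₁, X₂, X₃, sampleAmp]
    by_cases h1 : f (v i) w = y
    · by_cases h2 : GoodSample f u msg s (v i) w
      · have h3 : u (v i) y = w := by rw [← h1]; exact h2.1
        have h4 : msg w = xor (msg (u false y)) (s && v i) := by rw [← h1]; exact h2.2
        simp only [h1, h2, h3, h4, if_true, not_true_eq_false, and_false, and_self, if_false]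
        push_cast
        ring
      · have h3 : ¬ (f (v i) (u (v i) y) = y ∧ GoodSample f u msg s (v i) (u (v i) y)) ∨
            w ≠ u (v i) y := by
          by_cases h4 : w = u (v i) y
          · exact .inl fun h => h2 (h4 ▸ h.2)
          · exact .inr h4
        rcases h3 with h3 | h3
        · simp only [h1, h2, h3, if_true, not_false_eq_true, and_self, if_false]
          split_ifs <;> push_cast <;> ring
        · simp only [h1, h2, h3, if_true, not_false_eq_true, and_self, if_false]
          ring
    · have h3 : ¬ (f (v i) (u (v i) y) = y ∧ GoodSample f u msg s (v i) (u (v i) y)) ∨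
          w ≠ u (v i) y := by
        by_cases h4 : w = u (v i) y
        · exact .inl fun h => h1 (h4 ▸ h.1)
        · exact .inr h4
      rcases h3 with h3 | h3
      · simp only [h1, h3, false_and, if_false]
        split_ifs <;> push_cast <;> ring
      · simp only [h1, h3, false_and, if_false]
        ring
  have hpt : ∀ g y v w, ‖X (g, y) v w‖ ^ 2 ≤
      3 * (‖X₁ g y v w‖ ^ 2 + ‖X₂ g y v w‖ ^ 2 + ‖X₃ g y v w‖ ^ 2) := by
    intro g y v w
    rw [hsum]
    have h1 := norm_add₃_le (a := X₁ g y v w) (b := X₂ g y v w) (c := X₃ g y v w)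
    have h2 := norm_nonneg (X₁ g y v w + X₂ g y v w + X₃ g y v w)
    nlinarith [sq_nonneg (‖X₁ g y v w‖ - ‖X₂ g y v w‖), sq_nonneg (‖X₁ g y v w‖ - ‖X₃ g y v w‖),
      sq_nonneg (‖X₂ g y v w‖ - ‖X₃ g y v w‖)]
  have hsh : ∀ b, ∑ v, ‖sh v b‖ ^ 2 = nsq φ := fun b => sum_shift j b fun v => ‖φ v‖ ^ 2
  have hN := nsq_nonneg φ
  have hsq : ∀ w, ‖(Real.sqrt (D w) : ℂ)‖ ^ 2 = D w := fun w => by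
    rw [Complex.norm_real, Real.norm_eq_abs, sq_abs, Real.sq_sqrt (hD0 w)]
  have hS₁ : ∑ g, ∑ y, ∑ v, ∑ w, ‖X₁ g y v w‖ ^ 2 ≤ ε₀ * nsq φ := by
    calc ∑ g, ∑ y, ∑ v, ∑ w, ‖X₁ g y v w‖ ^ 2
        = ∑ g, ∑ v, ∑ w, ‖sh v (msg w)‖ ^ 2 * ‖amp g w - a g * Real.sqrt (D w)‖ ^ 2 := by
          refine Finset.sum_congr rfl fun g _ => ?_
          rw [Finset.sum_comm]
          refine Finset.sum_congr rfl fun v _ => ?_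
          rw [Finset.sum_comm]
          refine Finset.sum_congr rfl fun w _ => ?_
          rw [Finset.sum_eq_single (f (v i) w)] <;> simp +contextual [X₁, mul_pow, eq_comm]
      _ = (∑ g, ∑ w, ‖amp g w - a g * Real.sqrt (D w)‖ ^ 2) * nsq φ := by
          rw [Finset.sum_mul]
          refine Finset.sum_congr rfl fun g _ => ?_
          rw [Finset.sum_comm, Finset.sum_mul]
          refine Finset.sum_congr rfl fun w _ => ?_
          rw [← Finset.sum_mul, hsh, mul_comm]
      _ ≤ ε₀ * nsq φ := by
          gcongr
          exact hε₀
  have hS₂ : ∑ g, ∑ y, ∑ v, ∑ w, ‖X₂ g y v w‖ ^ 2 ≤ ε₁ * nsq φ := by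
    have h0 : ∀ w, 0 ≤ ∑ b, if ¬ GoodSample f u msg s b w then D w else 0 := fun w =>
      Finset.sum_nonneg fun b _ => by split_ifs <;> simp [hD0]
    calc ∑ g, ∑ y, ∑ v, ∑ w, ‖X₂ g y v w‖ ^ 2
        = ∑ g, ∑ v, ∑ w, if ¬ GoodSample f u msg s (v i) w then
            ‖sh v (msg w)‖ ^ 2 * (‖a g‖ ^ 2 * D w) else 0 := by
          refine Finset.sum_congr rfl fun g _ => ?_
          rw [Finset.sum_comm]
          refine Finset.sum_congr rfl fun v _ => ?_
          rw [Finset.sum_comm]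
          refine Finset.sum_congr rfl fun w _ => ?_
          rw [Finset.sum_eq_single (f (v i) w)]
          · by_cases h : GoodSample f u msg s (v i) w <;> simp [X₂, h, mul_pow, hsq, -Complex.norm_real]
          · intro y _ hy
            simp [X₂, Ne.symm hy]
          · simp
      _ ≤ ∑ g, ∑ v, ∑ w, ‖sh v (msg w)‖ ^ 2 * (‖a g‖ ^ 2 *
            ∑ b, if ¬ GoodSample f u msg s b w then D w else 0) := by
          refine Finset.sum_le_sum fun g _ => Finset.sum_le_sum fun v _ =>
            Finset.sum_le_sum fun w _ => ?_
          have h0' : ∀ b, 0 ≤ if ¬ GoodSample f u msg s b w then D w else 0 := fun b => by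
            split_ifs <;> simp [hD0]
          have h1 : (if ¬ GoodSample f u msg s (v i) w then D w else 0) ≤
              ∑ b, if ¬ GoodSample f u msg s b w then D w else 0 :=
            Finset.single_le_sum (f := fun b => if ¬ GoodSample f u msg s b w then D w else 0)
              (fun b _ => h0' b) (Finset.mem_univ (v i))
          have h2 : (if ¬ GoodSample f u msg s (v i) w then
              ‖sh v (msg w)‖ ^ 2 * (‖a g‖ ^ 2 * D w) else 0) = ‖sh v (msg w)‖ ^ 2 * (‖a g‖ ^ 2 *
                if ¬ GoodSample f u msg s (v i) w then D w else 0) := by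
            split_ifs <;> simp
          rw [h2]
          exact mul_le_mul_of_nonneg_left (mul_le_mul_of_nonneg_left h1 (sq_nonneg _))
            (sq_nonneg _)
      _ = (∑ g, ‖a g‖ ^ 2) * (∑ b, probOf D (fun w => ¬ GoodSample f u msg s b w)) * nsq φ := by
          rw [Finset.sum_mul, Finset.sum_mul]
          refine Finset.sum_congr rfl fun g _ => ?_
          rw [Finset.sum_comm]
          simp only [← Finset.sum_mul, hsh, ← Finset.mul_sum]
          rw [Finset.sum_comm]
          simp only [probOf_eq]
          ring
      _ ≤ 1 * ε₁ * nsq φ := by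
          have : 0 ≤ ∑ b, probOf D (fun w => ¬ GoodSample f u msg s b w) :=
            Finset.sum_nonneg fun b _ => by
              rw [probOf_eq]
              exact Finset.sum_nonneg fun w _ => by split_ifs <;> simp [hD0]
          gcongr
      _ = ε₁ * nsq φ := by ring
  have hS₃ : ∑ g, ∑ y, ∑ v, ∑ w, ‖X₃ g y v w‖ ^ 2 ≤ 2 * (ε₁ + ε₂) * nsq φ := by
    calc ∑ g, ∑ y, ∑ v, ∑ w, ‖X₃ g y v w‖ ^ 2
        = ∑ g, ∑ y, ∑ v, ‖sh v (xor (msg (u false y)) (s && v i))‖ ^ 2 *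
            (‖a g‖ ^ 2 * (sampleAmp D f u msg s (v i) y - F y) ^ 2) := by
          refine Finset.sum_congr rfl fun g _ => Finset.sum_congr rfl fun y _ =>
            Finset.sum_congr rfl fun v _ => ?_
          rw [Finset.sum_eq_single (u (v i) y)]
          · simp only [X₃, if_true, norm_mul, mul_pow, Complex.norm_real, Real.norm_eq_abs, sq_abs]
          · intro w _ hw
            simp [X₃, hw]
          · simp
      _ ≤ ∑ g, ∑ y, ∑ v, ∑ b, ‖sh v (xor (msg (u false y)) (s && b))‖ ^ 2 *
            (‖a g‖ ^ 2 * (sampleAmp D f u msg s b y - F y) ^ 2) := by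
          refine Finset.sum_le_sum fun g _ => Finset.sum_le_sum fun y _ =>
            Finset.sum_le_sum fun v _ => ?_
          exact Finset.single_le_sum
            (f := fun b => ‖sh v (xor (msg (u false y)) (s && b))‖ ^ 2 *
              (‖a g‖ ^ 2 * (sampleAmp D f u msg s b y - F y) ^ 2))
            (fun b _ => by positivity) (Finset.mem_univ (v i))
      _ = (∑ g, ‖a g‖ ^ 2) * (∑ b, ∑ y, (sampleAmp D f u msg s b y - F y) ^ 2) * nsq φ := by
          rw [Finset.sum_mul, Finset.sum_mul]
          refine Finset.sum_congr rfl fun g _ => ?_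
          have h1 : ∀ y, ∑ v, ∑ b, ‖sh v (xor (msg (u false y)) (s && b))‖ ^ 2 *
              (‖a g‖ ^ 2 * (sampleAmp D f u msg s b y - F y) ^ 2) =
              ∑ b, nsq φ * (‖a g‖ ^ 2 * (sampleAmp D f u msg s b y - F y) ^ 2) := by
            intro y
            rw [Finset.sum_comm]
            refine Finset.sum_congr rfl fun b _ => ?_
            rw [← Finset.sum_mul, hsh]
          simp only [h1]
          rw [Finset.sum_comm]
          simp only [← Finset.mul_sum]
          ring
      _ ≤ 1 * (2 * ε₁ + 2 * ε₂) * nsq φ := by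
          have h1 : ∑ b, ∑ y, (sampleAmp D f u msg s b y - F y) ^ 2 ≤ 2 * ε₁ + 2 * ε₂ := by
            refine (Finset.sum_le_sum fun b _ => sum_sampleAmp_sub_le hD0 b).trans ?_
            rw [Finset.sum_add_distrib, ← Finset.mul_sum, ← Finset.mul_sum]
            gcongr
            simpa using hε₂
          have h2 : 0 ≤ ∑ b, ∑ y, (sampleAmp D f u msg s b y - F y) ^ 2 := by positivity
          gcongr
      _ = 2 * (ε₁ + ε₂) * nsq φ := by ring
  calc ∑ g, ∑ y, ∑ v, ∑ w, ‖X (g, y) v w‖ ^ 2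
      ≤ ∑ g, ∑ y, ∑ v, ∑ w, 3 * (‖X₁ g y v w‖ ^ 2 + ‖X₂ g y v w‖ ^ 2 + ‖X₃ g y v w‖ ^ 2) :=
        Finset.sum_le_sum fun g _ => Finset.sum_le_sum fun y _ =>
          Finset.sum_le_sum fun v _ => Finset.sum_le_sum fun w _ => hpt g y v w
    _ = 3 * (∑ g, ∑ y, ∑ v, ∑ w, ‖X₁ g y v w‖ ^ 2 + ∑ g, ∑ y, ∑ v, ∑ w, ‖X₂ g y v w‖ ^ 2 +
          ∑ g, ∑ y, ∑ v, ∑ w, ‖X₃ g y v w‖ ^ 2) := by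
        simp only [← Finset.mul_sum, Finset.sum_add_distrib]
    _ ≤ 3 * (ε₀ * nsq φ + ε₁ * nsq φ + 2 * (ε₁ + ε₂) * nsq φ) := by linarith
    _ = _ := by ring

end Approx

/-! ### Expectations over the branches of a process -/

namespace QProg

variable {W α β : Type}

/-- The sum of `Q` over the branches of `m` from the initial state `ψ`. For `Q` quadratic in the
state this is an expectation. -/
def expect (m : QProg W α) (ψ : Vec W) (Q : α → Vec W → ℝ) : ℝ :=
  ((m ψ).map fun b => Q b.1 b.2).sum

theorem expect_pure (a : α) (ψ : Vec W) (Q : α → Vec W → ℝ) :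
    expect (pure a : QProg W α) ψ Q = Q a ψ := by
  change (Multiset.map _ {(a, ψ)}).sum = _
  simp

theorem expect_bind (m : QProg W α) (f : α → QProg W β) (ψ : Vec W) (Q : β → Vec W → ℝ) :
    expect (m >>= f) ψ Q = expect m ψ fun a φ => expect (f a) φ Q := by
  change (Multiset.map _ (Multiset.bind _ _)).sum = _
  rw [Multiset.map_bind, Multiset.sum_bind]
  rfl

theorem expect_op (U : Vec W → Vec W) (ψ : Vec W) (Q : Unit → Vec W → ℝ) :
    expect (op U) ψ Q = Q () (U ψ) := by
  change (Multiset.map _ {((), U ψ)}).sum = _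
  simp

theorem expect_kraus [Fintype α] (K : α → Vec W → Vec W) (ψ : Vec W) (Q : α → Vec W → ℝ) :
    expect (kraus K) ψ Q = ∑ a, Q a (K a ψ) := by
  unfold expect kraus
  rw [Multiset.map_map]
  rfl

theorem expect_coins {κ : Type} [Fintype κ] [DecidableEq κ] (ψ : Vec W)
    (Q : (κ → Bool) → Vec W → ℝ) :
    expect (coins κ) ψ Q =
      ∑ r, Q r (((1 / (Real.sqrt 2 : ℂ)) ^ Fintype.card κ) • ψ) := expect_kraus _ _ _

theorem expect_mono (m : QProg W α) (ψ : Vec W) {Q Q' : α → Vec W → ℝ} (h : ∀ a φ, Q a φ ≤ Q' a φ) :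
    expect m ψ Q ≤ expect m ψ Q' :=
  Multiset.sum_map_le_sum_map _ _ fun b _ => h b.1 b.2

theorem expect_add (m : QProg W α) (ψ : Vec W) (Q Q' : α → Vec W → ℝ) :
    expect m ψ (fun a φ => Q a φ + Q' a φ) = expect m ψ Q + expect m ψ Q' :=
  Multiset.sum_map_add

theorem expect_mul_left (m : QProg W α) (ψ : Vec W) (c : ℝ) (Q : α → Vec W → ℝ) :
    expect m ψ (fun a φ => c * Q a φ) = c * expect m ψ Q :=
  Multiset.sum_map_mul_left

theorem avg_expect {κ : Type} [Fintype κ] [DecidableEq κ] (m : QProg W α) (ψ : Vec W)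
    (Q : (κ → Bool) → α → Vec W → ℝ) :
    (avg fun r => expect m ψ (Q r)) = expect m ψ fun a φ => avg fun r => Q r a φ := by
  unfold expect avg
  induction m ψ using Multiset.induction with
  | empty => simp
  | cons b s ih => simp [Finset.sum_add_distrib, add_div, ih]

theorem expect_forFin_zero (f : Fin 0 → QProg W α) (ψ : Vec W) (Q : (Fin 0 → α) → Vec W → ℝ) :
    expect (forFin 0 f) ψ Q = Q Fin.elim0 ψ := expect_pure _ _ _

theorem expect_forFin_succ (k : ℕ) (f : Fin (k + 1) → QProg W α) (ψ : Vec W)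
    (Q : (Fin (k + 1) → α) → Vec W → ℝ) :
    expect (forFin (k + 1) f) ψ Q = expect (f 0) ψ fun a φ =>
      expect (forFin k fun i => f i.succ) φ fun r => Q (Fin.cons a r) := by
  rw [forFin, expect_bind]
  simp only [expect_bind, expect_pure]

variable [Fintype W] [DecidableEq W]

/-- The branches of a process carry the total probability of the initial state. -/
def NormPreserving (m : QProg W α) : Prop := ∀ ψ, expect m ψ (fun _ => nsq) = nsq ψ

theorem normPreserving_pure (a : α) : NormPreserving (pure a : QProg W α) :=
  fun ψ => expect_pure a ψ _

theorem NormPreserving.bind {m : QProg W α} {f : α → QProg W β} (hm : NormPreserving m)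
    (hf : ∀ a, NormPreserving (f a)) : NormPreserving (m >>= f) := fun ψ => by
  rw [expect_bind]
  simp only [hf _ _]
  exact hm ψ

theorem normPreserving_op {U : Vec W → Vec W} (hU : ∀ ψ, nsq (U ψ) = nsq ψ) :
    NormPreserving (op U) := fun ψ => by rw [expect_op, hU]

theorem sum_nsq_coins {κ : Type} [Fintype κ] [DecidableEq κ] (ψ : Vec W) (B : (κ → Bool) → ℝ) :
    ∑ r, nsq (((1 / (Real.sqrt 2 : ℂ)) ^ Fintype.card κ) • ψ) * B r = nsq ψ * avg B := by
  rw [nsq_smul, norm_one_div_sqrt_two_pow, ← Finset.mul_sum]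
  unfold avg
  ring

theorem normPreserving_coins (κ : Type) [Fintype κ] [DecidableEq κ] :
    NormPreserving (coins κ : QProg W (κ → Bool)) := fun ψ => by
  rw [expect_coins]
  simpa [avg_const] using sum_nsq_coins (κ := κ) ψ fun _ => 1

theorem NormPreserving.forFin : ∀ {k : ℕ} {f : Fin k → QProg W α},
    (∀ i, NormPreserving (f i)) → NormPreserving (forFin k f)
  | 0, _, _ => normPreserving_pure _
  | _ + 1, _, h => (h 0).bind fun _ => (NormPreserving.forFin fun i => h i.succ).bind fun _ =>
      normPreserving_pure _

/-- Coins contribute to an upper bound by the average over the coins. -/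
theorem expect_coins_le {κ : Type} [Fintype κ] [DecidableEq κ] {Q : (κ → Bool) → Vec W → ℝ}
    {F : Vec W → ℝ} (hF : ∀ (c : ℂ) φ, F (c • φ) = ‖c‖ ^ 2 * F φ) {B : (κ → Bool) → ℝ}
    (h : ∀ r φ, Q r φ ≤ F φ + nsq φ * B r) (ψ : Vec W) :
    expect (coins κ) ψ Q ≤ F ψ + nsq ψ * avg B := by
  rw [expect_coins]
  refine (Finset.sum_le_sum fun r _ => h r _).trans (le_of_eq ?_)
  rw [Finset.sum_add_distrib, sum_nsq_coins]
  congr 1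
  rw [hF, norm_one_div_sqrt_two_pow]
  simp

end QProg

open QProg

/-! ### The encrypted CNOT operation of a capable scheme -/

/-- The amplitudes of a state preparation, with the ancillas and the input as outcomes of a
measurement, have total norm one. -/
theorem StatePrep.sum_nsq_amp {ι o : Type} [Fintype ι] [DecidableEq ι] [Fintype o] [DecidableEq o]
    (P : StatePrep ι o) (x : ι → Bool) : ∑ g, nsq (P.amp x g) = 1 := by
  have h1 : nsq (runGates P.gates (ket (Sum.elim x fun _ => false))) = 1 := by
    rw [nsq_runGates, nsq_ket]
  rw [← h1]
  unfold nsq StatePrep.amp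
  rw [← Fintype.sum_prod_type']
  let e : (ι ⊕ Fin P.anc → Bool) × (o → Bool) ≃ (ι ⊕ o ⊕ Fin P.anc → Bool) :=
    { toFun := fun p => Sum.elim (fun i => p.1 (.inl i)) (Sum.elim p.2 fun i => p.1 (.inr i))
      invFun := fun v => (Sum.elim (fun i => v (.inl i)) fun i => v (.inr (.inr i)),
        fun i => v (.inr (.inl i)))
      left_inv := fun p => by
        refine Prod.ext (funext ?_) rfl
        rintro (i | i) <;> rfl
      right_inv := fun v => by
        funext i
        rcases i with i | i | i <;> rfl }
  exact Equiv.sum_comp e fun v =>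
    ‖runGates P.gates (ket (Sum.elim x fun _ => false)) v‖ ^ 2

theorem probOf_mono {X : Type} [Fintype X] {D : X → ℝ} (hD : ∀ w, 0 ≤ D w) {P Q : X → Prop}
    (h : ∀ w, P w → Q w) : probOf D P ≤ probOf D Q := by
  classical
  rw [probOf_eq, probOf_eq]
  refine Finset.sum_le_sum fun w _ => ?_
  by_cases hP : P w
  · simp [hP, h w hP]
  · rw [if_neg hP]
    split_ifs <;> simp [hD]

theorem probOf_or_le {X : Type} [Fintype X] {D : X → ℝ} (hD : ∀ w, 0 ≤ D w) (P Q : X → Prop) :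
    probOf D (fun w => P w ∨ Q w) ≤ probOf D P + probOf D Q := by
  classical
  rw [probOf_eq, probOf_eq, probOf_eq, ← Finset.sum_add_distrib]
  refine Finset.sum_le_sum fun w _ => ?_
  by_cases hP : P w <;> by_cases hQ : Q w <;> simp [hP, hQ, hD]

theorem probOf_nonneg {X : Type} [Fintype X] {D : X → ℝ} (hD : ∀ w, 0 ≤ D w) (P : X → Prop) :
    0 ≤ probOf D P := by
  classical
  rw [probOf_eq]
  exact Finset.sum_nonneg fun w _ => by split_ifs <;> simp [hD]

theorem pushDensity_nonneg {X Y : Type} [Fintype X] {D : X → ℝ} (hD : ∀ w, 0 ≤ D w) (F : X → Y)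
    (y : Y) : 0 ≤ pushDensity D F y := by
  classical
  rw [pushDensity_eq]
  exact Finset.sum_nonneg fun w _ => by split_ifs <;> simp [hD]

theorem sum_pushDensity_mul {X Y : Type} [Fintype X] [Fintype Y] (D : X → ℝ) (F : X → Y)
    (g : Y → ℝ) : ∑ y, pushDensity D F y * g y = ∑ w, D w * g (F w) := by
  classical
  simp only [pushDensity_eq, Finset.sum_mul]
  rw [Finset.sum_comm]
  refine Finset.sum_congr rfl fun w _ => ?_
  rw [Finset.sum_eq_single (F w)] <;> simp +contextual [eq_comm]

theorem sum_sqrt_sub_sqrt_sq {Y : Type} [Fintype Y] {f₁ f₂ : Y → ℝ} (h₁ : ∀ y, 0 ≤ f₁ y)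
    (h₂ : ∀ y, 0 ≤ f₂ y) (s₁ : ∑ y, f₁ y = 1) (s₂ : ∑ y, f₂ y = 1) :
    ∑ y, (Real.sqrt (f₂ y) - Real.sqrt (f₁ y)) ^ 2 = 2 * hellinger f₁ f₂ := by
  have h : ∀ y, (Real.sqrt (f₂ y) - Real.sqrt (f₁ y)) ^ 2 =
      f₂ y + f₁ y - 2 * Real.sqrt (f₁ y * f₂ y) := by
    intro y
    rw [Real.sqrt_mul (h₁ y), sub_sq, Real.sq_sqrt (h₁ y), Real.sq_sqrt (h₂ y)]
    ring
  simp only [h, Finset.sum_sub_distrib, Finset.sum_add_distrib, s₁, s₂, ← Finset.mul_sum, hellinger]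
  ring

/-- The probability of an event under two densities differs little if their Hellinger distance is
small. -/
theorem probOf_comp_le {X Y : Type} [Fintype X] [Fintype Y] {D : X → ℝ} (hD0 : ∀ w, 0 ≤ D w)
    (hD1 : ∑ w, D w = 1) (F₁ F₂ : X → Y) (P : Y → Prop) :
    probOf D (fun w => P (F₂ w)) ≤ 2 * probOf D (fun w => P (F₁ w)) +
      4 * hellinger (pushDensity D F₁) (pushDensity D F₂) := by
  classical
  have hs : ∀ F : X → Y, ∑ y, pushDensity D F y = 1 := fun F => by
    simpa [hD1] using sum_pushDensity_mul D F fun _ => 1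
  have hp : ∀ F : X → Y, probOf D (fun w => P (F w)) =
      ∑ y, pushDensity D F y * if P y then 1 else 0 := fun F => by
    rw [sum_pushDensity_mul, probOf_eq]
    simp
  have h4 : (4 : ℝ) * hellinger (pushDensity D F₁) (pushDensity D F₂) =
      2 * ∑ y, (Real.sqrt (pushDensity D F₂ y) - Real.sqrt (pushDensity D F₁ y)) ^ 2 := by
    rw [sum_sqrt_sub_sqrt_sq (pushDensity_nonneg hD0 _) (pushDensity_nonneg hD0 _) (hs _) (hs _)]
    ring
  rw [hp, hp, h4, Finset.mul_sum, Finset.mul_sum, ← Finset.sum_add_distrib]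
  refine Finset.sum_le_sum fun y _ => ?_
  have h1 := Real.sq_sqrt (pushDensity_nonneg hD0 F₁ y)
  have h2 := Real.sq_sqrt (pushDensity_nonneg hD0 F₂ y)
  split_ifs
  · nlinarith [sq_nonneg (Real.sqrt (pushDensity D F₂ y) - 2 * Real.sqrt (pushDensity D F₁ y))]
  · nlinarith [sq_nonneg (Real.sqrt (pushDensity D F₂ y) - Real.sqrt (pushDensity D F₁ y))]

section Encrypted

variable {HE : LeveledHE} {Lc : ℕ → ℕ} (A : AltScheme HE Lc) {W : Type} [Fintype W] [DecidableEq W]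

/-- The image of a sample, for the value `b` of the control qubit. -/
def shiftedEnc (n : ℕ) (pk : Bits (HE.pkLen n (Lc n))) (cHat : Bits (A.ctLen n)) (b : Bool)
    (w : Option (Fin (A.rndLen n)) → Bool) : Bits (A.ctLen n) :=
  if b then A.xor n pk (A.enc n pk w) cHat else A.enc n pk w

/-- The branches of an encrypted CNOT operation are given by the Kraus operators `cnotKraus`. -/
theorem expect_encryptedCNOT (n : ℕ) (pk : Bits (HE.pkLen n (Lc n))) (cHat : Bits (A.ctLen n))
    {i j : W} (hij : i ≠ j) (ψ : Vec W) (Q) :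
    expect (encryptedCNOT A n pk cHat i j) ψ Q =
      ∑ o, Q o.2 (cnotKraus ((A.prep n).amp pk) (shiftedEnc A n pk cHat) (fun w => w none)
        i j o ψ) := by
  unfold encryptedCNOT
  rw [expect_bind, expect_kraus]
  refine Finset.sum_congr rfl fun o _ => ?_
  rw [expect_pure]
  congr 1
  funext v
  unfold cnotKraus
  refine Finset.sum_congr rfl fun w _ => ?_
  beta_reduce
  rw [Fintype.card_option, Fintype.card_fin, Function.update_of_ne hij]
  rfl

theorem normPreserving_encryptedCNOT (n : ℕ) (pk : Bits (HE.pkLen n (Lc n)))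
    (cHat : Bits (A.ctLen n)) {i j : W} (hij : i ≠ j) :
    NormPreserving (encryptedCNOT A n pk cHat i j) := fun ψ => by
  rw [expect_encryptedCNOT A n pk cHat hij]
  exact sum_nsq_cnotKraus _ _ _ i j ((A.prep n).sum_nsq_amp pk) ψ

variable {A} {n s : ℕ} {ε : ℝ} {κ : Bits (HE.keyCoins n (Lc n))}

/-- The inverse of `shiftedEnc`. -/
def unshiftedRecover (A : AltScheme HE Lc) (κ : Bits (HE.keyCoins n (Lc n)))
    (cHat : Bits (A.ctLen n)) (b : Bool) (y : Bits (A.ctLen n)) :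
    Option (Fin (A.rndLen n)) → Bool :=
  A.recover n (HE.sk κ) (A.trapdoor n κ) (if b then A.xorInv n (HE.pk κ) y cHat else y)

/-- Almost all samples are recovered correctly from their images. For images shifted by `cHat` this
uses that these are distributed almost like fresh ciphertexts of AltHE. -/
theorem AltScheme.Capable.sum_probOf_le (hcap : A.Capable n s ε κ)
    (hD0 : ∀ w, 0 ≤ A.D n (HE.pk κ) w) (hD1 : ∑ w, A.D n (HE.pk κ) w = 1)
    {c : Bits (HE.ctLen n (Lc n))} (hc : HE.Occurs s κ c) :
    ∑ b, probOf (A.D n (HE.pk κ)) (fun w =>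
      ¬ GoodSample (shiftedEnc A n (HE.pk κ) (A.convert n (HE.pk κ) c))
        (unshiftedRecover A κ (A.convert n (HE.pk κ) c)) (fun w => w none)
        (HE.dec n (Lc n) (HE.sk κ) c) b w) ≤ 12 * ε := by
  obtain ⟨-, hrec, hdec, hcc⟩ := hcap
  obtain ⟨hconv, hxor, hinv, hhel⟩ := hcc c hc
  set cHat := A.convert n (HE.pk κ) c
  set D := A.D n (HE.pk κ)
  -- For the control zero, `hF` is the recovery of the randomness.
  have hF : probOf D (fun w => ¬ GoodSample (shiftedEnc A n (HE.pk κ) cHat)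
      (unshiftedRecover A κ cHat) (fun w => w none) (HE.dec n (Lc n) (HE.sk κ) c) false w) ≤ ε := by
    refine (probOf_mono hD0 fun w hw => ?_).trans hrec
    contrapose! hw
    refine ⟨hw, ?_⟩
    simp [unshiftedRecover, shiftedEnc, hw]
  -- The recovered message bit of the shifted ciphertext has to be related to its decryption. The
  -- event that they differ depends on the ciphertext alone, so that its probability can be bounded
  -- for fresh ciphertexts instead.
  let bad (y : Bits (A.ctLen n)) : Prop :=
    A.dec n (HE.sk κ) y ≠ A.recover n (HE.sk κ) (A.trapdoor n κ) y none
  have hbad : probOf D (fun w => bad (A.xor n (HE.pk κ) (A.enc n (HE.pk κ) w) cHat)) ≤ 8 * ε := by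
    have h1 := probOf_comp_le hD0 hD1 (fun w => A.enc n (HE.pk κ) w)
      (fun w => A.xor n (HE.pk κ) (A.enc n (HE.pk κ) w) cHat) bad
    have h2 : probOf D (fun w => bad (A.enc n (HE.pk κ) w)) ≤ ε + ε := by
      refine ((probOf_mono hD0 fun w hw => ?_).trans (probOf_or_le hD0 _ _)).trans
        (add_le_add hrec hdec)
      by_contra! h
      exact hw (by rw [h.1, h.2])
    linarith
  have hT : probOf D (fun w => ¬ GoodSample (shiftedEnc A n (HE.pk κ) cHat)
      (unshiftedRecover A κ cHat) (fun w => w none) (HE.dec n (Lc n) (HE.sk κ) c) true w) ≤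
      11 * ε := by
    have h1 := probOf_or_le hD0 (fun w => A.xorInv n (HE.pk κ)
        (A.xor n (HE.pk κ) (A.enc n (HE.pk κ) w) cHat) cHat ≠ A.enc n (HE.pk κ) w)
      (fun w => A.recover n (HE.sk κ) (A.trapdoor n κ) (A.enc n (HE.pk κ) w) ≠ w)
    have h2 := probOf_or_le hD0 (fun w => A.dec n (HE.sk κ)
        (A.xor n (HE.pk κ) (A.enc n (HE.pk κ) w) cHat) ≠ Bool.xor (w none) (A.dec n (HE.sk κ) cHat))
      (fun w => bad (A.xor n (HE.pk κ) (A.enc n (HE.pk κ) w) cHat))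
    have h3 := (probOf_or_le hD0 _ _).trans (add_le_add h1 h2)
    refine le_trans ((probOf_mono hD0 fun w hw => ?_).trans h3) (by linarith)
    by_contra! h
    obtain ⟨⟨h4, h5⟩, h6, h7⟩ := h
    refine hw ⟨?_, ?_⟩
    · simp [unshiftedRecover, shiftedEnc, h4, h5]
    · have h8 := not_not.1 h7
      rw [h6, hconv] at h8
      simp [unshiftedRecover, shiftedEnc, ← h8]
  rw [Fintype.sum_bool]
  linarith

/-- An encrypted CNOT operation removes the gate `CNOT^s`, where `s` is the encrypted bit, and leaves
the Pauli operator described by `leftover`. -/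
theorem AltScheme.Capable.expect_encryptedCNOT_le (hcap : A.Capable n s ε κ)
    (hD0 : ∀ w, 0 ≤ A.D n (HE.pk κ) w) (hD1 : ∑ w, A.D n (HE.pk κ) w = 1)
    {c : Bits (HE.ctLen n (Lc n))} (hc : HE.Occurs s κ c) {i j : W} (hij : i ≠ j) {T : ℝ}
    (hT : 0 < T) {χ : Vec W} (hχ : nsq χ = 1) (φ : Vec W) :
    expect (encryptedCNOT A n (HE.pk κ) (A.convert n (HE.pk κ) c) i j) φ (fun o =>
      infid (zOp i (leftover A (HE.sk κ) (A.trapdoor n κ) (HE.pk κ)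
          (Sum.elim (A.convert n (HE.pk κ) c) (Sum.elim o.1 o.2))).1
        (xOp j (leftover A (HE.sk κ) (A.trapdoor n κ) (HE.pk κ)
          (Sum.elim (A.convert n (HE.pk κ) c) (Sum.elim o.1 o.2))).2 χ))) ≤
      (1 + 1 / T) * infid (cxOp i j (HE.dec n (Lc n) (HE.sk κ) c) χ) φ +
        (1 + T) * (126 * ε) * nsq φ := by
  have hε₁ := hcap.sum_probOf_le hD0 hD1 hc
  obtain ⟨hprep, hrec, -, hcc⟩ := hcap
  obtain ⟨-, -, -, hhel⟩ := hcc c hc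
  set cHat := A.convert n (HE.pk κ) c
  set D := A.D n (HE.pk κ)
  set b := HE.dec n (Lc n) (HE.sk κ) c
  set amp := (A.prep n).amp (HE.pk κ)
  have hχD : nsq (fun w => (Real.sqrt (D w) : ℂ)) = 1 := by
    rw [← hD1]
    refine Finset.sum_congr rfl fun w _ => ?_
    rw [Complex.norm_real, Real.norm_eq_abs, sq_abs, Real.sq_sqrt (hD0 w)]
  have hamp : ∑ g, nsq (amp g) = 1 := (A.prep n).sum_nsq_amp (HE.pk κ)
  have hinf : ∑ g, infid (fun w => (Real.sqrt (D w) : ℂ)) (amp g) =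
      1 - ∑ g, ‖ip (fun w => (Real.sqrt (D w) : ℂ)) (amp g)‖ ^ 2 := by
    rw [← hamp, ← Finset.sum_sub_distrib]
    rfl
  have ha : ∑ g, ‖ip (fun w => (Real.sqrt (D w) : ℂ)) (amp g)‖ ^ 2 ≤ 1 := by
    have := Finset.sum_nonneg fun g (_ : g ∈ Finset.univ) => infid_nonneg hχD (amp g)
    linarith
  -- The prepared mixed state is close to a pure one, so that its branches are close to multiples of
  -- this pure state.
  have hε₀ : ∑ g, nsq (amp g - ip (fun w => (Real.sqrt (D w) : ℂ)) (amp g) •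
      fun w => (Real.sqrt (D w) : ℂ)) ≤ 2 * ε := by
    simp only [← infid_eq hχD]
    rw [hinf]
    have h1 := one_sub_le_traceDist hχD (Finset.univ.val.map amp)
    rw [Multiset.map_map, Multiset.map_map] at h1
    have h2 : traceDist (Multiset.map (outer ∘ amp) Finset.univ.val).sum
        (outer fun w => (Real.sqrt (D w) : ℂ)) ≤ ε := hprep
    refine le_trans (le_of_eq ?_) (h1.trans (by linarith))
    rfl
  have hsF : ∀ F : (Option (Fin (A.rndLen n)) → Bool) → Bits (A.ctLen n),
      ∑ y, pushDensity D F y = 1 := fun F => by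
    simpa [hD1] using sum_pushDensity_mul D F fun _ => 1
  have hε₂ : ∑ y, (Real.sqrt (pushDensity D (shiftedEnc A n (HE.pk κ) cHat true) y) -
      Real.sqrt (pushDensity D (shiftedEnc A n (HE.pk κ) cHat false) y)) ^ 2 ≤ 2 * ε := by
    rw [sum_sqrt_sub_sqrt_sq (pushDensity_nonneg hD0 _) (pushDensity_nonneg hD0 _) (hsF _) (hsF _)]
    exact mul_le_mul_of_nonneg_left hhel (by norm_num)
  have hK := sum_nsq_cnotKraus_sub_le hD0 ha hε₀ hε₁ hε₂ hij φ
  have hc1 := sum_norm_idealCoeff_le (f := shiftedEnc A n (HE.pk κ) cHat)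
    (u := unshiftedRecover A κ cHat) hD0 hD1 ha
  set u := unshiftedRecover A κ cHat
  -- Up to a coefficient, each branch is close to the unitary operation `U o`, which maps the target
  -- state `CNOT^s χ` to `χ` with the leftover Pauli operator.
  let U (o : (Fin (HE.pkLen n (Lc n)) ⊕ Fin (A.prep n).anc → Bool) × Bits (A.ctLen n) ×
      (Option (Fin (A.rndLen n)) → Bool)) (φ : Vec W) : Vec W :=
    idealKraus u (fun w => w none) b i j o φ
  have hU : ∀ o, IsLinearMap ℂ (U o) := fun o =>
    ⟨fun x y => by
      change zOp _ _ (xOp _ _ (cxOp _ _ _ (x + y))) = _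
      rw [(cxOp_isLinearMap i j b).map_add, (xOp_isLinearMap j _).map_add,
        (zOp_isLinearMap i _).map_add]
      rfl, fun a x => by
      change zOp _ _ (xOp _ _ (cxOp _ _ _ (a • x))) = _
      rw [(cxOp_isLinearMap i j b).map_smul, (xOp_isLinearMap j _).map_smul,
        (zOp_isLinearMap i _).map_smul]
      rfl⟩
  have hUn : ∀ o φ, nsq (U o φ) = nsq φ := fun o φ => by
    change nsq (zOp _ _ (xOp _ _ (cxOp _ _ _ φ))) = _
    rw [nsq_zOp, nsq_xOp, nsq_cxOp hij]
  have hcx : ∀ φ : Vec W, cxOp i j b (cxOp i j b φ) = φ := by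
    intro φ
    funext v
    simp only [cxOp, Function.update_self, Function.update_of_ne hij, Bool.xor_assoc,
      Bool.xor_self, Bool.xor_false, Function.update_idem, Function.update_eq_self]
  have hχ' : nsq (cxOp i j b χ) = 1 := by rw [nsq_cxOp hij, hχ]
  rw [expect_encryptedCNOT A n _ _ hij]
  calc _ ≤ ∑ o, ((1 + T) * nsq (cnotKraus amp (shiftedEnc A n (HE.pk κ) cHat) (fun w => w none)
          i j o φ - idealCoeff amp D (shiftedEnc A n (HE.pk κ) cHat) u o • U o φ) +
        (1 + 1 / T) * (‖idealCoeff amp D (shiftedEnc A n (HE.pk κ) cHat) u o‖ ^ 2 *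
          infid (cxOp i j b χ) φ)) := by
        refine Finset.sum_le_sum fun o _ => ?_
        refine le_trans (le_of_eq ?_) (infid_approx_le (hU o) (hUn o) hχ' hT φ _ _)
        change _ = infid (zOp _ _ (xOp _ _ (cxOp i j b (cxOp i j b χ)))) _
        rw [hcx]
        rfl
    _ = (1 + T) * ∑ o, nsq (cnotKraus amp (shiftedEnc A n (HE.pk κ) cHat) (fun w => w none)
          i j o φ - idealCoeff amp D (shiftedEnc A n (HE.pk κ) cHat) u o • U o φ) +
        (1 + 1 / T) * ((∑ o, ‖idealCoeff amp D (shiftedEnc A n (HE.pk κ) cHat) u o‖ ^ 2) *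
          infid (cxOp i j b χ) φ) := by
        rw [Finset.sum_add_distrib, ← Finset.mul_sum, ← Finset.mul_sum, ← Finset.sum_mul]
    _ ≤ (1 + T) * (3 * (2 * ε + 3 * (12 * ε) + 2 * (2 * ε)) * nsq φ) +
        (1 + 1 / T) * (1 * infid (cxOp i j b χ) φ) := by
        have := infid_nonneg hχ' φ
        gcongr
    _ = _ := by ring

end Encrypted

/-! ### Moving Pauli operators past gates -/

section Sign

variable {R : Type} [Fintype R] [DecidableEq R]

theorem sgn_eq_mul (z v : R → Bool) (i : R) :
    sgn z v = (if z i && v i then -1 else 1) * sgn (Function.update z i false) v := by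
  rw [sgn_eq_prod, sgn_eq_prod, ← Finset.mul_prod_erase _ _ (Finset.mem_univ i),
    ← Finset.mul_prod_erase Finset.univ (fun k => if Function.update z i false k && v k then
      (-1 : ℂ) else 1) (Finset.mem_univ i)]
  simp only [Function.update_self, Bool.false_and, Bool.false_eq_true, if_false, one_mul]
  congr 1
  refine Finset.prod_congr rfl fun k hk => ?_
  rw [Function.update_of_ne (Finset.ne_of_mem_erase hk)]

theorem sgn_update_left (z v : R → Bool) (i : R) (b : Bool) :
    sgn (Function.update z i b) v =
      (if b && v i then -1 else 1) * sgn (Function.update z i false) v := by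
  rw [sgn_eq_mul _ v i]
  simp

theorem sgn_update_right (z v : R → Bool) (i : R) (b : Bool) :
    sgn z (Function.update v i b) =
      (if z i && b then -1 else 1) * sgn (Function.update z i false) v := by
  rw [sgn_eq_mul _ _ i]
  simp only [Function.update_self]
  congr 1
  rw [sgn_eq_prod, sgn_eq_prod]
  refine Finset.prod_congr rfl fun k _ => ?_
  by_cases hk : k = i
  · subst hk
    simp
  · simp [Function.update_of_ne hk]

theorem sgn_xor_left (z v : R → Bool) (i : R) (b : Bool) :
    sgn (Function.update z i (xor (z i) b)) v = (if b && v i then -1 else 1) * sgn z v := by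
  rw [sgn_update_left, sgn_eq_mul z v i]
  cases z i <;> cases b <;> cases v i <;> simp

theorem sgn_xor_right (z v : R → Bool) (i : R) (b : Bool) :
    sgn z (Function.update v i (xor (v i) b)) = (if z i && b then -1 else 1) * sgn z v := by
  rw [sgn_update_right, sgn_eq_mul z v i]
  cases z i <;> cases b <;> cases v i <;> simp

end Sign

section Keys

variable {W : Type} [DecidableEq W] (k : KeyIdx W → Bool)

theorem addKey_apply (i j : KeyIdx W) (b : Bool) :
    addKey k i b j = xor (k j) (decide (j = i) && b) := by
  unfold addKey
  by_cases h : j = i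
  · subst h
    simp
  · simp [h]

theorem addKey_comp_inl (i : W) (b : Bool) : (fun j => addKey k (.inl i) b (.inl j)) =
    Function.update (fun j => k (.inl j)) i (xor (k (.inl i)) b) := by
  funext j
  by_cases h : j = i
  · subst h
    simp [addKey]
  · simp [addKey, h]

theorem addKey_comp_inr (i : W) (b : Bool) : (fun j => addKey k (.inr i) b (.inr j)) =
    Function.update (fun j => k (.inr j)) i (xor (k (.inr i)) b) := by
  funext j
  by_cases h : j = i
  · subst h
    simp [addKey]
  · simp [addKey, h]

theorem bxor_update (v x : W → Bool) (i : W) (b : Bool) :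
    bxor v (Function.update x i (xor (x i) b)) = bxor (Function.update v i (xor (v i) b)) x := by
  funext j
  unfold bxor
  by_cases h : j = i
  · subst h
    simp [Bool.xor_comm, Bool.xor_left_comm]
  · simp [h]

variable [Fintype W]

theorem pauli_isLinearMap : IsLinearMap ℂ (pauli k) :=
  ⟨fun _ _ => funext fun _ => mul_add _ _ _, fun _ _ => funext fun _ => mul_left_comm _ _ _⟩

theorem bxor_involutive {ι : Type} (x : ι → Bool) : Function.Involutive fun v => bxor v x := by
  intro v
  funext i
  simp [bxor]

theorem bxor_bxor {ι : Type} (v x : ι → Bool) : bxor (bxor v x) x = v := bxor_involutive x v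

theorem nsq_pauli (ψ : Vec W) : nsq (pauli k ψ) = nsq ψ := by
  rw [← nsq_reindex (bxor_involutive fun i => k (.inr i)) ψ]
  refine Finset.sum_congr rfl fun v _ => ?_
  rw [pauli, norm_mul, norm_sgn, one_mul]

theorem sgn_mul_self {R : Type} [Fintype R] (d u : R → Bool) : sgn d u * sgn d u = 1 := by
  rw [← sgn_bxor, sgn_eq_prod]
  simp [bxor]

theorem pauliInv_pauli (ψ : Vec W) : pauliInv k (pauli k ψ) = ψ := by
  funext v
  change sgn _ _ * (sgn _ _ * ψ (bxor (bxor v _) _)) = ψ v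
  rw [← mul_assoc, sgn_mul_self, one_mul, bxor_bxor]

theorem pauli_pauliInv (ψ : Vec W) : pauli k (pauliInv k ψ) = ψ := by
  funext v
  change sgn _ _ * (sgn _ (bxor (bxor v _) _) * ψ (bxor (bxor v _) _)) = ψ v
  rw [bxor_bxor, ← mul_assoc, sgn_mul_self, one_mul]

theorem pauli_addKey_inl (i : W) (b : Bool) (ψ : Vec W) :
    pauli (addKey k (.inl i) b) ψ = zOp i b (pauli k ψ) := by
  funext v
  simp only [pauli, zOp, addKey_comp_inl]
  rw [sgn_xor_left (fun j => k (.inl j)) v i b, mul_assoc]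
  rfl

theorem pauli_addKey_inr (i : W) (b : Bool) (ψ : Vec W) : pauli (addKey k (.inr i) b) ψ =
    (if k (.inl i) && b then (-1 : ℂ) else 1) • xOp i b (pauli k ψ) := by
  funext v
  simp only [pauli, xOp, addKey_comp_inr, Pi.smul_apply, smul_eq_mul]
  rw [sgn_xor_right, bxor_update v (fun j => k (.inr j)) i b, ← mul_assoc, ← mul_assoc]
  congr 1
  have h : (fun j => addKey k (.inr i) b (.inl j)) = fun j => k (.inl j) := by
    funext j
    simp [addKey]
  rw [h]
  split_ifs <;> simp

/-- A Pauli operator is moved past a Clifford gate, up to a phase. -/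
theorem CliffordGate.exists_apply_pauli (g : CliffordGate W) :
    ∃ c : ℂ, ‖c‖ = 1 ∧ ∀ ψ, g.apply (pauli k ψ) = c • pauli (g.updateKey k) (g.apply ψ) := by
  cases g with
  | h i =>
    refine ⟨if k (.inr i) && k (.inl i) then -1 else 1, by split_ifs <;> simp, fun ψ => ?_⟩
    funext v
    have hz : (fun j => updateKey k (.h i) (.inl j)) =
        Function.update (fun j => k (.inl j)) i (k (.inr i)) := by
      funext j
      by_cases h : j = i
      · subst h
        simp [updateKey]
      · simp [updateKey, h]
    have hx : (fun j => updateKey k (.h i) (.inr j)) =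
        Function.update (fun j => k (.inr j)) i (k (.inl i)) := by
      funext j
      by_cases h : j = i
      · subst h
        simp [updateKey]
      · simp [updateKey, h]
    have h1 : ∀ b, bxor (Function.update v i b) (fun j => k (.inr j)) =
        Function.update (bxor v fun j => k (.inr j)) i (xor b (k (.inr i))) := by
      intro b
      funext j
      by_cases h : j = i
      · subst h
        simp [bxor]
      · simp [bxor, h]
    have h2 : ∀ b, Function.update
        (bxor v (Function.update (fun j => k (.inr j)) i (k (.inl i)))) i b =
        Function.update (bxor v fun j => k (.inr j)) i b := by
      intro b
      funext j
      by_cases h : j = i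
      · subst h
        simp
      · simp [bxor, h]
    simp only [CliffordGate.apply, pauli, hz, hx, Pi.smul_apply, smul_eq_mul, h1, h2,
      sgn_update_left _ v i (k (.inr i)), sgn_update_right]
    simp only [bxor, Function.update_self]
    cases k (.inr i) <;> cases k (.inl i) <;> cases v i <;> simp <;> ring
  | k i =>
    refine ⟨if k (.inr i) then -Complex.I else 1, by split_ifs <;> simp, fun ψ => ?_⟩
    funext v
    have hx : (fun j => updateKey k (.k i) (.inr j)) = fun j => k (.inr j) := by
      funext j
      simp [updateKey, addKey]
    have hz : (fun j => updateKey k (.k i) (.inl j)) =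
        Function.update (fun j => k (.inl j)) i (xor (k (.inl i)) (k (.inr i))) :=
      addKey_comp_inl k i _
    simp only [CliffordGate.apply, pauli, hz, hx, Pi.smul_apply, smul_eq_mul]
    rw [sgn_xor_left (fun j => k (.inl j)) v i]
    simp only [bxor]
    -- The phase of `K` on a flipped bit differs by a factor `-i` and a sign, and the sign is a `Z`
    -- operator.
    have h : ∀ (x y : Bool) (a b : ℂ), (if y then Complex.I else 1) * (a * b) =
        (if x then -Complex.I else 1) * ((if x && y then -1 else 1) * a *
          ((if xor y x then Complex.I else 1) * b)) := by
      intro x y a b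
      cases x <;> cases y <;> simp <;> ring_nf <;> simp
    exact h _ _ _ _
  | cnot c t hne =>
    refine ⟨1, by simp, fun ψ => ?_⟩
    funext v
    have hz : (fun j => updateKey k (.cnot c t hne) (.inl j)) =
        Function.update (fun j => k (.inl j)) c (xor (k (.inl c)) (k (.inl t))) := by
      funext j
      by_cases h : j = c
      · subst h
        simp [updateKey, addKey]
      · simp [updateKey, addKey, h]
    have hx : (fun j => updateKey k (.cnot c t hne) (.inr j)) =
        Function.update (fun j => k (.inr j)) t (xor (k (.inr t)) (k (.inr c))) := by
      funext j
      by_cases h : j = t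
      · subst h
        simp [updateKey, addKey]
      · simp [updateKey, addKey, h]
    simp only [CliffordGate.apply, pauli, hz, hx, one_smul]
    rw [sgn_xor_left (fun j => k (.inl j)) v c, sgn_xor_right]
    congr 2
    funext j
    by_cases h : j = t
    · subst h
      simp only [bxor, Function.update_self, Function.update_of_ne hne]
      cases v j <;> cases v c <;> cases k (.inr j) <;> cases k (.inr c) <;> rfl
    · simp [bxor, h]

end Keys

/-! ### The correction of a Toffoli gate -/

section Correction

variable {W : Type} [DecidableEq W]

/-- The gate number `j` of the correction of a Toffoli gate, to the power `s`. -/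
def ToffoliGate.corrGate (t : ToffoliGate W) (j : Fin 3) (s : Bool) : Vec W → Vec W :=
  ![cxOp t.a t.c s, cxOp t.b t.c s, czOp t.a t.b s] j

/-- The Pauli operator left by the removal of the gate number `j` of the correction. -/
def ToffoliGate.residue (t : ToffoliGate W) (j : Fin 3) (e : Bool × Bool) (ψ : Vec W) : Vec W :=
  zOp (![t.a, t.b, t.a] j) e.1 (![xOp t.c e.2, xOp t.c e.2, zOp t.b e.2] j ψ)

/-- The correction of a Toffoli gate. -/
def ToffoliGate.corr (t : ToffoliGate W) (s : Fin 3 → Bool) (ψ : Vec W) : Vec W :=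
  t.corrGate 0 (s 0) (t.corrGate 1 (s 1) (t.corrGate 2 (s 2) ψ))

/-- The Pauli operator left by the removal of the correction. -/
def ToffoliGate.residues (t : ToffoliGate W) (e : Fin 3 → Bool × Bool) (ψ : Vec W) : Vec W :=
  t.residue 2 (e 2) (t.residue 1 (e 1) (t.residue 0 (e 0) ψ))

theorem zOp_czOp_comm (i a b : W) (c s : Bool) (ψ : Vec W) :
    zOp i c (czOp a b s ψ) = czOp a b s (zOp i c ψ) :=
  funext fun _ => mul_left_comm _ _ _

theorem zOp_cxOp_comm {i t : W} (h : i ≠ t) (a : W) (c s : Bool) (ψ : Vec W) :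
    zOp i c (cxOp a t s ψ) = cxOp a t s (zOp i c ψ) := by
  funext v
  simp [zOp, cxOp, Function.update_of_ne h]

theorem xOp_czOp_comm {i a b : W} (ha : i ≠ a) (hb : i ≠ b) (c s : Bool) (ψ : Vec W) :
    xOp i c (czOp a b s ψ) = czOp a b s (xOp i c ψ) := by
  funext v
  simp [xOp, czOp, Function.update_of_ne ha.symm, Function.update_of_ne hb.symm]

theorem xOp_cxOp_comm {i a : W} (h : i ≠ a) (t : W) (c s : Bool) (ψ : Vec W) :
    xOp i c (cxOp a t s ψ) = cxOp a t s (xOp i c ψ) := by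
  funext v
  simp only [xOp, cxOp, Function.update_of_ne h.symm]
  congr 1
  by_cases hit : t = i
  · subst hit
    simp only [Function.update_self, Function.update_idem, Bool.xor_assoc, Bool.xor_comm]
  · rw [Function.update_of_ne hit, Function.update_of_ne (Ne.symm hit), Function.update_comm hit]

theorem corrGate_isLinearMap (t : ToffoliGate W) (j : Fin 3) (s : Bool) :
    IsLinearMap ℂ (t.corrGate j s) := by
  fin_cases j
  · exact cxOp_isLinearMap _ _ _
  · exact cxOp_isLinearMap _ _ _
  · exact ⟨fun _ _ => funext fun _ => mul_add _ _ _, fun _ _ => funext fun _ => mul_left_comm _ _ _⟩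

theorem corr_smul (t : ToffoliGate W) (s : Fin 3 → Bool) (c : ℂ) (ψ : Vec W) :
    t.corr s (c • ψ) = c • t.corr s ψ := by
  unfold ToffoliGate.corr
  rw [(corrGate_isLinearMap t _ _).map_smul, (corrGate_isLinearMap t _ _).map_smul,
    (corrGate_isLinearMap t _ _).map_smul]

theorem nsq_corrGate [Fintype W] (t : ToffoliGate W) (j : Fin 3) (s : Bool) (ψ : Vec W) :
    nsq (t.corrGate j s ψ) = nsq ψ := by
  fin_cases j
  · exact nsq_cxOp t.hac _ _
  · exact nsq_cxOp t.hbc _ _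
  · exact nsq_czOp _ _ _ _

theorem nsq_residue [Fintype W] (t : ToffoliGate W) (j : Fin 3) (e : Bool × Bool) (ψ : Vec W) :
    nsq (t.residue j e ψ) = nsq ψ := by
  unfold ToffoliGate.residue
  rw [nsq_zOp]
  fin_cases j
  · exact nsq_xOp _ _ _
  · exact nsq_xOp _ _ _
  · exact nsq_zOp _ _ _

/-- The Pauli operators left by the removal of one gate of the correction commute with the gates
that are removed later: none of these has its target where a `Z` operator acts, or its control where
an `X` operator acts. -/
theorem residue_zero_corrGate (t : ToffoliGate W) (e : Bool × Bool) (s s' : Bool) (ψ : Vec W) :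
    t.residue 0 e (t.corrGate 1 s (t.corrGate 2 s' ψ)) =
      t.corrGate 1 s (t.corrGate 2 s' (t.residue 0 e ψ)) := by
  change zOp t.a e.1 (xOp t.c e.2 (cxOp t.b t.c s (czOp t.a t.b s' ψ))) =
    cxOp t.b t.c s (czOp t.a t.b s' (zOp t.a e.1 (xOp t.c e.2 ψ)))
  rw [xOp_cxOp_comm t.hbc.symm, zOp_cxOp_comm t.hac, xOp_czOp_comm t.hac.symm t.hbc.symm,
    zOp_czOp_comm]

theorem residue_one_corrGate (t : ToffoliGate W) (e : Bool × Bool) (s : Bool) (ψ : Vec W) :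
    t.residue 1 e (t.corrGate 2 s ψ) = t.corrGate 2 s (t.residue 1 e ψ) := by
  change zOp t.b e.1 (xOp t.c e.2 (czOp t.a t.b s ψ)) =
    czOp t.a t.b s (zOp t.b e.1 (xOp t.c e.2 ψ))
  rw [xOp_czOp_comm t.hac.symm t.hbc.symm, zOp_czOp_comm]

/-- The Toffoli gates `t` and `t'` act on different qubits. -/
abbrev ToffoliGate.Separate (t t' : ToffoliGate W) : Prop :=
  Disjoint ({t.a, t.b, t.c} : Set W) ({t'.a, t'.b, t'.c} : Set W)

theorem ToffoliGate.Separate.ne {t t' : ToffoliGate W} (h : t.Separate t') {i j : W}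
    (hi : i = t.a ∨ i = t.b ∨ i = t.c) (hj : j = t'.a ∨ j = t'.b ∨ j = t'.c) : i ≠ j := by
  rintro rfl
  exact Set.disjoint_left.1 h (by simpa using hi) (by simpa using hj)

theorem zOp_corr_comm {t : ToffoliGate W} {i : W} (hi : i ≠ t.c) (b : Bool) (s : Fin 3 → Bool)
    (ψ : Vec W) : zOp i b (t.corr s ψ) = t.corr s (zOp i b ψ) := by
  change zOp i b (cxOp _ _ _ (cxOp _ _ _ (czOp _ _ _ ψ))) =
    cxOp _ _ _ (cxOp _ _ _ (czOp _ _ _ (zOp i b ψ)))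
  rw [zOp_cxOp_comm hi, zOp_cxOp_comm hi, zOp_czOp_comm]

theorem xOp_corr_comm {t : ToffoliGate W} {i : W} (ha : i ≠ t.a) (hb : i ≠ t.b) (b : Bool)
    (s : Fin 3 → Bool) (ψ : Vec W) : xOp i b (t.corr s ψ) = t.corr s (xOp i b ψ) := by
  change xOp i b (cxOp _ _ _ (cxOp _ _ _ (czOp _ _ _ ψ))) =
    cxOp _ _ _ (cxOp _ _ _ (czOp _ _ _ (xOp i b ψ)))
  rw [xOp_cxOp_comm ha, xOp_cxOp_comm hb, xOp_czOp_comm ha hb]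

theorem residues_corr_comm {t t' : ToffoliGate W} (h : t.Separate t') (e : Fin 3 → Bool × Bool)
    (s : Fin 3 → Bool) (ψ : Vec W) : t.residues e (t'.corr s ψ) = t'.corr s (t.residues e ψ) := by
  have hac : t.a ≠ t'.c := h.ne (by simp) (by simp)
  have hbc : t.b ≠ t'.c := h.ne (by simp) (by simp)
  have hca : t.c ≠ t'.a := h.ne (by simp) (by simp)
  have hcb : t.c ≠ t'.b := h.ne (by simp) (by simp)
  change zOp t.a _ (zOp t.b _ (zOp t.b _ (xOp t.c _ (zOp t.a _ (xOp t.c _ (t'.corr s ψ)))))) = _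
  rw [xOp_corr_comm hca hcb, zOp_corr_comm hac, xOp_corr_comm hca hcb, zOp_corr_comm hbc,
    zOp_corr_comm hbc, zOp_corr_comm hac]
  rfl

theorem tof_corr_comm {t t' : ToffoliGate W} (h : t.Separate t') (s : Fin 3 → Bool) (ψ : Vec W) :
    t'.apply (t.corr s ψ) = t.corr s (t'.apply ψ) := by
  have hn : ∀ {i j : W}, (i = t.a ∨ i = t.b ∨ i = t.c) → (j = t'.a ∨ j = t'.b ∨ j = t'.c) → i ≠ j :=
    fun hi hj => h.ne hi hj
  have haa : t.a ≠ t'.a := hn (by simp) (by simp)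
  have hab : t.a ≠ t'.b := hn (by simp) (by simp)
  have hac : t.a ≠ t'.c := hn (by simp) (by simp)
  have hba : t.b ≠ t'.a := hn (by simp) (by simp)
  have hbb : t.b ≠ t'.b := hn (by simp) (by simp)
  have hbc : t.b ≠ t'.c := hn (by simp) (by simp)
  have hca : t.c ≠ t'.a := hn (by simp) (by simp)
  have hcb : t.c ≠ t'.b := hn (by simp) (by simp)
  have hcc : t.c ≠ t'.c := hn (by simp) (by simp)
  -- Only the controls and the target of the other gate matter, and these differ.
  have hx : ∀ (a : W) (_ : a ≠ t'.c) (s : Bool) (ψ : Vec W),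
      t'.apply (cxOp a t.c s ψ) = cxOp a t.c s (t'.apply ψ) := by
    intro a ha s ψ
    funext v
    simp only [ToffoliGate.apply, cxOp, Function.update_of_ne ha, Function.update_of_ne hcc,
      Function.update_of_ne hca.symm, Function.update_of_ne hcb.symm, Function.update_of_ne hcc.symm]
    rw [Function.update_comm hcc]
  have hz : ∀ (s : Bool) (ψ : Vec W),
      t'.apply (czOp t.a t.b s ψ) = czOp t.a t.b s (t'.apply ψ) := by
    intro s ψ
    funext v
    simp only [ToffoliGate.apply, czOp, Function.update_of_ne hac, Function.update_of_ne hbc]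
  change t'.apply (cxOp _ _ _ (cxOp _ _ _ (czOp _ _ _ ψ))) =
    cxOp _ _ _ (cxOp _ _ _ (czOp _ _ _ (t'.apply ψ)))
  rw [hx _ hac, hx _ hbc, hz]

variable [Fintype W]

/-- The leftover Pauli operators update the Pauli key, up to a phase. -/
theorem exists_residues_pauli (t : ToffoliGate W) (k : KeyIdx W → Bool) (e : Fin 3 → Bool × Bool) :
    ∃ c : ℂ, ‖c‖ = 1 ∧ ∀ ψ, t.residues e (pauli k ψ) = c • pauli (t.correctKey k e) ψ := by
  have hx : ∀ (i : W) (b : Bool) (k : KeyIdx W → Bool), ∃ c : ℂ, ‖c‖ = 1 ∧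
      ∀ ψ, xOp i b (pauli k ψ) = c • pauli (addKey k (.inr i) b) ψ := by
    intro i b k
    refine ⟨if k (.inl i) && b then -1 else 1, by split_ifs <;> simp, fun ψ => ?_⟩
    rw [pauli_addKey_inr, smul_smul]
    split_ifs <;> simp
  have hz : ∀ (i : W) (b : Bool) (c : ℂ) (ψ : Vec W), zOp i b (c • ψ) = c • zOp i b ψ :=
    fun i b c ψ => (zOp_isLinearMap i b).map_smul c ψ
  obtain ⟨c, hc, h1⟩ := hx t.c (e 0).2 k
  obtain ⟨c', hc', h2⟩ := hx t.c (e 1).2 (addKey (addKey k (.inr t.c) (e 0).2) (.inl t.a) (e 0).1)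
  refine ⟨c * c', by rw [norm_mul, hc, hc', one_mul], fun ψ => ?_⟩
  change zOp t.a _ (zOp t.b _ (zOp t.b _ (xOp t.c _ (zOp t.a _ (xOp t.c _ (pauli k ψ)))))) = _
  rw [h1, hz, (xOp_isLinearMap _ _).map_smul, ← pauli_addKey_inl, h2, hz, hz, hz, hz, hz, hz,
    ← pauli_addKey_inl, ← pauli_addKey_inl, ← pauli_addKey_inl, smul_smul]
  congr 2
  funext j
  simp only [ToffoliGate.correctKey, addKey_apply]
  have hab := t.hab
  rcases j with j | j
  · by_cases h1 : j = t.a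
    · subst h1
      simp [hab]
    · by_cases h2 : j = t.b
      · subst h2
        simp [Ne.symm hab]
      · simp [h1, h2]
  · by_cases h1 : j = t.c <;> simp [h1]

/-- A Pauli operator is moved past a Toffoli gate at the cost of the correction of the gate. -/
theorem ToffoliGate.apply_pauli (t : ToffoliGate W) (k : KeyIdx W → Bool) (ψ : Vec W) :
    t.apply (pauli k ψ) = t.corr (t.controls k) (pauli (t.updateKey k) (t.apply ψ)) := by
  have hab := t.hab
  have hac := t.hac
  have hbc := t.hbc
  have h0 : t.updateKey k = addKey (addKey (addKey k (.inr t.c) (k (.inr t.a) && k (.inr t.b)))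
      (.inl t.b) (k (.inr t.a) && k (.inl t.c))) (.inl t.a) (k (.inr t.b) && k (.inl t.c)) := by
    funext j
    simp only [ToffoliGate.updateKey, addKey_apply]
    rcases j with j | j
    · simp only [reduceCtorEq, decide_false, Bool.false_and, Bool.xor_false, Sum.inl.injEq,
        Bool.xor_assoc]
      congr 1
      exact Bool.xor_comm _ _
    · simp
  rw [h0, pauli_addKey_inl, pauli_addKey_inl, pauli_addKey_inr]
  funext v
  change sgn _ _ * ψ _ = czOp _ _ _ (zOp _ _ (zOp _ _ (_ • xOp _ _ (pauli k (t.apply ψ))))) _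
  simp only [czOp, zOp, Pi.smul_apply, xOp, pauli, smul_eq_mul, ToffoliGate.controls,
    Matrix.cons_val_zero, Matrix.cons_val_one, Matrix.cons_val, Function.update_self,
    Function.update_of_ne hac, Function.update_of_ne hbc,
    Function.update_idem, ToffoliGate.apply]
  have h1 : ∀ (b : Bool), bxor (Function.update v t.c b) (fun j => k (.inr j)) =
      Function.update (bxor v fun j => k (.inr j)) t.c (xor b (k (.inr t.c))) := by
    intro b
    funext j
    by_cases h : j = t.c
    · subst h
      simp [bxor]
    · simp [bxor, h]
  rw [h1, h1, sgn_update_right, sgn_update_right]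
  simp only [Function.update_self, Function.update_idem, Function.update_of_ne hac,
    Function.update_of_ne hbc]
  simp only [bxor]
  -- The product of the shifted controls is expanded: the mixed terms are the CNOT gates of the
  -- correction, and `x && y` is part of the new key.
  have h2 : ∀ a b c x y z : Bool, xor (xor (xor (xor (xor c (y && a)) (x && b)) (x && y)) z)
      ((xor a x) && (xor b y)) = xor (xor c (a && b)) z := by decide
  rw [h2 (v t.a) (v t.b) (v t.c) (k (.inr t.a)) (k (.inr t.b)) (k (.inr t.c))]
  simp only [← mul_assoc]
  congr 2
  cases v t.a <;> cases v t.b <;> cases v t.c <;> cases k (.inr t.a) <;> cases k (.inr t.b) <;>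
    cases k (.inl t.c) <;> simp

end Correction

/-! ### The quantum part of a level -/

section Corrections

variable {W : Type} [DecidableEq W]

/-- The corrections of a list of Toffoli gates. -/
def corrs : (ts : List (ToffoliGate W)) → (Fin ts.length → Fin 3 → Bool) → Vec W → Vec W
  | [], _, ψ => ψ
  | t :: ts, s, ψ => t.corr (s 0) (corrs ts (fun m => s m.succ) ψ)

theorem corrs_smul : ∀ (ts : List (ToffoliGate W)) (s) (c : ℂ) (ψ : Vec W),
    corrs ts s (c • ψ) = c • corrs ts s ψ
  | [], _, _, _ => rfl
  | t :: ts, s, c, ψ => by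
    rw [corrs, corrs_smul ts, corr_smul]
    rfl

theorem nsq_corr [Fintype W] (t : ToffoliGate W) (s : Fin 3 → Bool) (ψ : Vec W) :
    nsq (t.corr s ψ) = nsq ψ := by
  unfold ToffoliGate.corr
  rw [nsq_corrGate, nsq_corrGate, nsq_corrGate]

theorem nsq_corrs [Fintype W] : ∀ (ts : List (ToffoliGate W)) (s) (ψ : Vec W),
    nsq (corrs ts s ψ) = nsq ψ
  | [], _, _ => rfl
  | t :: ts, s, ψ => by rw [corrs, nsq_corr, nsq_corrs ts]

theorem residues_corrs_comm {t : ToffoliGate W} (e : Fin 3 → Bool × Bool) :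
    ∀ (ts : List (ToffoliGate W)) (_ : ∀ t' ∈ ts, t.Separate t') (s) (ψ : Vec W),
      t.residues e (corrs ts s ψ) = corrs ts s (t.residues e ψ)
  | [], _, _, _ => rfl
  | t' :: ts, h, s, ψ => by
    rw [corrs, residues_corr_comm (h t' (by simp)), residues_corrs_comm e ts
      fun t'' ht'' => h t'' (by simp [ht''])]
    rfl

theorem foldl_tof_corr_comm {t : ToffoliGate W} (s : Fin 3 → Bool) :
    ∀ (ts : List (ToffoliGate W)) (_ : ∀ t' ∈ ts, t.Separate t') (ψ : Vec W),
      ts.foldl (fun φ t => t.apply φ) (t.corr s ψ) = t.corr s (ts.foldl (fun φ t => t.apply φ) ψ)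
  | [], _, _ => rfl
  | t' :: ts, h, ψ => by
    rw [List.foldl_cons, tof_corr_comm (h t' (by simp)), foldl_tof_corr_comm s ts
      fun t'' ht'' => h t'' (by simp [ht''])]
    rfl

theorem controls_updateKey {t t' : ToffoliGate W} (h : t.Separate t') (k : KeyIdx W → Bool) :
    t'.controls (t.updateKey k) = t'.controls k := by
  have h1 : t'.b ≠ t.c := (h.ne (by simp) (by simp)).symm
  have h2 : t'.a ≠ t.c := (h.ne (by simp) (by simp)).symm
  have h3 : t'.c ≠ t.a := (h.ne (by simp) (by simp)).symm
  have h4 : t'.c ≠ t.b := (h.ne (by simp) (by simp)).symm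
  simp [ToffoliGate.controls, ToffoliGate.updateKey, addKey_apply, h1, h2, h3, h4]

variable [Fintype W]

/-- A Pauli operator is moved past a layer of Toffoli gates. -/
theorem foldl_tof_pauli : ∀ (ts : List (ToffoliGate W)) (_ : ts.Pairwise ToffoliGate.Separate)
    (k : KeyIdx W → Bool) (ψ : Vec W),
      ts.foldl (fun φ t => t.apply φ) (pauli k ψ) =
        corrs ts (fun m => (ts.get m).controls k)
          (pauli (ts.foldl (fun k t => t.updateKey k) k) (ts.foldl (fun φ t => t.apply φ) ψ))
  | [], _, _, _ => rfl
  | t :: ts, h, k, ψ => by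
    rw [List.pairwise_cons] at h
    rw [List.foldl_cons, t.apply_pauli, foldl_tof_corr_comm _ ts h.1,
      foldl_tof_pauli ts h.2 (t.updateKey k), corrs]
    have h1 : ∀ m, (ts.get m).controls (t.updateKey k) = (ts.get m).controls k := fun m =>
      controls_updateKey (h.1 _ (ts.get_mem m)) k
    simp only [h1]
    rfl

/-- A Pauli operator is moved past a list of Clifford gates, up to a phase. -/
theorem exists_foldl_cliff_pauli : ∀ (gs : List (CliffordGate W)) (k : KeyIdx W → Bool),
    ∃ c : ℂ, ‖c‖ = 1 ∧ ∀ ψ, gs.foldl (fun φ g => g.apply φ) (pauli k ψ) =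
      c • pauli (gs.foldl (fun k g => g.updateKey k) k) (gs.foldl (fun φ g => g.apply φ) ψ)
  | [], _ => ⟨1, by simp, fun _ => by simp⟩
  | g :: gs, k => by
    obtain ⟨c, hc, h⟩ := g.exists_apply_pauli k
    obtain ⟨c', hc', h'⟩ := exists_foldl_cliff_pauli gs (g.updateKey k)
    have hl : ∀ (gs : List (CliffordGate W)) (φ : Vec W), gs.foldl (fun φ g => g.apply φ) (c • φ) =
        c • gs.foldl (fun φ g => g.apply φ) φ := by
      intro gs
      induction gs with
      | nil => exact fun _ => rfl
      | cons g gs ih =>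
        intro φ
        rw [List.foldl_cons, g.isLinearMap.map_smul, ih]
        rfl
    refine ⟨c * c', by rw [norm_mul, hc, hc', one_mul], fun ψ => ?_⟩
    rw [List.foldl_cons, h, hl, h', smul_smul]
    rfl

theorem nsq_foldl_tof : ∀ (ts : List (ToffoliGate W)) (ψ : Vec W),
    nsq (ts.foldl (fun φ t => t.apply φ) ψ) = nsq ψ
  | [], _ => rfl
  | t :: ts, ψ => by rw [List.foldl_cons, nsq_foldl_tof ts, t.nsq_apply]

theorem nsq_foldl_cliff : ∀ (gs : List (CliffordGate W)) (ψ : Vec W),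
    nsq (gs.foldl (fun φ g => g.apply φ) ψ) = nsq ψ
  | [], _ => rfl
  | g :: gs, ψ => by rw [List.foldl_cons, nsq_foldl_cliff gs, g.nsq_apply]

theorem Level.nsq_apply (l : Level W) (ψ : Vec W) : nsq (l.apply ψ) = nsq ψ := by
  unfold Level.apply
  rw [nsq_foldl_tof, nsq_foldl_cliff]

theorem foldl_tof_isLinearMap : ∀ ts : List (ToffoliGate W),
    IsLinearMap ℂ fun ψ : Vec W => ts.foldl (fun φ t => t.apply φ) ψ
  | [] => ⟨fun _ _ => rfl, fun _ _ => rfl⟩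
  | t :: ts => ⟨fun x y => by
      simp only [List.foldl_cons, t.isLinearMap.map_add]
      exact (foldl_tof_isLinearMap ts).map_add _ _, fun c x => by
      simp only [List.foldl_cons, t.isLinearMap.map_smul]
      exact (foldl_tof_isLinearMap ts).map_smul _ _⟩

theorem foldl_cliff_isLinearMap : ∀ gs : List (CliffordGate W),
    IsLinearMap ℂ fun ψ : Vec W => gs.foldl (fun φ t => t.apply φ) ψ
  | [] => ⟨fun _ _ => rfl, fun _ _ => rfl⟩
  | g :: gs => ⟨fun x y => by
      simp only [List.foldl_cons, g.isLinearMap.map_add]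
      exact (foldl_cliff_isLinearMap gs).map_add _ _, fun c x => by
      simp only [List.foldl_cons, g.isLinearMap.map_smul]
      exact (foldl_cliff_isLinearMap gs).map_smul _ _⟩

theorem Level.isLinearMap (l : Level W) : IsLinearMap ℂ l.apply :=
  ⟨fun x y => by
    unfold Level.apply
    rw [(foldl_cliff_isLinearMap _).map_add, (foldl_tof_isLinearMap _).map_add],
  fun c x => by
    unfold Level.apply
    rw [(foldl_cliff_isLinearMap _).map_smul, (foldl_tof_isLinearMap _).map_smul]⟩

/-- A Pauli operator is moved past a level, up to a phase, at the cost of the corrections of the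
Toffoli gates. -/
theorem Level.exists_apply_pauli (l : Level W) (k : KeyIdx W → Bool) :
    ∃ c : ℂ, ‖c‖ = 1 ∧ ∀ ψ, l.apply (pauli k ψ) =
      c • corrs l.tof (fun m => (l.tof.get m).controls (l.cliffKey k))
        (pauli (l.tofKey k) (l.apply ψ)) := by
  obtain ⟨c, hc, h⟩ := exists_foldl_cliff_pauli l.cliff k
  refine ⟨c, hc, fun ψ => ?_⟩
  unfold Level.apply
  rw [h, (foldl_tof_isLinearMap _).map_smul, foldl_tof_pauli _ l.disjoint]
  rfl

end Corrections

section Removal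

variable {W : Type} [Fintype W] [DecidableEq W]

theorem h_h (b : W) (ψ : Vec W) :
    (CliffordGate.h b).apply ((CliffordGate.h b).apply ψ) = ψ := by
  funext v
  have hs := one_div_sqrt_two_mul_self
  have hv : Function.update v b (v b) = v := Function.update_eq_self b v
  simp only [CliffordGate.apply, Function.update_idem, Function.update_self]
  cases h : v b <;> rw [h] at hv
  · simp only [hv, Bool.false_eq_true, if_false, if_true, one_mul]
    linear_combination (2 * ψ v) * hs
  · simp only [hv, Bool.false_eq_true, if_false, if_true, one_mul]
    linear_combination (2 * ψ v) * hs

theorem xOp_h (b : W) (c : Bool) (ψ : Vec W) :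
    xOp b c ((CliffordGate.h b).apply ψ) = (CliffordGate.h b).apply (zOp b c ψ) := by
  funext v
  simp only [CliffordGate.apply, xOp, zOp, Function.update_idem, Function.update_self]
  cases v b <;> cases c <;> simp

theorem zOp_h {a b : W} (hab : a ≠ b) (c : Bool) (ψ : Vec W) :
    zOp a c ((CliffordGate.h b).apply ψ) = (CliffordGate.h b).apply (zOp a c ψ) := by
  funext v
  simp only [CliffordGate.apply, zOp, Function.update_of_ne hab]
  ring

theorem cxOp_h {a b : W} (hab : a ≠ b) (s : Bool) (ψ : Vec W) :
    cxOp a b s ((CliffordGate.h b).apply ψ) = (CliffordGate.h b).apply (czOp a b s ψ) := by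
  funext v
  simp only [CliffordGate.apply, cxOp, czOp, Function.update_idem, Function.update_self,
    Function.update_of_ne hab]
  cases v a <;> cases v b <;> cases s <;> simp

variable {HE : LeveledHE} {Lc : ℕ → ℕ} {A : AltScheme HE Lc} {n s : ℕ} {ε : ℝ}
  {κ : Bits (HE.keyCoins n (Lc n))}

theorem normPreserving_removeGate (A : AltScheme HE Lc) (n : ℕ) (pk : Bits (HE.pkLen n (Lc n)))
    (t : ToffoliGate W) (j : Fin 3) (c : Bits (HE.ctLen n (Lc n))) :
    NormPreserving (removeGate A n pk t j c) := by
  unfold removeGate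
  split_ifs
  · exact (normPreserving_encryptedCNOT A n _ _ t.hac).bind fun _ => normPreserving_pure _
  · exact (normPreserving_encryptedCNOT A n _ _ t.hbc).bind fun _ => normPreserving_pure _
  · exact (normPreserving_op (CliffordGate.h t.b).nsq_apply).bind fun _ =>
      (normPreserving_encryptedCNOT A n _ _ t.hab).bind fun _ =>
        (normPreserving_op (CliffordGate.h t.b).nsq_apply).bind fun _ => normPreserving_pure _

/-- The removal of one gate of the correction of a Toffoli gate. -/
theorem AltScheme.Capable.expect_removeGate_le (hcap : A.Capable n s ε κ)
    (hD0 : ∀ w, 0 ≤ A.D n (HE.pk κ) w) (hD1 : ∑ w, A.D n (HE.pk κ) w = 1)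
    (t : ToffoliGate W) (j : Fin 3)
    {c : Bits (HE.ctLen n (Lc n))} (hc : HE.Occurs s κ c) {T : ℝ}
    (hT : 0 < T) {χ : Vec W} (hχ : nsq χ = 1) (φ : Vec W) :
    expect (removeGate A n (HE.pk κ) t j c) φ (fun e =>
      infid (t.residue j (leftover A (HE.sk κ) (A.trapdoor n κ) (HE.pk κ) e) χ)) ≤
      (1 + 1 / T) * infid (t.corrGate j (HE.dec n (Lc n) (HE.sk κ) c) χ) φ +
        (1 + T) * (126 * ε) * nsq φ := by
  unfold removeGate
  have hH := (CliffordGate.h t.b : CliffordGate W).isLinearMap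
  have hHn := (CliffordGate.h t.b : CliffordGate W).nsq_apply
  fin_cases j
  · refine le_trans (le_of_eq ?_) (hcap.expect_encryptedCNOT_le hD0 hD1 hc t.hac hT hχ φ)
    simp only [Fin.zero_eta, if_true, expect_bind]
    congr 1
    funext o φ'
    exact expect_pure _ _ _
  · refine le_trans (le_of_eq ?_) (hcap.expect_encryptedCNOT_le hD0 hD1 hc t.hbc hT hχ φ)
    simp only [Fin.mk_one, one_ne_zero, if_false, if_true, expect_bind]
    congr 1
    funext o φ'
    exact expect_pure _ _ _
  -- The third gate is a CNOT gate between two Hadamard gates, which turn the leftover `X` operator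
  -- into a `Z` operator.
  · have hχ' : nsq ((CliffordGate.h t.b).apply χ) = 1 := by rw [hHn, hχ]
    have hcz : nsq (czOp t.a t.b (HE.dec n (Lc n) (HE.sk κ) c) χ) = 1 := by rw [nsq_czOp, hχ]
    have h1 := hcap.expect_encryptedCNOT_le hD0 hD1 hc t.hab hT hχ' ((CliffordGate.h t.b).apply φ)
    rw [hHn, cxOp_h t.hab] at h1
    have h2 := infid_map_le hH hHn hcz φ
    have hT' : 0 ≤ 1 + 1 / T := by positivity
    refine le_trans ?_ (h1.trans (add_le_add (mul_le_mul_of_nonneg_left h2 hT') le_rfl))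
    have h20 : ¬ (2 : Fin 3) = 0 := by decide
    have h21 : ¬ (2 : Fin 3) = 1 := by decide
    simp only [Fin.reduceFinMk, h20, h21, if_false, expect_bind, expect_op]
    refine expect_mono _ _ fun o φ' => ?_
    rw [xOp_h, zOp_h t.hab]
    refine le_trans (le_of_eq ?_) (infid_map_le hH hHn (χ := (CliffordGate.h t.b).apply (zOp t.a _
      (zOp t.b _ χ))) (by rw [hHn, nsq_zOp, nsq_zOp, hχ]) φ')
    rw [h_h]
    exact expect_pure _ _ _

/-- The removal of the correction of a Toffoli gate. -/
theorem AltScheme.Capable.expect_removeGates_le (hcap : A.Capable n s ε κ)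
    (hD0 : ∀ w, 0 ≤ A.D n (HE.pk κ) w) (hD1 : ∑ w, A.D n (HE.pk κ) w = 1)
    (t : ToffoliGate W)
    {c : Fin 3 → Bits (HE.ctLen n (Lc n))} (hc : ∀ j, HE.Occurs s κ (c j)) {T : ℝ}
    (hT : 0 < T) {χ : Vec W} (hχ : nsq χ = 1) (φ : Vec W) :
    expect (forFin 3 fun j => removeGate A n (HE.pk κ) t j (c j)) φ (fun e =>
      infid (t.residues (fun j => leftover A (HE.sk κ) (A.trapdoor n κ) (HE.pk κ) (e j)) χ)) ≤
      (1 + 1 / T) ^ 3 * (infid (t.corr (fun j => HE.dec n (Lc n) (HE.sk κ) (c j)) χ) φ +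
        3 * ((1 + T) * (126 * ε)) * nsq φ) := by
  set lo := leftover A (HE.sk κ) (A.trapdoor n κ) (HE.pk κ)
  set b : Fin 3 → Bool := fun j => HE.dec n (Lc n) (HE.sk κ) (c j)
  set ρ := 1 + 1 / T
  set δ := (1 + T) * (126 * ε)
  have hT' : 0 < 1 / T := by positivity
  have hρ : 1 ≤ ρ := by simp only [ρ]; linarith
  have hε : 0 ≤ ε := (probOf_nonneg hD0 _).trans hcap.2.1
  have hδ : 0 ≤ δ := by positivity
  have hnp : ∀ j φ, expect (removeGate A n (HE.pk κ) t j (c j)) φ (fun _ => nsq) = nsq φ :=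
    fun j => normPreserving_removeGate A n _ t j _
  have h0 : ∀ {χ : Vec W}, nsq χ = 1 → ∀ j φ, expect (removeGate A n (HE.pk κ) t j (c j)) φ
      (fun e => infid (t.residue j (lo e) χ)) ≤ ρ * infid (t.corrGate j (b j) χ) φ + δ * nsq φ :=
    fun hχ j φ => hcap.expect_removeGate_le hD0 hD1 t j (hc j) hT hχ φ
  -- The operations are analysed from the last to the first, so that each bound is available under
  -- the expectation over the preceding branches.
  have step2 : ∀ e₀ e₁ φ, expect (removeGate A n (HE.pk κ) t 2 (c 2)) φ
      (fun e => infid (t.residue 2 (lo e) (t.residue 1 (lo e₁) (t.residue 0 (lo e₀) χ)))) ≤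
      ρ * infid (t.corrGate 2 (b 2) (t.residue 1 (lo e₁) (t.residue 0 (lo e₀) χ))) φ + δ * nsq φ :=
    fun e₀ e₁ φ => h0 (by rw [nsq_residue, nsq_residue, hχ]) 2 φ
  have step1 : ∀ e₀ φ, expect (removeGate A n (HE.pk κ) t 1 (c 1)) φ (fun e₁ φ =>
      ρ * infid (t.corrGate 2 (b 2) (t.residue 1 (lo e₁) (t.residue 0 (lo e₀) χ))) φ + δ * nsq φ) ≤
      ρ * (ρ * infid (t.corrGate 1 (b 1) (t.corrGate 2 (b 2) (t.residue 0 (lo e₀) χ))) φ +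
        δ * nsq φ) + δ * nsq φ := by
    intro e₀ φ
    rw [expect_add, expect_mul_left, expect_mul_left, hnp]
    have h1 := h0 (χ := t.corrGate 2 (b 2) (t.residue 0 (lo e₀) χ))
      (by rw [nsq_corrGate, nsq_residue, hχ]) 1 φ
    simp only [residue_one_corrGate] at h1
    gcongr
  have step0 : ∀ φ, expect (removeGate A n (HE.pk κ) t 0 (c 0)) φ (fun e₀ φ =>
      ρ * (ρ * infid (t.corrGate 1 (b 1) (t.corrGate 2 (b 2) (t.residue 0 (lo e₀) χ))) φ +
        δ * nsq φ) + δ * nsq φ) ≤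
      ρ * (ρ * (ρ * infid (t.corr b χ) φ + δ * nsq φ) + δ * nsq φ) + δ * nsq φ := by
    intro φ
    rw [expect_add, expect_mul_left, expect_add, expect_mul_left, expect_mul_left, hnp]
    have h1 := h0 (χ := t.corrGate 1 (b 1) (t.corrGate 2 (b 2) χ))
      (by rw [nsq_corrGate, nsq_corrGate, hχ]) 0 φ
    simp only [residue_zero_corrGate] at h1
    change _ ≤ ρ * infid (t.corr b χ) φ + _ at h1
    gcongr
  have hN := nsq_nonneg φ
  calc _ ≤ ρ * (ρ * (ρ * infid (t.corr b χ) φ + δ * nsq φ) + δ * nsq φ) + δ * nsq φ := by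
        -- The target state for each step still contains the gates that are removed later.
        refine le_trans ?_ (step0 φ)
        rw [expect_forFin_succ]
        refine expect_mono _ _ fun e₀ φ => ?_
        refine le_trans ?_ (step1 e₀ φ)
        rw [expect_forFin_succ]
        refine expect_mono _ _ fun e₁ φ => ?_
        refine le_trans ?_ (step2 e₀ e₁ φ)
        rw [expect_forFin_succ]
        refine expect_mono _ _ fun e₂ φ => ?_
        rw [expect_forFin_zero]
        exact le_rfl
    _ = ρ ^ 3 * infid (t.corr b χ) φ + (ρ ^ 2 + ρ + 1) * (δ * nsq φ) := by ring
    _ ≤ ρ ^ 3 * infid (t.corr b χ) φ + (ρ ^ 3 + ρ ^ 3 + ρ ^ 3) * (δ * nsq φ) := by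
        have h1 : ρ ^ 2 ≤ ρ ^ 3 := pow_le_pow_right₀ hρ (by norm_num)
        have h2 : ρ ≤ ρ ^ 3 := by simpa using pow_le_pow_right₀ hρ (show 1 ≤ 3 by norm_num)
        have h3 : 1 ≤ ρ ^ 3 := one_le_pow₀ hρ
        gcongr
    _ = _ := by ring

/-- The removal of the corrections of a layer of Toffoli gates. -/
theorem AltScheme.Capable.expect_removeLayer_le (hcap : A.Capable n s ε κ)
    (hD0 : ∀ w, 0 ≤ A.D n (HE.pk κ) w) (hD1 : ∑ w, A.D n (HE.pk κ) w = 1) {T : ℝ}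
    (hT : 0 < T) {χ : Vec W} (hχ : nsq χ = 1) :
    ∀ (ts : List (ToffoliGate W)) (_ : ts.Pairwise ToffoliGate.Separate)
      (c : Fin ts.length → Fin 3 → Bits (HE.ctLen n (Lc n))) (_ : ∀ m j, HE.Occurs s κ (c m j))
      (k : KeyIdx W → Bool) (φ : Vec W),
      expect (forFin ts.length fun m => forFin 3 fun j =>
        removeGate A n (HE.pk κ) (ts.get m) j (c m j)) φ (fun e =>
        infid (pauli ((List.finRange ts.length).foldl (fun k m => (ts.get m).correctKey k fun j =>
          leftover A (HE.sk κ) (A.trapdoor n κ) (HE.pk κ) (e m j)) k) χ)) ≤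
        (1 + 1 / T) ^ (3 * ts.length) *
          (infid (corrs ts (fun m j => HE.dec n (Lc n) (HE.sk κ) (c m j)) (pauli k χ)) φ +
            (3 * ts.length : ℕ) * ((1 + T) * (126 * ε)) * nsq φ)
  | [], _, c, _, k, φ => by
    refine le_of_eq ((expect_forFin_zero _ _ _).trans ?_)
    simp [corrs]
  | t :: ts, hd, c, hc, k, φ => by
    rw [List.pairwise_cons] at hd
    set ρ := 1 + 1 / T
    set δ := (1 + T) * (126 * ε)
    have hT' : 0 < 1 / T := by positivity
    have hρ : 0 ≤ ρ := by simp only [ρ]; linarith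
    have hε : 0 ≤ ε := (probOf_nonneg hD0 _).trans hcap.2.1
    have hδ : 0 ≤ δ := by positivity
    set lo := leftover A (HE.sk κ) (A.trapdoor n κ) (HE.pk κ)
    have ih := fun e => expect_removeLayer_le hcap hD0 hD1 hT hχ ts hd.2 (fun m => c m.succ)
      (fun m => hc m.succ) (t.correctKey k e)
    have hχ' : nsq (corrs ts (fun m j => HE.dec n (Lc n) (HE.sk κ) (c m.succ j))
        (pauli k χ)) = 1 := by
      rw [nsq_corrs, nsq_pauli, hχ]
    have h1 := hcap.expect_removeGates_le hD0 hD1 t (hc 0) hT hχ' φ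
    -- The Pauli operators left by the first gate commute with the corrections of the other gates,
    -- and update the Pauli key.
    have h2 : ∀ e : Fin 3 → Bool × Bool, infid (t.residues e
        (corrs ts (fun m j => HE.dec n (Lc n) (HE.sk κ) (c m.succ j)) (pauli k χ))) =
        infid (corrs ts (fun m j => HE.dec n (Lc n) (HE.sk κ) (c m.succ j))
          (pauli (t.correctKey k e) χ)) := by
      intro e
      obtain ⟨a, ha, h⟩ := exists_residues_pauli t k e
      funext φ
      rw [residues_corrs_comm e ts hd.1, h, corrs_smul, infid_smul_left _ _ ha]
    simp only [h2] at h1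
    refine (expect_forFin_succ ts.length (fun m => forFin 3 fun j =>
        removeGate A n (HE.pk κ) ((t :: ts).get m) j (c m j)) φ _).trans_le ?_
    calc _ ≤ expect (forFin 3 fun j => removeGate A n (HE.pk κ) t j (c 0 j)) φ (fun e φ =>
            ρ ^ (3 * ts.length) * (infid (corrs ts (fun m j => HE.dec n (Lc n) (HE.sk κ)
              (c m.succ j)) (pauli (t.correctKey k fun j => lo (e j)) χ)) φ +
              (3 * ts.length : ℕ) * δ * nsq φ)) := by
          refine expect_mono _ _ fun e φ => ?_
          refine le_trans (le_of_eq ?_) (ih (fun j => lo (e j)) φ)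
          congr 1
          funext r φ
          congr 2
          change List.foldl _ _ (List.finRange (ts.length + 1)) = _
          rw [List.finRange_succ, List.foldl_cons, List.foldl_map]
          rfl
      _ = ρ ^ (3 * ts.length) * (expect (forFin 3 fun j => removeGate A n (HE.pk κ) t j (c 0 j)) φ
            (fun e => infid (corrs ts (fun m j => HE.dec n (Lc n) (HE.sk κ)
              (c m.succ j)) (pauli (t.correctKey k fun j => lo (e j)) χ))) +
              (3 * ts.length : ℕ) * δ * nsq φ) := by
          rw [expect_mul_left, expect_add, expect_mul_left]
          congr 2
          congr 1
          exact NormPreserving.forFin (fun j => normPreserving_removeGate A n _ t j _) φ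
      _ ≤ ρ ^ (3 * ts.length) * (ρ ^ 3 * (infid (t.corr (fun j => HE.dec n (Lc n) (HE.sk κ) (c 0 j))
            (corrs ts (fun m j => HE.dec n (Lc n) (HE.sk κ) (c m.succ j)) (pauli k χ))) φ +
            3 * δ * nsq φ) + ρ ^ 3 * ((3 * ts.length : ℕ) * δ * nsq φ)) := by
          have h3 : 1 ≤ ρ ^ 3 := one_le_pow₀ (by simp only [ρ]; linarith)
          have h4 : 0 ≤ ((3 * ts.length : ℕ) : ℝ) * δ * nsq φ := by
            have := nsq_nonneg φ
            positivity
          have h5 := le_mul_of_one_le_left h4 h3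
          gcongr
      _ = _ := by
          change _ = ρ ^ (3 * (ts.length + 1)) * (infid (t.corr (fun j =>
            HE.dec n (Lc n) (HE.sk κ) (c 0 j)) (corrs ts (fun m j => HE.dec n (Lc n) (HE.sk κ)
            (c m.succ j)) (pauli k χ))) φ + ((3 * (ts.length + 1) : ℕ) : ℝ) * δ * nsq φ)
          push_cast
          ring

theorem normPreserving_runLevel (A : AltScheme HE Lc) (n : ℕ) (pk : Bits (HE.pkLen n (Lc n)))
    (l : Level W) (c : LevelOut l → Bits (HE.ctLen n (Lc n))) :
    NormPreserving (runLevel A n pk l c) :=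
  (normPreserving_op l.nsq_apply).bind fun _ =>
    (NormPreserving.forFin fun _ => NormPreserving.forFin fun _ =>
      normPreserving_removeGate A n _ _ _ _).bind fun _ => normPreserving_pure _

/-- If the ciphertexts of the controls are correct, then the quantum part of a level maps the state
`χ`, encrypted with the Pauli key `k`, to the state `l.apply χ`, encrypted with the Pauli key that
belongs to the data of the encrypted CNOT operations. -/
theorem AltScheme.Capable.expect_runLevel_le (hcap : A.Capable n s ε κ)
    (hD0 : ∀ w, 0 ≤ A.D n (HE.pk κ) w) (hD1 : ∑ w, A.D n (HE.pk κ) w = 1) {T : ℝ}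
    (hT : 0 < T) {χ : Vec W} (hχ : nsq χ = 1) (l : Level W) (k : KeyIdx W → Bool)
    {c : LevelOut l → Bits (HE.ctLen n (Lc n))} (hc : ∀ o, HE.Occurs s κ (c o))
    (hdec : ∀ o, HE.dec n (Lc n) (HE.sk κ) (c o) = l.output k o) (φ : Vec W) :
    expect (runLevel A n (HE.pk κ) l c) φ (fun e =>
      infid (pauli (l.correctKey (fun j => HE.dec n (Lc n) (HE.sk κ) (e.1 j)) fun t =>
        leftover A (HE.sk κ) (A.trapdoor n κ) (HE.pk κ) (e.2 t)) (l.apply χ))) ≤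
      (1 + 1 / T) ^ (3 * l.tof.length) * (infid (pauli k χ) φ +
        (3 * l.tof.length : ℕ) * ((1 + T) * (126 * ε)) * nsq φ) := by
  have hχ' : nsq (l.apply χ) = 1 := by rw [l.nsq_apply, hχ]
  have h1 := hcap.expect_removeLayer_le hD0 hD1 hT hχ' l.tof l.disjoint
    (fun m j => c (.inr (m, j))) (fun m j => hc _) (l.tofKey k) (l.apply φ)
  obtain ⟨a, ha, h2⟩ := l.exists_apply_pauli k
  -- The ciphertexts of the controls encrypt the exponents of the corrections.
  have h3 : (fun m j => HE.dec n (Lc n) (HE.sk κ) (c (.inr (m, j)))) =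
      fun m => (l.tof.get m).controls (l.cliffKey k) := by
    funext m j
    exact hdec (.inr (m, j))
  rw [h3, ← infid_smul_left _ _ ha, ← h2, l.nsq_apply] at h1
  have h4 : infid (l.apply (pauli k χ)) (l.apply φ) ≤ infid (pauli k χ) φ :=
    infid_map_le l.isLinearMap l.nsq_apply (by rw [nsq_pauli, hχ]) φ
  have hT' : 0 < 1 / T := by positivity
  refine le_trans (le_of_eq ?_) (h1.trans (mul_le_mul_of_nonneg_left (add_le_add h4 le_rfl)
    (by positivity)))
  unfold runLevel
  simp only [expect_bind, expect_op, expect_pure]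
  congr 1
  funext e φ
  have h5 : (fun j => HE.dec n (Lc n) (HE.sk κ) (c (.inl j))) = l.tofKey k := by
    funext j
    exact hdec (.inl j)
  rw [h5]
  rfl

end Removal

/-! ### One-bit circuits -/

namespace BoolCircuit

variable {ι o : Type} [Fintype ι]

theorem depth_single (C : BoolCircuit ι o) (j : o) : (C.single j).depth = C.depth := by
  unfold depth single
  rw [List.foldl_map]
  have h : ∀ (ds : List ℕ) (g : BoolGate ι),
      gateDepth ds (mapGate (Fintype.equivFin ι) g) = gateDepth ds g := by
    have hw : ∀ (ds : List ℕ) (a : ι ⊕ ℕ),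
        wireDepth ds (a.map (Fintype.equivFin ι) id) = wireDepth ds a := by
      rintro ds (a | a) <;> rfl
    intro ds g
    cases g <;> simp [gateDepth, mapGate, hw]
  simp only [h]

/-- The homomorphic evaluation of a circuit is defined output by output, with the inputs numbered.
-/
theorem eval_single (C : BoolCircuit ι o) (j : o) (x : ι → Bool) :
    (C.single j).eval (fun i => x ((Fintype.equivFin ι).symm i)) () = C.eval x j := by
  have hw : ∀ (vs : List Bool) (a : ι ⊕ ℕ),
      wireVal (fun i => x ((Fintype.equivFin ι).symm i)) vs (a.map (Fintype.equivFin ι) id) =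
        wireVal x vs a := by
    rintro vs (a | a) <;> simp [wireVal]
  have h : ∀ (vs : List Bool) (g : BoolGate ι),
      gateVal (fun i => x ((Fintype.equivFin ι).symm i)) vs (mapGate (Fintype.equivFin ι) g) =
        gateVal x vs g := by
    intro vs g
    cases g <;> simp [gateVal, mapGate, hw]
  unfold eval vals single
  rw [List.foldl_map]
  simp only [h, hw]

theorem size_single_le [Fintype o] (C : BoolCircuit ι o) (j : o) : (C.single j).size ≤ C.size := by
  have : 0 < Fintype.card o := Fintype.card_pos_iff.2 ⟨j⟩
  simp only [size, single, List.length_map, Fintype.card_fin, Fintype.card_unit]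
  omega

end BoolCircuit

/-! ### Homomorphic evaluation in a level -/

/-- An average over a part of the coins. -/
theorem avg_comp {κ κ' : Type} [Fintype κ] [DecidableEq κ] [Fintype κ'] [DecidableEq κ']
    {e : κ → κ'} (he : Function.Injective e) (f : (κ → Bool) → ℝ) :
    (avg fun r : κ' → Bool => f fun i => r (e i)) = avg f := by
  rw [avg_glue ⟨e, he⟩]
  have h : ∀ b r, (fun i => glue ⟨e, he⟩ b r (e i)) = b := fun b r => glue_comp ⟨e, he⟩ b r
  simp only [h, avg_const]

open Classical in
/-- The indicator of a proposition. -/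
def ind (P : Prop) : ℝ := if P then 1 else 0

theorem ind_nonneg (P : Prop) : 0 ≤ ind P := by
  unfold ind
  split_ifs <;> simp

theorem ind_mono {P Q : Prop} (h : P → Q) : ind P ≤ ind Q := by
  unfold ind
  by_cases hP : P
  · simp [hP, h hP]
  · rw [if_neg hP]
    split_ifs <;> simp

theorem ind_or_le (P Q : Prop) : ind (P ∨ Q) ≤ ind P + ind Q := by
  unfold ind
  by_cases hP : P <;> by_cases hQ : Q <;> simp [hP, hQ]

theorem ind_exists_le {I : Type} [Fintype I] (P : I → Prop) : ind (∃ i, P i) ≤ ∑ i, ind (P i) := by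
  by_cases h : ∃ i, P i
  · obtain ⟨i, hi⟩ := h
    refine le_trans (le_of_eq ?_)
      (Finset.single_le_sum (fun i _ => ind_nonneg (P i)) (Finset.mem_univ i))
    simp [ind, hi, show ∃ i, P i from ⟨i, hi⟩]
  · refine le_trans (le_of_eq ?_) (Finset.sum_nonneg fun i _ => ind_nonneg (P i))
    simp [ind, h]

section LevelStep

variable {HE : LeveledHE} {Lc : ℕ → ℕ} {A : AltScheme HE Lc} {n s : ℕ} {ε : ℝ}

/-- The ciphertexts that result from evaluating a circuit on fresh ciphertexts of `x`. -/
def freshEval {I O : Type} [Fintype I] [Fintype O] (Lc : ℕ → ℕ)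
    (κ : Bits (HE.keyCoins n (Lc n))) (C : BoolCircuit I O) (x : I → Bool)
    (w : I × Fin (HE.encCoins n (Lc n)) → Bool)
    (ρ : (Σ o : O, Fin (HE.evalCoins n (Lc n) (C.single o))) → Bool) :
    O → Bits (HE.ctLen n (Lc n)) := fun o =>
  HE.eval n (Lc n) (C.single o) (HE.evk κ)
    (fun j => HE.enc n (Lc n) (HE.pk κ) (x ((Fintype.equivFin I).symm j))
      fun a => w ((Fintype.equivFin I).symm j, a)) fun a => ρ ⟨o, a⟩

/-- The keys are not suited for encrypted CNOT operations, or the homomorphic evaluation fails. -/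
def Fails {I O : Type} [Fintype I] [Fintype O] (A : AltScheme HE Lc) (s : ℕ) (ε : ℝ)
    (κ : Bits (HE.keyCoins n (Lc n))) (C : BoolCircuit I O) (x : I → Bool)
    (w : I × Fin (HE.encCoins n (Lc n)) → Bool)
    (ρ : (Σ o : O, Fin (HE.evalCoins n (Lc n) (C.single o))) → Bool) : Prop :=
  ¬ A.Capable n s ε κ ∨
    ∃ o, HE.dec n (Lc n) (HE.sk κ) (freshEval Lc κ C x w ρ o) ≠ C.eval x o

/-- For security parameter `n` and circuits of size at most `s`: the keys are suited for encrypted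
CNOT operations with error `ε`, and homomorphic evaluation of a bit is correct, except with
probability `ε`. -/
structure ErrorBound (A : AltScheme HE Lc) (n s : ℕ) (ε : ℝ) : Prop where
  density : ∀ pk, (∀ w, 0 ≤ A.D n pk w) ∧ ∑ w, A.D n pk w = 1
  capable : prob (fun κ => ¬ A.Capable n s ε κ) ≤ ε
  correct : ∀ (l : ℕ) (f : BoolCircuit (Fin l) Unit) (μ : Bits l), f.depth ≤ Lc n → f.size ≤ s →
    prob (fun r : Fin (HE.keyCoins n (Lc n)) ⊕ (Fin l × Fin (HE.encCoins n (Lc n))) ⊕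
        Fin (HE.evalCoins n (Lc n) f) → Bool =>
      let κ : Bits (HE.keyCoins n (Lc n)) := fun i => r (.inl i)
      HE.dec n (Lc n) (HE.sk κ) (HE.eval n (Lc n) f (HE.evk κ)
        (fun j => HE.enc n (Lc n) (HE.pk κ) (μ j) fun i => r (.inr (.inl (j, i))))
        fun i => r (.inr (.inr i))) ≠ f.eval μ ()) ≤ ε

theorem ErrorBound.nonneg (h : ErrorBound A n s ε) : 0 ≤ ε := (prob_nonneg _).trans h.capable

/-- The probability of a failure when all coins are independent. -/
theorem ErrorBound.avg_fails_le (hE : ErrorBound A n s ε) {I O J : Type} [Fintype I] [Fintype O]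
    [DecidableEq O] [Fintype J] [DecidableEq J] {C : BoolCircuit I O} (hd : C.depth ≤ Lc n)
    (hs : C.size ≤ s) (x : I → Bool) {f : Fin (HE.keyCoins n (Lc n)) → J}
    {g : I × Fin (HE.encCoins n (Lc n)) → J}
    {h : (Σ o : O, Fin (HE.evalCoins n (Lc n) (C.single o))) → J}
    (hinj : Function.Injective (Sum.elim f (Sum.elim g h))) :
    (avg fun r : J → Bool => ind (Fails A s ε (fun i => r (f i)) C x (fun i => r (g i))
      fun i => r (h i))) ≤ (s + 1 : ℕ) * ε := by
  have hε := hE.nonneg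
  have h1 : (avg fun r : J → Bool => ind (¬ A.Capable n s ε fun i => r (f i))) ≤ ε := by
    have hf : Function.Injective f := hinj.comp Sum.inl_injective
    rw [avg_comp hf fun κ => ind (¬ A.Capable n s ε κ)]
    exact hE.capable
  have h2 : ∀ o, (avg fun r : J → Bool => ind (HE.dec n (Lc n) (HE.sk fun i => r (f i))
      (freshEval Lc (fun i => r (f i)) C x (fun i => r (g i)) (fun i => r (h i)) o) ≠
        C.eval x o)) ≤ ε := by
    intro o
    -- The coins used for the output bit `o` are distinct, and therefore independent.
    have he : Function.Injective (Sum.elim f (Sum.elim g h) ∘ Sum.map id (Sum.map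
        (fun p : Fin (Fintype.card I) × Fin (HE.encCoins n (Lc n)) =>
          ((Fintype.equivFin I).symm p.1, p.2))
        (fun a : Fin (HE.evalCoins n (Lc n) (C.single o)) =>
          (⟨o, a⟩ : Σ o : O, Fin (HE.evalCoins n (Lc n) (C.single o)))))) := by
      refine hinj.comp (Function.injective_id.sumMap (Function.Injective.sumMap ?_ ?_))
      · rintro ⟨a, b⟩ ⟨a', b'⟩ hab
        simpa using hab
      · rintro a b hab
        simpa using hab
    have h3 := hE.correct _ (C.single o) (fun j => x ((Fintype.equivFin I).symm j))
      (by rwa [C.depth_single]) ((C.size_single_le o).trans hs)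
    refine le_trans (le_of_eq ?_) h3
    rw [C.eval_single]
    exact avg_comp he fun r => ind (HE.dec n (Lc n) (HE.sk fun i => r (.inl i))
      (HE.eval n (Lc n) (C.single o) (HE.evk fun i => r (.inl i))
        (fun j => HE.enc n (Lc n) (HE.pk fun i => r (.inl i)) (x ((Fintype.equivFin I).symm j))
          fun i => r (.inr (.inl (j, i)))) fun i => r (.inr (.inr i))) ≠ C.eval x o)
  have hO : Fintype.card O ≤ s := by
    unfold BoolCircuit.size at hs
    omega
  calc _ ≤ avg fun r : J → Bool => ind (¬ A.Capable n s ε fun i => r (f i)) +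
          ∑ o, ind (HE.dec n (Lc n) (HE.sk fun i => r (f i))
            (freshEval Lc (fun i => r (f i)) C x (fun i => r (g i)) (fun i => r (h i)) o) ≠
              C.eval x o) :=
        avg_mono fun r => (ind_or_le _ _).trans (add_le_add le_rfl (ind_exists_le _))
    _ ≤ ε + ∑ _o : O, ε := by
        rw [avg_add, avg_sum]
        exact add_le_add h1 (Finset.sum_le_sum fun o _ => h2 o)
    _ ≤ (s + 1 : ℕ) * ε := by
        rw [Finset.sum_const, Finset.card_univ, nsmul_eq_mul]
        push_cast
        have : (Fintype.card O : ℝ) ≤ s := by exact_mod_cast hO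
        nlinarith

/-- The Pauli key that belongs to the data of the server after level `l`. -/
def serverKey (A : AltScheme HE Lc) (κ : Bits (HE.keyCoins n (Lc n))) (l : Level (Fin n))
    (e : ServerData A n l) : KeyIdx (Fin n) → Bool :=
  l.correctKey (fun j => HE.dec n (Lc n) (HE.sk κ) (e.1 j)) fun t =>
    leftover A (HE.sk κ) (A.trapdoor n κ) (HE.pk κ) (e.2 t)

/-- A level, given fresh ciphertexts of the input `x` of its classical computation. -/
theorem ErrorBound.expect_evalLevel_le (hE : ErrorBound A n s ε) {I : Type} [Fintype I] {T : ℝ}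
    (hT : 0 < T) {χ : Vec (Fin n)} (hχ : nsq χ = 1) (l : Level (Fin n))
    (k : KeyIdx (Fin n) → Bool) (κ : Bits (HE.keyCoins n (Lc n)))
    {C : BoolCircuit I (LevelOut l)} (hd : C.depth ≤ Lc n) (hs : C.size ≤ s) {x : I → Bool}
    (hx : C.eval x = l.output k) (w : I × Fin (HE.encCoins n (Lc n)) → Bool) (φ : Vec (Fin n)) :
    expect (evalBits n (Lc n) C (HE.evk κ) (fun i => HE.enc n (Lc n) (HE.pk κ) (x i)
        fun a => w (i, a)) >>= runLevel A n (HE.pk κ) l) φ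
      (fun e => infid (pauli (serverKey A κ l e) (l.apply χ))) ≤
      (1 + 1 / T) ^ (3 * l.tof.length) * (infid (pauli k χ) φ +
        (3 * l.tof.length : ℕ) * ((1 + T) * (126 * ε)) * nsq φ) +
        nsq φ * avg fun ρ => ind (Fails A s ε κ C x w ρ) := by
  have hε := hE.nonneg
  have hT' : 0 < 1 / T := by positivity
  have hk : nsq (pauli k χ) = 1 := by rw [nsq_pauli, hχ]
  unfold evalBits
  rw [expect_bind, expect_bind]
  refine expect_coins_le (F := fun φ => (1 + 1 / T) ^ (3 * l.tof.length) * (infid (pauli k χ) φ +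
        (3 * l.tof.length : ℕ) * ((1 + T) * (126 * ε)) * nsq φ)) (fun c φ => ?_)
    (fun ρ φ => ?_) φ
  · simp only [infid_smul, nsq_smul]
    ring
  · rw [expect_pure]
    change expect (runLevel A n (HE.pk κ) l (freshEval Lc κ C x w ρ)) _ _ ≤ _
    have hN := nsq_nonneg φ
    by_cases hF : Fails A s ε κ C x w ρ
    -- If the evaluation fails, the infidelity is bounded by the norm.
    · have h1 : expect (runLevel A n (HE.pk κ) l (freshEval Lc κ C x w ρ)) φ
          (fun e => infid (pauli (serverKey A κ l e) (l.apply χ))) ≤ nsq φ :=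
        (expect_mono _ _ fun e φ => infid_le_nsq _ _).trans_eq
          (normPreserving_runLevel A n (HE.pk κ) l _ φ)
      have h2 := infid_nonneg hk φ
      have h3 : ind (Fails A s ε κ C x w ρ) = 1 := if_pos hF
      rw [h3, mul_one]
      exact le_add_of_nonneg_of_le (by positivity) h1
    · have h3 : ind (Fails A s ε κ C x w ρ) = 0 := if_neg hF
      rw [h3, mul_zero, add_zero]
      unfold Fails at hF
      push Not at hF
      refine hF.1.expect_runLevel_le (hE.density _).1 (hE.density _).2 hT hχ l k (fun o => ?_)
        (fun o => (hF.2 o).trans (congrFun hx o)) φ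
      exact ⟨_, C.single o, _, fun j a => w ((Fintype.equivFin I).symm j, a), _,
        by rwa [C.depth_single], (C.size_single_le o).trans hs, rfl⟩

end LevelStep

/-! ### Induction over the levels -/

/-- The state after the first `i` levels. -/
def QCircuit.stateAfter {W : Type} [DecidableEq W] {L : ℕ} (C : QCircuit W L) (ψ : Vec W) :
    ℕ → Vec W
  | 0 => ψ
  | i + 1 => (C.level i).apply (C.stateAfter ψ i)

/-- The evaluation has one level more than the circuit; `C.level L` is empty. -/
theorem QCircuit.stateAfter_eq {W : Type} [DecidableEq W] {L : ℕ} (C : QCircuit W L) (ψ : Vec W) :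
    C.stateAfter ψ (L + 1) = C.apply ψ := by
  have h : ∀ i ≤ L, C.stateAfter ψ i =
      ((List.ofFn C).take i).foldl (fun φ l => l.apply φ) ψ := by
    intro i
    induction i with
    | zero => exact fun _ => rfl
    | succ i ih =>
      intro hi
      have hi' : i < (List.ofFn C).length := by simpa using hi
      rw [List.take_add_one, List.foldl_append, ← ih (by omega), stateAfter,
        List.getElem?_eq_getElem hi']
      simp [level, show i < L from hi]
  change (C.level L).apply (C.stateAfter ψ L) = _
  rw [h L le_rfl, List.take_of_length_le (by simp)]
  unfold level
  rw [dif_neg (lt_irrefl L)]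
  rfl

theorem QCircuit.nsq_stateAfter {W : Type} [Fintype W] [DecidableEq W] {L : ℕ} (C : QCircuit W L)
    (ψ : Vec W) : ∀ i, nsq (C.stateAfter ψ i) = nsq ψ
  | 0 => rfl
  | i + 1 => by rw [stateAfter, Level.nsq_apply, nsq_stateAfter]

section Levels

variable {HE : LeveledHE} {Lc : ℕ → ℕ} {A : AltScheme HE Lc} {n s : ℕ} {ε : ℝ}

theorem normPreserving_encBits {W : Type} [Fintype W] [DecidableEq W] (n L : ℕ) {I : Type}
    [Fintype I] [DecidableEq I] (pk : Bits (HE.pkLen n L)) (x : I → Bool) :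
    NormPreserving (encBits n L pk x : QProg W _) :=
  (normPreserving_coins _).bind fun _ => normPreserving_pure _

theorem normPreserving_evalBits {W : Type} [Fintype W] [DecidableEq W] (n L : ℕ) {I O : Type}
    [Fintype I] [Fintype O] [DecidableEq O] (C : BoolCircuit I O) (evk : Bits (HE.evkLen n L))
    (c : I → Bits (HE.ctLen n L)) : NormPreserving (evalBits n L C evk c : QProg W _) :=
  (normPreserving_coins _).bind fun _ => normPreserving_pure _

theorem expect_encBits_le {W : Type} [Fintype W] [DecidableEq W] {L : ℕ} {I : Type}
    [Fintype I] [DecidableEq I] {pk : Bits (HE.pkLen n L)} {x : I → Bool}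
    {Q : (I → Bits (HE.ctLen n L)) → Vec W → ℝ} {F : Vec W → ℝ}
    (hF : ∀ (c : ℂ) φ, F (c • φ) = ‖c‖ ^ 2 * F φ) {B : (I × Fin (HE.encCoins n L) → Bool) → ℝ}
    (h : ∀ r φ, Q (fun j => HE.enc n L pk (x j) fun i => r (j, i)) φ ≤ F φ + nsq φ * B r)
    (φ : Vec W) : expect (encBits n L pk x) φ Q ≤ F φ + nsq φ * avg B := by
  unfold encBits
  rw [expect_bind]
  refine expect_coins_le hF (fun r φ => ?_) φ
  rw [expect_pure]
  exact h r φ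

theorem normPreserving_runUpTo (V : LevelCircuits A) {L : ℕ} (C : QCircuit (Fin n) L)
    (pk : Bits (HE.pkLen n (Lc n))) (e : EvkIdx A n L → Bool)
    (c : KeyIdx (Fin n) → Bits (HE.ctLen n (Lc n))) :
    ∀ (i : ℕ) (h : i ≤ L), NormPreserving (runUpTo V C pk e c i h)
  | 0, _ => (normPreserving_evalBits _ _ _ _ _).bind fun _ => normPreserving_runLevel _ _ _ _ _
  | i + 1, h => (normPreserving_runUpTo V C pk e c i _).bind fun _ =>
      (normPreserving_encBits _ _ _ _).bind fun _ => (normPreserving_encBits _ _ _ _).bind fun _ =>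
      (normPreserving_encBits _ _ _ _).bind fun _ =>
      (normPreserving_evalBits _ _ _ _ _).bind fun _ => normPreserving_runLevel _ _ _ _ _

/-- The computation up to level `i` does not use the keys of later levels. -/
theorem runUpTo_congr (V : LevelCircuits A) {L : ℕ} (C : QCircuit (Fin n) L)
    {pk pk' : Bits (HE.pkLen n (Lc n))} {e e' : EvkIdx A n L → Bool}
    (c : KeyIdx (Fin n) → Bits (HE.ctLen n (Lc n))) :
    ∀ (i : ℕ) (h : i ≤ L) (_ : ∀ j, j.1 ≤ i → evkAt e j = evkAt e' j)
      (_ : ∀ j, j.1 ≤ i → pkAt pk e j = pkAt pk' e' j)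
      (_ : ∀ j, j.1 < i → encKeyAt e j = encKeyAt e' j),
      runUpTo V C pk e c i h = runUpTo V C pk' e' c i h
  | 0, h, he, hp, _ => by
    have h0 := hp 0 le_rfl
    change pk = pk' at h0
    rw [runUpTo, runUpTo, he 0 le_rfl, h0]
  | i + 1, h, he, hp, hk => by
    rw [runUpTo, runUpTo, runUpTo_congr V C c i (Nat.le_of_succ_le h)
      (fun j hj => he j (hj.trans (Nat.le_succ i))) (fun j hj => hp j (hj.trans (Nat.le_succ i)))
      (fun j hj => hk j (hj.trans (Nat.lt_succ_self i))), hp ⟨i, by omega⟩ (Nat.le_succ i),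
      hp ⟨i + 1, by omega⟩ le_rfl, he ⟨i + 1, by omega⟩ le_rfl, hk ⟨i, by omega⟩ (Nat.lt_succ_self i)]

theorem pkAt_makeEvk {L : ℕ} (κ : KeyCoinIdx A n L → Bool) (i : Fin (L + 1)) :
    pkAt (HE.pk (coinsAt κ 0)) (makeEvk κ) i = HE.pk (coinsAt κ i) := by
  cases i using Fin.cases <;> rfl

/-- The input of the classical computation that follows a level. -/
def nextInput (A : AltScheme HE Lc) {l : Level (Fin n)} (κ : Bits (HE.keyCoins n (Lc n)))
    (e : ServerData A n l) : NextIn A n l → Bool :=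
  Sum.elim (Sum.elim (HE.sk κ) (Sum.elim (A.trapdoor n κ) (HE.pk κ)))
    (Sum.elim (fun p => e.1 p.1 p.2) fun p => e.2 p.1 p.2)

/-- The coins for the encryption of the input of the classical computation that follows a level; the
coins for the secret key and the trapdoor belong to the evaluation key. -/
abbrev NextCoins (A : AltScheme HE Lc) (l : Level (Fin n)) : Type :=
  ((Fin (HE.skLen n (Lc n)) ⊕ Fin (A.tdLen n)) × Fin (HE.encCoins n (Lc n))) ⊕
    (Fin (HE.pkLen n (Lc n)) × Fin (HE.encCoins n (Lc n))) ⊕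
    ((KeyIdx (Fin n) × Fin (HE.ctLen n (Lc n))) × Fin (HE.encCoins n (Lc n))) ⊕
    (((Fin l.tof.length × Fin 3) × RecIdx A n) × Fin (HE.encCoins n (Lc n)))

/-- The position of a coin. -/
def nextPos {l : Level (Fin n)} (p : NextIn A n l × Fin (HE.encCoins n (Lc n))) : NextCoins A l :=
  Sum.elim
    (Sum.elim (fun i => .inl (.inl i, p.2))
      (Sum.elim (fun i => .inl (.inr i, p.2)) fun i => .inr (.inl (i, p.2))))
    (Sum.elim (fun i => .inr (.inr (.inl (i, p.2)))) fun i => .inr (.inr (.inr (i, p.2)))) p.1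

theorem nextPos_injective {l : Level (Fin n)} :
    Function.Injective (nextPos : NextIn A n l × Fin (HE.encCoins n (Lc n)) → NextCoins A l) := by
  rintro ⟨(i | i | i) | i | i, a⟩ ⟨(j | j | j) | j | j, b⟩ h <;> simp_all [nextPos]

/-- The coins of the key pair of level `i + 1` and the coins for the ciphertexts of the secret key and
the trapdoor of level `i`. -/
def nextBlock {L i : ℕ} (hi : i + 1 ≤ L) :
    Fin (HE.keyCoins n (Lc n)) ⊕
      ((Fin (HE.skLen n (Lc n)) ⊕ Fin (A.tdLen n)) × Fin (HE.encCoins n (Lc n))) ↪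
      KeyCoinIdx A n L where
  toFun := Sum.elim (fun b => .inl (⟨i + 1, by omega⟩, b)) fun p => .inr (⟨i, by omega⟩, p.1, p.2)
  inj' := by
    rintro (a | a) (b | b) h
    · simpa using h
    · simp at h
    · simp at h
    · simp only [Sum.elim_inr, Sum.inr.injEq, Prod.mk.injEq, true_and] at h
      exact congrArg _ (Prod.ext h.1 h.2)

section Block

variable {L i : ℕ} (hi : i + 1 ≤ L)
  (b : Fin (HE.keyCoins n (Lc n)) ⊕
      ((Fin (HE.skLen n (Lc n)) ⊕ Fin (A.tdLen n)) × Fin (HE.encCoins n (Lc n))) → Bool)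
  (κ : KeyCoinIdx A n L → Bool)

theorem coinsAt_nextBlock_self : coinsAt (glue (nextBlock hi) b κ) ⟨i + 1, by omega⟩ =
    fun a => b (.inl a) :=
  funext fun a => glue_apply (nextBlock hi) b κ (.inl a)

theorem coinsAt_nextBlock_of_le {j : Fin (L + 1)} (hj : j.1 ≤ i) :
    coinsAt (glue (nextBlock hi) b κ) j = coinsAt κ j := by
  funext a
  refine glue_of_notMem ?_
  rintro (c | c) h
  · change (Sum.inl (⟨i + 1, by omega⟩, c) : KeyCoinIdx A n L) = _ at h
    simp only [Sum.inl.injEq, Prod.mk.injEq] at h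
    have := congrArg Fin.val h.1
    simp at this
    omega
  · simp [nextBlock] at h

theorem glue_nextBlock_self (p) : glue (nextBlock hi) b κ (.inr (⟨i, by omega⟩, p.1, p.2)) =
    b (.inr p) := glue_apply (nextBlock hi) b κ (.inr p)

/-- The ciphertexts of earlier secret keys and trapdoors are not affected. -/
theorem encKeyAt_nextBlock_of_lt {j : Fin L} (hj : j.1 < i) :
    encKeyAt (makeEvk (glue (nextBlock hi) b κ)) j = encKeyAt (makeEvk κ) j := by
  funext x y
  change HE.enc _ _ _ (Sum.elim _ _ _) _ _ = HE.enc _ _ _ (Sum.elim _ _ _) _ _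
  rw [coinsAt_nextBlock_of_le hi b κ (j := j.succ) (by simpa using hj),
    coinsAt_nextBlock_of_le hi b κ (j := j.castSucc) (by simpa using hj.le)]
  congr 1
  funext a
  refine glue_of_notMem ?_
  rintro (c | c) h
  · simp [nextBlock] at h
  · change (Sum.inr (⟨i, by omega⟩, c.1, c.2) : KeyCoinIdx A n L) = _ at h
    simp only [Sum.inr.injEq, Prod.mk.injEq] at h
    have := congrArg Fin.val h.1
    simp at this
    omega

end Block

/-- The probability of a failure in a level but the first, over the coins tossed by the server. -/
def failProb (V : LevelCircuits A) (s : ℕ) (ε : ℝ) (l l' : Level (Fin n))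
    (κ κ' : Bits (HE.keyCoins n (Lc n)))
    (u : (Fin (HE.skLen n (Lc n)) ⊕ Fin (A.tdLen n)) × Fin (HE.encCoins n (Lc n)) → Bool)
    (e : ServerData A n l) : ℝ :=
  avg fun r₁ => avg fun r₂ => avg fun r₃ => avg fun ρ =>
    ind (Fails A s ε κ' (V.next n l l') (nextInput A κ e)
      (fun p => Sum.elim u (Sum.elim r₁ (Sum.elim r₂ r₃)) (nextPos p)) ρ)

/-- Whatever the server data of level `l` are, the evaluation in the next level rarely fails, as the
key pair and all ciphertexts of the next level use independent coins. -/
theorem ErrorBound.avg_failProb_le (hE : ErrorBound A n s ε) {V : LevelCircuits A} (hV : V.Valid)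
    {l l' : Level (Fin n)} (hs : (V.next n l l').size ≤ s) (κ : Bits (HE.keyCoins n (Lc n)))
    (e : ServerData A n l) :
    (avg fun b : Fin (HE.keyCoins n (Lc n)) ⊕
      ((Fin (HE.skLen n (Lc n)) ⊕ Fin (A.tdLen n)) × Fin (HE.encCoins n (Lc n))) → Bool =>
        failProb V s ε l l' κ (fun a => b (.inl a)) (fun p => b (.inr p)) e) ≤
      (s + 1 : ℕ) * ε := by
  have h := hE.avg_fails_le (J := Fin (HE.keyCoins n (Lc n)) ⊕ NextCoins A l ⊕
      (Σ o : LevelOut l', Fin (HE.evalCoins n (Lc n) ((V.next n l l').single o))))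
    (C := V.next n l l') (hV.2.2.2.1 n l l') hs (nextInput A κ e) (f := Sum.inl)
    (g := fun p => .inr (.inl (nextPos p))) (h := fun p => .inr (.inr p)) (by
      rintro (a | a | a) (b | b | b) h
      · simpa using h
      · simp at h
      · simp at h
      · simp at h
      · simp only [Sum.elim_inr, Sum.elim_inl, Sum.inr.injEq, Sum.inl.injEq] at h
        rw [nextPos_injective h]
      · simp at h
      · simp at h
      · simp at h
      · simpa using h)
  refine le_trans (le_of_eq ?_) h
  simp only [avg_sumElim, failProb, Sum.elim_inl, Sum.elim_inr]

/-- One level but the first: encryption of the server data under the next key, homomorphic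
computation of the Pauli keys and controls, and the quantum part of the level. -/
theorem ErrorBound.expect_nextLevel_le (hE : ErrorBound A n s ε) {V : LevelCircuits A}
    (hV : V.Valid) {l l' : Level (Fin n)} (hs : (V.next n l l').size ≤ s) {T : ℝ} (hT : 0 < T)
    {χ : Vec (Fin n)} (hχ : nsq χ = 1) (κ κ' : Bits (HE.keyCoins n (Lc n)))
    (u : (Fin (HE.skLen n (Lc n)) ⊕ Fin (A.tdLen n)) × Fin (HE.encCoins n (Lc n)) → Bool)
    (e : ServerData A n l) (φ : Vec (Fin n)) :
    expect (do
      let cpk ← encBits n (Lc n) (HE.pk κ') (HE.pk κ)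
      let cc ← encBits n (Lc n) (HE.pk κ')
        fun x : KeyIdx (Fin n) × Fin (HE.ctLen n (Lc n)) => e.1 x.1 x.2
      let ce ← encBits n (Lc n) (HE.pk κ')
        fun x : (Fin l.tof.length × Fin 3) × RecIdx A n => e.2 x.1 x.2
      let c' ← evalBits n (Lc n) (V.next n l l') (HE.evk κ')
        (Sum.elim (Sum.elim (fun j => HE.enc n (Lc n) (HE.pk κ') (HE.sk κ j)
            fun a => u (.inl j, a))
          (Sum.elim (fun j => HE.enc n (Lc n) (HE.pk κ') (A.trapdoor n κ j)
            fun a => u (.inr j, a)) cpk)) (Sum.elim cc ce))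
      runLevel A n (HE.pk κ') l' c') φ
      (fun e => infid (pauli (serverKey A κ' l' e) (l'.apply χ))) ≤
    (1 + 1 / T) ^ (3 * l'.tof.length) * (infid (pauli (serverKey A κ l e) χ) φ +
        (3 * l'.tof.length : ℕ) * ((1 + T) * (126 * ε)) * nsq φ) +
        nsq φ * failProb V s ε l l' κ κ' u e := by
  have hF : ∀ (c : ℂ) φ, (1 + 1 / T) ^ (3 * l'.tof.length) *
      (infid (pauli (serverKey A κ l e) χ) (c • φ) +
        (3 * l'.tof.length : ℕ) * ((1 + T) * (126 * ε)) * nsq (c • φ)) =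
      ‖c‖ ^ 2 * ((1 + 1 / T) ^ (3 * l'.tof.length) * (infid (pauli (serverKey A κ l e) χ) φ +
        (3 * l'.tof.length : ℕ) * ((1 + T) * (126 * ε)) * nsq φ)) := fun c φ => by
    rw [infid_smul, nsq_smul]
    ring
  unfold failProb
  rw [expect_bind]
  -- The coins of the three encryptions are tossed one after the other.
  refine expect_encBits_le (F := fun φ => (1 + 1 / T) ^ (3 * l'.tof.length) *
    (infid (pauli (serverKey A κ l e) χ) φ +
        (3 * l'.tof.length : ℕ) * ((1 + T) * (126 * ε)) * nsq φ)) hF (fun r₁ φ => ?_) φ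
  rw [expect_bind]
  refine expect_encBits_le (F := fun φ => (1 + 1 / T) ^ (3 * l'.tof.length) *
    (infid (pauli (serverKey A κ l e) χ) φ +
        (3 * l'.tof.length : ℕ) * ((1 + T) * (126 * ε)) * nsq φ)) hF (fun r₂ φ => ?_) φ
  rw [expect_bind]
  refine expect_encBits_le (F := fun φ => (1 + 1 / T) ^ (3 * l'.tof.length) *
    (infid (pauli (serverKey A κ l e) χ) φ +
        (3 * l'.tof.length : ℕ) * ((1 + T) * (126 * ε)) * nsq φ)) hF (fun r₃ φ => ?_) φ
  refine le_trans (le_of_eq ?_) (hE.expect_evalLevel_le hT hχ l' (serverKey A κ l e) κ'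
    (hV.2.2.2.1 n l l') hs (x := nextInput A κ e) (funext fun o => ?_)
    (fun p => Sum.elim u (Sum.elim r₁ (Sum.elim r₂ r₃)) (nextPos p)) φ)
  · congr 3
    funext x
    rcases x with (x | x | x) | x | x <;> rfl
  · rw [hV.2.1]
    rfl

variable {L : ℕ}

/-- The number of encrypted CNOT operations up to level `i`. -/
def opCount (C : QCircuit (Fin n) L) (i : ℕ) : ℕ :=
  ∑ j ∈ Finset.range (i + 1), 3 * (C.level j).tof.length

/-- The error of the computation up to level `i`, averaged over the keys. -/
theorem ErrorBound.avg_runUpTo_le (hE : ErrorBound A n s ε) {V : LevelCircuits A}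
    (hV : V.Valid) (C : QCircuit (Fin n) L) (hs₀ : (V.first n (C.level 0)).size ≤ s)
    (hs : ∀ i, (V.next n (C.level i) (C.level (i + 1))).size ≤ s) {T : ℝ} (hT : 0 < T)
    {ψ : Vec (Fin n)} (hψ : nsq ψ = 1) (k : KeyIdx (Fin n) → Bool) {φ : Vec (Fin n)}
    (hφ : infid (pauli k ψ) φ = 0) : ∀ (i : ℕ) (hi : i ≤ L),
    (avg fun w : KeyIdx (Fin n) × Fin (HE.encCoins n (Lc n)) → Bool =>
      avg fun κ : KeyCoinIdx A n L → Bool =>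
        expect (runUpTo V C (HE.pk (coinsAt κ 0)) (makeEvk κ)
          (fun j => HE.enc n (Lc n) (HE.pk (coinsAt κ 0)) (k j) fun a => w (j, a)) i hi) φ
          (fun e => infid (pauli (serverKey A (coinsAt κ ⟨i, by omega⟩) (C.level i) e)
            (C.stateAfter ψ (i + 1))))) ≤
      (1 + 1 / T) ^ opCount C i * (opCount C i * ((1 + T) * (126 * ε)) +
        (i + 1 : ℕ) * ((s + 1 : ℕ) * ε)) * nsq φ
  | 0, hi => by
    have hε := hE.nonneg
    have hT' : 0 < 1 / T := by positivity
    have h0 : opCount C 0 = 3 * (C.level 0).tof.length := by simp [opCount]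
    have hN := nsq_nonneg φ
    have h1 : (avg fun w : KeyIdx (Fin n) × Fin (HE.encCoins n (Lc n)) → Bool =>
        avg fun κ : KeyCoinIdx A n L → Bool => avg fun ρ =>
          ind (Fails A s ε (coinsAt κ 0) (V.first n (C.level 0)) k w ρ)) ≤ (s + 1 : ℕ) * ε := by
      have h := hE.avg_fails_le (J := (KeyIdx (Fin n) × Fin (HE.encCoins n (Lc n))) ⊕
          KeyCoinIdx A n L ⊕ (Σ o : LevelOut (C.level 0),
            Fin (HE.evalCoins n (Lc n) ((V.first n (C.level 0)).single o))))
        (C := V.first n (C.level 0)) (hV.2.2.1 n _) hs₀ k (f := fun b => .inr (.inl (.inl (0, b))))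
        (g := Sum.inl) (h := fun p => .inr (.inr p)) (by
          rintro (a | a | a) (b | b | b) h <;> simp_all)
      refine le_trans (le_of_eq ?_) h
      simp only [avg_sumElim, Sum.elim_inl, Sum.elim_inr]
      rfl
    have h2 : ∀ (w : KeyIdx (Fin n) × Fin (HE.encCoins n (Lc n)) → Bool)
        (κ : KeyCoinIdx A n L → Bool), expect (runUpTo V C (HE.pk (coinsAt κ 0)) (makeEvk κ)
          (fun j => HE.enc n (Lc n) (HE.pk (coinsAt κ 0)) (k j) fun a => w (j, a)) 0 hi) φ
          (fun e => infid (pauli (serverKey A (coinsAt κ 0) (C.level 0) e)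
            (C.stateAfter ψ 1))) ≤
        (1 + 1 / T) ^ opCount C 0 * (opCount C 0 * ((1 + T) * (126 * ε)) * nsq φ) +
          nsq φ * avg fun ρ =>
            ind (Fails A s ε (coinsAt κ 0) (V.first n (C.level 0)) k w ρ) := by
      intro w κ
      have h := hE.expect_evalLevel_le hT hψ (C.level 0) k (coinsAt κ 0)
        (hV.2.2.1 n (C.level 0)) hs₀ (funext fun o => congrFun (hV.1 n (C.level 0) k) o) w φ
      rw [hφ, zero_add, ← h0] at h
      exact h
    calc _ ≤ avg fun w : KeyIdx (Fin n) × Fin (HE.encCoins n (Lc n)) → Bool =>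
          avg fun κ : KeyCoinIdx A n L → Bool =>
          (1 + 1 / T) ^ opCount C 0 * (opCount C 0 * ((1 + T) * (126 * ε)) * nsq φ) +
          nsq φ * avg fun ρ =>
            ind (Fails A s ε (coinsAt κ 0) (V.first n (C.level 0)) k w ρ) :=
          avg_mono fun w => avg_mono fun κ => h2 w κ
      _ = (1 + 1 / T) ^ opCount C 0 * (opCount C 0 * ((1 + T) * (126 * ε)) * nsq φ) +
          nsq φ * avg fun w : KeyIdx (Fin n) × Fin (HE.encCoins n (Lc n)) → Bool =>
            avg fun κ : KeyCoinIdx A n L → Bool => avg fun ρ =>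
            ind (Fails A s ε (coinsAt κ 0) (V.first n (C.level 0)) k w ρ) := by
          simp only [avg_add, avg_const, avg_mul_left]
      _ ≤ (1 + 1 / T) ^ opCount C 0 * (opCount C 0 * ((1 + T) * (126 * ε)) * nsq φ) +
          (1 + 1 / T) ^ opCount C 0 * (nsq φ * ((s + 1 : ℕ) * ε)) := by
          refine add_le_add le_rfl ?_
          have h3 : 1 ≤ (1 + 1 / T) ^ opCount C 0 := one_le_pow₀ (by linarith)
          refine (mul_le_mul_of_nonneg_left h1 hN).trans (le_mul_of_one_le_left (by positivity) h3)
      _ = _ := by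
          push_cast
          ring
  | i + 1, hi => by
    have ih := avg_runUpTo_le hE hV C hs₀ hs hT hψ k hφ i (by omega)
    have hε := hE.nonneg
    have hT' : 0 < 1 / T := by positivity
    have hN := nsq_nonneg φ
    have hcount : opCount C (i + 1) = opCount C i + 3 * (C.level (i + 1)).tof.length := by
      rw [opCount, Finset.sum_range_succ]
      rfl
    have hχ : nsq (C.stateAfter ψ (i + 1)) = 1 := by rw [C.nsq_stateAfter, hψ]
    set m := 3 * (C.level (i + 1)).tof.length
    set δ := (1 + T) * (126 * ε)
    let P (w : KeyIdx (Fin n) × Fin (HE.encCoins n (Lc n)) → Bool) (κ : KeyCoinIdx A n L → Bool) :=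
      runUpTo V C (HE.pk (coinsAt κ 0)) (makeEvk κ)
        (fun j => HE.enc n (Lc n) (HE.pk (coinsAt κ 0)) (k j) fun a => w (j, a)) i (by omega)
    let G (κ : KeyCoinIdx A n L → Bool) (e : ServerData A n (C.level i)) : ℝ :=
      failProb V s ε (C.level i) (C.level (i + 1)) (coinsAt κ ⟨i, by omega⟩)
        (coinsAt κ ⟨i + 1, by omega⟩) (fun p => κ (.inr (⟨i, by omega⟩, p.1, p.2))) e
    -- The last level is split off; `P` is the computation before it, and `G` is the probability of a
    -- failure in the last level.
    have h2 : ∀ (w : KeyIdx (Fin n) × Fin (HE.encCoins n (Lc n)) → Bool)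
        (κ : KeyCoinIdx A n L → Bool), expect (runUpTo V C (HE.pk (coinsAt κ 0)) (makeEvk κ)
          (fun j => HE.enc n (Lc n) (HE.pk (coinsAt κ 0)) (k j) fun a => w (j, a)) (i + 1) hi) φ
          (fun e => infid (pauli (serverKey A (coinsAt κ ⟨i + 1, by omega⟩) (C.level (i + 1)) e)
            (C.stateAfter ψ (i + 1 + 1)))) ≤
        (1 + 1 / T) ^ m * (expect (P w κ) φ
          (fun e => infid (pauli (serverKey A (coinsAt κ ⟨i, by omega⟩) (C.level i) e)
            (C.stateAfter ψ (i + 1)))) + m * δ * nsq φ) +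
          expect (P w κ) φ fun e φ => nsq φ * G κ e := by
      intro w κ
      have hnp : expect (P w κ) φ (fun _ => nsq) = nsq φ := normPreserving_runUpTo V C _ _ _ _ _ φ
      rw [runUpTo, expect_bind]
      simp only [pkAt_makeEvk]
      refine (expect_mono (P w κ) φ fun e φ => hE.expect_nextLevel_le hV (hs i) hT hχ
        (coinsAt κ ⟨i, by omega⟩) (coinsAt κ ⟨i + 1, by omega⟩)
        (fun p => κ (.inr (⟨i, by omega⟩, p.1, p.2))) e φ).trans (le_of_eq ?_)
      rw [expect_add, expect_mul_left, expect_add, expect_mul_left, hnp]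
    have h1 : (avg fun w : KeyIdx (Fin n) × Fin (HE.encCoins n (Lc n)) → Bool =>
        avg fun κ : KeyCoinIdx A n L → Bool => expect (P w κ) φ fun e φ => nsq φ * G κ e) ≤
        nsq φ * ((s + 1 : ℕ) * ε) := by
      rw [← avg_const (κ := KeyIdx (Fin n) × Fin (HE.encCoins n (Lc n)))
        (nsq φ * ((s + 1 : ℕ) * ε))]
      refine avg_mono fun w => ?_
      -- The coins of the next key pair and of the ciphertexts of the secret key and trapdoor are not
      -- used by the computation before. They are averaged first.
      rw [avg_glue (nextBlock hi),
        ← avg_const (κ := KeyCoinIdx A n L) (nsq φ * ((s + 1 : ℕ) * ε))]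
      refine avg_mono fun κ => ?_
      have h3 : ∀ b, P w (glue (nextBlock hi) b κ) = P w κ := by
        intro b
        have h00 : coinsAt (glue (nextBlock hi) b κ) 0 = coinsAt κ 0 :=
          coinsAt_nextBlock_of_le hi b κ (Nat.zero_le i)
        simp only [P]
        rw [h00]
        refine runUpTo_congr V C _ i _ (fun j hj => ?_) (fun j hj => ?_) (fun j hj => ?_)
        · funext x
          change HE.evk (coinsAt _ j) x = HE.evk (coinsAt _ j) x
          rw [coinsAt_nextBlock_of_le hi b κ hj]
        · have h := pkAt_makeEvk (glue (nextBlock hi) b κ) j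
          rw [h00] at h
          rw [h, pkAt_makeEvk, coinsAt_nextBlock_of_le hi b κ hj]
        · exact encKeyAt_nextBlock_of_lt hi b κ hj
      have h4 : ∀ b e, G (glue (nextBlock hi) b κ) e =
          failProb V s ε (C.level i) (C.level (i + 1)) (coinsAt κ ⟨i, by omega⟩)
            (fun a => b (.inl a)) (fun p => b (.inr p)) e := by
        intro b e
        simp only [G]
        rw [coinsAt_nextBlock_of_le hi b κ (j := ⟨i, by omega⟩) le_rfl, coinsAt_nextBlock_self]
        congr 1
        funext p
        exact glue_nextBlock_self hi b κ p
      simp only [h3, h4]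
      rw [avg_expect]
      calc _ ≤ expect (P w κ) φ fun _ φ => ((s + 1 : ℕ) * ε) * nsq φ := by
            refine expect_mono _ _ fun e φ => ?_
            rw [avg_mul_left, mul_comm]
            exact mul_le_mul_of_nonneg_right (hE.avg_failProb_le hV (hs i) _ e) (nsq_nonneg φ)
        _ = nsq φ * ((s + 1 : ℕ) * ε) := by
            rw [expect_mul_left, mul_comm]
            congr 1
            exact normPreserving_runUpTo V C _ _ _ _ _ φ
    calc _ ≤ avg fun w : KeyIdx (Fin n) × Fin (HE.encCoins n (Lc n)) → Bool =>
          avg fun κ : KeyCoinIdx A n L → Bool => (1 + 1 / T) ^ m * (expect (P w κ) φ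
          (fun e => infid (pauli (serverKey A (coinsAt κ ⟨i, by omega⟩) (C.level i) e)
            (C.stateAfter ψ (i + 1)))) + m * δ * nsq φ) +
          expect (P w κ) φ fun e φ => nsq φ * G κ e :=
          avg_mono fun w => avg_mono fun κ => h2 w κ
      _ = (1 + 1 / T) ^ m * ((avg fun w : KeyIdx (Fin n) × Fin (HE.encCoins n (Lc n)) → Bool =>
          avg fun κ : KeyCoinIdx A n L → Bool => expect (P w κ) φ
          (fun e => infid (pauli (serverKey A (coinsAt κ ⟨i, by omega⟩) (C.level i) e)
            (C.stateAfter ψ (i + 1))))) + m * δ * nsq φ) +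
          avg fun w : KeyIdx (Fin n) × Fin (HE.encCoins n (Lc n)) → Bool =>
          avg fun κ : KeyCoinIdx A n L → Bool => expect (P w κ) φ fun e φ => nsq φ * G κ e := by
          simp only [avg_add, avg_const, avg_mul_left]
      _ ≤ (1 + 1 / T) ^ m * ((1 + 1 / T) ^ opCount C i * (opCount C i * δ +
            (i + 1 : ℕ) * ((s + 1 : ℕ) * ε)) * nsq φ +
            (1 + 1 / T) ^ opCount C i * (m * δ * nsq φ)) +
          (1 + 1 / T) ^ (m + opCount C i) * (nsq φ * ((s + 1 : ℕ) * ε)) := by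
          have h3 : ∀ N : ℕ, 1 ≤ (1 + 1 / T) ^ N := fun N => one_le_pow₀ (by linarith)
          have h4 : 0 ≤ m * δ * nsq φ := by positivity
          have h5 := le_mul_of_one_le_left h4 (h3 (opCount C i))
          have h6 : 0 ≤ nsq φ * ((s + 1 : ℕ) * ε) := by positivity
          have h7 := h1.trans (le_mul_of_one_le_left h6 (h3 (m + opCount C i)))
          exact add_le_add (mul_le_mul_of_nonneg_left (add_le_add ih h5) (by positivity)) h7
      _ = _ := by
          rw [hcount]
          push_cast
          ring

end Levels

/-! ### Correctness of the scheme -/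

theorem Negligible.add {μ ν : ℕ → ℝ} (hμ : Negligible μ) (hν : Negligible ν) :
    Negligible fun n => μ n + ν n :=
  Asymptotics.SuperpolynomialDecay.add hμ hν

theorem Negligible.abs {μ : ℕ → ℝ} (hμ : Negligible μ) : Negligible fun n => |μ n| := by
  intro k
  have h := (hμ k).abs
  rw [abs_zero] at h
  refine h.congr fun n => ?_
  rw [abs_mul, abs_of_nonneg (by positivity)]

theorem Negligible.sqrt {μ : ℕ → ℝ} (hμ : Negligible μ) :
    Negligible fun n => Real.sqrt (μ n) := by
  intro k
  have h := (hμ (2 * k)).sqrt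
  rw [Real.sqrt_zero] at h
  refine h.congr fun n => ?_
  rw [Real.sqrt_mul (by positivity), mul_comm 2 k, pow_mul, Real.sqrt_sq (by positivity)]

section Final

variable {HE : LeveledHE} {Lc : ℕ → ℕ} {A : AltScheme HE Lc} {n s : ℕ} {ε : ℝ}

theorem AltScheme.Capable.mono {κ : Bits (HE.keyCoins n (Lc n))} {ε' : ℝ}
    (h : A.Capable n s ε κ) (hε : ε ≤ ε') : A.Capable n s ε' κ := by
  obtain ⟨h1, h2, h3, h4⟩ := h
  refine ⟨h1.trans hε, h2.trans hε, h3.trans hε, fun c hc => ?_⟩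
  obtain ⟨g1, g2, g3, g4⟩ := h4 c hc
  exact ⟨g1, g2.trans hε, g3.trans hε, g4.trans hε⟩

/-- Correctness and quantum capability provide negligible error bounds. -/
theorem exists_errorBound (hHE : HE.Correct) (hLc : PolyBounded Lc) (hA : A.IsQuantumCapable)
    (S : Polynomial ℕ) :
    ∃ ε : ℕ → ℝ, Negligible ε ∧ ∀ n, ErrorBound A n (S.eval n) (ε n) := by
  obtain ⟨ν₁, hν₁, h₁⟩ := hHE Lc hLc S
  obtain ⟨ν₂, hν₂, h₂⟩ := hA.2.2 S
  refine ⟨fun n => |ν₁ n| + |ν₂ n|, hν₁.abs.add hν₂.abs, fun n => ?_⟩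
  have hle₁ : ν₁ n ≤ |ν₁ n| + |ν₂ n| := by
    linarith [le_abs_self (ν₁ n), abs_nonneg (ν₂ n)]
  have hle₂ : ν₂ n ≤ |ν₁ n| + |ν₂ n| := by
    linarith [le_abs_self (ν₂ n), abs_nonneg (ν₁ n)]
  exact
    { density := hA.2.1 n
      capable := (avg_mono fun κ => ind_mono fun h h' => h (h'.mono hle₂)).trans
        ((h₂ n).trans hle₂)
      correct := fun l f μ hd hs => (h₁ n l f μ hd hs).trans hle₁ }

theorem QCircuit.sum_size_level {W : Type} {L : ℕ} (C : QCircuit W L) :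
    ∑ j ∈ Finset.range (L + 1), (C.level j).size = C.size := by
  rw [Finset.sum_range_succ, Finset.sum_range, QCircuit.size]
  have h1 : (C.level L).size = 0 := by
    unfold level
    rw [dif_neg (lt_irrefl L)]
    rfl
  rw [h1, add_zero]
  refine Finset.sum_congr rfl fun i _ => ?_
  unfold level
  rw [dif_pos i.2]

theorem QCircuit.size_level_le {W : Type} {L : ℕ} (C : QCircuit W L) (i : ℕ) :
    (C.level i).size ≤ C.size := by
  by_cases hi : i < L
  · rw [← C.sum_size_level]
    exact Finset.single_le_sum (f := fun j => (C.level j).size) (fun _ _ => Nat.zero_le _)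
      (Finset.mem_range.2 (by omega))
  · unfold level
    rw [dif_neg hi]
    exact Nat.zero_le _

theorem opCount_le {L : ℕ} (C : QCircuit (Fin n) L) : opCount C L ≤ 3 * C.size := by
  rw [← C.sum_size_level, opCount, Finset.mul_sum]
  exact Finset.sum_le_sum fun j _ => Nat.mul_le_mul_left _ (Nat.le_add_left _ _)

/-- With the choice `T = M + 1`, the factors `1 + 1 / T` of at most `M` operations are harmless. -/
theorem one_add_pow_le_three {N M : ℕ} (h : N ≤ M) : (1 + 1 / ((M : ℝ) + 1)) ^ N ≤ 3 := by
  have hM : (0 : ℝ) < M + 1 := by positivity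
  calc (1 + 1 / ((M : ℝ) + 1)) ^ N ≤ Real.exp (1 / ((M : ℝ) + 1)) ^ N := by
        refine pow_le_pow_left₀ (by positivity) ?_ N
        rw [add_comm]
        exact Real.add_one_le_exp _
    _ = Real.exp (N * (1 / ((M : ℝ) + 1))) := by rw [← Real.exp_nat_mul]
    _ ≤ Real.exp 1 := by
        refine Real.exp_le_exp.2 ?_
        rw [mul_one_div, div_le_one hM]
        have : (N : ℝ) ≤ M := by exact_mod_cast h
        linarith
    _ ≤ 3 := by
        have := Real.exp_one_lt_d9
        linarith

/-- The factor between the error of the whole computation and the error of its parts, for `L`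
levels, at most `c` gates and circuits of size at most `s`. -/
def errorFactor (L c s : ℕ) : ℕ := 3 * (3 * c * ((3 * c + 2) * 126) + (L + 1) * (s + 1))

theorem serverKey_of_eq_empty {κ : Bits (HE.keyCoins n (Lc n))} {l : Level (Fin n)}
    (hl : l = Level.empty) (e : ServerData A n l) :
    serverKey A κ l e = fun j => HE.dec n (Lc n) (HE.sk κ) (e.1 j) := by
  subst hl
  rfl

/-- The decryption of the final Pauli keys. -/
def finalKey {L : ℕ} (κ : KeyCoinIdx A n L → Bool)
    (out : KeyIdx (Fin n) × Fin (HE.ctLen n (Lc n)) → Bool) : KeyIdx (Fin n) → Bool := fun j =>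
  HE.dec n (Lc n) (HE.sk (coinsAt κ (Fin.last L))) fun b => out (j, b)

/-- The evaluation, for a state that is encrypted with the Pauli key `k`, leads to the final state
that is encrypted with the decrypted final Pauli key. -/
theorem ErrorBound.avg_eval_le {L c : ℕ} (hE : ErrorBound A n s ε) {V : LevelCircuits A}
    (hV : V.Valid) (C : QCircuit (Fin n) L) (hc : C.size ≤ c)
    (hs₀ : (V.first n (C.level 0)).size ≤ s)
    (hs : ∀ i, (V.next n (C.level i) (C.level (i + 1))).size ≤ s) {ψ : Vec (Fin n)}
    (hψ : nsq ψ = 1) (k : KeyIdx (Fin n) → Bool) (a : ℂ) :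
    (avg fun w : KeyIdx (Fin n) × Fin (HE.encCoins n (Lc n)) → Bool =>
      avg fun κ : KeyCoinIdx A n L → Bool =>
        expect ((QHE V).eval n L C (HE.pk (coinsAt κ 0)) (makeEvk κ) fun x =>
          HE.enc n (Lc n) (HE.pk (coinsAt κ 0)) (k x.1) (fun a => w (x.1, a)) x.2) (a • pauli k ψ)
          (fun out φ => infid (C.apply ψ) (pauliInv (finalKey κ out) φ))) ≤
      errorFactor L c s * ε * ‖a‖ ^ 2 := by
  have hε := hE.nonneg
  have hCψ : nsq (C.apply ψ) = 1 := by rw [← C.stateAfter_eq, C.nsq_stateAfter, hψ]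
  have hkψ : nsq (pauli k ψ) = 1 := by rw [nsq_pauli, hψ]
  -- There are at most `3 * c` encrypted CNOT operations; each contributes a factor `1 + 1 / T`.
  have hT : (0 : ℝ) < (3 * c : ℕ) + 1 := by positivity
  have h := hE.avg_runUpTo_le hV C hs₀ hs hT hψ k (infid_smul_self hkψ a) L le_rfl
  rw [nsq_smul, hkψ, mul_one, C.stateAfter_eq] at h
  have hlev : C.level L = Level.empty := by
    unfold QCircuit.level
    rw [dif_neg (lt_irrefl L)]
  refine (avg_mono fun w => avg_mono fun κ => ?_).trans (h.trans ?_)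
  · refine (expect_bind _ _ _ _).trans_le ?_
    refine expect_mono _ _ fun e φ => ?_
    refine (expect_pure _ _ _).trans_le ?_
    rw [serverKey_of_eq_empty hlev]
    have hk : finalKey κ (fun x : KeyIdx (Fin n) × Fin (HE.ctLen n (Lc n)) => e.1 x.1 x.2) =
        fun j => HE.dec n (Lc n) (HE.sk (coinsAt κ ⟨L, by omega⟩)) (e.1 j) := rfl
    rw [hk]
    set K := fun j => HE.dec n (Lc n) (HE.sk (coinsAt κ ⟨L, by omega⟩)) (e.1 j)
    have hlin : IsLinearMap ℂ (pauliInv K) :=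
      ⟨fun _ _ => funext fun _ => mul_add _ _ _, fun _ _ => funext fun _ => mul_left_comm _ _ _⟩
    have hn : ∀ φ, nsq (pauliInv K φ) = nsq φ := fun φ => by
      rw [← nsq_pauli K (pauliInv K φ), pauli_pauliInv]
    have h1 := infid_map_le hlin hn (χ := pauli K (C.apply ψ)) (by rw [nsq_pauli, hCψ]) φ
    rwa [pauliInv_pauli] at h1
  · refine mul_le_mul_of_nonneg_right ?_ (by positivity)
    have hN : opCount C L ≤ 3 * c := (opCount_le C).trans (Nat.mul_le_mul_left 3 hc)
    have hN' : (opCount C L : ℝ) ≤ (3 * c : ℕ) := by exact_mod_cast hN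
    calc _ ≤ 3 * ((3 * c : ℕ) * ((1 + (((3 * c : ℕ) : ℝ) + 1)) * (126 * ε)) +
          (L + 1 : ℕ) * ((s + 1 : ℕ) * ε)) := by
          refine mul_le_mul (one_add_pow_le_three hN) ?_ (by positivity) (by norm_num)
          gcongr
      _ = _ := by
          unfold errorFactor
          push_cast
          ring

/-- A sum over coins as an average. -/
theorem sum_eq_avg {κ : Type} [Fintype κ] [DecidableEq κ] (f : (κ → Bool) → ℝ) :
    ∑ r, f r = 2 ^ Fintype.card κ * avg f := by
  unfold avg
  field_simp

theorem normPreserving_eval (V : LevelCircuits A) {L : ℕ} (C : QCircuit (Fin n) L)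
    (pk : Bits (HE.pkLen n (Lc n))) (e : EvkIdx A n L → Bool) (c) :
    NormPreserving ((QHE V).eval n L C pk e c) :=
  (normPreserving_runUpTo V C _ _ _ _ _).bind fun _ => normPreserving_pure _

/-- The branches are weighted by the norms of their states: each coin contributes a factor `1 / √2`
to the amplitudes. The sum over the coins is turned into an average. -/
theorem expect_stateExperiment_le {L c : ℕ} (hE : ErrorBound A n s ε) {V : LevelCircuits A}
    (hV : V.Valid) (C : QCircuit (Fin n) L) (hc : C.size ≤ c)
    (hs₀ : (V.first n (C.level 0)).size ≤ s)
    (hs : ∀ i, (V.next n (C.level i) (C.level (i + 1))).size ≤ s) {ψ : Vec (Fin n)}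
    (hψ : nsq ψ = 1) :
    expect (stateExperiment V C) ψ (fun _ => infid (C.apply ψ)) ≤ errorFactor L c s * ε := by
  unfold stateExperiment encBits
  simp only [expect_bind, expect_coins, expect_op, expect_pure]
  have hlin : ∀ (k : KeyIdx (Fin n) → Bool) (a b c : ℂ),
      c • pauli k (b • a • ψ) = (c * (b * a)) • pauli k ψ := fun k a b c => by
    rw [smul_smul b a, (pauli_isLinearMap k).map_smul, smul_smul]
  simp only [hlin, sum_eq_avg, avg_mul_left]
  -- The amplitude of a branch after all coins are tossed; all branches together have total weight
  -- one.
  set a : ℂ := (1 / (Real.sqrt 2 : ℂ)) ^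
      Fintype.card (KeyIdx (Fin n) × Fin (HE.encCoins n (Lc n))) *
    ((1 / (Real.sqrt 2 : ℂ)) ^ Fintype.card (KeyIdx (Fin n)) *
      (1 / (Real.sqrt 2 : ℂ)) ^ Fintype.card (KeyCoinIdx A n L)) with ha
  have ha' : ‖a‖ ^ 2 * 2 ^ Fintype.card (KeyCoinIdx A n L) * 2 ^ Fintype.card (KeyIdx (Fin n)) *
      2 ^ Fintype.card (KeyIdx (Fin n) × Fin (HE.encCoins n (Lc n))) = 1 := by
    rw [ha, norm_mul, norm_mul, mul_pow, mul_pow, norm_one_div_sqrt_two_pow,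
      norm_one_div_sqrt_two_pow, norm_one_div_sqrt_two_pow]
    field_simp
  rw [avg_comm]
  have h1 : ∀ k : KeyIdx (Fin n) → Bool, _ := fun k => hE.avg_eval_le hV C hc hs₀ hs hψ k a
  have h2 := avg_mono h1
  rw [avg_const] at h2
  simp only [avg_comm (κ := KeyIdx (Fin n) × Fin (HE.encCoins n (Lc n)))
    (κ' := KeyCoinIdx A n L)] at h2
  have h3 := mul_le_mul_of_nonneg_left h2 (by positivity :
    (0 : ℝ) ≤ 2 ^ Fintype.card (KeyCoinIdx A n L) * 2 ^ Fintype.card (KeyIdx (Fin n)) *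
      2 ^ Fintype.card (KeyIdx (Fin n) × Fin (HE.encCoins n (Lc n))))
  refine le_trans (le_of_eq ?_) (h3.trans (le_of_eq ?_))
  · simp only [mul_assoc]
    rfl
  · linear_combination (errorFactor L c s * ε) * ha'

theorem normPreserving_stateExperiment (V : LevelCircuits A) {L : ℕ} (C : QCircuit (Fin n) L) :
    NormPreserving (stateExperiment V C) :=
  (normPreserving_coins _).bind fun _ => (normPreserving_coins _).bind fun k =>
    (normPreserving_op (nsq_pauli k)).bind fun _ => (normPreserving_encBits _ _ _ _).bind fun _ =>
    (normPreserving_eval V C _ _ _).bind fun out => normPreserving_op fun φ => by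
      rw [← nsq_pauli _ (pauliInv _ φ), pauli_pauliInv]

/-- The final state is close to `C|ψ⟩` in trace distance. -/
theorem traceDist_stateExperiment_le {L c : ℕ} (hE : ErrorBound A n s ε) {V : LevelCircuits A}
    (hV : V.Valid) (C : QCircuit (Fin n) L) (hc : C.size ≤ c)
    (hs₀ : (V.first n (C.level 0)).size ≤ s)
    (hs : ∀ i, (V.next n (C.level i) (C.level (i + 1))).size ≤ s) {ψ : Vec (Fin n)}
    (hψ : nsq ψ = 1) :
    traceDist ((stateExperiment V C).density ψ) (outer (C.apply ψ)) ≤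
      Real.sqrt (errorFactor L c s * ε) + errorFactor L c s * ε := by
  have hCψ : nsq (C.apply ψ) = 1 := by rw [← C.stateAfter_eq, C.nsq_stateAfter, hψ]
  have h := traceDist_outer_le hCψ ((stateExperiment V C ψ).map Prod.snd)
    (η := errorFactor L c s * ε)
    (by
      rw [Multiset.map_map]
      exact expect_stateExperiment_le hE hV C hc hs₀ hs hψ)
    (by
      rw [Multiset.map_map]
      exact (normPreserving_stateExperiment V C ψ).trans hψ)
  rw [Multiset.map_map] at h
  exact h

/-- Generate keys, encrypt `m` and evaluate `C`; the result consists of the coins of the key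
generation and the classical part of the output. -/
def evalExperiment (V : LevelCircuits A) {L : ℕ} (C : QCircuit (Fin n) L) (m : Bits n) :
    QProg (Fin n)
      ((KeyCoinIdx A n L → Bool) × ((KeyIdx (Fin n) × Fin (HE.ctLen n (Lc n))) → Bool)) :=
  do
    let κ ← QProg.coins (KeyCoinIdx A n L)
    let r ← QProg.coins (KeyIdx (Fin n) ⊕ (KeyIdx (Fin n) × Fin (HE.encCoins n (Lc n))))
    let c := (QHE V).enc n L ((QHE V).pk n L κ) m r
    QProg.op fun ψ v => ψ (bxor v c.1)
    let out ← (QHE V).eval n L C ((QHE V).pk n L κ) ((QHE V).evk n L κ) c.2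
    pure (κ, out)

theorem normPreserving_evalExperiment (V : LevelCircuits A) {L : ℕ} (C : QCircuit (Fin n) L)
    (m : Bits n) : NormPreserving (evalExperiment V C m) :=
  (normPreserving_coins _).bind fun _ => (normPreserving_coins _).bind fun _ =>
    (normPreserving_op fun ψ => nsq_reindex (bxor_involutive _) ψ).bind fun _ =>
    (normPreserving_eval V C _ _ _).bind fun _ => normPreserving_pure _

/-- Measuring and decrypting the measured string has the same effect as decrypting the state and
measuring it. -/
theorem resultProb_experiment (V : LevelCircuits A) {L : ℕ} (C : QCircuit (Fin n) L) (m m' : Bits n)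
    (ψ : Vec (Fin n)) : ((QHE V).experiment C m).resultProb ψ m' =
      expect (evalExperiment V C m) ψ fun b φ => ‖pauliInv (finalKey b.1 b.2) φ m'‖ ^ 2 := by
  have h1 : ((QHE V).experiment C m).resultProb ψ m' =
      expect ((QHE V).experiment C m) ψ fun b φ => if b = m' then nsq φ else 0 := rfl
  rw [h1]
  unfold QuantumHE.experiment evalExperiment
  simp only [expect_bind, expect_pure]
  refine congrArg _ (funext fun κ => funext fun φ => ?_)
  refine congrArg _ (funext fun r => funext fun φ => ?_)
  refine congrArg _ (funext fun _ => funext fun φ => ?_)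
  refine congrArg _ (funext fun out => funext fun φ => ?_)
  unfold QProg.measure
  rw [expect_kraus]
  let X : Bits n := fun i => finalKey κ out (.inr i)
  have hdec : ∀ x, (QHE V).dec n L ((QHE V).sk n L κ) x out = bxor X x := fun x => rfl
  simp only [hdec]
  -- Only one measured string is decrypted to `m'`.
  rw [Finset.sum_eq_single (bxor m' X)]
  · have h2 : bxor X (bxor m' X) = m' := by
      funext i
      simp [bxor, Bool.xor_comm, Bool.xor_left_comm]
    rw [if_pos h2]
    unfold nsq
    rw [Finset.sum_eq_single (bxor m' X)]
    · change ‖if bxor m' X = bxor m' X then φ (bxor m' X) else 0‖ ^ 2 =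
        ‖sgn (fun i => finalKey κ out (.inl i)) (bxor m' X) * φ (bxor m' X)‖ ^ 2
      rw [if_pos rfl, norm_mul, norm_sgn, one_mul]
    · intro v _ hv
      simp [hv]
    · simp
  · intro x _ hx
    rw [if_neg]
    rintro rfl
    refine hx ?_
    funext i
    simp [bxor, Bool.xor_comm, Bool.xor_left_comm]
  · simp

/-- For a classical message, the state register starts with zeros, and is set to the padded message.
-/
theorem expect_evalExperiment_le {L c : ℕ} (hE : ErrorBound A n s ε) {V : LevelCircuits A}
    (hV : V.Valid) (C : QCircuit (Fin n) L) (hc : C.size ≤ c)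
    (hs₀ : (V.first n (C.level 0)).size ≤ s)
    (hs : ∀ i, (V.next n (C.level i) (C.level (i + 1))).size ≤ s) (m : Bits n) :
    expect (evalExperiment V C m) (ket fun _ => false)
      (fun b φ => infid (C.apply (ket m)) (pauliInv (finalKey b.1 b.2) φ)) ≤
        errorFactor L c s * ε := by
  unfold evalExperiment
  simp only [expect_bind, expect_coins, expect_op, expect_pure]
  set b : ℂ := (1 / (Real.sqrt 2 : ℂ)) ^
    Fintype.card (KeyIdx (Fin n) ⊕ (KeyIdx (Fin n) × Fin (HE.encCoins n (Lc n)))) *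
      (1 / (Real.sqrt 2 : ℂ)) ^ Fintype.card (KeyCoinIdx A n L) with hb
  have hb' : ‖b‖ ^ 2 * 2 ^ Fintype.card (KeyCoinIdx A n L) *
      2 ^ Fintype.card (KeyIdx (Fin n) ⊕ (KeyIdx (Fin n) × Fin (HE.encCoins n (Lc n)))) = 1 := by
    rw [hb, norm_mul, mul_pow, norm_one_div_sqrt_two_pow, norm_one_div_sqrt_two_pow]
    field_simp
  -- the padded message is the message state encrypted with the Pauli key, up to a sign
  have hst : ∀ (k : KeyIdx (Fin n) → Bool), (fun v => (b • ket fun _ => false : Vec (Fin n))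
      (bxor v (bxor (fun i => k (.inr i)) m))) =
      (b * sgn (fun i => k (.inl i)) (bxor (fun i => k (.inr i)) m)) • pauli k (ket m) := by
    intro k
    funext v
    have hv : (bxor v (bxor (fun i => k (.inr i)) m) = fun _ => false) ↔
        bxor v (fun i => k (.inr i)) = m := by
      rw [funext_iff, funext_iff]
      refine forall_congr' fun i => ?_
      simp only [bxor]
      cases v i <;> cases k (.inr i) <;> cases m i <;> simp
    simp only [Pi.smul_apply, smul_eq_mul, ket, pauli, hv]
    by_cases h : bxor v (fun i => k (.inr i)) = m
    · have h' : bxor (fun i => k (.inr i)) m = v := by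
        rw [← h]
        funext i
        simp [bxor, Bool.xor_comm, Bool.xor_left_comm]
      rw [if_pos h, h']
      linear_combination (-b) * sgn_mul_self (fun i => k (.inl i)) v
    · simp [h]
  have h1 : ∀ k : KeyIdx (Fin n) → Bool, _ := fun k => hE.avg_eval_le hV C hc hs₀ hs (nsq_ket m) k
    (b * sgn (fun i => k (.inl i)) (bxor (fun i => k (.inr i)) m))
  simp only [norm_mul, norm_sgn, mul_one] at h1
  have h2 := avg_mono h1
  rw [avg_const] at h2
  simp only [sum_eq_avg, avg_mul_left, smul_smul, ← hb]
  have h3 := mul_le_mul_of_nonneg_left h2 (by positivity :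
    (0 : ℝ) ≤ 2 ^ Fintype.card (KeyCoinIdx A n L) *
      2 ^ Fintype.card (KeyIdx (Fin n) ⊕ (KeyIdx (Fin n) × Fin (HE.encCoins n (Lc n)))))
  refine le_trans (le_of_eq ?_) (h3.trans (le_of_eq ?_))
  · rw [mul_assoc]
    congr 2
    rw [avg_comm, avg_sumElim]
    refine congrArg _ (funext fun k => congrArg _ (funext fun w => congrArg _ (funext fun κ => ?_)))
    rw [← hst k]
    rfl
  · linear_combination (errorFactor L c s * ε) * hb'

/-- The decrypted result is distributed almost like the measured output of `C`. -/
theorem sum_abs_resultProb_sub_le {L c : ℕ} (hE : ErrorBound A n s ε) {V : LevelCircuits A}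
    (hV : V.Valid) (C : QCircuit (Fin n) L) (hc : C.size ≤ c)
    (hs₀ : (V.first n (C.level 0)).size ≤ s)
    (hs : ∀ i, (V.next n (C.level i) (C.level (i + 1))).size ≤ s) (m : Bits n) :
    ∑ m' : Bits n, |((QHE V).experiment C m).resultProb (ket fun _ => false) m' -
        ‖C.apply (ket m) m'‖ ^ 2| ≤
      2 * Real.sqrt (errorFactor L c s * ε) + 2 * (errorFactor L c s * ε) := by
  have hCψ : nsq (C.apply (ket m)) = 1 := by rw [← C.stateAfter_eq, C.nsq_stateAfter, nsq_ket]
  have h := sum_abs_measure_sub_le (isParseval_single (X := Bits n)) hCψ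
    ((evalExperiment V C m (ket fun _ => false)).map fun b =>
      pauliInv (finalKey b.1.1 b.1.2) b.2) (η := errorFactor L c s * ε)
    (by
      rw [Multiset.map_map]
      exact expect_evalExperiment_le hE hV C hc hs₀ hs m)
    (by
      rw [Multiset.map_map]
      refine Eq.trans ?_ ((normPreserving_evalExperiment V C m (ket fun _ => false)).trans
        (nsq_ket fun _ => false))
      refine congrArg Multiset.sum (Multiset.map_congr rfl fun b _ => ?_)
      change nsq (pauliInv _ _) = nsq _
      rw [← nsq_pauli _ (pauliInv _ _), pauli_pauliInv])
  have hip : ∀ (m' : Bits n) (φ : Vec (Fin n)),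
      ip (fun y => if y = m' then (1 : ℂ) else 0) φ = φ m' := by
    intro m' φ
    unfold ip
    rw [Finset.sum_eq_single m'] <;> simp +contextual
  simp only [hip, Multiset.map_map] at h
  refine le_trans (le_of_eq ?_) h
  refine Finset.sum_congr rfl fun m' _ => ?_
  rw [resultProb_experiment]
  rfl

/-- Bounds for the sizes of the classical circuits of all levels of quantum circuits of polynomial
size. -/
theorem LevelCircuits.Valid.exists_size_le {V : LevelCircuits A} (hV : V.Valid)
    (p : Polynomial ℕ) : ∃ S : Polynomial ℕ, ∀ (n L : ℕ) (C : QCircuit (Fin n) L),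
      C.size ≤ p.eval n → (V.first n (C.level 0)).size ≤ S.eval n ∧
        ∀ i, (V.next n (C.level i) (C.level (i + 1))).size ≤ S.eval n := by
  obtain ⟨q, hq₀, hq⟩ := hV.2.2.2.2
  refine ⟨q.comp (Polynomial.X + 2 * p), fun n L C hC => ⟨?_, fun i => ?_⟩⟩
  · refine (hq₀ n _).trans ?_
    have h := C.size_level_le 0
    simp only [Polynomial.eval_comp, Polynomial.eval_add, Polynomial.eval_X, Polynomial.eval_mul,
      Polynomial.eval_ofNat]
    exact eval_mono q (by omega)
  · refine (hq n _ _).trans ?_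
    have h := C.size_level_le i
    have h' := C.size_level_le (i + 1)
    simp only [Polynomial.eval_comp, Polynomial.eval_add, Polynomial.eval_X, Polynomial.eval_mul,
      Polynomial.eval_ofNat]
    exact eval_mono q (by omega)

theorem negligible_errorFactor_mul {L : ℕ → ℕ} (hL : PolyBounded L) (p S : Polynomial ℕ)
    {ε : ℕ → ℝ} (hε : Negligible ε) :
    Negligible fun n => (errorFactor (L n) (p.eval n) (S.eval n) : ℝ) * ε n := by
  have hp : PolyBounded fun n => p.eval n := ⟨p, fun _ => le_rfl⟩
  have hS : PolyBounded fun n => S.eval n := ⟨S, fun _ => le_rfl⟩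
  refine Negligible.polynomial_mul ?_ hε
  exact (PolyBounded.const 3).mul (((((PolyBounded.const 3).mul hp).mul
    ((((PolyBounded.const 3).mul hp).add (.const 2)).mul (.const 126)))).add
      ((hL.add (.const 1)).mul (hS.add (.const 1))))

/-- Homomorphic evaluation of classical messages. -/
theorem QHE_correct (hHE : HE.Correct) (hLc : PolyBounded Lc) (hA : A.IsQuantumCapable)
    {V : LevelCircuits A} (hV : V.Valid) : (QHE V).Correct := by
  intro L hL p
  obtain ⟨S, hS⟩ := hV.exists_size_le p
  obtain ⟨ε, hε, hE⟩ := exists_errorBound hHE hLc hA S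
  have hη := negligible_errorFactor_mul hL p S hε
  refine ⟨_, hη.sqrt.add hη, fun n C m hC => ?_⟩
  obtain ⟨hs₀, hs⟩ := hS n (L n) C hC
  have h := sum_abs_resultProb_sub_le (hE n) hV C hC hs₀ hs m
  linarith

/-- Homomorphic evaluation of quantum states. -/
theorem QHE_finalStateCorrect (hHE : HE.Correct) (hLc : PolyBounded Lc) (hA : A.IsQuantumCapable)
    {V : LevelCircuits A} (hV : V.Valid) : FinalStateCorrect V := by
  intro L hL p
  obtain ⟨S, hS⟩ := hV.exists_size_le p
  obtain ⟨ε, hε, hE⟩ := exists_errorBound hHE hLc hA S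
  have hη := negligible_errorFactor_mul hL p S hε
  refine ⟨_, hη.sqrt.add hη, fun n C ψ hψ hC => ?_⟩
  obtain ⟨hs₀, hs⟩ := hS n (L n) C hC
  exact traceDist_stateExperiment_le (hE n) hV C hC hs₀ hs hψ

end Final

/-! ### Quantum circuits for quantum-classical processes -/

section Loads

variable {W ι R : Type} [Fintype ι] [Fintype R]

/-- The state `ψ` on the qubits `W`, with the classical input `x` and zeros on the qubits `R`. -/
def load (ψ : Vec W) (x : ι → Bool) : Vec (W ⊕ ι ⊕ R) := fun u =>
  ψ (fun i => u (.inl i)) * ket (Sum.elim x fun _ => false) fun i => u (.inr i)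

open Classical in
theorem load_apply (ψ : Vec W) (x x' : ι → Bool) (v : W → Bool) (b : R → Bool) :
    load ψ x (Sum.elim v (Sum.elim x' b)) =
      if x' = x then (if b = fun _ => false then ψ v else 0) else 0 := by
  have h : (Sum.elim x' b : ι ⊕ R → Bool) = (Sum.elim x fun _ => false) ↔
      x' = x ∧ b = fun _ => false := by
    constructor
    · exact fun h => ⟨funext fun i => congrFun h (.inl i), funext fun i => congrFun h (.inr i)⟩
    · rintro ⟨rfl, rfl⟩
      rfl
  change ψ v * ket _ (Sum.elim x' b) = _
  unfold ket
  simp only [h, mul_ite, mul_one, mul_zero]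
  split_ifs <;> simp_all

theorem load_zero (x : ι → Bool) : load (0 : Vec W) x = (0 : Vec (W ⊕ ι ⊕ R)) := by
  funext u
  simp [load]

end Loads

/-- An assignment that agrees with `z` on the image of `e` and with `u` elsewhere is `glue e z u`.
-/
theorem glue_eq {Q Q' : Type} {e : Q ↪ Q'} {z : Q → Bool} {u t : Q' → Bool}
    (h1 : ∀ i, t (e i) = z i) (h2 : ∀ j, (∀ i, e i ≠ j) → t j = u j) : glue e z u = t := by
  funext j
  by_cases h : ∃ i, e i = j
  · obtain ⟨i, rfl⟩ := h
    rw [glue_apply, h1]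
  · push Not at h
    rw [glue_of_notMem h, h2 j h]

theorem Permutes.injective {Q : Type} [Fintype Q] [DecidableEq Q] {gs : List (QGate Q)}
    {R : (Q → Bool) → (Q → Bool)} (h : Permutes gs R) : Function.Injective R := by
  intro a b hab
  by_contra hne
  have h1 := h (ket a) a
  have h2 := h (ket a) b
  rw [hab, h2] at h1
  simp [ket, Ne.symm hne] at h1

/-- The oracle of a Boolean circuit adds its value to the output qubits of a state in which the
ancillas are zero. -/
theorem Comp.exists_oracle_apply {E o : Type} [Fintype E] [DecidableEq E] [Fintype o]
    [DecidableEq o] {F : (E → Bool) → (o → Bool)} {g : ℕ} (hF : Comp F g) :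
    ∃ (n : ℕ) (U : List (QGate (OracleWires E o n))), n ≤ g ∧
      U.length ≤ 10 * g + Fintype.card o ∧
      ∀ {Q : Type} [Fintype Q] [DecidableEq Q] (e : OracleWires E o n ↪ Q) (Ψ : Vec Q),
        (∀ u k, u (e (.inr (.inr k))) = true → Ψ u = 0) → ∀ u t : Q → Bool,
        (∀ j, t (e (.inr (.inl j))) =
          xor (u (e (.inr (.inl j)))) (F (fun i => u (e (.inl i))) j)) →
        (∀ q, (∀ j, e (.inr (.inl j)) ≠ q) → t q = u q) →
        runGates (U.map (QGate.map e)) Ψ u = Ψ t := by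
  obtain ⟨n, U, R, hn, hU, hR, hRF⟩ := hF.exists_oracle
  refine ⟨n, U, hn, hU, ?_⟩
  intro Q _ _ e Ψ hΨ u t ht ht'
  have hP := hR.map e
  -- basis states with ancillas zero are permuted among themselves
  have key : ∀ p : Q → Bool, (∀ k, p (e (.inr (.inr k))) = false) →
      glue e (R fun i => p (e i)) p = glue e (Sum.elim (fun i => p (e (.inl i))) (Sum.elim
        (bxor (fun j => p (e (.inr (.inl j)))) (F fun i => p (e (.inl i)))) fun _ => false)) p := by
    intro p hp
    rw [← hRF]
    congr 2
    funext i
    rcases i with i | i | i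
    · rfl
    · rfl
    · exact hp i
  by_cases hu : ∀ k, u (e (.inr (.inr k))) = false
  · have htk : ∀ k, t (e (.inr (.inr k))) = false := fun k => by
      rw [ht' _ fun j h => by simpa using e.injective h, hu]
    have hti : ∀ i, t (e (.inl i)) = u (e (.inl i)) := fun i =>
      ht' _ fun j h => by simpa using e.injective h
    have h1 := hP Ψ t
    dsimp only at h1
    rw [key t htk] at h1
    rw [← h1]
    congr 1
    symm
    refine glue_eq ?_ ?_
    · rintro (i | i | i)
      · exact (hti i).symm
      · simp only [Sum.elim_inr, Sum.elim_inl, bxor, ht, hti]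
        simp
      · exact hu i
    · exact fun q hq => (ht' q fun j => hq _).symm
  -- A basis state with a nonzero ancilla is the image of such a state, since the permutation maps
  -- those with ancillas zero among themselves; so both sides vanish.
  · have htz : Ψ t = 0 := by
      push Not at hu
      obtain ⟨k, hk⟩ := hu
      refine hΨ t k ?_
      rw [ht' _ fun j h => by simpa using e.injective h]
      simpa using hk
    rw [htz]
    obtain ⟨p, rfl⟩ := (Finite.injective_iff_surjective.1 hP.injective) u
    rw [hP]
    by_contra hp
    have hpk : ∀ k, p (e (.inr (.inr k))) = false := fun k => by
      by_contra h
      exact hp (hΨ p k (by simpa using h))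
    refine hu fun k => ?_
    dsimp only
    rw [key p hpk, glue_apply]
    rfl

section Realizes

variable {W ι ι' o o' α β : Type} [Fintype W] [DecidableEq W] [Fintype ι] [DecidableEq ι]
  [Fintype ι'] [DecidableEq ι'] [Fintype o] [DecidableEq o] [Fintype o'] [DecidableEq o']

/-- The process `m`, which depends on classical input bits `ι`, is realized by a quantum circuit
with at most `s` ancillas and gates: if the output qubits `o` and the ancillas are zero initially,
and if all but the qubits `W` are measured finally, then the input is unchanged, and the states `K`
that belong to the values of the output and of the ancillas are the branches of `m`, up to branches
of probability zero. Results of `m` are encoded in output bits by `D`. -/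
def Realizes (m : (ι → Bool) → QProg W α) (D : (o → Bool) → α) (s : ℕ) : Prop :=
  ∃ (anc : Type) (_ : Fintype anc) (_ : DecidableEq anc)
    (gates : List (QGate (W ⊕ ι ⊕ o ⊕ anc)))
    (K : (ι → Bool) → (o → Bool) → (anc → Bool) → Vec W → Vec W),
    Fintype.card anc + gates.length ≤ s ∧
    (∀ x ψ v x' a f, runGates gates (load ψ x) (Sum.elim v (Sum.elim x' (Sum.elim a f))) =
      if x' = x then K x a f ψ v else 0) ∧
    ∀ x ψ {M : Type} [AddCommMonoid M] (G : α → Vec W → M), (∀ a, G (D a) 0 = 0) →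
      ∑ a, ∑ f, G (D a) (K x a f ψ) = ((m x ψ).map fun b => G b.1 b.2).sum

theorem Realizes.mono {m : (ι → Bool) → QProg W α} {D : (o → Bool) → α} {s s' : ℕ}
    (h : Realizes m D s) (hs : s ≤ s') : Realizes m D s' := by
  obtain ⟨anc, i1, i2, gates, K, h1, h2⟩ := h
  exact ⟨anc, i1, i2, gates, K, h1.trans hs, h2⟩

theorem Realizes.congr {m m' : (ι → Bool) → QProg W α} {D D' : (o → Bool) → α} {s : ℕ}
    (h : Realizes m D s) (hm : ∀ x, m x = m' x) (hD : ∀ a, D a = D' a) : Realizes m' D' s := by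
  obtain rfl : m = m' := funext hm
  obtain rfl : D = D' := funext hD
  exact h

theorem load_apply_sum {R S : Type} [Fintype R] [DecidableEq R] [Fintype S] [DecidableEq S]
    (ψ : Vec W) (x x' : ι → Bool) (v : W → Bool) (a : R → Bool) (f : S → Bool) :
    load ψ x (Sum.elim v (Sum.elim x' (Sum.elim a f))) =
      if x' = x then (if a = fun _ => false then (if f = fun _ => false then ψ v else 0) else 0)
        else 0 := by
  classical
  have h : (Sum.elim a f : R ⊕ S → Bool) = (fun _ => false) ↔
      a = (fun _ => false) ∧ f = fun _ => false := by
    constructor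
    · exact fun h => ⟨funext fun i => congrFun h (.inl i), funext fun i => congrFun h (.inr i)⟩
    · rintro ⟨rfl, rfl⟩
      funext i
      cases i <;> rfl
  rw [load_apply]
  simp only [h]
  split_ifs <;> simp_all

theorem forall_sumElim {A B C E : Type} {P : (A ⊕ B ⊕ C ⊕ E → Bool) → Prop}
    (h : ∀ a b c d, P (Sum.elim a (Sum.elim b (Sum.elim c d)))) (u : A ⊕ B ⊕ C ⊕ E → Bool) :
    P u := by
  have := h (fun i => u (.inl i)) (fun i => u (.inr (.inl i))) (fun i => u (.inr (.inr (.inl i))))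
    fun i => u (.inr (.inr (.inr i)))
  convert this using 1
  funext i
  rcases i with i | i | i | i <;> rfl

/-- A computed classical value. -/
theorem realizes_pure {F : (ι → Bool) → (o → Bool)} {g : ℕ} (hF : Comp F g)
    (D : (o → Bool) → α) :
    Realizes (W := W) (fun x => pure (D (F x))) D (11 * g + Fintype.card o + 1) := by
  obtain ⟨n, U, hn, hU, h⟩ := hF.exists_oracle_apply
  refine ⟨Fin (n + 1), inferInstance, inferInstance, U.map (QGate.map .inr),
    fun x a f ψ => if a = F x then (if f = fun _ => false then ψ else 0) else 0, ?_, ?_, ?_⟩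
  · rw [Fintype.card_fin, List.length_map]
    omega
  · intro x ψ v x' a f
    -- The output is zero initially, so the amplitude of `a` is nonzero only if `a = F x'`.
    rw [h .inr (load ψ x) _ _ (Sum.elim v (Sum.elim x' (Sum.elim (bxor a (F x')) f)))]
    · rw [load_apply_sum]
      have hb : bxor a (F x') = (fun _ => false) ↔ a = F x' := by
        simp only [funext_iff, bxor, bne_eq_false_iff_eq]
      simp only [hb]
      split_ifs <;> simp_all
    · intro j
      rfl
    · rintro (q | q | q | q) hq
      · rfl
      · rfl
      · exact (hq q rfl).elim
      · rfl
    · refine forall_sumElim fun v x' a f k hk => ?_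
      rw [load_apply_sum, if_neg (c := f = _)]
      · simp
      · rintro rfl
        cases hk
  · intro x ψ M _ G hG
    have h1 : ∀ a : o → Bool, ∑ f : Fin (n + 1) → Bool,
        G (D a) (if a = F x then (if f = fun _ => false then ψ else 0) else 0) =
          if a = F x then G (D a) ψ else 0 := by
      intro a
      split_ifs with ha
      · rw [Finset.sum_eq_single fun _ => false]
        · rw [if_pos rfl]
        · intro f _ hf
          rw [if_neg hf, hG]
        · simp
      · simp [hG]
    simp only [h1]
    change _ = (Multiset.map _ {(D (F x), ψ)}).sum
    simp

/-- Additional input bits are ignored. -/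
theorem Realizes.comap {m : (ι → Bool) → QProg W α} {D : (o → Bool) → α} {s : ℕ}
    (h : Realizes m D s) (e : ι ↪ ι') : Realizes (fun x => m fun i => x (e i)) D s := by
  obtain ⟨anc, i1, i2, gates, K, h1, h2, h3⟩ := h
  let e' : W ⊕ ι ⊕ o ⊕ anc ↪ W ⊕ ι' ⊕ o ⊕ anc :=
    .sumMap (.refl _) (.sumMap e (.refl _))
  refine ⟨anc, i1, i2, gates.map (QGate.map e'), fun x => K fun i => x (e i), by simpa using h1,
    ?_, fun x => h3 _⟩
  intro x ψ v x' a f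
  have hg : ∀ z : W ⊕ ι ⊕ o ⊕ anc → Bool,
      glue e' z (Sum.elim v (Sum.elim x' (Sum.elim a f))) =
        Sum.elim (fun i => z (.inl i)) (Sum.elim (glue e (fun i => z (.inr (.inl i))) x')
          (fun i => z (.inr (.inr i)))) := by
    intro z
    refine glue_eq ?_ ?_
    · rintro (i | i | i)
      · rfl
      · exact glue_apply e (fun i => z (.inr (.inl i))) x' i
      · rfl
    · rintro (j | j | j) hj
      · exact (hj (.inl j) rfl).elim
      · exact glue_of_notMem (e := e) (v := fun i => z (.inr (.inl i))) (v' := x')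
          fun i hi => hj (.inr (.inl i)) (congrArg (Sum.inr ∘ Sum.inl) hi)
      · exact (hj (.inr (.inr j)) rfl).elim
  -- The input bits outside the image of `e` are untouched, so they have to agree with those of `x`.
  have hx : ∀ z : ι → Bool, glue e z x' = x ↔ z = (fun i => x (e i)) ∧ glue e z x' = x :=
    fun z => ⟨fun h => ⟨by rw [← h, glue_comp], h⟩, fun h => h.2⟩
  rw [runGates_map]
  have hl : (fun z => load ψ x (glue e' z (Sum.elim v (Sum.elim x' (Sum.elim a f)))) :
      Vec (W ⊕ ι ⊕ o ⊕ anc)) = if glue e (fun i => x (e i)) x' = x then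
        load ψ fun i => x (e i) else 0 := by
    funext z
    revert z
    refine forall_sumElim fun v z a f => ?_
    rw [hg]
    refine (load_apply_sum ψ x _ v a f).trans ?_
    simp only [Sum.elim_inl, Sum.elim_inr]
    by_cases h : z = fun i => x (e i)
    · subst h
      split_ifs <;> simp_all [load_apply_sum]
    · refine (if_neg fun h' => h ((hx z).1 h').1).trans ?_
      split_ifs
      · rw [load_apply_sum, if_neg h]
      · rfl
  rw [hl]
  by_cases hxx : x' = x
  · subst hxx
    rw [glue_self, if_pos rfl, if_pos rfl]
    have := h2 (fun i => x' (e i)) ψ v (fun i => x' (e i)) a f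
    rw [if_pos rfl] at this
    refine Eq.trans ?_ this
    congr 1
    funext i
    rcases i with i | i | i | i <;> rfl
  · rw [if_neg hxx]
    split_ifs with h
    · have h4 : (fun i => x' (e i)) ≠ fun i => x (e i) := by
        intro h5
        refine hxx ?_
        rw [← h, ← h5, glue_self]
      have := h2 (fun i => x (e i)) ψ v (fun i => x' (e i)) a f
      rw [if_neg h4] at this
      refine Eq.trans ?_ this
      congr 1
      funext i
      rcases i with i | i | i | i <;> rfl
    · rw [runGates_zero]
      rfl

theorem sumElim_eq_iff {A B : Type} {a a' : A → Bool} {b b' : B → Bool} :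
    Sum.elim a b = Sum.elim a' b' ↔ a = a' ∧ b = b' := by
  constructor
  · exact fun h => ⟨funext fun i => congrFun h (.inl i), funext fun i => congrFun h (.inr i)⟩
  · rintro ⟨rfl, rfl⟩
    rfl

/-- The branches of a realized process on the zero vector contribute nothing, since the circuit acts
linearly. -/
theorem Realizes.sum_zero {m : (ι → Bool) → QProg W α} {D : (o → Bool) → α} {s : ℕ}
    (h : Realizes m D s) (x : ι → Bool) {M : Type} [AddCommMonoid M] (G : α → Vec W → M)
    (hG : ∀ a, G (D a) 0 = 0) : ((m x 0).map fun b => G b.1 b.2).sum = 0 := by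
  obtain ⟨anc, i1, i2, gates, K, h1, h2, h3⟩ := h
  rw [← h3 x 0 G hG]
  refine Finset.sum_eq_zero fun a _ => Finset.sum_eq_zero fun f _ => ?_
  have : K x a f 0 = 0 := by
    funext v
    have := h2 x 0 v x a f
    rw [load_zero, runGates_zero, if_pos rfl] at this
    exact this.symm
  rw [this, hG]

theorem map_bind_sum {M : Type} [AddCommMonoid M] (m : QProg W α) (f : α → QProg W β) (ψ : Vec W)
    (G : β → Vec W → M) : (((m >>= f) ψ).map fun b => G b.1 b.2).sum =
      ((m ψ).map fun b => ((f b.1 b.2).map fun c => G c.1 c.2).sum).sum := by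
  change (Multiset.map _ (Multiset.bind _ _)).sum = _
  rw [Multiset.map_bind, Multiset.sum_bind]

/-- Sequential composition, where the output of the first process is classical input of the second
one: intermediate measurements are deferred to the end. -/
theorem Realizes.bind {m : (ι → Bool) → QProg W α} {D : (o → Bool) → α} {s s' : ℕ}
    {f : (ι → Bool) → α → QProg W β} {D' : (o' → Bool) → β} (hm : Realizes m D s)
    (hf : Realizes (fun z : ι ⊕ o → Bool => f (fun i => z (.inl i)) (D fun i => z (.inr i)))
      D' s') :
    Realizes (fun x => m x >>= f x) D' (s + Fintype.card o + s') := by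
  have hf0 := fun x {M : Type} [AddCommMonoid M] (G : β → Vec W → M) hG => hf.sum_zero x G hG
  obtain ⟨anc, i1, i2, gs, K, h1, h2, h3⟩ := hm
  obtain ⟨anc', j1, j2, gs', K', h1', h2', h3'⟩ := hf
  -- The output bits of the first circuit become ancillas of the composite circuit. They are measured
  -- only at the end.
  let e1 : W ⊕ ι ⊕ o ⊕ anc ↪ W ⊕ ι ⊕ o' ⊕ o ⊕ anc ⊕ anc' :=
    ⟨Sum.elim .inl (Sum.elim (fun i => .inr (.inl i)) (Sum.elim
      (fun i => .inr (.inr (.inr (.inl i)))) fun i => .inr (.inr (.inr (.inr (.inl i)))))), by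
      rintro (i | i | i | i) (j | j | j | j) h <;> cases h <;> rfl⟩
  let e2 : W ⊕ (ι ⊕ o) ⊕ o' ⊕ anc' ↪ W ⊕ ι ⊕ o' ⊕ o ⊕ anc ⊕ anc' :=
    ⟨Sum.elim .inl (Sum.elim (Sum.elim (fun i => .inr (.inl i))
      fun i => .inr (.inr (.inr (.inl i)))) (Sum.elim (fun i => .inr (.inr (.inl i)))
        fun i => .inr (.inr (.inr (.inr (.inr i)))))), by
      rintro (i | (i | i) | i | i) (j | (j | j) | j | j) h <;> cases h <;> rfl⟩
  refine ⟨o ⊕ anc ⊕ anc', inferInstance, inferInstance,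
    gs.map (QGate.map e1) ++ gs'.map (QGate.map e2),
    fun x a' f ψ => K' (Sum.elim x fun i => f (.inl i)) a' (fun i => f (.inr (.inr i)))
      (K x (fun i => f (.inl i)) (fun i => f (.inr (.inl i))) ψ), ?_, ?_, ?_⟩
  · simp only [Fintype.card_sum, List.length_append, List.length_map]
    omega
  · intro x ψ v x' a' F
    obtain ⟨a, f, f', rfl⟩ : ∃ a f f', F = Sum.elim a (Sum.elim f f') :=
      ⟨fun i => F (.inl i), fun i => F (.inr (.inl i)), fun i => F (.inr (.inr i)), by
        funext i
        rcases i with i | i | i <;> rfl⟩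
    rw [runGates_append, runGates_map]
    -- For given final ancillas of the first circuit, the second circuit starts from a sum over the
    -- outputs `a₁` of the first one. It does not change its classical input, so only `a₁ = a`
    -- contributes to the amplitude.
    have hst : (fun z => runGates (gs.map (QGate.map e1)) (load ψ x) (glue e2 z
        (Sum.elim v (Sum.elim x' (Sum.elim a' (Sum.elim a (Sum.elim f f')))))) :
          Vec (W ⊕ (ι ⊕ o) ⊕ o' ⊕ anc')) =
        ∑ a₁ : o → Bool, load (K x a₁ f ψ) (Sum.elim x a₁) := by
      funext z
      revert z
      refine forall_sumElim fun v₁ xa a₁' f₁' => ?_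
      obtain ⟨x₁, a₁, rfl⟩ : ∃ x₁ a₁, xa = Sum.elim x₁ a₁ :=
        ⟨fun i => xa (.inl i), fun i => xa (.inr i), by funext i; cases i <;> rfl⟩
      have hg : glue e2 (Sum.elim v₁ (Sum.elim (Sum.elim x₁ a₁) (Sum.elim a₁' f₁')))
          (Sum.elim v (Sum.elim x' (Sum.elim a' (Sum.elim a (Sum.elim f f'))))) =
          Sum.elim v₁ (Sum.elim x₁ (Sum.elim a₁' (Sum.elim a₁ (Sum.elim f f₁')))) := by
        refine glue_eq ?_ ?_
        · rintro (i | (i | i) | i | i) <;> rfl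
        · rintro (j | j | j | j | j | j) hj
          · exact (hj (.inl j) rfl).elim
          · exact (hj (.inr (.inl (.inl j))) rfl).elim
          · exact (hj (.inr (.inr (.inl j))) rfl).elim
          · exact (hj (.inr (.inl (.inr j))) rfl).elim
          · rfl
          · exact (hj (.inr (.inr (.inr j))) rfl).elim
      rw [hg, runGates_map, Finset.sum_apply]
      have hst' : (fun z => load ψ x (glue e1 z
          (Sum.elim v₁ (Sum.elim x₁ (Sum.elim a₁' (Sum.elim a₁ (Sum.elim f f₁')))))) :
            Vec (W ⊕ ι ⊕ o ⊕ anc)) =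
          if a₁' = fun _ => false then (if f₁' = fun _ => false then load ψ x else 0) else 0 := by
        funext z
        revert z
        refine forall_sumElim fun v₂ x₂ a₂ f₂ => ?_
        have hg' : glue e1 (Sum.elim v₂ (Sum.elim x₂ (Sum.elim a₂ f₂)))
            (Sum.elim v₁ (Sum.elim x₁ (Sum.elim a₁' (Sum.elim a₁ (Sum.elim f f₁'))))) =
            Sum.elim v₂ (Sum.elim x₂ (Sum.elim a₁' (Sum.elim a₂ (Sum.elim f₂ f₁')))) := by
          refine glue_eq ?_ ?_
          · rintro (i | i | i | i) <;> rfl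
          · rintro (j | j | j | j | j | j) hj
            · exact (hj (.inl j) rfl).elim
            · exact (hj (.inr (.inl j)) rfl).elim
            · rfl
            · exact (hj (.inr (.inr (.inl j))) rfl).elim
            · exact (hj (.inr (.inr (.inr j))) rfl).elim
            · rfl
        have h0 : (fun _ => false : o ⊕ anc ⊕ anc' → Bool) =
            Sum.elim (fun _ => false) (Sum.elim (fun _ => false) fun _ => false) := by
          funext i
          rcases i with i | i | i <;> rfl
        rw [hg', load_apply_sum, h0]
        simp only [sumElim_eq_iff]
        clear h0
        by_cases ha : a₁' = fun _ => false
        · by_cases hf : f₁' = fun _ => false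
          · rw [if_pos ha, if_pos hf, if_pos ha, load_apply_sum]
            simp only [ha, hf, if_true, and_true]
            split_ifs <;> simp_all
          · rw [if_pos ha, if_neg hf, if_pos ha, if_neg (c := _ ∧ _ ∧ _) fun h => hf h.2.2,
              ite_self]
            rfl
        · rw [if_neg ha, if_neg ha, ite_self]
          rfl
      rw [hst']
      have hR : ∀ a₀ : o → Bool, load (K x a₀ f ψ) (Sum.elim x a₀)
          (Sum.elim v₁ (Sum.elim (Sum.elim x₁ a₁) (Sum.elim a₁' f₁'))) =
            if a₀ = a₁ then (if x₁ = x then (if a₁' = fun _ => false then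
              (if f₁' = fun _ => false then K x a₀ f ψ v₁ else 0) else 0) else 0) else 0 := by
        intro a₀
        rw [load_apply_sum]
        simp only [sumElim_eq_iff]
        by_cases h : a₀ = a₁
        · subst h
          simp
        · rw [if_neg h, if_neg fun h' => h h'.2.symm]
      simp only [hR, Finset.sum_ite_eq', Finset.mem_univ, if_true]
      have hu : (fun i => (Sum.elim v₁ (Sum.elim x₁ (Sum.elim a₁' (Sum.elim a₁ (Sum.elim f f₁')))) :
          _ → Bool) (e1 i)) = Sum.elim v₁ (Sum.elim x₁ (Sum.elim a₁ f)) := by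
        funext i
        rcases i with i | i | i | i <;> rfl
      rw [hu]
      by_cases ha : a₁' = fun _ => false
      · by_cases hf : f₁' = fun _ => false
        · rw [if_pos ha, if_pos hf, h2, if_pos ha, if_pos hf]
        · rw [if_pos ha, if_neg hf, if_pos ha, if_neg hf, runGates_zero, ite_self]
          rfl
      · rw [if_neg ha, if_neg ha, runGates_zero, ite_self]
        rfl
    have hu : (fun i => (Sum.elim v (Sum.elim x' (Sum.elim a' (Sum.elim a (Sum.elim f f')))) :
        _ → Bool) (e2 i)) = Sum.elim v (Sum.elim (Sum.elim x' a) (Sum.elim a' f')) := by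
      funext i
      rcases i with i | (i | i) | i | i <;> rfl
    rw [hst, hu, runGates_sum, Finset.sum_apply]
    simp only [h2', sumElim_eq_iff]
    rw [Finset.sum_eq_single a]
    · simp only [and_true]
      rfl
    · intro a₀ _ ha
      rw [if_neg fun h' => ha h'.2.symm]
    · simp
  · intro x ψ M _ G hG
    rw [map_bind_sum, ← h3 x ψ (fun b φ => ((f x b φ).map fun c => G c.1 c.2).sum)]
    · rw [Finset.sum_comm]
      have h4 := fun a g => h3' (Sum.elim x a) (K x a g ψ) G hG
      simp only [Sum.elim_inl, Sum.elim_inr] at h4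
      simp only [← h4]
      rw [← (Equiv.sumArrowEquivProdArrow o (anc ⊕ anc') Bool).symm.sum_comp,
        Fintype.sum_prod_type]
      refine Finset.sum_congr rfl fun a _ => ?_
      rw [← (Equiv.sumArrowEquivProdArrow anc anc' Bool).symm.sum_comp, Fintype.sum_prod_type]
      refine Finset.sum_congr rfl fun g _ => ?_
      rw [Finset.sum_comm]
      rfl
    · intro a
      have h5 := hf0 (Sum.elim x a) G hG
      exact h5

theorem glue_inl {A B : Type} (z v : A → Bool) (b : B → Bool) :
    glue .inl z (Sum.elim v b) = Sum.elim z b := by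
  refine glue_eq (fun _ => rfl) ?_
  rintro (j | j) hj
  · exact (hj j rfl).elim
  · rfl

/-- Gates on the qubits of the process. -/
theorem realizes_op (gs : List (QGate W)) :
    Realizes (fun _ : ι → Bool => op (runGates gs)) (fun _ : Empty → Bool => ()) gs.length := by
  refine ⟨Empty, inferInstance, inferInstance, gs.map (QGate.map .inl),
    fun _ _ _ ψ => runGates gs ψ, by simp, ?_, ?_⟩
  · intro x ψ v x' a f
    rw [runGates_map]
    have h : (fun z => load ψ x (glue .inl z (Sum.elim v (Sum.elim x' (Sum.elim a f)))) : Vec W) =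
        if x' = x then ψ else 0 := by
      funext z
      rw [glue_inl, load_apply_sum, if_pos (c := a = _) (Subsingleton.elim _ _),
        if_pos (c := f = _) (Subsingleton.elim _ _)]
      split_ifs <;> rfl
    rw [h]
    split_ifs
    · rfl
    · rw [runGates_zero]
      rfl
  · intro x ψ M _ G _
    change _ = (Multiset.map _ {((), runGates gs ψ)}).sum
    simp

theorem map_kraus_sum [Fintype α] {M : Type} [AddCommMonoid M] (K : α → Vec W → Vec W) (ψ : Vec W)
    (G : α → Vec W → M) : ((kraus K ψ).map fun b => G b.1 b.2).sum = ∑ a, G a (K a ψ) := by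
  unfold kraus
  rw [Multiset.map_map]
  rfl

/-- Coins are tossed by the measurement of qubits in a uniform superposition. -/
theorem realizes_coins (κ : Type) [Fintype κ] [DecidableEq κ] :
    Realizes (W := W) (fun _ : ι → Bool => coins κ) (fun r => r) (Fintype.card κ) := by
  let e : κ ↪ W ⊕ ι ⊕ κ ⊕ Empty :=
    ⟨fun i => .inr (.inr (.inl i)), fun i j h => by cases h; rfl⟩
  refine ⟨Empty, inferInstance, inferInstance,
    (Finset.univ.toList.map fun i : κ => .cliff (.h i)).map (QGate.map e),
    fun _ _ _ ψ => ((1 / (Real.sqrt 2 : ℂ)) ^ Fintype.card κ) • ψ, by simp, ?_, ?_⟩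
  · intro x ψ v x' a f
    rw [runGates_map, runGates_hadamard]
    have hg : ∀ z, glue e z (Sum.elim v (Sum.elim x' (Sum.elim a f))) =
        Sum.elim v (Sum.elim x' (Sum.elim z f)) := by
      intro z
      refine glue_eq (fun _ => rfl) ?_
      rintro (j | j | j | j) hj
      · rfl
      · rfl
      · exact (hj j rfl).elim
      · rfl
    simp only [hg, load_apply_sum]
    rw [Finset.sum_eq_single fun _ => false]
    · rw [if_pos (c := f = _) (Subsingleton.elim _ _), if_pos rfl]
      have hs : sgn (fun i => (Sum.elim v (Sum.elim x' (Sum.elim a f)) : _ → Bool) (e i))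
          (fun _ => false) = 1 := by simp [sgn, overlap]
      rw [hs, mul_one]
      split_ifs
      · rfl
      · rw [mul_zero]
    · intro z _ hz
      rw [if_neg hz, ite_self, mul_zero]
    · simp
  · intro x ψ M _ G _
    unfold coins
    rw [map_kraus_sum]
    refine Finset.sum_congr rfl fun a _ => ?_
    simp

/-- The classical input is computed from other classical data. -/
theorem Realizes.precomp {m : (ι → Bool) → QProg W α} {D : (o → Bool) → α} {s g : ℕ}
    (h : Realizes m D s) {F : (ι' → Bool) → (ι → Bool)} (hF : Comp F g) :
    Realizes (fun x => m (F x)) D (11 * g + 2 * Fintype.card ι + 1 + s) := by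
  have h1 := (realizes_pure (W := W) hF fun a => a).bind (f := fun _ a => m a) (D' := D)
    (h.comap (Function.Embedding.inr (α := ι')))
  refine (h1.mono (by omega)).congr (fun x => ?_) fun _ => rfl
  funext ψ
  change Multiset.bind {(F x, ψ)} _ = _
  simp

/-- A computed classical value, in the presence of a decoding. -/
theorem realizes_pure' {F : (ι → Bool) → (o → Bool)} {g : ℕ} (hF : Comp F g)
    {D : (o → Bool) → α} {a : (ι → Bool) → α} (ha : ∀ x, a x = D (F x)) :
    Realizes (W := W) (fun x => pure (a x)) D (11 * g + Fintype.card o + 1) :=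
  (realizes_pure hF D).congr (fun x => by rw [ha]) fun _ => rfl

/-- A loop is the iterated sequential composition. In each round, the earlier results are passed on
and copied, which accounts for the factor `k + 1`. -/
theorem realizes_forFin {s : ℕ} {D : (o → Bool) → α} (k : ℕ)
    (m : Fin k → (ι → Bool) → QProg W α) (h : ∀ j, Realizes (m j) D s) :
    Realizes (fun x => forFin k fun j => m j x)
      (fun (a : Fin k × o → Bool) j => D fun b => a (j, b))
      (k * (s + 1 + (k + 1) * Fintype.card o) + 1) := by
  induction k with
  | zero =>
    refine (realizes_pure' (o := Fin 0 × o) (D := fun a j => D fun b => a (j, b)) (g := 0)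
      (comp_isEmpty fun _ _ => false) fun x => ?_).mono (by simp)
    exact funext fun j => j.elim0
  | succ k ih =>
    have h1 := (ih (fun j => m j.succ) fun j => h j.succ).comap
      (Function.Embedding.inl (β := o))
    have h2 : Realizes (W := W)
        (fun z : (ι ⊕ o) ⊕ (Fin k × o) → Bool => pure (Fin.cons (D fun b => z (.inl (.inr b)))
          (fun j => D fun b => z (.inr (j, b))) : Fin (k + 1) → α))
        (fun a j => D fun b => a (j, b)) _ :=
      realizes_pure' (o := Fin (k + 1) × o) (comp_wire fun p : Fin (k + 1) × o =>
        Fin.cases (motive := fun _ => (ι ⊕ o) ⊕ (Fin k × o)) (.inl (.inr p.2))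
          (fun j => .inr (j, p.2)) p.1) fun z => by
        funext j
        refine Fin.cases ?_ (fun j => ?_) j <;> rfl
    have h3 := h1.bind (f := fun (z : ι ⊕ o → Bool) (r : Fin k → α) =>
      (pure (Fin.cons (D fun b => z (.inr b)) r) : QProg W (Fin (k + 1) → α))) h2
    have h4 := (h 0).bind (f := fun x a =>
      (forFin k (fun j => m j.succ x) >>= fun r => pure (Fin.cons a r) :
        QProg W (Fin (k + 1) → α))) h3
    refine Realizes.mono h4 (le_of_eq ?_)
    simp only [Fintype.card_prod, Fintype.card_fin]
    ring

/-- The realization of a process gives a quantum circuit for it. -/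
theorem Realizes.qComputableInSize {m : (ι → Bool) → QProg W (o → Bool)} {s t : ℕ}
    (h : Realizes m (fun a => a) s)
    (ht : Fintype.card W + Fintype.card ι + Fintype.card o + s ≤ t) : QComputableInSize m t := by
  obtain ⟨anc, i1, i2, gs, K, h1, h2, h3⟩ := h
  -- `QComputableInSize` requires numbered ancillas.
  let q := Fintype.equivFin anc
  let e : W ⊕ ι ⊕ o ⊕ anc ↪ W ⊕ ι ⊕ o ⊕ Fin (Fintype.card anc) :=
    .sumMap (.refl _) (.sumMap (.refl _) (.sumMap (.refl _) q.toEmbedding))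
  refine ⟨Fintype.card anc, gs.map (QGate.map e), ?_, ?_⟩
  · simp only [Fintype.card_sum, Fintype.card_fin, List.length_map]
    omega
  · intro x ψ a
    have hamp : ∀ v x' a f, runGates (gs.map (QGate.map e)) (load ψ x)
        (Sum.elim v (Sum.elim x' (Sum.elim a f))) =
          if x' = x then K x a (fun i => f (q i)) ψ v else 0 := by
      intro v x' a f
      rw [runGates_map, ← h2]
      have hst : (fun z => load ψ x (glue e z (Sum.elim v (Sum.elim x' (Sum.elim a f)))) : Vec _) =
          load ψ x := by
        funext z
        revert z
        refine forall_sumElim fun v₁ x₁ a₁ f₁ => ?_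
        have hg : glue e (Sum.elim v₁ (Sum.elim x₁ (Sum.elim a₁ f₁)))
            (Sum.elim v (Sum.elim x' (Sum.elim a f))) =
              Sum.elim v₁ (Sum.elim x₁ (Sum.elim a₁ fun i => f₁ (q.symm i))) := by
          refine glue_eq ?_ ?_
          · rintro (i | i | i | i)
            · rfl
            · rfl
            · rfl
            · exact congrArg f₁ (q.symm_apply_apply i)
          · rintro (j | j | j | j) hj
            · exact (hj (.inl j) rfl).elim
            · exact (hj (.inr (.inl j)) rfl).elim
            · exact (hj (.inr (.inr (.inl j))) rfl).elim
            · exact (hj (.inr (.inr (.inr (q.symm j))))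
                (congrArg (Sum.inr ∘ Sum.inr ∘ Sum.inr) (q.apply_symm_apply j))).elim
        have hf : (fun i => f₁ (q.symm i)) = (fun _ => false) ↔ f₁ = fun _ => false := by
          constructor
          · intro h
            funext i
            simpa using congrFun h (q i)
          · rintro rfl
            rfl
        rw [hg, load_apply_sum, load_apply_sum]
        simp only [hf]
      rw [hst]
      congr 1
      funext i
      rcases i with i | i | i | i <;> rfl
    have h4 := h3 x ψ (fun b φ => if b = a then outer φ else 0) fun b => by
      split_ifs
      · funext u v
        simp [outer]
      · rfl
    unfold densityAt
    rw [← h4, Finset.sum_eq_single a]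
    · simp only [if_true]
      rw [← (Equiv.sumArrowEquivProdArrow ι (Fin (Fintype.card anc)) Bool).symm.sum_comp,
        Fintype.sum_prod_type, Finset.sum_eq_single x]
      · rw [← (Equiv.arrowCongr q (Equiv.refl Bool)).sum_comp]
        refine Finset.sum_congr rfl fun f _ => congrArg outer (funext fun v => ?_)
        refine Eq.symm ((hamp v x a _).trans ?_)
        rw [if_pos rfl]
        congr 2
        funext i
        simp
      -- The input is unchanged, so only the final input value `x` has nonzero amplitude.
      · intro x' _ hx
        refine Finset.sum_eq_zero fun f _ => ?_
        have : (fun v => runGates (gs.map (QGate.map e)) (load ψ x)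
            (Sum.elim v (Sum.elim x' (Sum.elim a f)))) = 0 := by
          funext v
          rw [hamp, if_neg hx]
          rfl
        refine (congrArg outer this).trans ?_
        funext u v
        simp [outer]
      · simp
    · intro b _ hb
      simp [hb]
    · simp

end Realizes

/-! ### Quantum circuit for the encrypted CNOT operation -/

section EncryptedCNOT

variable {W P Y R : Type} [Fintype W] [DecidableEq W] [Fintype P] [DecidableEq P] [Fintype Y]
  [DecidableEq Y] [Fintype R] [DecidableEq R]

/-- The qubits of the circuit for an encrypted CNOT operation: the data, the public key and the
ciphertext of the control, the registers for `y` and for the superposition, a copy of the public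
key, the ancillas of the preparation, and the ancillas of two oracles. -/
abbrev CnotWires (W P Y R : Type) (a n₁ n₂ : ℕ) : Type :=
  W ⊕ (P ⊕ Y) ⊕ (Y ⊕ R) ⊕ (P ⊕ Fin a ⊕ Fin (n₁ + 1) ⊕ Fin (n₂ + 1))

/-- The assignment of the qubits of the circuit for an encrypted CNOT operation. -/
def cnotBits {a n₁ n₂ : ℕ} (v : W → Bool) (p : P → Bool) (c y : Y → Bool) (w : R → Bool)
    (q : P → Bool) (f : Fin a → Bool) (k₁ : Fin (n₁ + 1) → Bool) (k₂ : Fin (n₂ + 1) → Bool) :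
    CnotWires W P Y R a n₁ n₂ → Bool :=
  Sum.elim v (Sum.elim (Sum.elim p c) (Sum.elim (Sum.elim y w)
    (Sum.elim q (Sum.elim f (Sum.elim k₁ k₂)))))

theorem forall_cnotBits {a n₁ n₂ : ℕ} {Q : (CnotWires W P Y R a n₁ n₂ → Bool) → Prop}
    (h : ∀ v p c y w q f k₁ k₂, Q (cnotBits v p c y w q f k₁ k₂)) (u) : Q u := by
  have := h (fun i => u (.inl i)) (fun i => u (.inr (.inl (.inl i))))
    (fun i => u (.inr (.inl (.inr i)))) (fun i => u (.inr (.inr (.inl (.inl i)))))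
    (fun i => u (.inr (.inr (.inl (.inr i))))) (fun i => u (.inr (.inr (.inr (.inl i)))))
    (fun i => u (.inr (.inr (.inr (.inr (.inl i))))))
    (fun i => u (.inr (.inr (.inr (.inr (.inr (.inl i)))))))
    (fun i => u (.inr (.inr (.inr (.inr (.inr (.inr i)))))))
  convert this using 1
  funext i
  rcases i with i | (i | i) | (i | i) | i | i | i | i <;> rfl

/-- Initially, all qubits except the data and the classical input are zero. -/
theorem load_cnotBits {a n₁ n₂ : ℕ} (ψ : Vec W) (x : P ⊕ Y → Bool) (v : W → Bool) (p : P → Bool)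
    (c y : Y → Bool) (w : R → Bool) (q : P → Bool) (f : Fin a → Bool) (k₁ : Fin (n₁ + 1) → Bool)
    (k₂ : Fin (n₂ + 1) → Bool) : load ψ x (cnotBits v p c y w q f k₁ k₂) =
      if (Sum.elim p c = x ∧ y = (fun _ => false) ∧ k₁ = (fun _ => false) ∧ k₂ = fun _ => false) then
        (if w = (fun _ => false) ∧ q = (fun _ => false) ∧ f = (fun _ => false) then ψ v else 0)
      else 0 := by
  have h0 : ∀ A B : Type, (fun _ => false : A ⊕ B → Bool) =
      Sum.elim (fun _ => false) fun _ => false := by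
    intro A B
    funext i
    cases i <;> rfl
  unfold cnotBits
  rw [load_apply_sum]
  simp only [h0, sumElim_eq_iff]
  split_ifs <;> simp_all

set_option synthInstance.maxSize 1000 in
set_option synthInstance.maxHeartbeats 100000 in
/-- The circuit copies the public key, prepares the superposition, computes `y`, adds the message
bit to the target, and applies Hadamard gates. The amplitudes are computed backwards, gate by gate,
from the final basis state. -/
theorem exists_gates_encryptedCNOT (prep : StatePrep P R) {g : ℕ}
    {F : ((P ⊕ Y) ⊕ Unit ⊕ R → Bool) → (Y → Bool)} (hF : Comp F g) (i j : W) (r₀ : R) :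
    ∃ (n₁ n₂ : ℕ) (gates : List (QGate (CnotWires W P Y R prep.anc n₁ n₂))), n₁ ≤ 0 ∧ n₂ ≤ g ∧
      gates.length ≤ Fintype.card P + prep.gates.length + (10 * g + Fintype.card Y) + 1 +
        Fintype.card R ∧
      ∀ x ψ v p c y d q f k₁ k₂,
        runGates gates (load ψ x) (cnotBits v p c y d q f k₁ k₂) =
          if Sum.elim p c = x ∧ k₁ = (fun _ => false) ∧ k₂ = (fun _ => false) then
            ∑ w : R → Bool, (1 / (Real.sqrt 2 : ℂ)) ^ Fintype.card R * sgn d w *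
              if F (Sum.elim x (Sum.elim (fun _ => Function.update v j (xor (v j) (w r₀)) i) w)) = y
              then ψ (Function.update v j (xor (v j) (w r₀))) *
                prep.amp (fun i => x (.inl i)) (Sum.elim q f) w else 0
          else 0 := by
  obtain ⟨n₁, U₁, hn₁, hU₁, h₁⟩ := (comp_wire (id : P → P)).exists_oracle_apply
  obtain ⟨n₂, U₂, hn₂, hU₂, h₂⟩ := hF.exists_oracle_apply
  -- The preparation acts on a copy of the public key, since it may alter this register. Here `e₁`
  -- places the copying oracle, `e₂` the preparation, `e₃` the oracle for `y`, and `e₄` the register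
  -- that is measured to obtain `d`.
  let e₁ : OracleWires P P n₁ ↪ CnotWires W P Y R prep.anc n₁ n₂ :=
    ⟨Sum.elim (fun i => .inr (.inl (.inl i))) (Sum.elim (fun i => .inr (.inr (.inr (.inl i))))
      fun i => .inr (.inr (.inr (.inr (.inr (.inl i)))))), by
      rintro (i | i | i) (j | j | j) h <;> cases h <;> rfl⟩
  let e₂ : P ⊕ R ⊕ Fin prep.anc ↪ CnotWires W P Y R prep.anc n₁ n₂ :=
    ⟨Sum.elim (fun i => .inr (.inr (.inr (.inl i)))) (Sum.elim
      (fun i => .inr (.inr (.inl (.inr i)))) fun i => .inr (.inr (.inr (.inr (.inl i))))), by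
      rintro (i | i | i) (j | j | j) h <;> cases h <;> rfl⟩
  let e₃ : OracleWires ((P ⊕ Y) ⊕ Unit ⊕ R) Y n₂ ↪ CnotWires W P Y R prep.anc n₁ n₂ :=
    ⟨Sum.elim (Sum.elim (fun i => .inr (.inl i)) (Sum.elim (fun _ => .inl i)
      fun i => .inr (.inr (.inl (.inr i))))) (Sum.elim (fun i => .inr (.inr (.inl (.inl i))))
      fun i => .inr (.inr (.inr (.inr (.inr (.inr i)))))), by
      rintro ((i | i | i) | i | i) ((j | j | j) | j | j) h <;> cases h <;> rfl⟩
  let e₄ : R ↪ CnotWires W P Y R prep.anc n₁ n₂ :=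
    ⟨fun i => .inr (.inr (.inl (.inr i))), fun i j h => by cases h; rfl⟩
  refine ⟨n₁, n₂, U₁.map (QGate.map e₁) ++ (prep.gates.map (QGate.map e₂) ++
    (U₂.map (QGate.map e₃) ++ (.cliff (.cnot (e₄ r₀) (.inl j) (by simp [e₄])) ::
      (Finset.univ.toList.map fun i : R => .cliff (.h i)).map (QGate.map e₄)))), hn₁, hn₂, ?_, ?_⟩
  · simp only [List.length_append, List.length_map, List.length_cons, Finset.length_toList,
      Finset.card_univ]
    omega
  intro x ψ v p c y d q f k₁ k₂
  -- The amplitudes after copying the public key (`s₁`), after the preparation (`s₂`), and after the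
  -- computation of `y` (`s₃`).
  have s₁ : ∀ v p c y w q f k₁ k₂, runGates (U₁.map (QGate.map e₁)) (load ψ x)
      (cnotBits v p c y w q f k₁ k₂) = if (Sum.elim p c = x ∧ y = (fun _ => false) ∧
        k₁ = (fun _ => false) ∧ k₂ = fun _ => false) then (if w = (fun _ => false) ∧
          q = (fun i => x (.inl i)) ∧ f = (fun _ => false) then ψ v else 0) else 0 := by
    intro v p c y w q f k₁ k₂
    rw [h₁ e₁ (load ψ x) _ _ (cnotBits v p c y w (bxor q p) f k₁ k₂), load_cnotBits]
    · by_cases hx : Sum.elim p c = x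
      · subst hx
        have hb : bxor q p = (fun _ => false) ↔ q = p := by
          simp only [funext_iff, bxor, bne_eq_false_iff_eq]
        simp only [hb, Sum.elim_inl]
        rfl
      · simp only [hx, false_and, if_false]
    · intro i
      rfl
    · rintro (i | (i | i) | (i | i) | i | i | i | i) hi
      all_goals first | rfl | exact (hi _ rfl).elim
    · refine forall_cnotBits fun v p c y w q f k₁ k₂ k hk => ?_
      rw [load_cnotBits, if_neg]
      rintro ⟨-, -, rfl, -⟩
      cases hk
  have s₂ : ∀ v p c y w q f k₁ k₂, runGates (prep.gates.map (QGate.map e₂))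
      (runGates (U₁.map (QGate.map e₁)) (load ψ x)) (cnotBits v p c y w q f k₁ k₂) =
        if (Sum.elim p c = x ∧ y = (fun _ => false) ∧ k₁ = (fun _ => false) ∧
          k₂ = fun _ => false) then ψ v * prep.amp (fun i => x (.inl i)) (Sum.elim q f) w
        else 0 := by
    intro v p c y w q f k₁ k₂
    rw [runGates_map]
    have hst : (fun z => runGates (U₁.map (QGate.map e₁)) (load ψ x)
        (glue e₂ z (cnotBits v p c y w q f k₁ k₂)) : Vec _) =
        (if (Sum.elim p c = x ∧ y = (fun _ => false) ∧ k₁ = (fun _ => false) ∧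
          k₂ = fun _ => false) then ψ v else 0) •
            ket (Sum.elim (fun i => x (.inl i)) fun _ => false) := by
      funext z
      obtain ⟨q', w', f', rfl⟩ : ∃ q' w' f', z = Sum.elim q' (Sum.elim w' f') :=
        ⟨fun i => z (.inl i), fun i => z (.inr (.inl i)), fun i => z (.inr (.inr i)), by
          funext i
          rcases i with i | i | i <;> rfl⟩
      have hg : glue e₂ (Sum.elim q' (Sum.elim w' f')) (cnotBits v p c y w q f k₁ k₂) =
          cnotBits v p c y w' q' f' k₁ k₂ := by
        refine glue_eq ?_ ?_
        · rintro (i | i | i) <;> rfl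
        · rintro (i | (i | i) | (i | i) | i | i | i | i) hi
          all_goals first
            | rfl
            | exact (hi (.inl _) rfl).elim
            | exact (hi (.inr (.inl _)) rfl).elim
            | exact (hi (.inr (.inr _)) rfl).elim
      have h0 : (fun _ => false : R ⊕ Fin prep.anc → Bool) =
          Sum.elim (fun _ => false) fun _ => false := by
        funext i
        cases i <;> rfl
      rw [hg, s₁, Pi.smul_apply, smul_eq_mul]
      unfold ket
      simp only [h0, sumElim_eq_iff, mul_ite, mul_one, mul_zero]
      clear s₁ h₁ h₂ hg
      split_ifs <;> simp_all
    rw [hst, (runGates_isLinearMap _).map_smul, Pi.smul_apply, smul_eq_mul]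
    have ha : runGates prep.gates (ket (Sum.elim (fun i => x (.inl i)) fun _ => false))
        (fun i => cnotBits v p c y w q f k₁ k₂ (e₂ i)) =
          prep.amp (fun i => x (.inl i)) (Sum.elim q f) w := by
      unfold StatePrep.amp
      congr 1
      funext i
      rcases i with i | i | i <;> rfl
    rw [ha, ite_mul, zero_mul]
  have s₃ : ∀ v p c y w q f k₁ k₂, runGates (U₂.map (QGate.map e₃))
      (runGates (prep.gates.map (QGate.map e₂)) (runGates (U₁.map (QGate.map e₁)) (load ψ x)))
        (cnotBits v p c y w q f k₁ k₂) =
        if (Sum.elim p c = x ∧ k₁ = (fun _ => false) ∧ k₂ = fun _ => false) then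
          (if F (Sum.elim x (Sum.elim (fun _ => v i) w)) = y then
            ψ v * prep.amp (fun i => x (.inl i)) (Sum.elim q f) w else 0) else 0 := by
    intro v p c y w q f k₁ k₂
    rw [h₂ e₃ _ _ _ (cnotBits v p c (bxor y (F (Sum.elim (Sum.elim p c)
      (Sum.elim (fun _ => v i) w)))) w q f k₁ k₂), s₂]
    · by_cases hx : Sum.elim p c = x
      · subst hx
        have hb : bxor y (F (Sum.elim (Sum.elim p c) (Sum.elim (fun _ => v i) w))) =
            (fun _ => false) ↔ F (Sum.elim (Sum.elim p c) (Sum.elim (fun _ => v i) w)) = y := by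
          rw [eq_comm (b := y)]
          simp only [funext_iff, bxor, bne_eq_false_iff_eq]
        simp only [hb, true_and]
        clear s₁ s₂ h₁ h₂
        split_ifs <;> simp_all
      · simp only [hx, false_and, if_false]
    · intro l
      have : (fun l => cnotBits v p c y w q f k₁ k₂ (e₃ (.inl l))) =
          Sum.elim (Sum.elim p c) (Sum.elim (fun _ => v i) w) := by
        funext l
        rcases l with (l | l) | l | l <;> rfl
      rw [this]
      rfl
    · rintro (l | (l | l) | (l | l) | l | l | l | l) hl
      all_goals first | rfl | exact (hl _ rfl).elim
    · refine forall_cnotBits fun v p c y w q f k₁ k₂ k hk => ?_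
      rw [s₂, if_neg]
      rintro ⟨-, -, -, rfl⟩
      cases hk
  rw [runGates_append, runGates_append, runGates_append, runGates_cons, runGates_map,
    runGates_hadamard]
  have hg : ∀ w, glue e₄ w (cnotBits v p c y d q f k₁ k₂) = cnotBits v p c y w q f k₁ k₂ := by
    intro w
    refine glue_eq (fun _ => rfl) ?_
    rintro (l | (l | l) | (l | l) | l | l | l | l) hl
    all_goals first | rfl | exact (hl _ rfl).elim
  -- The message bit of the superposition is added to the target.
  have s₄ : ∀ (Ψ : Vec (CnotWires W P Y R prep.anc n₁ n₂)) w h,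
      QGate.apply (.cliff (.cnot (e₄ r₀) (.inl j) h)) Ψ (cnotBits v p c y w q f k₁ k₂) =
        Ψ (cnotBits (Function.update v j (xor (v j) (w r₀))) p c y w q f k₁ k₂) := by
    intro Ψ w h
    change Ψ (Function.update _ _ _) = _
    congr 1
    unfold cnotBits
    rw [Sum.update_elim_inl]
    rfl
  simp only [hg, s₄, s₃]
  by_cases hx : Sum.elim p c = x ∧ k₁ = (fun _ => false) ∧ k₂ = fun _ => false
  · simp only [if_pos hx]
    refine Finset.sum_congr rfl fun w _ => ?_
    rfl
  · simp only [if_neg hx, mul_zero, Finset.sum_const_zero]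

end EncryptedCNOT

/-! ### Quantum circuits for the evaluation of a level -/

theorem comp_ite_bit {ι : Type} (c a b : ι) :
    Comp (fun (x : ι → Bool) (_ : Unit) => if x c then x a else x b) 3 := by
  refine ⟨⟨[.xor (.inl a) (.inl b), .and (.inl c) (.inr 0), .xor (.inl b) (.inr 1)],
    fun _ => .inr 2⟩, le_rfl, ?_, ?_⟩
  · intro j k h
    cases h
    exact Nat.lt_succ_self 2
  · intro x
    funext j
    cases hc : x c <;> cases ha : x a <;> cases hb : x b <;>
      simp [BoolCircuit.eval, BoolCircuit.vals, BoolCircuit.wireVal, BoolCircuit.gateVal, hc, ha, hb]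

theorem comp_ite {ι o : Type} [Fintype o] (c : ι) (a b : o → ι) :
    Comp (fun (x : ι → Bool) j => if x c then x (a j) else x (b j)) (Fintype.card o * 3) :=
  (Comp.family fun j => comp_ite_bit c (a j) (b j)).reindex fun j => (j, ())

section Level

variable {HE : LeveledHE} {Lc : ℕ → ℕ} {A : AltScheme HE Lc} {n b : ℕ}
  {W ι : Type} [Fintype W] [DecidableEq W] [Fintype ι] [DecidableEq ι]

/-- A circuit for the AltHE ciphertext of the encrypted CNOT operation: from the public key, `cHat`,
the control bit and `(μ, r)`, it computes the encryption of `μ` with randomness `r`, shifted by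
`cHat` if the control is `1`. -/
theorem SizeBound.comp_image (hb : SizeBound A n b) :
    Comp (fun z : (Fin (HE.pkLen n (Lc n)) ⊕ Fin (A.ctLen n)) ⊕ Unit ⊕
        Option (Fin (A.rndLen n)) → Bool =>
      if z (.inr (.inl ())) then A.xor n (fun i => z (.inl (.inl i)))
        (A.enc n (fun i => z (.inl (.inl i))) fun i => z (.inr (.inr i)))
          (fun i => z (.inl (.inr i)))
      else A.enc n (fun i => z (.inl (.inl i))) fun i => z (.inr (.inr i))) (5 * b) := by
  let E := (Fin (HE.pkLen n (Lc n)) ⊕ Fin (A.ctLen n)) ⊕ Unit ⊕ Option (Fin (A.rndLen n))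
  have h1 := (comp_wire (id : E → E)).sum (hb.altEnc.precomp (ι' := E)
    (Sum.elim (fun i => .inl (.inl i)) fun i => .inr (.inr i)))
  have h2 := (comp_wire (id : E ⊕ Fin (A.ctLen n) → _)).sum
    (hb.xor.precomp (ι' := E ⊕ Fin (A.ctLen n)) (Sum.elim (fun i => .inl (.inl (.inl i)))
      (Sum.elim (fun i => .inr i) fun i => .inl (.inl (.inr i)))))
  have h3 := (h1.compose h2).compose (comp_ite (ι := (E ⊕ Fin (A.ctLen n)) ⊕ Fin (A.ctLen n))
    (.inl (.inl (.inr (.inl ())))) (fun i => .inr i) fun i => .inl (.inr i))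
  have hl := hb.altLen
  refine (h3.mono (by simp only [Fintype.card_fin]; omega)).congr fun z => ?_
  funext i
  cases h : z (.inr (.inl ())) <;> simp [h]

/-- The Kraus operators of the encrypted CNOT operation. -/
def encryptedKraus (A : AltScheme HE Lc) (n : ℕ) (pk : Bits (HE.pkLen n (Lc n)))
    (cHat : Bits (A.ctLen n)) (i j : W) (g : Fin (HE.pkLen n (Lc n)) ⊕ Fin (A.prep n).anc → Bool)
    (y : Bits (A.ctLen n)) (d : Option (Fin (A.rndLen n)) → Bool) (ψ : Vec W) : Vec W := fun v =>
  ∑ w : Option (Fin (A.rndLen n)) → Bool, (1 / (Real.sqrt 2 : ℂ)) ^ (A.rndLen n + 1) * sgn d w *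
    if (if Function.update v j (xor (v j) (w none)) i then A.xor n pk (A.enc n pk w) cHat
      else A.enc n pk w) = y
    then ψ (Function.update v j (xor (v j) (w none))) * (A.prep n).amp pk g w else 0

theorem encryptedCNOT_eq (pk : Bits (HE.pkLen n (Lc n))) (cHat : Bits (A.ctLen n)) (i j : W) :
    encryptedCNOT A n pk cHat i j =
      (kraus fun o : (Fin (HE.pkLen n (Lc n)) ⊕ Fin (A.prep n).anc → Bool) ×
        Bits (A.ctLen n) × (Option (Fin (A.rndLen n)) → Bool) =>
          encryptedKraus A n pk cHat i j o.1 o.2.1 o.2.2) >>= fun o => pure o.2 := rfl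

/-- Sums over the branches of the encrypted CNOT operation, with the result encoded in bits. -/
theorem map_encryptedCNOT_sum {M : Type} [AddCommMonoid M] (pk : Bits (HE.pkLen n (Lc n)))
    (cHat : Bits (A.ctLen n)) (i j : W) (ψ : Vec W)
    (G : Bits (A.ctLen n) × (Option (Fin (A.rndLen n)) → Bool) → Vec W → M) :
    ((encryptedCNOT A n pk cHat i j ψ).map fun b => G b.1 b.2).sum =
      ∑ a : Fin (A.ctLen n) ⊕ Option (Fin (A.rndLen n)) → Bool, ∑ g,
        G (fun l => a (.inl l), fun l => a (.inr l))
          (encryptedKraus A n pk cHat i j g (fun l => a (.inl l)) (fun l => a (.inr l)) ψ) := by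
  rw [encryptedCNOT_eq, map_bind_sum]
  have h := map_kraus_sum (fun o : (Fin (HE.pkLen n (Lc n)) ⊕ Fin (A.prep n).anc → Bool) ×
        Bits (A.ctLen n) × (Option (Fin (A.rndLen n)) → Bool) =>
          encryptedKraus A n pk cHat i j o.1 o.2.1 o.2.2) ψ fun o φ => G o.2 φ
  refine Eq.trans ?_ (h.trans ?_)
  · refine congrArg Multiset.sum (Multiset.map_congr rfl fun c _ => ?_)
    change (Multiset.map _ {(c.1.2, c.2)}).sum = _
    simp
  · rw [Fintype.sum_prod_type, Finset.sum_comm]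
    rw [← (Equiv.sumArrowEquivProdArrow _ _ Bool).sum_comp]
    rfl

/-- A circuit for the encrypted CNOT operation, with input the public key and `cHat`. The final
values of the copied public key and of the ancillas of the preparation label Kraus operators; the
ancillas of the oracles return to zero. -/
theorem realizes_encryptedCNOT (hb : SizeBound A n b) (i j : W) :
    Realizes (fun x : Fin (HE.pkLen n (Lc n)) ⊕ Fin (A.ctLen n) → Bool =>
      encryptedCNOT A n (fun a => x (.inl a)) (fun a => x (.inr a)) i j)
      (fun a : Fin (A.ctLen n) ⊕ Option (Fin (A.rndLen n)) → Bool =>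
        (fun l => a (.inl l), fun l => a (.inr l))) (60 * b + 3) := by
  obtain ⟨n₁, n₂, gates, hn₁, hn₂, hg, h⟩ :=
    exists_gates_encryptedCNOT (A.prep n) hb.comp_image i j none
  refine ⟨_, inferInstance, inferInstance, gates, fun x a f ψ =>
    if (fun l => f (.inr (.inr (.inl l)))) = (fun _ => false) ∧
        (fun l => f (.inr (.inr (.inr l)))) = (fun _ => false) then
      encryptedKraus A n (fun a => x (.inl a)) (fun a => x (.inr a)) i j
        (Sum.elim (fun i => f (.inl i)) fun i => f (.inr (.inl i))) (fun l => a (.inl l))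
        (fun l => a (.inr l)) ψ
    else 0, ?_, ?_, ?_⟩
  · have h1 := hb.prep
    unfold StatePrep.size at h1
    have h2 := hb.pkLen
    have h3 := hb.altLen
    have h4 := hb.rndLen
    simp only [Fintype.card_sum, Fintype.card_fin, Fintype.card_option] at hg ⊢
    omega
  · intro x ψ v x' a f
    have hu : (Sum.elim v (Sum.elim x' (Sum.elim a f)) : _ → Bool) =
        cnotBits v (fun i => x' (.inl i)) (fun i => x' (.inr i)) (fun i => a (.inl i))
          (fun i => a (.inr i)) (fun i => f (.inl i)) (fun i => f (.inr (.inl i)))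
          (fun l => f (.inr (.inr (.inl l)))) (fun l => f (.inr (.inr (.inr l)))) := by
      funext l
      rcases l with l | (l | l) | (l | l) | l | l | l | l <;> rfl
    have hx : Sum.elim (fun i => x' (.inl i)) (fun i => x' (.inr i)) = x' :=
      funext fun l => by cases l <;> rfl
    rw [hu, h, hx]
    by_cases hxx : x' = x
    · rw [if_pos hxx]
      simp only [hxx, true_and, Fintype.card_option, Fintype.card_fin]
      split_ifs
      · rfl
      · rfl
    · rw [if_neg hxx, if_neg fun h' => hxx h'.1]
  · intro x ψ M _ G hG
    rw [map_encryptedCNOT_sum]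
    refine Finset.sum_congr rfl fun a _ => ?_
    let e : Fin (HE.pkLen n (Lc n)) ⊕ Fin (A.prep n).anc ↪ Fin (HE.pkLen n (Lc n)) ⊕
        Fin (A.prep n).anc ⊕ Fin (n₁ + 1) ⊕ Fin (n₂ + 1) :=
      ⟨Sum.elim .inl fun i => .inr (.inl i), by rintro (i | i) (j | j) h <;> cases h <;> rfl⟩
    -- Only the values of `f` with zero oracle ancillas contribute.
    rw [sum_glue e fun _ => false]
    · refine Finset.sum_congr rfl fun g _ => ?_
      have hg : glue e g (fun _ => false) = Sum.elim (fun i => g (.inl i))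
          (Sum.elim (fun i => g (.inr i)) fun _ => false) := by
        refine glue_eq ?_ ?_
        · rintro (i | i) <;> rfl
        · rintro (i | i | i) hi
          · exact (hi (.inl i) rfl).elim
          · exact (hi (.inr i) rfl).elim
          · rfl
      rw [hg]
      refine congrArg (G _) ((if_pos ⟨rfl, rfl⟩).trans ?_)
      congr 1
      funext i
      cases i <;> rfl
    · rintro f ⟨j, hj, hf⟩
      refine (congrArg (G _) (if_neg ?_)).trans (hG a)
      rintro ⟨h1, h2⟩
      rcases j with j | j | j | j
      · exact hj (.inl j) rfl
      · exact hj (.inr j) rfl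
      · exact hf (congrFun h1 j)
      · exact hf (congrFun h2 j)

end Level

section Level

variable {HE : LeveledHE} {Lc : ℕ → ℕ} {A : AltScheme HE Lc} {n b : ℕ}
  {W ι : Type} [Fintype W] [DecidableEq W] [Fintype ι] [DecidableEq ι]

theorem runGates_cliff (gs : List (CliffordGate W)) (ψ : Vec W) :
    runGates (gs.map .cliff) ψ = gs.foldl (fun φ g => g.apply φ) ψ := by
  unfold runGates
  rw [List.foldl_map]
  rfl

theorem Level.apply_eq_runGates (l : Level W) :
    l.apply = runGates (l.cliff.map .cliff ++ l.tof.map .tof) := by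
  funext ψ
  rw [runGates_append, runGates_cliff]
  unfold runGates
  rw [List.foldl_map]
  rfl

theorem realizes_level (l : Level W) :
    Realizes (fun _ : ι → Bool => op l.apply) (fun _ : Empty → Bool => ()) l.size := by
  rw [l.apply_eq_runGates]
  exact (realizes_op _).mono (by simp [Level.size])

/-- The bits of the result `y, d` of an encrypted CNOT operation. -/
abbrev CnotIdx (A : AltScheme HE Lc) (n : ℕ) : Type :=
  Fin (A.ctLen n) ⊕ Option (Fin (A.rndLen n))

/-- The encrypted CNOT operation, for a control ciphertext that is converted. -/
theorem realizes_convert_encryptedCNOT (hb : SizeBound A n b) (p : Fin (HE.pkLen n (Lc n)) → ι)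
    (c : Fin (HE.ctLen n (Lc n)) → ι) (i j : W) :
    Realizes (fun x : ι → Bool => encryptedCNOT A n (fun a => x (p a))
      (A.convert n (fun a => x (p a)) fun a => x (c a)) i j)
      (fun a : CnotIdx A n → Bool =>
        (fun l => a (.inl l), fun l => a (.inr l))) (75 * b + 4) := by
  have h1 := (realizes_encryptedCNOT hb i j).precomp ((comp_wire p).sum
    (hb.convert.precomp (Sum.elim p c)))
  refine h1.mono ?_
  have := hb.pkLen
  have := hb.altLen
  simp only [Fintype.card_sum, Fintype.card_fin]
  omega

/-- A circuit for the `j`-th encrypted CNOT operation that corrects a Toffoli gate. The third one is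
conjugated by Hadamard gates on the second qubit of the Toffoli gate. -/
theorem realizes_removeGate (hb : SizeBound A n b) (p : Fin (HE.pkLen n (Lc n)) → ι)
    (c : Fin (HE.ctLen n (Lc n)) → ι) (t : ToffoliGate W) (j : Fin 3) :
    Realizes (fun x : ι → Bool => removeGate A n (fun a => x (p a)) t j fun a => x (c a))
      (fun a => a) (91 * b + 7) := by
  have hy := hb.altLen
  have hr := hb.rndLen
  have hfin : Realizes (W := W) (fun z : ι ⊕ CnotIdx A n → Bool =>
      pure (Sum.elim (A.convert n (fun a => z (.inl (p a))) fun a => z (.inl (c a)))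
        (Sum.elim (fun l => z (.inr (.inl l))) fun l => z (.inr (.inr l))) : RecIdx A n → Bool))
      (fun a => a) (11 * b + 3 * b + 1) := by
    have h1 := (hb.convert.precomp (ι' := ι ⊕ CnotIdx A n)
      (Sum.elim (fun a => .inl (p a)) fun a => .inl (c a))).sum
        (comp_wire (ι := ι ⊕ CnotIdx A n) fun l : CnotIdx A n => .inr l)
    refine (realizes_pure' h1 (D := fun a => a) fun z => ?_).mono ?_
    swap
    · simp only [Fintype.card_sum, Fintype.card_fin, Fintype.card_option]
      omega
    funext l
    rcases l with l | l | l <;> rfl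
  -- without the Hadamard gates of the third operation
  have hplain : ∀ i k : W, Realizes (fun x : ι → Bool =>
      encryptedCNOT A n (fun a => x (p a)) (A.convert n (fun a => x (p a)) fun a => x (c a)) i k >>=
        fun yd => pure (Sum.elim (A.convert n (fun a => x (p a)) fun a => x (c a))
          (Sum.elim yd.1 yd.2) : RecIdx A n → Bool)) (fun a => a) (91 * b + 5) := by
    intro i k
    refine ((realizes_convert_encryptedCNOT hb p c i k).bind (f := fun x yd =>
      (pure (Sum.elim (A.convert n (fun a => x (p a)) fun a => x (c a))
          (Sum.elim yd.1 yd.2) : RecIdx A n → Bool) : QProg W _)) hfin).mono ?_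
    simp only [Fintype.card_sum, Fintype.card_fin, Fintype.card_option]
    omega
  have hop : ∀ {ι' : Type} [Fintype ι'] [DecidableEq ι'], Realizes
      (fun _ : ι' → Bool => op (CliffordGate.h t.b).apply) (fun _ : Empty → Bool => ()) 1 :=
    fun {ι'} _ _ => realizes_op (ι := ι') [.cliff (.h t.b)]
  fin_cases j
  · exact (hplain t.a t.c).mono (by omega)
  · exact (hplain t.b t.c).mono (by omega)
  · have h1 := (hop (ι' := ι ⊕ CnotIdx A n)).bind (D := fun _ : Empty → Bool => ())
      (f := fun z _ => pure (Sum.elim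
        (A.convert n (fun a => z (.inl (p a))) fun a => z (.inl (c a)))
        (Sum.elim (fun l => z (.inr (.inl l))) fun l => z (.inr (.inr l))) : RecIdx A n → Bool))
      (hfin.comap .inl)
    have h2 := (realizes_convert_encryptedCNOT hb p c t.a t.b).bind (f := fun x yd =>
      (op (CliffordGate.h t.b).apply >>= fun _ =>
        pure (Sum.elim (A.convert n (fun a => x (p a)) fun a => x (c a))
          (Sum.elim yd.1 yd.2) : RecIdx A n → Bool) : QProg W _)) h1
    have h3 := (hop (ι' := ι)).bind (D := fun _ : Empty → Bool => ()) (f := fun x _ =>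
      (encryptedCNOT A n (fun a => x (p a)) (A.convert n (fun a => x (p a)) fun a => x (c a))
        t.a t.b >>= fun yd => op (CliffordGate.h t.b).apply >>= fun _ =>
        pure (Sum.elim (A.convert n (fun a => x (p a)) fun a => x (c a))
          (Sum.elim yd.1 yd.2) : RecIdx A n → Bool) : QProg W _)) (h2.comap .inl)
    refine Realizes.mono h3 ?_
    simp only [Fintype.card_empty, Fintype.card_sum, Fintype.card_fin, Fintype.card_option]
    omega

/-- The bits of the classical data held by the server after a level. -/
abbrev DataIdx (A : AltScheme HE Lc) (n : ℕ) (l : Level W) : Type :=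
  (KeyIdx W × Fin (HE.ctLen n (Lc n))) ⊕ ((Fin l.tof.length × Fin 3) × RecIdx A n)

/-- The bits of the results of the encrypted CNOT operations of a level. -/
abbrev OpIdx (A : AltScheme HE Lc) (n : ℕ) (l : Level W) : Type :=
  Fin l.tof.length × Fin 3 × RecIdx A n

/-- The classical data of the server given by their bits. -/
def decodeData (l : Level W) (a : DataIdx A n l → Bool) : ServerData A n l :=
  (fun j i => a (.inl (j, i)), fun t i => a (.inr (t, i)))

set_option synthInstance.maxSize 1000 in
set_option synthInstance.maxHeartbeats 100000 in
/-- A circuit for the quantum part of a level: the gates of the level, and the removal of the gates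
that remain of the Pauli keys. -/
theorem realizes_runLevel (hb : SizeBound A n b) (l : Level W) (p : Fin (HE.pkLen n (Lc n)) → ι)
    (c : LevelOut l × Fin (HE.ctLen n (Lc n)) → ι) (hl : l.size ≤ b)
    (hd : Fintype.card (DataIdx A n l) ≤ b) :
    Realizes (fun x : ι → Bool => runLevel A n (fun a => x (p a)) l fun j a => x (c (j, a)))
      (decodeData l) (400 * (b + 1) ^ 3) := by
  have h1 : Realizes (fun x : ι → Bool => forFin l.tof.length fun t => forFin 3 fun j =>
      removeGate A n (fun a => x (p a)) (l.tof.get t) j fun a => x (c (.inr (t, j), a)))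
      (fun (a : OpIdx A n l → Bool) t j i => a (t, j, i)) _ :=
    realizes_forFin _ _ fun t => realizes_forFin 3 _ fun j =>
      realizes_removeGate hb p (fun a => c (.inr (t, j), a)) (l.tof.get t) j
  have h2 : Realizes (W := W) (fun z : ι ⊕ OpIdx A n l → Bool => pure
      ((fun i a => z (.inl (c (.inl i, a))), fun t i => z (.inr (t.1, t.2, i))) : ServerData A n l))
      (decodeData l) _ :=
    realizes_pure' (comp_wire (ι := ι ⊕ OpIdx A n l) (o := DataIdx A n l) (Sum.elim
      (fun q => .inl (c (.inl q.1, q.2))) fun q => .inr (q.1.1, q.1.2, q.2))) fun z => rfl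
  have h3 := h1.bind (f := fun (x : ι → Bool) (e : Fin l.tof.length → Fin 3 → RecIdx A n → Bool) =>
    (pure ((fun i a => x (c (.inl i, a)), fun t => e t.1 t.2) : ServerData A n l) :
      QProg W _)) h2
  have h4 := (realizes_level (ι := ι) l).bind (f := fun x _ =>
    (forFin l.tof.length (fun t => forFin 3 fun j =>
      removeGate A n (fun a => x (p a)) (l.tof.get t) j fun a => x (c (.inr (t, j), a))) >>=
      fun e => pure ((fun i a => x (c (.inl i, a)), fun t => e t.1 t.2) : ServerData A n l) :
      QProg W _)) (h3.comap .inl)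
  refine Realizes.mono h4 ?_
  have hR : Fintype.card (RecIdx A n) ≤ 3 * b := by
    have := hb.altLen
    have := hb.rndLen
    simp only [Fintype.card_sum, Fintype.card_fin, Fintype.card_option]
    omega
  have hk : l.tof.length ≤ b := by
    unfold Level.size at hl
    omega
  have hT : Fintype.card (OpIdx A n l) ≤ b := by
    refine le_trans ?_ hd
    simp only [OpIdx, DataIdx, Fintype.card_sum, Fintype.card_prod]
    nlinarith
  have hR3 : Fintype.card (Fin 3 × RecIdx A n) ≤ 9 * b := by
    rw [Fintype.card_prod, Fintype.card_fin]
    omega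
  rw [Fintype.card_empty]
  clear h1 h2 h3 h4
  generalize Fintype.card (RecIdx A n) = r at *
  generalize Fintype.card (OpIdx A n l) = t at *
  generalize Fintype.card (DataIdx A n l) = d at *
  generalize Fintype.card (Fin 3 × RecIdx A n) = r' at *
  generalize l.tof.length = k at *
  have e1 : 3 * (91 * b + 7 + 1 + (3 + 1) * r) + 1 ≤ 309 * b + 25 := by omega
  have e2 : k * (3 * (91 * b + 7 + 1 + (3 + 1) * r) + 1 + 1 + (k + 1) * r') + 1 ≤
      b * (309 * b + 25 + 1 + (b + 1) * (9 * b)) + 1 := by gcongr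
  calc _ ≤ b + 0 + (b * (309 * b + 25 + 1 + (b + 1) * (9 * b)) + 1 + b + (11 * 0 + b + 1)) := by
        gcongr
    _ ≤ _ := by nlinarith [Nat.zero_le (b ^ 3), Nat.zero_le (b ^ 2)]

end Level

/-! ### Quantum circuits for the homomorphic evaluation -/

section Eval

variable {HE : LeveledHE} {Lc : ℕ → ℕ} {A : AltScheme HE Lc} {n b : ℕ}
  {W ι I O : Type} [Fintype W] [DecidableEq W] [Fintype ι] [DecidableEq ι]
  [Fintype I] [DecidableEq I] [Fintype O] [DecidableEq O]

/-- Bits in the classical register are encrypted with coins that are tossed by measurements. -/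
theorem realizes_encBits (hb : SizeBound A n b) (p : Fin (HE.pkLen n (Lc n)) → ι) (q : I → ι) :
    Realizes (W := W) (fun x : ι → Bool => encBits n (Lc n) (fun a => x (p a)) fun j => x (q j))
      (fun (a : I × Fin (HE.ctLen n (Lc n)) → Bool) j i => a (j, i))
      (14 * (Fintype.card I * b) + 1) := by
  have h1 := realizes_coins (W := W) (ι := ι) (I × Fin (HE.encCoins n (Lc n)))
  have h2 : Comp (fun (z : ι ⊕ (I × Fin (HE.encCoins n (Lc n))) → Bool)
      (r : I × Fin (HE.ctLen n (Lc n))) => HE.enc n (Lc n) (fun a => z (.inl (p a)))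
        (z (.inl (q r.1))) (fun i => z (.inr (r.1, i))) r.2) (Fintype.card I * b) :=
    Comp.family fun j => hb.enc.precomp (ι' := ι ⊕ (I × Fin (HE.encCoins n (Lc n))))
      (Sum.elim (fun a => .inl (p a)) (Sum.elim (fun _ => .inl (q j)) fun i => .inr (j, i)))
  have h3 := h1.bind (f := fun x r => (pure fun j => HE.enc n (Lc n) (fun a => x (p a)) (x (q j))
    fun i => r (j, i) : QProg W (I → Bits (HE.ctLen n (Lc n)))))
    (D' := fun (a : I × Fin (HE.ctLen n (Lc n)) → Bool) j i => a (j, i))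
    (realizes_pure' h2 fun z => rfl)
  refine Realizes.mono h3 ?_
  have h4 := Nat.mul_le_mul_left (Fintype.card I) hb.encCoins
  have h5 := Nat.mul_le_mul_left (Fintype.card I) hb.ctLen
  simp only [Fintype.card_prod, Fintype.card_fin]
  omega

/-- Homomorphic evaluation, for each output bit separately. -/
theorem realizes_evalBits (hb : SizeBound A n b) (C : BoolCircuit I O)
    (hC : ∀ o, HE.evalCoins n (Lc n) (C.single o) ≤ b ∧ Comp
      (fun x : Fin (HE.evkLen n (Lc n)) ⊕ (Fin (Fintype.card I) × Fin (HE.ctLen n (Lc n))) ⊕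
          Fin (HE.evalCoins n (Lc n) (C.single o)) → Bool =>
        HE.eval n (Lc n) (C.single o) (fun i => x (.inl i)) (fun j i => x (.inr (.inl (j, i))))
          fun i => x (.inr (.inr i))) b)
    (p : Fin (HE.evkLen n (Lc n)) → ι) (q : I × Fin (HE.ctLen n (Lc n)) → ι) :
    Realizes (W := W) (fun x : ι → Bool =>
        evalBits n (Lc n) C (fun a => x (p a)) fun j a => x (q (j, a)))
      (fun (a : O × Fin (HE.ctLen n (Lc n)) → Bool) j i => a (j, i))
      (14 * (Fintype.card O * b) + 1) := by
  let K := Σ o : O, Fin (HE.evalCoins n (Lc n) (C.single o))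
  have h1 := realizes_coins (W := W) (ι := ι) K
  have h2 : Comp (fun (z : ι ⊕ K → Bool) (r : O × Fin (HE.ctLen n (Lc n))) =>
      HE.eval n (Lc n) (C.single r.1) (fun a => z (.inl (p a)))
        (fun j i => z (.inl (q ((Fintype.equivFin I).symm j, i)))) (fun i => z (.inr ⟨r.1, i⟩)) r.2)
      (Fintype.card O * b) :=
    Comp.family fun o => (hC o).2.precomp (ι' := ι ⊕ K) (Sum.elim (fun a => .inl (p a))
      (Sum.elim (fun r => .inl (q ((Fintype.equivFin I).symm r.1, r.2))) fun i => .inr ⟨o, i⟩))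
  have h3 := h1.bind (f := fun x r => (pure fun o => HE.eval n (Lc n) (C.single o)
    (fun a => x (p a)) (fun j i => x (q ((Fintype.equivFin I).symm j, i)))
    fun i => r ⟨o, i⟩ : QProg W (O → Bits (HE.ctLen n (Lc n)))))
    (D' := fun (a : O × Fin (HE.ctLen n (Lc n)) → Bool) j i => a (j, i))
    (realizes_pure' h2 fun z => rfl)
  refine Realizes.mono h3 ?_
  have h4 : Fintype.card K ≤ Fintype.card O * b := by
    rw [Fintype.card_sigma]
    simp only [Fintype.card_fin]
    refine (Finset.sum_le_sum fun o _ => (hC o).1).trans ?_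
    simp
  have h5 := Nat.mul_le_mul_left (Fintype.card O) hb.ctLen
  simp only [Fintype.card_prod, Fintype.card_fin]
  omega

/-- All quantities on which the size of the evaluation of `C` depends are at most `b`. The circuits
that are evaluated homomorphically have size at most `s`. -/
structure EvalBound (V : LevelCircuits A) {L : ℕ} (C : QCircuit (Fin n) L) (s b : ℕ) : Prop where
  sizes : SizeBound A n b
  le : s ≤ b
  level : ∀ i, (C.level i).size ≤ b
  first : (V.first n (C.level 0)).size ≤ s
  next : ∀ i, (V.next n (C.level i) (C.level (i + 1))).size ≤ s
  eval : ∀ (l : ℕ) (f : BoolCircuit (Fin l) Unit), f.size ≤ s → HE.evalCoins n (Lc n) f ≤ b ∧ Comp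
    (fun x : Fin (HE.evkLen n (Lc n)) ⊕ (Fin l × Fin (HE.ctLen n (Lc n))) ⊕
        Fin (HE.evalCoins n (Lc n) f) → Bool =>
      HE.eval n (Lc n) f (fun i => x (.inl i)) (fun j i => x (.inr (.inl (j, i))))
        fun i => x (.inr (.inr i))) b

variable {V : LevelCircuits A} {L s : ℕ} {C : QCircuit (Fin n) L}

theorem EvalBound.card_nextIn (h : EvalBound V C s b) (i : ℕ) :
    Fintype.card (NextIn A n (C.level i)) ≤ b := by
  have h1 := h.next i
  have h2 := h.le
  unfold BoolCircuit.size at h1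
  omega

theorem EvalBound.card_dataIdx (h : EvalBound V C s b) (i : ℕ) :
    Fintype.card (DataIdx A n (C.level i)) ≤ b := by
  refine le_trans ?_ (h.card_nextIn i)
  rw [Fintype.card_sum (α := _ ⊕ _)]
  exact Nat.le_add_left _ _

theorem EvalBound.card_levelOut (h : EvalBound V C s b) (i : ℕ) :
    Fintype.card (LevelOut (C.level i)) ≤ b := by
  cases i with
  | zero =>
    have h1 := h.first
    have h2 := h.le
    unfold BoolCircuit.size at h1
    omega
  | succ i =>
    have h1 := h.next i
    have h2 := h.le
    unfold BoolCircuit.size at h1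
    omega

/-- The evaluation of a classical circuit and the quantum part of a level. -/
theorem EvalBound.realizes_evalLevel (h : EvalBound V C s b) (i : ℕ)
    (F : BoolCircuit I (LevelOut (C.level i))) (hF : F.size ≤ s)
    (v : Fin (HE.evkLen n (Lc n)) → ι) (p : Fin (HE.pkLen n (Lc n)) → ι)
    (q : I × Fin (HE.ctLen n (Lc n)) → ι) :
    Realizes (fun x : ι → Bool =>
      evalBits n (Lc n) F (fun a => x (v a)) (fun j a => x (q (j, a))) >>= fun c =>
        runLevel A n (fun a => x (p a)) (C.level i) c)
      (decodeData (C.level i)) (420 * (b + 1) ^ 3) := by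
  have h1 := realizes_evalBits (W := Fin n) h.sizes F
    (fun o => h.eval _ _ ((F.size_single_le o).trans hF)) v q
  have h2 := realizes_runLevel (ι := ι ⊕ (LevelOut (C.level i) × Fin (HE.ctLen n (Lc n)))) h.sizes
    (C.level i) (fun a => .inl (p a)) .inr (h.level i) (h.card_dataIdx i)
  have h3 := h1.bind (f := fun (x : ι → Bool) (c : LevelOut (C.level i) → _) =>
    runLevel A n (fun a => x (p a)) (C.level i) c) h2
  refine Realizes.mono h3 ?_
  have h4 := Nat.mul_le_mul_right b (h.card_levelOut i)
  have h5 := Nat.mul_le_mul (h.card_levelOut i) h.sizes.ctLen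
  rw [Fintype.card_prod, Fintype.card_fin]
  nlinarith [Nat.zero_le (b ^ 3), Nat.zero_le (b ^ 2)]

end Eval

section Eval

variable {HE : LeveledHE} {Lc : ℕ → ℕ} {A : AltScheme HE Lc} {n b s L : ℕ}
  {V : LevelCircuits A} {C : QCircuit (Fin n) L}
  {ι : Type} [Fintype ι] [DecidableEq ι]

set_option synthInstance.maxSize 2000 in
set_option synthInstance.maxHeartbeats 400000 in
/-- The computation of the server between the quantum parts of two levels, and the quantum part of
the second one. -/
theorem EvalBound.realizes_nextLevel (h : EvalBound V C s b) (i : ℕ)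
    (v : Fin (HE.evkLen n (Lc n)) → ι) (p₀ p₁ : Fin (HE.pkLen n (Lc n)) → ι)
    (k : (Fin (HE.skLen n (Lc n)) ⊕ Fin (A.tdLen n)) × Fin (HE.ctLen n (Lc n)) → ι)
    (d : DataIdx A n (C.level i) → ι) :
    Realizes (fun x : ι → Bool =>
      encBits n (Lc n) (fun a => x (p₁ a)) (fun a => x (p₀ a)) >>= fun cpk =>
      encBits n (Lc n) (fun a => x (p₁ a))
        (fun q : KeyIdx (Fin n) × Fin (HE.ctLen n (Lc n)) => x (d (.inl q))) >>= fun cc =>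
      encBits n (Lc n) (fun a => x (p₁ a))
        (fun q : (Fin (C.level i).tof.length × Fin 3) × RecIdx A n => x (d (.inr q))) >>= fun ce =>
      evalBits n (Lc n) (V.next n (C.level i) (C.level (i + 1))) (fun a => x (v a))
        (Sum.elim (Sum.elim (fun j a => x (k (.inl j, a)))
          (Sum.elim (fun j a => x (k (.inr j, a))) cpk)) (Sum.elim cc ce)) >>= fun c =>
      runLevel A n (fun a => x (p₁ a)) (C.level (i + 1)) c)
      (decodeData (C.level (i + 1))) (500 * (b + 1) ^ 3) := by
  -- The bits of the new ciphertexts: of the old public key, of the encrypted Pauli keys, and of the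
  -- results of the encrypted CNOT operations.
  let K₁ := Fin (HE.pkLen n (Lc n)) × Fin (HE.ctLen n (Lc n))
  let K₂ := (KeyIdx (Fin n) × Fin (HE.ctLen n (Lc n))) × Fin (HE.ctLen n (Lc n))
  let K₃ := ((Fin (C.level i).tof.length × Fin 3) × RecIdx A n) × Fin (HE.ctLen n (Lc n))
  have h1 := realizes_encBits (W := Fin n) h.sizes p₁ p₀
  have h2 := realizes_encBits (W := Fin n) (ι := ι ⊕ K₁) h.sizes (fun a => .inl (p₁ a))
    fun q : KeyIdx (Fin n) × Fin (HE.ctLen n (Lc n)) => .inl (d (.inl q))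
  have h3 := realizes_encBits (W := Fin n) (ι := (ι ⊕ K₁) ⊕ K₂) h.sizes
    (fun a => .inl (.inl (p₁ a)))
    fun q : (Fin (C.level i).tof.length × Fin 3) × RecIdx A n => .inl (.inl (d (.inr q)))
  have h4 := h.realizes_evalLevel (ι := ((ι ⊕ K₁) ⊕ K₂) ⊕ K₃) (i + 1)
    (V.next n (C.level i) (C.level (i + 1))) (h.next i) (fun a => .inl (.inl (.inl (v a))))
    (fun a => .inl (.inl (.inl (p₁ a))))
    fun q : NextIn A n (C.level i) × Fin (HE.ctLen n (Lc n)) =>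
      match q with
      | (.inl (.inl j), a) => .inl (.inl (.inl (k (.inl j, a))))
      | (.inl (.inr (.inl j)), a) => .inl (.inl (.inl (k (.inr j, a))))
      | (.inl (.inr (.inr j)), a) => .inl (.inl (.inr (j, a)))
      | (.inr (.inl j), a) => .inl (.inr (j, a))
      | (.inr (.inr j), a) => .inr (j, a)
  -- The part that follows the encryptions is replaced by a variable `G`, which keeps the terms in
  -- the compositions below small.
  obtain ⟨G, hG⟩ : ∃ G : (ι → Bool) → (Fin (HE.pkLen n (Lc n)) → Bits (HE.ctLen n (Lc n))) →
      (KeyIdx (Fin n) × Fin (HE.ctLen n (Lc n)) → Bits (HE.ctLen n (Lc n))) →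
      ((Fin (C.level i).tof.length × Fin 3) × RecIdx A n → Bits (HE.ctLen n (Lc n))) →
      QProg (Fin n) (ServerData A n (C.level (i + 1))), ∀ x cpk cc ce, G x cpk cc ce =
    evalBits n (Lc n) (V.next n (C.level i) (C.level (i + 1))) (fun a => x (v a))
      (Sum.elim (Sum.elim (fun j a => x (k (.inl j, a)))
        (Sum.elim (fun j a => x (k (.inr j, a))) cpk)) (Sum.elim cc ce)) >>= fun c =>
      runLevel A n (fun a => x (p₁ a)) (C.level (i + 1)) c := ⟨_, fun _ _ _ _ => rfl⟩
  have h5 : Realizes (fun z : ((ι ⊕ K₁) ⊕ K₂) ⊕ K₃ → Bool =>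
      G (fun i => z (.inl (.inl (.inl i)))) (fun j a => z (.inl (.inl (.inr (j, a)))))
        (fun j a => z (.inl (.inr (j, a)))) fun j a => z (.inr (j, a)))
      (decodeData (C.level (i + 1))) (420 * (b + 1) ^ 3) := by
    refine h4.congr (fun z => ?_) fun _ => rfl
    rw [hG]
    refine congrArg (fun B =>
      evalBits (W := Fin n) n (Lc n) (V.next n (C.level i) (C.level (i + 1)))
        (fun a => z (.inl (.inl (.inl (v a))))) B >>= fun c =>
          runLevel A n (fun a => z (.inl (.inl (.inl (p₁ a))))) (C.level (i + 1)) c)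
      (funext fun j => ?_)
    rcases j with (j | j | j) | j | j <;> rfl
  clear h4
  have h6 := h3.bind (f := fun z ce => G (fun i => z (.inl (.inl i)))
    (fun j a => z (.inl (.inr (j, a)))) (fun j a => z (.inr (j, a))) ce) h5
  have h7 := h2.bind (f := fun (z : ι ⊕ K₁ → Bool) cc =>
    encBits n (Lc n) (fun a => z (.inl (p₁ a)))
        (fun q : (Fin (C.level i).tof.length × Fin 3) × RecIdx A n => z (.inl (d (.inr q)))) >>=
      fun ce => G (fun i => z (.inl i)) (fun j a => z (.inr (j, a))) cc ce) h6
  have h8 := h1.bind (f := fun (x : ι → Bool) cpk =>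
    encBits n (Lc n) (fun a => x (p₁ a))
        (fun q : KeyIdx (Fin n) × Fin (HE.ctLen n (Lc n)) => x (d (.inl q))) >>= fun cc =>
      encBits n (Lc n) (fun a => x (p₁ a))
        (fun q : (Fin (C.level i).tof.length × Fin 3) × RecIdx A n => x (d (.inr q))) >>=
      fun ce => G x cpk cc ce) h7
  simp only [hG] at h8
  refine Realizes.mono h8 ?_
  clear h1 h2 h3 h5 h6 h7 h8
  have hd := h.card_dataIdx i
  rw [Fintype.card_sum] at hd
  have e1 := Nat.mul_le_mul_right b h.sizes.pkLen
  have e2 := Nat.mul_le_mul_right b ((Nat.le_add_right _ _).trans hd)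
  have e3 := Nat.mul_le_mul_right b ((Nat.le_add_left _ _).trans hd)
  have f1 := Nat.mul_le_mul h.sizes.pkLen h.sizes.ctLen
  have f2 := Nat.mul_le_mul ((Nat.le_add_right _ _).trans hd) h.sizes.ctLen
  have f3 := Nat.mul_le_mul ((Nat.le_add_left _ _).trans hd) h.sizes.ctLen
  rw [Fintype.card_prod (α := Fin (HE.pkLen n (Lc n))), Fintype.card_prod (α := KeyIdx (Fin n) × _),
    Fintype.card_prod (α := (Fin (C.level i).tof.length × Fin 3) × RecIdx A n)]
  simp only [Fintype.card_fin] at e1 e2 e3 f1 f2 f3 ⊢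
  nlinarith [Nat.zero_le (b ^ 3), Nat.zero_le (b ^ 2)]

end Eval

section Run

variable {HE : LeveledHE} {Lc : ℕ → ℕ} {A : AltScheme HE Lc} {n b s L : ℕ}
  {V : LevelCircuits A} {C : QCircuit (Fin n) L}

/-- The input bits of the evaluation: the public key, the evaluation key and the encrypted Pauli
key. -/
abbrev EvalIn (A : AltScheme HE Lc) (n L : ℕ) : Type :=
  Fin (HE.pkLen n (Lc n)) ⊕ EvkIdx A n L ⊕ (KeyIdx (Fin n) × Fin (HE.ctLen n (Lc n)))

/-- The input bits that hold the public key of level `i`. -/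
def pkWire (A : AltScheme HE Lc) (n L : ℕ) (i : Fin (L + 1)) (a : Fin (HE.pkLen n (Lc n))) :
    EvalIn A n L :=
  Fin.cases (motive := fun _ => EvalIn A n L) (.inl a) (fun i => .inr (.inl (.inr (.inl (i, a))))) i

theorem pkAt_eq (x : EvalIn A n L → Bool) (i : Fin (L + 1)) :
    pkAt (fun a => x (.inl a)) (fun q => x (.inr (.inl q))) i = fun a => x (pkWire A n L i a) := by
  refine Fin.cases rfl (fun i => rfl) i

set_option synthInstance.maxSize 2000 in
set_option synthInstance.maxHeartbeats 400000 in
/-- A circuit for the first `i + 1` levels. -/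
theorem EvalBound.realizes_runUpTo (h : EvalBound V C s b) (i : ℕ) (hi : i ≤ L) :
    Realizes (fun x : EvalIn A n L → Bool => runUpTo V C (fun a => x (.inl a))
      (fun q => x (.inr (.inl q))) (fun j a => x (.inr (.inr (j, a)))) i hi)
      (decodeData (C.level i)) ((i + 1) * (501 * (b + 1) ^ 3)) := by
  induction i with
  | zero =>
    refine (h.realizes_evalLevel (ι := EvalIn A n L) 0 (V.first n (C.level 0)) h.first
      (fun a => .inr (.inl (.inl (0, a)))) .inl fun q => .inr (.inr q)).mono ?_
    rw [Nat.zero_add, one_mul]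
    gcongr
    norm_num
  | succ i ih =>
    have h1 := ih (Nat.le_of_succ_le hi)
    have h2 := h.realizes_nextLevel (ι := EvalIn A n L ⊕ DataIdx A n (C.level i)) i
      (fun a => .inl (.inr (.inl (.inl (⟨i + 1, by omega⟩, a)))))
      (fun a => .inl (pkWire A n L ⟨i, by omega⟩ a))
      (fun a => .inl (pkWire A n L ⟨i + 1, by omega⟩ a))
      (fun q => .inl (.inr (.inl (.inr (.inr (⟨i, by omega⟩, q))))))
      .inr
    have h3 := h1.bind (f := fun (x : EvalIn A n L → Bool) (S : ServerData A n (C.level i)) =>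
      encBits n (Lc n) (fun a => x (pkWire A n L ⟨i + 1, by omega⟩ a))
        (fun a => x (pkWire A n L ⟨i, by omega⟩ a)) >>= fun cpk =>
      encBits n (Lc n) (fun a => x (pkWire A n L ⟨i + 1, by omega⟩ a))
        (fun q : KeyIdx (Fin n) × Fin (HE.ctLen n (Lc n)) => S.1 q.1 q.2) >>= fun cc =>
      encBits n (Lc n) (fun a => x (pkWire A n L ⟨i + 1, by omega⟩ a))
        (fun q : (Fin (C.level i).tof.length × Fin 3) × RecIdx A n => S.2 q.1 q.2) >>= fun ce =>
      evalBits n (Lc n) (V.next n (C.level i) (C.level (i + 1)))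
        (fun a => x (.inr (.inl (.inl (⟨i + 1, by omega⟩, a)))))
        (Sum.elim (Sum.elim (fun j a => x (.inr (.inl (.inr (.inr (⟨i, by omega⟩, .inl j, a))))))
          (Sum.elim (fun j a => x (.inr (.inl (.inr (.inr (⟨i, by omega⟩, .inr j, a)))))) cpk))
          (Sum.elim cc ce)) >>= fun c =>
      runLevel A n (fun a => x (pkWire A n L ⟨i + 1, by omega⟩ a)) (C.level (i + 1)) c) h2
    refine (Realizes.mono h3 ?_).congr (fun x => ?_) fun _ => rfl
    · have h4 := h.card_dataIdx i
      have h5 : b ≤ (b + 1) ^ 3 := by nlinarith [Nat.zero_le (b ^ 3), Nat.zero_le (b ^ 2)]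
      calc _ ≤ (i + 1) * (501 * (b + 1) ^ 3) + b + 500 * (b + 1) ^ 3 := by gcongr
        _ ≤ _ := by
          rw [add_mul (i + 1) 1]
          omega
    · simp only [← pkAt_eq]
      rfl

/-- A circuit for the whole evaluation; the output consists of the final encrypted Pauli keys. -/
theorem EvalBound.realizes_eval (h : EvalBound V C s b) :
    Realizes (fun x : EvalIn A n L → Bool => (QHE V).eval n L C (fun a => x (.inl a))
      (fun q => x (.inr (.inl q))) fun q => x (.inr (.inr q)))
      (fun a : KeyIdx (Fin n) × Fin (HE.ctLen n (Lc n)) → Bool => a)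
      ((L + 2) * (501 * (b + 1) ^ 3)) := by
  have h1 := h.realizes_runUpTo L le_rfl
  have h2 : Realizes (W := Fin n) (fun z : EvalIn A n L ⊕ DataIdx A n (C.level L) → Bool =>
      (pure fun q => z (.inr (.inl q)) :
        QProg (Fin n) (KeyIdx (Fin n) × Fin (HE.ctLen n (Lc n)) → Bool))) (fun a => a) _ :=
    realizes_pure' (comp_wire fun q => .inr (.inl q)) fun z => rfl
  have h3 := h1.bind (f := fun (x : EvalIn A n L → Bool) (S : ServerData A n (C.level L)) =>
    (pure fun q => S.1 q.1 q.2 :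
      QProg (Fin n) (KeyIdx (Fin n) × Fin (HE.ctLen n (Lc n)) → Bool))) h2
  refine Realizes.mono h3 ?_
  have h4 := h.card_dataIdx L
  have h5 : Fintype.card (KeyIdx (Fin n) × Fin (HE.ctLen n (Lc n))) ≤ b := by
    refine le_trans ?_ h4
    rw [Fintype.card_sum (α := _ × _)]
    exact Nat.le_add_right _ _
  have h6 : b + 1 ≤ (b + 1) ^ 3 := Nat.le_self_pow (by norm_num) _
  calc _ ≤ (L + 1) * (501 * (b + 1) ^ 3) + b + (11 * 0 + b + 1) := by gcongr
    _ ≤ _ := by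
      rw [show L + 2 = (L + 1) + 1 from rfl, add_mul (L + 1) 1]
      omega

theorem EvalBound.qComputableInSize_eval (h : EvalBound V C s b) :
    QComputableInSize (fun x : EvalIn A n L → Bool => (QHE V).eval n L C (fun a => x (.inl a))
      (fun q => x (.inr (.inl q))) fun q => x (.inr (.inr q)))
      ((L + 2) * (600 * (b + 1) ^ 3)) := by
  refine h.realizes_eval.qComputableInSize ?_
  have h1 := h.sizes.self
  have h2 := h.sizes.pkLen
  have h3 := h.sizes.evkLen
  have h4 : Fintype.card (KeyIdx (Fin n) × Fin (HE.ctLen n (Lc n))) ≤ b := by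
    refine le_trans ?_ (h.card_dataIdx 0)
    rw [Fintype.card_sum (α := _ × _)]
    exact Nat.le_add_right _ _
  have h5 : (HE.skLen n (Lc n) + A.tdLen n) * HE.ctLen n (Lc n) ≤ (b + b) * b :=
    Nat.mul_le_mul (Nat.add_le_add h.sizes.skLen h.sizes.tdLen) h.sizes.ctLen
  have h6 : Fintype.card (EvalIn A n L) ≤ b + ((L + 1) * b + (L * b + L * ((b + b) * b)) + b) := by
    rw [Fintype.card_sum, Fintype.card_sum (α := EvkIdx A n L)]
    simp only [Fintype.card_sum (α := Fin (L + 1) × _), Fintype.card_sum (α := Fin L × _),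
      Fintype.card_prod (α := Fin L), Fintype.card_prod (α := Fin (L + 1)),
      Fintype.card_prod (α := Fin (HE.skLen n (Lc n)) ⊕ Fin (A.tdLen n)),
      Fintype.card_sum (α := Fin (HE.skLen n (Lc n))), Fintype.card_fin]
    gcongr
  rw [Fintype.card_fin]
  calc _ ≤ b + (b + ((L + 1) * b + (L * b + L * ((b + b) * b)) + b)) + b +
        (L + 2) * (501 * (b + 1) ^ 3) := by gcongr
    _ ≤ _ := by nlinarith [Nat.zero_le (L * b ^ 3), Nat.zero_le (L * b ^ 2), Nat.zero_le (L * b),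
        Nat.zero_le (b ^ 3), Nat.zero_le (b ^ 2)]

end Run

/-! ### Efficiency and compactness -/

section Efficiency

variable {HE : LeveledHE} {Lc : ℕ → ℕ} {A : AltScheme HE Lc} {n b L : ℕ}

theorem SizeBound.mono (h : SizeBound A n b) {b' : ℕ} (hb : b ≤ b') : SizeBound A n b' where
  self := h.self.trans hb
  pkLen := h.pkLen.trans hb
  evkLen := h.evkLen.trans hb
  skLen := h.skLen.trans hb
  ctLen := h.ctLen.trans hb
  keyCoins := h.keyCoins.trans hb
  encCoins := h.encCoins.trans hb
  altLen := h.altLen.trans hb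
  rndLen := h.rndLen.trans hb
  tdLen := h.tdLen.trans hb
  keygen := h.keygen.mono hb
  enc := h.enc.mono hb
  dec := h.dec.mono hb
  altEnc := h.altEnc.mono hb
  convert := h.convert.mono hb
  xor := h.xor.mono hb
  trapdoor := h.trapdoor.mono hb
  prep := h.prep.trans hb

theorem SizeBound.comp_pk (h : SizeBound A n b) (i : Fin (L + 1)) :
    Comp (fun κ : KeyCoinIdx A n L → Bool => HE.pk (coinsAt κ i)) b :=
  (h.keygen.reindex .inl).precomp (ι' := KeyCoinIdx A n L) fun a => .inl (i, a)

theorem SizeBound.comp_evk (h : SizeBound A n b) (i : Fin (L + 1)) :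
    Comp (fun κ : KeyCoinIdx A n L → Bool => HE.evk (coinsAt κ i)) b :=
  (h.keygen.reindex fun a => .inr (.inl a)).precomp (ι' := KeyCoinIdx A n L) fun a => .inl (i, a)

theorem SizeBound.comp_sk (h : SizeBound A n b) (i : Fin (L + 1)) :
    Comp (fun κ : KeyCoinIdx A n L → Bool => HE.sk (coinsAt κ i)) b :=
  (h.keygen.reindex fun a => .inr (.inr a)).precomp (ι' := KeyCoinIdx A n L) fun a => .inl (i, a)

theorem SizeBound.comp_trapdoor (h : SizeBound A n b) (i : Fin (L + 1)) :
    Comp (fun κ : KeyCoinIdx A n L → Bool => A.trapdoor n (coinsAt κ i)) b :=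
  h.trapdoor.precomp (ι' := KeyCoinIdx A n L) fun a => .inl (i, a)

/-- The encryption of a bit of the secret key or the trapdoor under the next public key. -/
theorem SizeBound.comp_encKey (h : SizeBound A n b) (i : Fin L)
    (j : Fin (HE.skLen n (Lc n)) ⊕ Fin (A.tdLen n)) :
    Comp (fun κ : KeyCoinIdx A n L → Bool => HE.enc n (Lc n) (HE.pk (coinsAt κ i.succ))
        (Sum.elim (HE.sk (coinsAt κ i.castSucc)) (A.trapdoor n (coinsAt κ i.castSucc)) j)
        fun a => κ (.inr (i, j, a))) (4 * b) := by
  have h1 := ((h.comp_sk (L := L) i.castSucc).sum (h.comp_trapdoor i.castSucc)).reindex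
    fun _ : Unit => j
  have h2 := (h.comp_pk (L := L) i.succ).sum (h1.sum (comp_wire
    fun a : Fin (HE.encCoins n (Lc n)) => (.inr (i, j, a) : KeyCoinIdx A n L)))
  exact (h2.compose h.enc).mono (by omega)

/-- A circuit for the key generation. -/
theorem SizeBound.comp_keyGen (h : SizeBound A n b) :
    Comp (fun κ : KeyCoinIdx A n L → Bool => Sum.elim (HE.pk (coinsAt κ 0))
      (Sum.elim (makeEvk κ) (HE.sk (coinsAt κ (Fin.last L)))))
      ((2 * L + 3) * b + L * (8 * b * b)) := by
  have h1 := Comp.family fun i : Fin (L + 1) => h.comp_evk i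
  have h2 := Comp.family fun i : Fin L => h.comp_pk i.succ
  have h3 := (Comp.family fun q : Fin L × (Fin (HE.skLen n (Lc n)) ⊕ Fin (A.tdLen n)) =>
    h.comp_encKey q.1 q.2).reindex
      fun q : Fin L × (Fin (HE.skLen n (Lc n)) ⊕ Fin (A.tdLen n)) × Fin (HE.ctLen n (Lc n)) =>
        ((q.1, q.2.1), q.2.2)
  have h4 := (h.comp_pk (L := L) 0).sum ((h1.sum (h2.sum h3)).sum (h.comp_sk (Fin.last L)))
  refine (h4.mono ?_).congr fun κ => ?_
  · simp only [Fintype.card_prod, Fintype.card_sum, Fintype.card_fin]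
    have h5 : L * (HE.skLen n (Lc n) + A.tdLen n) * (4 * b) ≤ L * (b + b) * (4 * b) := by
      gcongr
      · exact h.skLen
      · exact h.tdLen
    nlinarith
  · funext q
    rcases q with q | (q | q | q) | q <;> rfl

/-- A circuit for the encryption of a message. -/
theorem SizeBound.comp_enc (h : SizeBound A n b) :
    Comp (fun x : Fin (HE.pkLen n (Lc n)) ⊕ Fin n ⊕ (KeyIdx (Fin n) ⊕
        (KeyIdx (Fin n) × Fin (HE.encCoins n (Lc n)))) → Bool =>
      Sum.elim (bxor (fun i => x (.inr (.inr (.inl (.inr i))))) fun i => x (.inr (.inl i)))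
        (fun q : KeyIdx (Fin n) × Fin (HE.ctLen n (Lc n)) =>
          HE.enc n (Lc n) (fun a => x (.inl a)) (x (.inr (.inr (.inl q.1))))
            (fun a => x (.inr (.inr (.inr (q.1, a))))) q.2)) (b + 2 * b * b) := by
  let E := Fin (HE.pkLen n (Lc n)) ⊕ Fin n ⊕ (KeyIdx (Fin n) ⊕
        (KeyIdx (Fin n) × Fin (HE.encCoins n (Lc n))))
  have h1 := comp_xor (ι := E) (o := Fin n) (fun i => .inr (.inr (.inl (.inr i))))
    fun i => .inr (.inl i)
  have h2 := Comp.family fun j : KeyIdx (Fin n) => h.enc.precomp (ι' := E)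
    (Sum.elim (fun a => .inl a) (Sum.elim (fun _ => .inr (.inr (.inl j)))
      fun a => .inr (.inr (.inr (j, a)))))
  refine ((h1.sum h2).mono ?_).congr fun x => rfl
  have := h.self
  simp only [Fintype.card_sum, Fintype.card_fin]
  nlinarith

/-- A circuit for the decryption of a measured string. -/
theorem SizeBound.comp_dec (h : SizeBound A n b) :
    Comp (fun x : Fin (HE.skLen n (Lc n)) ⊕ Fin n ⊕ (KeyIdx (Fin n) × Fin (HE.ctLen n (Lc n))) →
        Bool =>
      bxor (fun i : Fin n => HE.dec n (Lc n) (fun a => x (.inl a))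
        fun a => x (.inr (.inr (.inr i, a)))) fun i => x (.inr (.inl i))) (b * b + b) := by
  let E := Fin (HE.skLen n (Lc n)) ⊕ Fin n ⊕ (KeyIdx (Fin n) × Fin (HE.ctLen n (Lc n)))
  have h1 := Comp.family fun i : Fin n => h.dec.precomp (ι' := E)
    (Sum.elim (fun a => .inl a) fun a => .inr (.inr (.inr i, a)))
  have h2 := (h1.sum (comp_wire fun i : Fin n => (.inr (.inl i) : E))).compose
    (comp_xor (o := Fin n) (fun i => .inl (i, ())) fun i => .inr i)
  refine (h2.mono ?_).congr fun x => rfl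
  have := h.self
  simp only [Fintype.card_fin]
  nlinarith

theorem SizeBound.card_evkIdx_le (h : SizeBound A n b) :
    Fintype.card (EvkIdx A n L) ≤ (2 * L + 1) * b + L * (2 * b * b) := by
  have h5 : (HE.skLen n (Lc n) + A.tdLen n) * HE.ctLen n (Lc n) ≤ (b + b) * b :=
    Nat.mul_le_mul (Nat.add_le_add h.skLen h.tdLen) h.ctLen
  simp only [Fintype.card_sum, Fintype.card_prod, Fintype.card_fin]
  have h1 := Nat.mul_le_mul_left (L + 1) h.evkLen
  have h2 := Nat.mul_le_mul_left L h.pkLen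
  have h3 := Nat.mul_le_mul_left L h5
  nlinarith

/-- The output of the evaluation consists of `n` qubits and `2 * n` classical ciphertexts of
polynomial length, for all circuits and all `L`. -/
theorem QHE_compact (hHE : HE.Efficient) (hLc : PolyBounded Lc) (hA : A.Efficient)
    (V : LevelCircuits A) : (QHE V).Compact := by
  obtain ⟨b, ⟨p, hp⟩, hb⟩ := exists_sizeBound hHE hLc hA
  have h1 : PolyBounded fun n => n + 2 * n * p.eval n :=
    .add .self (.mul (.mul (.const 2) .self) (.eval p .self))
  obtain ⟨q, hq⟩ := h1
  refine ⟨q, fun n _ => le_trans ?_ (hq n)⟩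
  change n + Fintype.card (KeyIdx (Fin n) × Fin (HE.ctLen n (Lc n))) ≤ _
  simp only [Fintype.card_sum, Fintype.card_prod, Fintype.card_fin]
  have h2 := Nat.mul_le_mul_left (n + n) ((hb n).ctLen.trans (hp n))
  rw [← two_mul n] at h2 ⊢
  exact Nat.add_le_add_left h2 n

/-- The parameters of the evaluation are polynomially bounded in `n`, `L` and the size of `C`. -/
theorem exists_evalBound (hHE : HE.Efficient) (hLc : PolyBounded Lc) (hA : A.Efficient)
    {V : LevelCircuits A} (hV : V.Valid) : ∃ b : ℕ → ℕ, PolyBounded b ∧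
      ∀ n L (C : QCircuit (Fin n) L), ∃ s, EvalBound V C s (b (n + L + C.size)) := by
  obtain ⟨b₀, ⟨p₀, hp₀⟩, hb₀⟩ := exists_sizeBound hHE hLc hA
  obtain ⟨pL, hpL⟩ := hLc
  obtain ⟨p, hp⟩ := hHE
  obtain ⟨-, -, -, -, pV, hV₁, hV₂⟩ := hV
  let s (t : ℕ) : ℕ := pV.eval (t + t + t)
  have hs : PolyBounded s := .eval pV (.add (.add .self .self) .self)
  let e (t : ℕ) : ℕ := p.eval (t + pL.eval t + s t) + 1
  have he : PolyBounded e := .add (.eval p (.add (.add .self (.eval pL .self)) hs)) (.const 1)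
  refine ⟨fun t => p₀.eval t + t + s t + e t,
    .add (.add (.add (.eval p₀ .self) .self) hs) he, fun n L C => ?_⟩
  set t := n + L + C.size with ht
  have hn : n ≤ t := by omega
  have hl : ∀ i, (C.level i).size ≤ t := fun i => (C.size_level_le i).trans (by omega)
  have h0 : b₀ n ≤ p₀.eval t := (hp₀ n).trans (eval_mono p₀ hn)
  refine ⟨s t, ?_⟩
  change EvalBound V C (s t) (p₀.eval t + t + s t + e t)
  exact
    { sizes := (hb₀ n).mono (by omega)
      le := by omega
      level := fun i => (hl i).trans (by omega)
      first := (hV₁ n _).trans (eval_mono pV (by have := hl 0; omega))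
      next := fun i => (hV₂ n _ _).trans
        (eval_mono pV (by have := hl i; have := hl (i + 1); omega))
      eval := fun l f hf => by
        have h1 := (hp n (Lc n)).2.2.2 l f
        have h2 : p.eval (n + Lc n + f.size) + 1 ≤ e t := by
          refine Nat.add_le_add_right (eval_mono p ?_) 1
          have := (hpL n).trans (eval_mono pL hn)
          dsimp only at this
          omega
        have h3 := h1.card_le
        simp only [Fintype.card_sum, Fintype.card_fin] at h3
        exact ⟨by omega, h1.comp.mono (by omega)⟩ }

/-- All algorithms of the scheme have polynomial size. -/
theorem QHE_efficient (hHE : HE.Efficient) (hLc : PolyBounded Lc) (hA : A.Efficient)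
    {V : LevelCircuits A} (hV : V.Valid) : (QHE V).Efficient := by
  obtain ⟨b₀, ⟨p₀, hp₀⟩, hb₀⟩ := exists_sizeBound hHE hLc hA
  obtain ⟨b₁, hb₁, hE⟩ := exists_evalBound hHE hLc hA hV
  -- one polynomial bounds the sizes of all circuits
  let T (t : ℕ) : ℕ := 100 * ((t + 1) * (p₀.eval t + 1) * (p₀.eval t + 1))
  have hT : PolyBounded T := .mul (.const 100) (.mul (.mul (.add .self (.const 1))
    (.add (.eval p₀ .self) (.const 1))) (.add (.eval p₀ .self) (.const 1)))
  let T' (t : ℕ) : ℕ := (t + 2) * (600 * ((b₁ t + 1) * (b₁ t + 1) * (b₁ t + 1)))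
  have hT' : PolyBounded T' := .mul (.add .self (.const 2)) (.mul (.const 600)
    (.mul (.mul (.add hb₁ (.const 1)) (.add hb₁ (.const 1))) (.add hb₁ (.const 1))))
  obtain ⟨P, hP⟩ := hT.add hT'
  refine ⟨P, fun n L => ?_⟩
  set b := p₀.eval (n + L) with hb_def
  have hb : SizeBound A n b := (hb₀ n).mono ((hp₀ n).trans (eval_mono p₀ (Nat.le_add_right n L)))
  have hP' : 100 * ((n + L + 1) * (b + 1) * (b + 1)) ≤ P.eval (n + L) :=
    le_trans (Nat.le_add_right _ _) (hP (n + L))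
  have hcard := hb.card_evkIdx_le (L := L)
  have hn := hb.self
  have hk₁ := hb.pkLen
  have hk₂ := hb.skLen
  have hk₃ := hb.encCoins
  have hk₄ := hb.ctLen
  refine ⟨?_, ?_, ?_, fun C => ?_⟩
  · refine hb.comp_keyGen.computableInSize (ι := KeyCoinIdx A n L) (le_trans ?_ hP')
    have h5 : (HE.skLen n (Lc n) + A.tdLen n) * HE.encCoins n (Lc n) ≤ (b + b) * b :=
      Nat.mul_le_mul (Nat.add_le_add hb.skLen hb.tdLen) hb.encCoins
    have h6 : Fintype.card (KeyCoinIdx A n L) ≤ (L + 1) * b + L * ((b + b) * b) := by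
      simp only [Fintype.card_sum, Fintype.card_prod, Fintype.card_fin]
      exact Nat.add_le_add (Nat.mul_le_mul_left _ hb.keyCoins) (Nat.mul_le_mul_left _ h5)
    have h7 : Fintype.card (Fin (HE.pkLen n (Lc n)) ⊕ EvkIdx A n L ⊕ Fin (HE.skLen n (Lc n))) ≤
        b + ((2 * L + 1) * b + L * (2 * b * b) + b) := by
      rw [Fintype.card_sum, Fintype.card_sum (α := EvkIdx A n L), Fintype.card_fin,
        Fintype.card_fin]
      omega
    refine (Nat.add_le_add_right (Nat.add_le_add h6 h7) _).trans ?_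
    nlinarith [Nat.zero_le (n * b * b), Nat.zero_le (L * b * b), Nat.zero_le (L * b),
      Nat.zero_le (b * b), Nat.zero_le (n * b)]
  · refine hb.comp_enc.computableInSize (le_trans ?_ hP')
    have h5 := Nat.mul_le_mul hn hk₃
    have h6 := Nat.mul_le_mul hn hk₄
    simp only [Fintype.card_sum, Fintype.card_prod, Fintype.card_fin]
    nlinarith [Nat.zero_le (n * b * b), Nat.zero_le (L * b * b), Nat.zero_le (L * b),
      Nat.zero_le (b * b), Nat.zero_le (n * b)]
  · refine hb.comp_dec.computableInSize (le_trans ?_ hP')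
    have h6 := Nat.mul_le_mul hn hk₄
    simp only [Fintype.card_sum, Fintype.card_prod, Fintype.card_fin]
    nlinarith [Nat.zero_le (n * b * b), Nat.zero_le (L * b * b), Nat.zero_le (L * b),
      Nat.zero_le (b * b), Nat.zero_le (n * b)]
  · obtain ⟨s, hs⟩ := hE n L C
    have h1 := hs.qComputableInSize_eval
    have h2 : (L + 2) * (600 * (b₁ (n + L + C.size) + 1) ^ 3) ≤ P.eval (n + L + C.size) := by
      refine le_trans ?_ ((Nat.le_add_left _ _).trans (hP (n + L + C.size)))
      simp only [T']
      rw [pow_three']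
      gcongr
      omega
    obtain ⟨anc, gates, h3, h4⟩ := h1
    exact ⟨anc, gates, h3.trans h2, h4⟩

end Efficiency

end QFHE

end

theorem mainTheorem2 (HE : QFHE.LeveledHE) (hHE : HE.IsLeveledFHE)
    (Lc : ℕ → ℕ) (hLc : QFHE.PolyBounded Lc)
    (A : QFHE.AltScheme HE Lc) (hA : A.IsQuantumCapable)
    (V : QFHE.LevelCircuits A) (hV : V.Valid) :
    (QFHE.QHE V).IsQuantumLeveledFHE ∧ QFHE.FinalStateCorrect V :=
  ⟨⟨QFHE.QHE_efficient hHE.1 hLc hA.1 hV, QFHE.QHE_cpaSecure hHE hLc hA.1 V,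
    QFHE.QHE_compact hHE.1 hLc hA.1 V, QFHE.QHE_correct hHE.2.1 hLc hA hV⟩,
    QFHE.QHE_finalStateCorrect hHE.2.1 hLc hA hV⟩
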